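/- **Setting.** Fix integers $d\ge 1$, $m,n\ge 0$; $\mathcal A=\mathbb Z[v,v^{-1}]$, $q=v^2$. For $x\le y$ write $[x..y]$ for the integers between $x$ and $y$. Let $\mathbb I=[-(m+n)..m+n]$; $i\in\mathbb I$ is even if $|i|\le m$ and odd otherwise. Let $W$ be the group of permutations $w$ of $[-d..d]$ with $w(-x)=-w(x)$, generated by $s_0=(-1,1)$ and $s_i=(i,i+1)(-i,-i-1)$ $(1\le i<d)$, with length function $\ell$, and let $\mathcal H$ be its Hecke algebra: the free $\mathcal A$-module on $\{T_w\}_{w\in W}$ with $T_wT_{w'}=T_{ww'}$ if $\ell(ww')=\ell(w)+\ell(w')$ and $(T_{s_i}+1)(T_{s_i}-q)=0$. Let $\Lambda$ be the set of $\lambda=(\lambda_0,\dots,\lambda_{m+n})\in\mathbb N^{m+n+1}$ with sum $d$; put $\tilde\lambda_i=\lambda_0+\dots+\lambda_i$, $R^\lambda_0=[-\lambda_0..\lambda_0]$, $R^\lambda_i=[\tilde\lambda_{i-1}+1..\tilde\lambda_i]$ and $R^\lambda_{-i}=-R^\lambda_i$ for $i>0$. Let $W_\lambda$ be generated by the $s_i$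 with $i\notin\{\tilde\lambda_0,\dots,\tilde\lambda_{m+n-1}\}$; it is the direct product of its even part $W_{\lambda^{(0)}}$ and its odd part $W_{\lambda^{(1)}}$, generated by those of these $s_i$ with $i<\tilde\lambda_m$, respectively $i>\tilde\lambda_m$; write $w=w^{(0)}w^{(1)}$ accordingly. Put $[xy]_\lambda=\sum_{w\in W_{\lambda^{(0)}}}T_w\cdot\sum_{w\in W_{\lambda^{(1)}}}(-q)^{-\ell(w)}T_w$. The $\imath$Schur superalgebra is $\mathcal S=\operatorname{End}_{\mathcal H}\big(\bigoplus_{\lambda\in\Lambda}[xy]_\lambda\mathcal H\big)$ (right $\mathcal H$-linear maps, multiplied by composition). Let $\Xi$ be the set of $A=(a_{ij})_{i,j\in\mathbb I}$ with entries in $\mathbb N$, $\sum a_{ij}=2d+1$, $a_{ij}=a_{-i,-j}$, and $a_{ij}\le 1$ whenever $i$, $j$ have different parity. Each $A\in\Xi$ is $\kappa(\mu,g,\nu)=(|R^\mu_i\cap gR^\nu_j|)_{i,j}$ for a unique triple $\mu,\nu\in\Lambda$, $g\in W$ such that $g$ is a shortest element of $W_\mu gW_\nu$ and $g^{-1}W_{\mu^{(1)}}g\cap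 W_{\nu^{(0)}}=g^{-1}W_{\mu^{(0)}}g\cap W_{\nu^{(1)}}=\{1\}$. Then $e_A\in\mathcal S$ is the well-defined map with $$e_A([xy]_\lambda h)=\delta_{\nu\lambda}\,[xy]_\mu T_g\Big(\sum_w(-q)^{-\ell(w^{(1)})}T_w\Big)h\qquad(\lambda\in\Lambda,\ h\in\mathcal H),$$ where $w=w^{(0)}w^{(1)}$ runs over the elements of $W_\nu$ that are shortest in their coset $(g^{-1}W_\mu g\cap W_\nu)w$. Put $e_M=0$ for an integer matrix $M\notin\Xi$. Let $$\operatorname{row}(A)=\Big(\tfrac{a_{00}-1}2+\sum_{j>0}a_{0j},\ \sum_ja_{1j},\dots,\sum_ja_{m+n,j}\Big),\qquad \operatorname{col}(A)=\operatorname{row}(A^{\mathsf T}),$$ and $E^\theta_{ij}=E_{ij}+E_{-i,-j}$ with $E_{ij}$ the matrix units. For a unit $p$ let $[a]_p=\frac{p^a-1}{p-1}$, $[a]_p!=\prod_{k=1}^a[k]_p$, $\begin{bmatrix}a\\b\end{bmatrix}_p=\frac{[a]_p!}{[b]_p!\,[a-b]_p!}$, and $[a]_{\mathbf c}!=\prod_{k=1}^a[k]_q(q^k+1)$.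 For $h\in\mathbb I$ put $(\mathbf q_h,\dot{\mathbf q}_h,\ddot{\mathbf q}_h)=(q,1,q)$ if $h$ is even and $(q^{-1},-q^{-1},-1)$ if $h$ is odd. In exponents and products, $j,k$ run over $\mathbb I$ subject to the stated conditions. **Proposition 3.5.** Let $A=(a_{ij}),B,C\in\Xi$ and $h\in[0..m+n-1]$ with $h\ne m$. (1) Let $b\in\mathbb N$ be such that $B-bE^\theta_{h,h+1}$ is diagonal, and let $\operatorname{col}(B)=\operatorname{row}(A)$. If $h\neq0$, then $$e_Be_A=\sum_{\mathbf t}\dot{\mathbf q}_{h+1}^{\sum_{j<k}(a_{h+1,j}-t_j)t_k}\,\ddot{\mathbf q}_h^{\sum_{j>k}a_{hj}t_k}\prod_{k\in\mathbb I}\begin{bmatrix}a_{hk}+t_k\\t_k\end{bmatrix}_{\mathbf q_h}e_{A_{\mathbf t,h+1}}.$$ If $h=0$, then $$e_Be_A=\sum_{\mathbf t}\dot{\mathbf q}_{1}^{\sum_{j<k}(a_{1j}-t_j)t_k}\,\ddot{\mathbf q}_0^{\sum_{j>k}a_{0j}t_k+\sum_{k<j<-k}t_jt_k+\frac12\sum_{k<0}t_k(t_k-1)}\cdot\frac{[\frac{a_{00}-1}2+t_0]_{\mathbf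 c}!}{[\frac{a_{00}-1}2]_{\mathbf c}!\,[t_0]_{\mathbf q_0}!}\prod_{k=1}^{m+n}\frac{[a_{0k}+t_k+t_{-k}]_{\mathbf q_0}!}{[a_{0k}]_{\mathbf q_0}!\,[t_k]_{\mathbf q_0}!\,[t_{-k}]_{\mathbf q_0}!}\;e_{A_{\mathbf t,1}}.$$ In both cases $\mathbf t=(t_i)_{i\in\mathbb I}$ runs over the families of natural numbers with $\sum_it_i=b$ and $t_i\le a_{h+1,i}$ for all $i$, and $A_{\mathbf t,h+1}=A+\sum_{i\in\mathbb I}t_i(E^\theta_{hi}-E^\theta_{h+1,i})$. (2) Let $c\in\mathbb N$ be such that $C-cE^\theta_{h+1,h}$ is diagonal, and let $\operatorname{col}(C)=\operatorname{row}(A)$. Then $$e_Ce_A=\sum_{\mathbf t}\dot{\mathbf q}_h^{\sum_{j>k}(a_{hj}-t_j)t_k}\,\ddot{\mathbf q}_{h+1}^{\sum_{j<k}a_{h+1,j}t_k}\prod_{k\in\mathbb I}\begin{bmatrix}a_{h+1,k}+t_k\\t_k\end{bmatrix}_{\mathbf q_{h+1}}e_{\check A_{\mathbf t,h+1}},$$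 where $\mathbf t=(t_i)_{i\in\mathbb I}$ runs over the families of natural numbers with $\sum_it_i=c$ and, for all $i$, $t_i\le a_{hi}$ if $h>0$, $t_i+t_{-i}\le a_{hi}$ if $h=0$, and $\check A_{\mathbf t,h+1}=A+\sum_{i\in\mathbb I}t_i(E^\theta_{h+1,i}-E^\theta_{hi})$. -/

import Mathlib

/-- The integral interval `[-k..k]`, with its order. -/
abbrev SymInt (k : ℕ) : Type := Set.Icc (-(k : ℤ)) (k : ℤ)
namespace SymInt
variable {k : ℕ}
instance : Neg (SymInt k) :=
  ⟨fun x => ⟨-x.1, by have := x.2; simp only [Set.mem_Icc] at this ⊢; omega⟩⟩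
instance : Zero (SymInt k) := ⟨⟨0, by simp⟩⟩
/-- A natural number `j ≤ k` as an element of `[-k..k]`. -/
noncomputable def ofNat (j : ℕ) (hj : j ≤ k) : SymInt k :=
  ⟨j, by simp only [Set.mem_Icc]; omega⟩
@[simp] theorem val_neg (x : SymInt k) : (-x).1 = -x.1 := rfl
@[simp] theorem val_zero : (0 : SymInt k).1 = 0 := rfl
@[simp] theorem val_ofNat (j : ℕ) (hj : j ≤ k) : (ofNat j hj).1 = (j : ℤ) := rfl
theorem neg_neg' (x : SymInt k) : - -x = x := Subtype.ext (by simp)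
end SymInt

namespace IotaSchur
noncomputable section

/-! ### The Weyl group of type `B_d` -/

/-- The group of permutations `w` of `[-d..d]` with `w(-x) = -w(x)`. -/
def SignedPerm (d : ℕ) : Subgroup (Equiv.Perm (SymInt d)) where
  carrier := {w | ∀ x, w (-x) = -(w x)}
  one_mem' := fun _ => rfl
  mul_mem' := fun {a b} ha hb x => by
    change ∀ x, a (-x) = -(a x) at ha
    change ∀ x, b (-x) = -(b x) at hb
    simp [Equiv.Perm.mul_apply, hb x, ha (b x)]
  inv_mem' := fun {a} ha x => by
    change ∀ x, a (-x) = -(a x) at ha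
    rw [Equiv.Perm.inv_eq_iff_eq, ha]; simp

instance (d : ℕ) : Fintype (SignedPerm d) := Fintype.ofFinite _

variable {d : ℕ}

theorem signed_map_neg (w : SignedPerm d) (x : SymInt d) : w.1 (-x) = -(w.1 x) := w.2 x

/-- `s_0 = (-1, 1)` and `s_i = (i, i+1)(-i, -i-1)`, as permutations. -/
def simpleReflPerm (i : Fin d) : Equiv.Perm (SymInt d) :=
  if i.1 = 0 then
    Equiv.swap (-SymInt.ofNat 1 (by have := i.2; omega)) (SymInt.ofNat 1 (by have := i.2; omega))
  else
    Equiv.swap (SymInt.ofNat i.1 i.2.le) (SymInt.ofNat (i.1 + 1) i.2) *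
      Equiv.swap (-SymInt.ofNat i.1 i.2.le) (-SymInt.ofNat (i.1 + 1) i.2)

/-- The values of `s_i` on integers. -/
def reflVal (i : ℕ) (x : ℤ) : ℤ :=
  if i = 0 then (if x = 1 ∨ x = -1 then -x else x) else
  if x = i then i + 1 else if x = i + 1 then (i : ℤ) else
  if x = -i then -i - 1 else if x = -i - 1 then -(i : ℤ) else x

theorem swap_val (a b x : SymInt d) :
    (Equiv.swap a b x).1 = if x.1 = a.1 then b.1 else if x.1 = b.1 then a.1 else x.1 := by
  rw [Equiv.swap_apply_def]
  simp only [Subtype.ext_iff]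
  split_ifs <;> rfl

theorem simpleReflPerm_val (i : Fin d) (x : SymInt d) :
    (simpleReflPerm i x).1 = reflVal i.1 x.1 := by
  unfold simpleReflPerm
  by_cases h0 : i.1 = 0
  · simp only [h0, ↓reduceIte, swap_val, SymInt.val_neg, SymInt.val_ofNat, reflVal]
    split_ifs <;> push_cast at * <;> omega
  · simp only [h0, ↓reduceIte, Equiv.Perm.mul_apply, swap_val, SymInt.val_neg, SymInt.val_ofNat,
      reflVal]
    generalize x.1 = y
    push_cast
    generalize i.1 = j at *
    by_cases h1 : y = -j
    · subst h1; split_ifs <;> omega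
    by_cases h2 : y = -(j + 1)
    · subst h2; split_ifs <;> omega
    simp only [h1, h2, ↓reduceIte]
    split_ifs <;> omega

/-- The simple reflections `s_0, …, s_{d-1}`. -/
def simpleRefl (i : Fin d) : SignedPerm d :=
  ⟨simpleReflPerm i, fun x => by
    apply Subtype.ext
    rw [simpleReflPerm_val, SymInt.val_neg, SymInt.val_neg, simpleReflPerm_val, reflVal, reflVal]
    split_ifs <;> omega⟩

theorem reflVal_reflVal (i : ℕ) (x : ℤ) : reflVal i (reflVal i x) = x := by
  by_cases h0 : i = 0
  · subst h0
    by_cases h : x = 1 ∨ x = -1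
    · rcases h with rfl | rfl <;> simp [reflVal]
    · simp [reflVal, h]
  · have e1 : reflVal i i = i + 1 := by simp [reflVal, h0]
    have e2 : reflVal i (i + 1) = i := by simp [reflVal, h0]
    have e3 : reflVal i (-i) = -i - 1 := by
      unfold reflVal; rw [if_neg h0, if_neg (by omega), if_neg (by omega), if_pos rfl]
    have e4 : reflVal i (-i - 1) = -i := by
      unfold reflVal
      rw [if_neg h0, if_neg (by omega), if_neg (by omega), if_neg (by omega), if_pos rfl]
    by_cases h1 : x = i
    · rw [h1, e1, e2]
    by_cases h2 : x = i + 1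
    · rw [h2, e2, e1]
    by_cases h3 : x = -i
    · rw [h3, e3, e4]
    by_cases h4 : x = -i - 1
    · rw [h4, e4, e3]
    have e5 : reflVal i x = x := by
      unfold reflVal
      rw [if_neg h0, if_neg h1, if_neg h2, if_neg h3, if_neg h4]
    rw [e5, e5]

theorem simpleRefl_mul_self (i : Fin d) : simpleRefl i * simpleRefl i = 1 := by
  apply Subtype.ext
  apply Equiv.ext
  intro x
  apply Subtype.ext
  change (simpleReflPerm i (simpleReflPerm i x)).1 = x.1
  rw [simpleReflPerm_val, simpleReflPerm_val, reflVal_reflVal]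

/-- The length of `w` with respect to the simple reflections: the least length of a word in them
with product `w`. -/
def length (w : SignedPerm d) : ℕ :=
  sInf {k | ∃ l : List (Fin d), l.length = k ∧ (l.map simpleRefl).prod = w}

/-! Combinatorics of the length function, for the associativity of the Hecke algebra. -/

/-- Inversions of `w`; there are `2 ℓ(w)` of them. -/
def invSet (w : SignedPerm d) : Finset (SymInt d × SymInt d) :=
  {p | p.2.1 ≠ 0 ∧ p.1.1 < p.2.1 ∧ (w.1 p.2).1 < (w.1 p.1).1}

/-- The number `i`, for a simple reflection `s_i`. -/
def lo (i : Fin d) : SymInt d := SymInt.ofNat i.1 i.2.le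
/-- The number `i + 1`, for a simple reflection `s_i`. -/
def hi (i : Fin d) : SymInt d := SymInt.ofNat (i.1 + 1) i.2

theorem lt_iff (i : Fin d) (x y : SymInt d) :
    (simpleReflPerm i x).1 < (simpleReflPerm i y).1 ↔
      (x.1 < y.1 ∧ ¬ (x = lo i ∧ y = hi i) ∧ ¬ (x = -hi i ∧ y = -lo i) ∧
        ¬ (i.1 = 0 ∧ x = -hi i ∧ y = hi i)) ∨
      (x = hi i ∧ y = lo i) ∨ (x = -lo i ∧ y = -hi i) ∨ (i.1 = 0 ∧ x = hi i ∧ y = -hi i) := by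
  simp only [simpleReflPerm_val, reflVal, Subtype.ext_iff, lo, hi, SymInt.val_neg, SymInt.val_ofNat]
  push_cast
  split_ifs <;> omega

theorem card_invSet_mul (w : SignedPerm d) (i : Fin d)
    (h : (w.1 (lo i)).1 < (w.1 (hi i)).1) :
    (invSet (w * simpleRefl i)).card = (invSet w).card + 2 := by
  have hn : ∀ x, (w.1 (-x)).1 = -(w.1 x).1 := fun x => by rw [signed_map_neg w]; rfl
  have ss : ∀ x, simpleReflPerm i (simpleReflPerm i x) = x := fun x => by
    have := congrArg (fun u : SignedPerm d => u.1 x) (simpleRefl_mul_self i)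
    exact this
  have s0 : ∀ x, (simpleReflPerm i x).1 = 0 ↔ x.1 = 0 := fun x => by
    rw [simpleReflPerm_val, reflVal]; split_ifs <;> omega
  let a : SymInt d × SymInt d := if i.1 = 0 then (hi i, -hi i) else (hi i, lo i)
  let b : SymInt d × SymInt d := (-lo i, -hi i)
  have key : (invSet (w * simpleRefl i)).map
      ((simpleReflPerm i).prodCongr (simpleReflPerm i)).toEmbedding
      = insert a (insert b (invSet w)) := by
    ext ⟨x, y⟩
    rw [Finset.mem_map_equiv]
    have hs : (simpleReflPerm i).symm = simpleReflPerm i := by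
      ext1 x; rw [Equiv.symm_apply_eq, ss]
    simp only [Equiv.prodCongr_symm, hs, Equiv.prodCongr_apply, Prod.map_apply, invSet,
      Finset.mem_filter, Finset.mem_univ, true_and, Finset.mem_insert]
    change _ ∧ _ ∧ (w.1 (simpleReflPerm i (simpleReflPerm i y))).1 <
      (w.1 (simpleReflPerm i (simpleReflPerm i x))).1 ↔ _
    rw [ss, ss, lt_iff, ne_eq, s0]
    have hw0 : i.1 = 0 → (w.1 (lo i)).1 = 0 := fun h0 => by
      have : lo i = -lo i := Subtype.ext (by simp [lo, h0])
      have h2 := hn (lo i)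
      rw [← this] at h2; omega
    have e1 : (lo i).1 = i.1 := rfl
    have e2 : (hi i).1 = i.1 + 1 := by simp [hi]
    have e3 := hn (lo i)
    have e4 := hn (hi i)
    simp only [a, b]
    have e5 : (-lo i).1 = -(lo i).1 := rfl
    have e6 : (-hi i).1 = -(hi i).1 := rfl
    by_cases h0 : i.1 = 0
    · simp only [h0, ↓reduceIte, Prod.mk.injEq, true_and]
      have := hw0 h0
      constructor
      · rintro ⟨h1, h2 | ⟨rfl, rfl⟩ | ⟨rfl, rfl⟩ | ⟨rfl, rfl⟩, h3⟩
        · exact Or.inr (Or.inr ⟨h1, h2.1, h3⟩)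
        · omega
        · simp
        · simp
      · rintro (⟨rfl, rfl⟩ | ⟨rfl, rfl⟩ | ⟨h1, h2, h3⟩)
        · refine ⟨by omega, by simp, by omega⟩
        · refine ⟨by omega, by simp, by omega⟩
        · refine ⟨h1, Or.inl ⟨h2, ?_, ?_, ?_⟩, h3⟩ <;> rintro ⟨rfl, rfl⟩ <;> omega
    · simp only [h0, ↓reduceIte, Prod.mk.injEq, false_and, or_false, not_false_eq_true, and_true]
      constructor
      · rintro ⟨h1, h2 | ⟨rfl, rfl⟩ | ⟨rfl, rfl⟩, h3⟩
        · exact Or.inr (Or.inr ⟨h1, h2.1, h3⟩)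
        · simp
        · simp
      · rintro (⟨rfl, rfl⟩ | ⟨rfl, rfl⟩ | ⟨h1, h2, h3⟩)
        · refine ⟨by omega, by simp, by omega⟩
        · refine ⟨by omega, by simp, by omega⟩
        · refine ⟨h1, Or.inl ⟨h2, ?_, ?_⟩, h3⟩ <;> rintro ⟨rfl, rfl⟩ <;> omega
  have hc := congrArg Finset.card key
  have e2 : (hi i).1 = i.1 + 1 := by simp [hi]
  have e1 : (lo i).1 = i.1 := rfl
  have e5 : (-lo i).1 = -(lo i).1 := rfl
  have e6 : (-hi i).1 = -(hi i).1 := rfl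
  rw [Finset.card_map, Finset.card_insert_of_notMem, Finset.card_insert_of_notMem] at hc
  · omega
  · simp only [invSet, Finset.mem_filter, b]
    rintro ⟨-, -, h1, -⟩
    omega
  · simp only [invSet, Finset.mem_filter, Finset.mem_insert, a, b]
    rintro (h1 | ⟨-, -, h1, -⟩)
    · split_ifs at h1 with h0
      · have := congrArg (fun p : SymInt d × SymInt d => p.1.1) h1
        simp only at this; omega
      · have := congrArg (fun p : SymInt d × SymInt d => p.1.1) h1
        simp only at this; omega
    · split_ifs at h1 with h0 <;> simp only at h1 <;> omega

theorem card_invSet_one : (invSet (1 : SignedPerm d)).card = 0 := by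
  rw [Finset.card_eq_zero, Finset.eq_empty_iff_forall_notMem]
  rintro ⟨x, y⟩ h
  simp only [invSet, Finset.mem_filter] at h
  have h1 := h.2.2.1
  have h2 : y.1 < x.1 := h.2.2.2
  omega

theorem lo_ne_hi (w : SignedPerm d) (i : Fin d) : (w.1 (lo i)).1 ≠ (w.1 (hi i)).1 := by
  intro h
  have := w.1.injective (Subtype.ext h)
  have := congrArg Subtype.val this
  simp [lo, hi] at this

theorem mul_lo (w : SignedPerm d) (i : Fin d) :
    ((w * simpleRefl i).1 (lo i)).1 = if i.1 = 0 then (w.1 (lo i)).1 else (w.1 (hi i)).1 := by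
  change (w.1 (simpleReflPerm i (lo i))).1 = _
  split_ifs with h
  · congr 2; apply Subtype.ext; rw [simpleReflPerm_val, reflVal]; simp [h, lo]
  · congr 2; apply Subtype.ext; rw [simpleReflPerm_val, reflVal]; simp [h, lo, hi]

theorem mul_hi (w : SignedPerm d) (i : Fin d) :
    ((w * simpleRefl i).1 (hi i)).1 = if i.1 = 0 then -(w.1 (hi i)).1 else (w.1 (lo i)).1 := by
  change (w.1 (simpleReflPerm i (hi i))).1 = _
  split_ifs with h
  · rw [← SymInt.val_neg, ← signed_map_neg w]
    congr 2; apply Subtype.ext; rw [simpleReflPerm_val, reflVal]; simp [h, hi]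
  · congr 2; apply Subtype.ext; rw [simpleReflPerm_val, reflVal]; simp [h, lo, hi]

theorem lo_zero (w : SignedPerm d) (i : Fin d) (h0 : i.1 = 0) : (w.1 (lo i)).1 = 0 := by
  have : lo i = -lo i := Subtype.ext (by simp [lo, h0])
  have h2 := congrArg Subtype.val (signed_map_neg w (lo i))
  rw [← this] at h2
  simp only [SymInt.val_neg] at h2; omega

/-- right ascent flips under right multiplication -/
theorem asc_mul (w : SignedPerm d) (i : Fin d) :
    ((w * simpleRefl i).1 (lo i)).1 < ((w * simpleRefl i).1 (hi i)).1 ↔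
      (w.1 (hi i)).1 < (w.1 (lo i)).1 := by
  rw [mul_lo, mul_hi]
  split_ifs with h
  · have := lo_zero w i h; omega
  · rfl

theorem card_invSet_mul' (w : SignedPerm d) (i : Fin d)
    (h : (w.1 (hi i)).1 < (w.1 (lo i)).1) :
    (invSet w).card = (invSet (w * simpleRefl i)).card + 2 := by
  have := card_invSet_mul (w * simpleRefl i) i ((asc_mul w i).2 h)
  rwa [mul_assoc, simpleRefl_mul_self, mul_one] at this

theorem eq_one_of_asc (w : SignedPerm d)
    (h : ∀ i : Fin d, (w.1 (lo i)).1 < (w.1 (hi i)).1) : w = 1 := by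
  have h0 : (w.1 0).1 = 0 := by
    have h2 := congrArg Subtype.val (signed_map_neg w 0)
    have : (-(0 : SymInt d)) = 0 := Subtype.ext (by simp)
    rw [this] at h2
    simp only [SymInt.val_neg] at h2; omega
  have up : ∀ (j : ℕ) (hj : j ≤ d), (j : ℤ) ≤ (w.1 (SymInt.ofNat j hj)).1 := by
    intro j
    induction j with
    | zero => intro hj; exact h0.ge
    | succ j ih =>
      intro hj
      have := ih (by omega)
      have h3 := h ⟨j, by omega⟩
      simp only [lo, hi] at h3
      push_cast; omega
  have down : ∀ (r j : ℕ) (hj : j ≤ d), j + r = d → (w.1 (SymInt.ofNat j hj)).1 ≤ j := by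
    intro r
    induction r with
    | zero =>
      intro j hj h1
      have := (w.1 (SymInt.ofNat j hj)).2
      simp only [Set.mem_Icc] at this
      omega
    | succ r ih =>
      intro j hj h1
      have := ih (j + 1) (by omega) (by omega)
      have h3 := h ⟨j, by omega⟩
      simp only [lo, hi] at h3
      push_cast at this; omega
  have all : ∀ (j : ℕ) (hj : j ≤ d), w.1 (SymInt.ofNat j hj) = SymInt.ofNat j hj := fun j hj =>
    Subtype.ext (le_antisymm (down (d - j) j hj (by omega)) (up j hj))
  apply Subtype.ext
  apply Equiv.ext
  intro x
  have hx := x.2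
  simp only [Set.mem_Icc] at hx
  change w.1 x = x
  rcases le_total 0 x.1 with h1 | h1
  · have : x = SymInt.ofNat x.1.toNat (by omega) := Subtype.ext (by simp [h1])
    rw [this, all]
  · have : x = -SymInt.ofNat (-x.1).toNat (by omega) := Subtype.ext (by simp [h1])
    rw [this, signed_map_neg w, all]

theorem exists_word (w : SignedPerm d) : ∃ l : List (Fin d),
    2 * l.length = (invSet w).card ∧ (l.map simpleRefl).prod = w := by
  induction hN : (invSet w).card using Nat.strong_induction_on generalizing w with
  | _ N ih =>
    by_cases h : ∀ i : Fin d, (w.1 (lo i)).1 < (w.1 (hi i)).1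
    · refine ⟨[], ?_, ?_⟩
      · rw [← hN, eq_one_of_asc w h, card_invSet_one]; rfl
      · rw [eq_one_of_asc w h]; rfl
    · push Not at h
      obtain ⟨i, hi'⟩ := h
      have hlt := lt_of_le_of_ne hi' (lo_ne_hi w i).symm
      have hc := card_invSet_mul' w i hlt
      obtain ⟨l, hl, hp⟩ := ih _ (by omega) (w * simpleRefl i) rfl
      refine ⟨l ++ [i], ?_, ?_⟩
      · simp; omega
      · simp [hp, mul_assoc, simpleRefl_mul_self]

theorem card_invSet_mul_le (w : SignedPerm d) (i : Fin d) :
    (invSet (w * simpleRefl i)).card ≤ (invSet w).card + 2 := by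
  rcases lt_or_gt_of_ne (lo_ne_hi w i) with h | h
  · exact (card_invSet_mul w i h).le
  · have := card_invSet_mul' w i h; omega

theorem card_invSet_word (l : List (Fin d)) :
    (invSet (l.map simpleRefl).prod).card ≤ 2 * l.length := by
  induction l using List.reverseRecOn with
  | nil => simp [card_invSet_one]
  | append_singleton l i ih =>
    have := card_invSet_mul_le (l.map simpleRefl).prod i
    simp only [List.map_append, List.map_cons, List.map_nil, List.prod_append, List.prod_cons,
      List.prod_nil, mul_one, List.length_append, List.length_cons, List.length_nil]
    omega

theorem exists_reduced_word (w : SignedPerm d) : ∃ l : List (Fin d),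
    l.length = length w ∧ (l.map simpleRefl).prod = w :=
  Nat.sInf_mem (s := {k | ∃ l : List (Fin d), l.length = k ∧ (l.map simpleRefl).prod = w})
    (by obtain ⟨l, -, h⟩ := exists_word w; exact ⟨_, l, rfl, h⟩)

theorem length_le_of_word {w : SignedPerm d} (l : List (Fin d))
    (h : (l.map simpleRefl).prod = w) : length w ≤ l.length :=
  Nat.sInf_le ⟨l, rfl, h⟩

theorem two_length (w : SignedPerm d) : 2 * length w = (invSet w).card := by
  obtain ⟨l, hl, hp⟩ := exists_reduced_word w
  obtain ⟨l', hl', hp'⟩ := exists_word w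
  have h1 := card_invSet_word l
  rw [hp] at h1
  have h2 := length_le_of_word l' hp'
  omega

/-- `ℓ (w s_i) > ℓ(w)` iff `w(i) < w(i+1)`. -/
theorem length_asc (w : SignedPerm d) (i : Fin d) :
    length w < length (w * simpleRefl i) ↔ (w.1 (lo i)).1 < (w.1 (hi i)).1 := by
  have h1 := two_length w
  have h2 := two_length (w * simpleRefl i)
  rcases lt_or_gt_of_ne (lo_ne_hi w i) with h | h
  · have := card_invSet_mul w i h; omega
  · have := card_invSet_mul' w i h; omega

theorem length_mul_cases (w : SignedPerm d) (i : Fin d) :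
    length (w * simpleRefl i) = length w + 1 ∨ length w = length (w * simpleRefl i) + 1 := by
  have h1 := two_length w
  have h2 := two_length (w * simpleRefl i)
  rcases lt_or_gt_of_ne (lo_ne_hi w i) with h | h
  · have := card_invSet_mul w i h; omega
  · have := card_invSet_mul' w i h; omega

theorem simpleRefl_inv (i : Fin d) : (simpleRefl i)⁻¹ = simpleRefl i :=
  inv_eq_of_mul_eq_one_left (simpleRefl_mul_self i)

theorem length_one : length (1 : SignedPerm d) = 0 :=
  Nat.le_zero.1 (length_le_of_word [] rfl)

theorem length_inv (w : SignedPerm d) : length w⁻¹ = length w := by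
  have : ∀ u : SignedPerm d, length u⁻¹ ≤ length u := fun u => by
    obtain ⟨l, hl, hp⟩ := exists_reduced_word u
    rw [← hl, ← List.length_reverse]
    apply length_le_of_word
    rw [← hp, List.prod_inv_reverse]
    simp [Function.comp_def, simpleRefl_inv]
  refine le_antisymm (this w) ?_
  simpa using this w⁻¹

theorem length_mul_le (u w : SignedPerm d) : length (u * w) ≤ length u + length w := by
  obtain ⟨l, hl, hp⟩ := exists_reduced_word u
  obtain ⟨l', hl', hp'⟩ := exists_reduced_word w
  rw [← hl, ← hl', ← List.length_append]
  apply length_le_of_word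
  simp [hp, hp']

theorem length_mul_simple (w : SignedPerm d) (i : Fin d) :
    length (w * simpleRefl i) = length w + 1 ∨ length w = length (w * simpleRefl i) + 1 :=
  length_mul_cases w i

theorem length_simple_mul (i : Fin d) (w : SignedPerm d) :
    length (simpleRefl i * w) = length w + 1 ∨ length w = length (simpleRefl i * w) + 1 := by
  have := length_mul_cases w⁻¹ i
  rw [← length_inv (simpleRefl i * w), mul_inv_rev, simpleRefl_inv, ← length_inv w]
  exact this

theorem length_asc_left (w : SignedPerm d) (i : Fin d) :
    length w < length (simpleRefl i * w) ↔ (w⁻¹.1 (lo i)).1 < (w⁻¹.1 (hi i)).1 := by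
  rw [← length_asc, ← length_inv w, ← length_inv (simpleRefl i * w), mul_inv_rev, simpleRefl_inv]

theorem refl_lo (i : Fin d) : simpleReflPerm i (lo i) = if i.1 = 0 then lo i else hi i := by
  apply Subtype.ext
  rw [simpleReflPerm_val, reflVal]
  by_cases h : i.1 = 0 <;> simp [h, lo, hi]

theorem refl_hi (i : Fin d) : simpleReflPerm i (hi i) = if i.1 = 0 then -hi i else lo i := by
  apply Subtype.ext
  rw [simpleReflPerm_val, reflVal]
  by_cases h : i.1 = 0 <;> simp [h, lo, hi]

theorem refl_neg_lo (i : Fin d) :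
    simpleReflPerm i (-lo i) = if i.1 = 0 then -lo i else -hi i := by
  have := signed_map_neg (simpleRefl i) (lo i)
  change simpleReflPerm i (-lo i) = -(simpleReflPerm i (lo i)) at this
  rw [this, refl_lo]; split_ifs <;> rfl

theorem refl_neg_hi (i : Fin d) :
    simpleReflPerm i (-hi i) = if i.1 = 0 then hi i else -lo i := by
  have := signed_map_neg (simpleRefl i) (hi i)
  change simpleReflPerm i (-hi i) = -(simpleReflPerm i (hi i)) at this
  rw [this, refl_hi]; split_ifs
  · exact SymInt.neg_neg' _
  · rfl

theorem refl_other (i : Fin d) (x : SymInt d)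
    (h : x ≠ lo i ∧ x ≠ hi i ∧ x ≠ -lo i ∧ x ≠ -hi i) : simpleReflPerm i x = x := by
  obtain ⟨h1, h2, h3, h4⟩ := h
  simp only [ne_eq, Subtype.ext_iff, lo, hi, SymInt.val_neg, SymInt.val_ofNat] at h1 h2 h3 h4
  push_cast at h1 h2 h3 h4
  apply Subtype.ext; rw [simpleReflPerm_val, reflVal]; split_ifs <;> omega

theorem int_refl (j : ℕ) (a b : ℤ)
    (h : (a = j ∧ b = j + 1) ∨ (a = -j - 1 ∧ b = -j) ∨ (a = j + 1 ∧ b = j) ∨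
      (a = -j ∧ b = -j - 1)) (hb : b ≠ 0) :
    reflVal j a = (if a = 0 then a else b) ∧ reflVal j b = (if a = 0 then -b else a) ∧
    reflVal j (-a) = (if a = 0 then -a else -b) ∧ reflVal j (-b) = (if a = 0 then b else -a) ∧
    ∀ x, x ≠ a → x ≠ b → x ≠ -a → x ≠ -b → reflVal j x = x := by
  rcases h with ⟨rfl, rfl⟩ | ⟨rfl, rfl⟩ | ⟨rfl, rfl⟩ | ⟨rfl, rfl⟩ <;>
  · refine ⟨?_, ?_, ?_, ?_, fun x h1 h2 h3 h4 => ?_⟩ <;> unfold reflVal <;> split_ifs <;> omega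

/-- If multiplication by `s_j` on the right changes whether `s_i` is a left ascent of `w`, then
`s_i w = w s_j`. -/
theorem exchange (w : SignedPerm d) (i j : Fin d)
    (h : ¬ (length w < length (simpleRefl i * w) ↔
      length (w * simpleRefl j) < length (simpleRefl i * (w * simpleRefl j)))) :
    simpleRefl i * w = w * simpleRefl j := by
  rw [length_asc_left, length_asc_left, mul_inv_rev, simpleRefl_inv] at h
  set u := w⁻¹ with hu
  change ¬ (_ ↔ (simpleReflPerm j (u.1 (lo i))).1 < (simpleReflPerm j (u.1 (hi i))).1) at h
  have hne := lo_ne_hi u i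
  rw [lt_iff] at h
  suffices H : u * simpleRefl i = simpleRefl j * u by
    have h1 : w = u⁻¹ := by simp [hu]
    rw [h1, eq_inv_mul_iff_mul_eq, ← mul_assoc, H, mul_assoc, mul_inv_cancel, mul_one]
  have hn : ∀ x, (u.1 (-x)).1 = -(u.1 x).1 := fun x => by rw [signed_map_neg u]; rfl
  have inj : ∀ x y, (u.1 x).1 = (u.1 y).1 ↔ x = y := fun x y =>
    ⟨fun h => u.1.injective (Subtype.ext h), fun h => by rw [h]⟩
  have hz := lo_zero u i
  have hz' : (u.1 (lo i)).1 = 0 → i.1 = 0 := fun h => by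
    have h2 := hn (lo i)
    have h3 := (inj (lo i) (-lo i)).1 (by omega)
    have := congrArg Subtype.val h3
    simp [lo] at this; omega
  have nh : (u.1 (hi i)).1 ≠ 0 := fun h => by
    have h2 := hn (hi i)
    have h3 := (inj (hi i) (-hi i)).1 (by omega)
    have := congrArg Subtype.val h3
    simp [hi] at this; omega
  have hop : (u.1 (lo i)).1 ≠ -(u.1 (hi i)).1 := fun h => by
    have h3 := (inj (lo i) (-hi i)).1 (by rw [hn]; exact h)
    have := congrArg Subtype.val h3
    simp [hi, lo] at this; omega
  apply Subtype.ext
  apply Equiv.ext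
  intro x
  change u.1 (simpleReflPerm i x) = simpleReflPerm j (u.1 x)
  have c : x = lo i ∨ x = hi i ∨ x = -lo i ∨ x = -hi i ∨
    (x ≠ lo i ∧ x ≠ hi i ∧ x ≠ -lo i ∧ x ≠ -hi i) := by tauto
  have v1 := refl_lo i
  have v2 := refl_hi i
  have v3 := refl_neg_lo i
  have v4 := refl_neg_hi i
  have v5 := refl_other i x
  have e3 := hn (lo i)
  have e4 := hn (hi i)
  have x1 := inj x (lo i)
  have x2 := inj x (hi i)
  have x3 := inj x (-lo i)
  have x4 := inj x (-hi i)
  have g1 : (lo j).1 = j.1 := rfl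
  have g2 : (hi j).1 = j.1 + 1 := by simp [hi]
  simp only [Subtype.ext_iff, SymInt.val_neg] at h
  rw [g1, g2] at h
  have h' : ((u.1 (lo i)).1 = j.1 ∧ (u.1 (hi i)).1 = j.1 + 1) ∨
      ((u.1 (lo i)).1 = -j.1 - 1 ∧ (u.1 (hi i)).1 = -j.1) ∨
      ((u.1 (lo i)).1 = j.1 + 1 ∧ (u.1 (hi i)).1 = j.1) ∨
      ((u.1 (lo i)).1 = -j.1 ∧ (u.1 (hi i)).1 = -j.1 - 1) := by
    clear c v1 v2 v3 v4 v5 x1 x2 x3 x4 inj hn e3 e4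
    generalize (u.1 (lo i)).1 = a at *
    generalize (u.1 (hi i)).1 = b at *
    rw [show (-(j.1 : ℤ) - 1) = -(j.1 + 1) by ring]
    by_contra hc
    rw [not_or, not_or, not_or] at hc
    obtain ⟨q1, q2, q3, q4⟩ := hc
    have q5 : ¬ (j.1 = 0 ∧ a = -((j.1 : ℤ) + 1) ∧ b = j.1 + 1) := fun h => by omega
    have q6 : ¬ (j.1 = 0 ∧ a = (j.1 : ℤ) + 1 ∧ b = -(j.1 + 1)) := fun h => by omega
    exact h (by simp only [q1, q2, q3, q4, q5, q6, not_false_eq_true, and_true, or_false])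
  clear h
  apply Subtype.ext
  rw [simpleReflPerm_val j (u.1 x)]
  have hz2 : (u.1 (lo i)).1 = 0 ↔ i.1 = 0 := ⟨hz', hz⟩
  have K := int_refl j.1 (u.1 (lo i)).1 (u.1 (hi i)).1 h' nh
  simp only [hz2] at K
  obtain ⟨k1, k2, k3, k4, k5⟩ := K
  rcases c with rfl | rfl | rfl | rfl | c
  · rw [k1, v1]; split_ifs <;> rfl
  · rw [k2, v2]; split_ifs
    · exact e4
    · rfl
  · rw [e3, k3, v3]; split_ifs
    · exact e3
    · exact e4
  · rw [e4, k4, v4]; split_ifs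
    · rfl
    · exact e3
  · obtain ⟨c1, c2, c3, c4⟩ := c
    rw [v5 ⟨c1, c2, c3, c4⟩]
    exact (k5 _ (x1.not.2 c1) (x2.not.2 c2) (e3 ▸ x3.not.2 c3) (e4 ▸ x4.not.2 c4)).symm

/-! ### The Hecke algebra -/

/-- The ring `ℤ[v, v⁻¹]`. -/
abbrev Coef : Type := LaurentPolynomial ℤ

/-- The indeterminate `v`, as a unit. -/
def vUnit : Coefˣ where
  val := LaurentPolynomial.T 1
  inv := LaurentPolynomial.T (-1)
  val_inv := by rw [← LaurentPolynomial.T_add]; simp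
  inv_val := by rw [← LaurentPolynomial.T_add]; simp

/-- `q = v²`, as a unit. -/
def q : Coefˣ := vUnit ^ 2

/-- The Hecke algebra of type `B_d` over `ℤ[v, v⁻¹]`: the free module on the basis `T_w`. Its
multiplication, below, is determined by `T_mul_T` and `quadratic`. -/
def Hecke (d : ℕ) : Type := SignedPerm d →₀ Coef

namespace Hecke

instance : AddCommGroup (Hecke d) := inferInstanceAs (AddCommGroup (SignedPerm d →₀ Coef))
instance : Module Coef (Hecke d) := inferInstanceAs (Module Coef (SignedPerm d →₀ Coef))

/-- The basis `(T_w)_w`. -/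
def basis (d : ℕ) : Module.Basis (SignedPerm d) Coef (Hecke d) :=
  (Finsupp.basisSingleOne : Module.Basis (SignedPerm d) Coef (SignedPerm d →₀ Coef))

/-- The basis element `T_w`. -/
def T (w : SignedPerm d) : Hecke d := basis d w

/-- Left multiplication by `T_{s_i}`. -/
def leftOp (i : Fin d) : Module.End Coef (Hecke d) :=
  (basis d).constr Coef fun w =>
    if length w < length (simpleRefl i * w) then T (simpleRefl i * w)
    else (q : Coef) • T (simpleRefl i * w) + ((q : Coef) - 1) • T w

/-- Right multiplication by `T_{s_i}`. -/
def rightOp (i : Fin d) : Module.End Coef (Hecke d) :=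
  (basis d).constr Coef fun w =>
    if length w < length (w * simpleRefl i) then T (w * simpleRefl i)
    else (q : Coef) • T (w * simpleRefl i) + ((q : Coef) - 1) • T w

theorem leftOp_T (i : Fin d) (w : SignedPerm d) : leftOp i (T w) =
    if length w < length (simpleRefl i * w) then T (simpleRefl i * w)
    else (q : Coef) • T (simpleRefl i * w) + ((q : Coef) - 1) • T w :=
  (basis d).constr_basis Coef _ w

theorem rightOp_T (i : Fin d) (w : SignedPerm d) : rightOp i (T w) =
    if length w < length (w * simpleRefl i) then T (w * simpleRefl i)
    else (q : Coef) • T (w * simpleRefl i) + ((q : Coef) - 1) • T w :=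
  (basis d).constr_basis Coef _ w

theorem leftOp_rightOp (i j : Fin d) : leftOp i * rightOp j = rightOp j * leftOp i := by
  refine (basis d).ext fun w => ?_
  change leftOp i (rightOp j (T w)) = rightOp j (leftOp i (T w))
  have hij : simpleRefl i * (w * simpleRefl j) = simpleRefl i * w * simpleRefl j :=
    (mul_assoc _ _ _).symm
  rw [rightOp_T, leftOp_T]
  by_cases h : simpleRefl i * w = w * simpleRefl j
  · have h2 : simpleRefl i * (w * simpleRefl j) = w := by
      rw [← h, ← mul_assoc, simpleRefl_mul_self, one_mul]
    have h3 : w * simpleRefl j * simpleRefl j = w := by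
      rw [mul_assoc, simpleRefl_mul_self, mul_one]
    rw [h]
    split_ifs with h1
    · rw [leftOp_T, rightOp_T, h2, h3]
    · simp only [map_add, map_smul, leftOp_T, rightOp_T, h2, h3, h]
  · have e1 : length w < length (simpleRefl i * w) ↔
        length (w * simpleRefl j) < length (simpleRefl i * (w * simpleRefl j)) := by
      by_contra hc; exact h (exchange w i j hc)
    have l1 := length_simple_mul i w
    have l2 := length_mul_simple w j
    have l3 := length_simple_mul i (w * simpleRefl j)
    have l4 := length_mul_simple (simpleRefl i * w) j
    rw [hij] at l3 e1
    by_cases h1 : length w < length (simpleRefl i * w) <;>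
    by_cases h2 : length w < length (w * simpleRefl j)
    · have h3 := e1.1 h1
      have h4 : length (simpleRefl i * w) < length (simpleRefl i * w * simpleRefl j) := by omega
      simp only [h1, h2, ↓reduceIte, leftOp_T, rightOp_T, hij, h3, h4]
    · have h3 := e1.1 h1
      have h4 : ¬ length (simpleRefl i * w) < length (simpleRefl i * w * simpleRefl j) := by omega
      simp only [h1, h2, ↓reduceIte, leftOp_T, rightOp_T, hij, h3, h4, map_add, map_smul]
    · have h3 := e1.not.1 h1
      have h4 : length (simpleRefl i * w) < length (simpleRefl i * w * simpleRefl j) := by omega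
      simp only [h1, h2, ↓reduceIte, leftOp_T, rightOp_T, hij, h3, h4, map_add, map_smul]
    · have h3 := e1.not.1 h1
      have h4 : ¬ length (simpleRefl i * w) < length (simpleRefl i * w * simpleRefl j) := by omega
      simp only [h1, h2, ↓reduceIte, leftOp_T, rightOp_T, hij, h3, h4, map_add, map_smul,
        smul_add, smul_smul]
      rw [mul_comm (q : Coef) ((q : Coef) - 1)]
      abel

/-- A reduced word of `w`. -/
def redWord (w : SignedPerm d) : List (Fin d) := (exists_reduced_word w).choose

/-- Left multiplication by `T_w`. -/
def opOf (w : SignedPerm d) : Module.End Coef (Hecke d) := ((redWord w).map leftOp).prod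

theorem opWord_T (l : List (Fin d)) (h : length (l.map simpleRefl).prod = l.length) :
    (l.map leftOp).prod (T 1) = T (l.map simpleRefl).prod := by
  induction l with
  | nil => rfl
  | cons i l ih =>
    simp only [List.map_cons, List.prod_cons, List.length_cons] at h ⊢
    have h1 := length_le_of_word l rfl
    have h2 := length_simple_mul i (l.map simpleRefl).prod
    have h3 : length (l.map simpleRefl).prod = l.length := by omega
    rw [Module.End.mul_apply, ih h3, leftOp_T, if_pos (by omega)]

theorem opOf_one (w : SignedPerm d) : opOf w (T 1) = T w := by
  have h := (exists_reduced_word w).choose_spec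
  have := opWord_T (redWord w) (by unfold redWord; rw [h.2, h.1])
  unfold redWord at this
  rw [h.2] at this
  exact this

theorem opWord_comm (l : List (Fin d)) (j : Fin d) : Commute (l.map leftOp).prod (rightOp j) := by
  induction l with
  | nil => exact Commute.one_left _
  | cons i l ih =>
    rw [List.map_cons, List.prod_cons]
    exact Commute.mul_left (leftOp_rightOp i j) ih

/-- The multiplication of the Hecke algebra. -/
def mulHom (d : ℕ) : Hecke d →ₗ[Coef] Module.End Coef (Hecke d) := (basis d).constr Coef opOf

theorem mulHom_T (w : SignedPerm d) : mulHom d (T w) = opOf w := (basis d).constr_basis Coef _ w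

theorem mulHom_one (x : Hecke d) : mulHom d x (T 1) = x := by
  have : (mulHom d).flip (T 1) = LinearMap.id := by
    refine (basis d).ext fun w => ?_
    change mulHom d (T w) (T 1) = T w
    rw [mulHom_T, opOf_one]
  exact LinearMap.congr_fun this x

theorem mulHom_comm (x : Hecke d) (j : Fin d) : Commute (mulHom d x) (rightOp j) := by
  have : LinearMap.mulRight Coef (rightOp j) ∘ₗ mulHom d =
      LinearMap.mulLeft Coef (rightOp j) ∘ₗ mulHom d := by
    refine (basis d).ext fun w => ?_
    change mulHom d (T w) * rightOp j = rightOp j * mulHom d (T w)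
    rw [mulHom_T]; exact opWord_comm _ _
  exact LinearMap.congr_fun this x

theorem eq_of_comm {f g : Module.End Coef (Hecke d)} (hf : ∀ j, Commute f (rightOp j))
    (hg : ∀ j, Commute g (rightOp j)) (h : f (T 1) = g (T 1)) : f = g := by
  have key : ∀ (k : ℕ) (w : SignedPerm d), length w = k → f (T w) = g (T w) := by
    intro k
    induction k with
    | zero =>
      intro w hw
      obtain ⟨l, hl, hp⟩ := exists_reduced_word w
      rw [hw, List.length_eq_zero_iff] at hl
      subst hl
      rw [← hp]
      exact h
    | succ k ih =>
      intro w hw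
      obtain ⟨l, hl, hp⟩ := exists_reduced_word w
      rcases List.eq_nil_or_concat l with rfl | ⟨l', j, rfl⟩
      · rw [List.length_nil] at hl; omega
      rw [List.concat_eq_append] at hl hp
      simp only [List.length_append, List.length_cons, List.length_nil, List.map_append,
        List.map_cons, List.map_nil, List.prod_append, List.prod_cons, List.prod_nil,
        mul_one] at hl hp
      have h1 := length_le_of_word l' rfl
      have h2 := length_mul_simple (l'.map simpleRefl).prod j
      rw [hp] at h2
      have h3 : length (l'.map simpleRefl).prod = k := by omega
      have e : T w = rightOp j (T (l'.map simpleRefl).prod) := by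
        rw [rightOp_T, hp, if_pos (by omega)]
      have e1 := LinearMap.congr_fun (hf j).eq (T (l'.map simpleRefl).prod)
      have e2 := LinearMap.congr_fun (hg j).eq (T (l'.map simpleRefl).prod)
      rw [Module.End.mul_apply, Module.End.mul_apply] at e1 e2
      rw [e, e1, e2, ih _ h3]
  exact (basis d).ext fun w => key _ w rfl

instance : Mul (Hecke d) := ⟨fun x y => mulHom d x y⟩
instance : One (Hecke d) := ⟨T 1⟩

theorem mul_def (x y : Hecke d) : x * y = mulHom d x y := rfl
theorem one_def : (1 : Hecke d) = T 1 := rfl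

theorem mulHom_mul (x y : Hecke d) : mulHom d (x * y) = mulHom d x * mulHom d y :=
  eq_of_comm (mulHom_comm _) (fun j => (mulHom_comm x j).mul_left (mulHom_comm y j)) (by
    rw [mulHom_one, Module.End.mul_apply, mulHom_one]; rfl)

theorem mulHom_T_one : mulHom d (T 1) = 1 :=
  eq_of_comm (mulHom_comm _) (fun _ => Commute.one_left _) (mulHom_one _)

instance : Ring (Hecke d) where
  __ := (inferInstance : AddCommGroup (Hecke d))
  mul_assoc x y z := by
    rw [mul_def (x * y), mulHom_mul]; rfl
  one_mul x := by rw [one_def, mul_def, mulHom_T_one]; rfl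
  mul_one x := mulHom_one x
  left_distrib x y z := map_add (mulHom d x) y z
  right_distrib x y z := by simp only [mul_def, map_add, LinearMap.add_apply]
  zero_mul x := by simp only [mul_def, map_zero, LinearMap.zero_apply]
  mul_zero x := map_zero (mulHom d x)

instance : Algebra Coef (Hecke d) :=
  Algebra.ofModule (fun c x y => by simp only [mul_def, map_smul, LinearMap.smul_apply])
    (fun c x y => by simp only [mul_def, map_smul])

theorem mulHom_simple (i : Fin d) : mulHom d (T (simpleRefl i)) = leftOp i :=
  eq_of_comm (mulHom_comm _) (fun j => leftOp_rightOp i j) (by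
    have h := length_simple_mul i (1 : SignedPerm d)
    rw [length_one] at h
    rw [mulHom_one, leftOp_T, if_pos (by rw [length_one]; omega), mul_one])

/-- `T_w T_{w'} = T_{w w'}` if `ℓ(w w') = ℓ(w) + ℓ(w')`. -/
theorem T_mul_T (u w : SignedPerm d) (h : length (u * w) = length u + length w) :
    T u * T w = T (u * w) := by
  have key : ∀ (l : List (Fin d)) (u : SignedPerm d), (l.map simpleRefl).prod = u →
      l.length = length u → length (u * w) = length u + length w → T u * T w = T (u * w) := by
    intro l
    induction l with
    | nil =>
      intro u hu _ _
      have : u = 1 := hu.symm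
      rw [this, one_mul, ← one_def, one_mul]
    | cons i l ih =>
      intro u hu hl h
      rw [List.map_cons, List.prod_cons] at hu
      rw [List.length_cons] at hl
      set u' := (l.map simpleRefl).prod with hu'
      have h1 := length_le_of_word l hu'.symm
      have h2 := length_simple_mul i u'
      rw [hu] at h2
      have h3 : l.length = length u' := by omega
      have h4 := length_mul_le u' w
      have h5 := length_simple_mul i (u' * w)
      rw [← mul_assoc, hu] at h5
      have e : T u = T (simpleRefl i) * T u' := by
        rw [mul_def, mulHom_simple, leftOp_T, hu, if_pos (by omega)]
      rw [e, mul_assoc, ih u' rfl h3 (by omega), mul_def, mulHom_simple, leftOp_T, ← mul_assoc,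
        hu, if_pos (by omega)]
  obtain ⟨l, hl, hp⟩ := exists_reduced_word u
  exact key l u hp hl h

/-- `(T_s + 1) (T_s - q) = 0`. -/
theorem quadratic (i : Fin d) :
    (T (simpleRefl i) + 1) * (T (simpleRefl i) - (q : Coef) • (1 : Hecke d)) = 0 := by
  have h := length_simple_mul i (1 : SignedPerm d)
  rw [length_one, mul_one] at h
  have e : T (simpleRefl i) * T (simpleRefl i) =
      (q : Coef) • (1 : Hecke d) + ((q : Coef) - 1) • T (simpleRefl i) := by
    rw [mul_def, mulHom_simple, leftOp_T, simpleRefl_mul_self, length_one, if_neg (by omega),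
      one_def]
  rw [mul_sub, add_mul, e, one_mul, mul_smul_comm, mul_one, smul_add, sub_smul, one_smul]
  abel

end Hecke

/-! ### Quantum integers -/

/-- `[a]_p = (p^a - 1) / (p - 1) = 1 + p + ⋯ + p^(a-1)`. -/
def qInt (p : Coef) (a : ℕ) : Coef := ∑ i ∈ Finset.range a, p ^ i

theorem qInt_mul (p : Coef) (a : ℕ) : qInt p a * (p - 1) = p ^ a - 1 := geom_sum_mul p a

/-- `[a]_p! = [a]_p [a-1]_p ⋯ [1]_p`. -/
def qFact (p : Coef) (a : ℕ) : Coef := ∏ i ∈ Finset.range a, qInt p (i + 1)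

/-- `[2a]_𝔠 = [a]_q (q^a + 1)`. -/
def cInt (a : ℕ) : Coef := qInt q a * ((q : Coef) ^ a + 1)

/-- `[a]_𝔠! = ∏_{k=1}^a [2k]_𝔠`. -/
def cFact (a : ℕ) : Coef := ∏ i ∈ Finset.range a, cInt (i + 1)

open Classical in
/-- The quotient `x / y` of Laurent polynomials, when `y` divides `x`
(for `y ≠ 0` it is then unique). -/
def exactDiv (x y : Coef) : Coef := if h : ∃ z, z * y = x then h.choose else 0

theorem exactDiv_mul {x y : Coef} (h : ∃ z, z * y = x) : exactDiv x y * y = x := by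
  rw [exactDiv, dif_pos h]; exact h.choose_spec

/-- `[a]_p! / ([b]_p! [a-b]_p!)`. -/
def qBinom (p : Coef) (a b : ℕ) : Coef := exactDiv (qFact p a) (qFact p b * qFact p (a - b))

theorem qInt_add (p : Coef) (a b : ℕ) : qInt p (a + b) = qInt p a + p ^ a * qInt p b := by
  simp only [qInt, Finset.sum_range_add, Finset.mul_sum, pow_add]

theorem qFact_succ (p : Coef) (a : ℕ) : qFact p (a + 1) = qFact p a * qInt p (a + 1) :=
  Finset.prod_range_succ _ _

theorem qFact_dvd (p : Coef) (a b : ℕ) : ∃ z, z * (qFact p a * qFact p b) = qFact p (a + b) := by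
  induction a generalizing b with
  | zero => exact ⟨1, by simp [qFact]⟩
  | succ a iha =>
    induction b with
    | zero => exact ⟨1, by simp [qFact]⟩
    | succ b ihb =>
      obtain ⟨y, hy⟩ := iha (b + 1)
      obtain ⟨z, hz⟩ := ihb
      refine ⟨y + p ^ (a + 1) * z, ?_⟩
      have e : a + 1 + (b + 1) = (a + (b + 1)) + 1 := by omega
      rw [e, qFact_succ p (a + (b + 1)), show a + (b + 1) + 1 = (a + 1) + (b + 1) by omega,
        qInt_add, mul_add]
      rw [show a + (b + 1) = a + 1 + b by omega] at hy ⊢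
      rw [add_mul]
      congr 1
      · rw [← hy, qFact_succ p a]; ring
      · rw [← hz, qFact_succ p b]; ring

/-- Quantum binomials are honest quotients. -/
theorem qBinom_mul (p : Coef) {a b : ℕ} (h : b ≤ a) :
    qBinom p a b * (qFact p b * qFact p (a - b)) = qFact p a :=
  exactDiv_mul (by simpa [Nat.add_sub_cancel' h] using qFact_dvd p b (a - b))

/-- Quantum trinomials are honest quotients. -/
theorem qTrinom_mul (p : Coef) (a b c : ℕ) :
    exactDiv (qFact p (a + b + c)) (qFact p a * qFact p b * qFact p c) *
      (qFact p a * qFact p b * qFact p c) = qFact p (a + b + c) :=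
  exactDiv_mul (by
    obtain ⟨y, hy⟩ := qFact_dvd p a b
    obtain ⟨z, hz⟩ := qFact_dvd p (a + b) c
    exact ⟨z * y, by rw [← hz, ← hy]; ring⟩)

/-- The type C factorial quotients are honest quotients. -/
theorem cQuot_mul (r t : ℕ) :
    exactDiv (cFact (r + t)) (cFact r * qFact q t) * (cFact r * qFact q t) = cFact (r + t) :=
  exactDiv_mul (by
    obtain ⟨y, hy⟩ := qFact_dvd q r t
    have e : ∀ a, cFact a = qFact q a * ∏ i ∈ Finset.range a, ((q : Coef) ^ (i + 1) + 1) :=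
      fun a => Finset.prod_mul_distrib
    refine ⟨y * ∏ i ∈ Finset.range t, ((q : Coef) ^ (r + i + 1) + 1), ?_⟩
    rw [e (r + t), ← hy, e r, Finset.prod_range_add]
    ring)

/-! ### Weak compositions and parabolic subgroups -/

/-- Weak compositions `(l₀, …, l_k)` of `d`. -/
abbrev WComp (k d : ℕ) : Type := {l : Fin (k + 1) → ℕ // ∑ i, l i = d}

variable {k d : ℕ}

/-- The partial sum `l₀ + ⋯ + l_i`. -/
def WComp.psum (l : WComp k d) (i : ℕ) : ℕ := ∑ j with j.1 ≤ i, l.1 j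

/-- The interval `R_i^l`. -/
def WComp.block (l : WComp k d) (i : SymInt k) : Finset (SymInt d) :=
  {x | if i.1 = 0 then |x.1| ≤ l.psum 0
    else if 0 < i.1 then (l.psum (i.1.toNat - 1) : ℤ) < x.1 ∧ x.1 ≤ l.psum i.1.toNat
    else (l.psum ((-i.1).toNat - 1) : ℤ) < -x.1 ∧ -x.1 ≤ l.psum (-i.1).toNat}

/-- The parabolic subgroup `W_l`, generated by the `s_i` with `i` not among the partial sums
`l₀ + ⋯ + l_j`, `0 ≤ j < k`. -/
def parabolic (l : WComp k d) : Subgroup (SignedPerm d) :=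
  Subgroup.closure (simpleRefl '' {i | ∀ j < k, i.1 ≠ l.psum j})

/-- The even part of `W_l`: its generators that move only positions of the even blocks
`R_i^l`, `|i| ≤ m`. -/
def evenParabolic (m : ℕ) (l : WComp k d) : Subgroup (SignedPerm d) :=
  Subgroup.closure (simpleRefl '' {i | (∀ j < k, i.1 ≠ l.psum j) ∧ i.1 < l.psum m})

/-- The odd part of `W_l`: its generators that move only positions of the odd blocks
`R_i^l`, `|i| > m`. -/
def oddParabolic (m : ℕ) (l : WComp k d) : Subgroup (SignedPerm d) :=
  Subgroup.closure (simpleRefl '' {i | (∀ j < k, i.1 ≠ l.psum j) ∧ l.psum m < i.1})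

/-- `g⁻¹ H g`. -/
def conjBy (g : SignedPerm d) (H : Subgroup (SignedPerm d)) : Subgroup (SignedPerm d) :=
  H.map (MulAut.conj g⁻¹).toMonoidHom

/-- `g` is a shortest representative of the double coset `W_l g W_l'`, and it has the even-odd
trivial intersection property. -/
structure IsSuperRep (m : ℕ) (l : WComp k d) (g : SignedPerm d) (l' : WComp k d) : Prop where
  shortest : ∀ x ∈ parabolic l, ∀ y ∈ parabolic l', length g ≤ length (x * g * y)
  odd_even : conjBy g (oddParabolic m l) ⊓ evenParabolic m l' = ⊥
  even_odd : conjBy g (evenParabolic m l) ⊓ oddParabolic m l' = ⊥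

/-- `κ(l, g, l') = (|R_i^l ∩ g R_j^l'|)_{i,j}`. -/
def kappa (l : WComp k d) (g : SignedPerm d) (l' : WComp k d) :
    Matrix (SymInt k) (SymInt k) ℕ :=
  Matrix.of fun i j => (l.block i ∩ (l'.block j).image g.1).card

/-! ### Signed permutation modules and the Schur superalgebra -/

open Classical in
/-- `[xy]_l = x y` with `x = ∑ T_w` over the even part and `y = ∑ (-q)^{-ℓ(w)} T_w` over the
odd part of `W_l`. -/
def xy (m : ℕ) (l : WComp k d) : Hecke d :=
  (∑ w with w ∈ evenParabolic m l, Hecke.T w) *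
    ∑ w with w ∈ oddParabolic m l, (((-q) ^ (-(length w : ℤ)) : Coefˣ) : Coef) • Hecke.T w

open Classical in
/-- `T_{W_l g W_l'} = [xy]_l T_g ∑ (-q)^{-ℓ(w₁)} T_{w₀ w₁}`, where `w₀`, `w₁` run over the even and
the odd part of `W_l'` such that `w₀ w₁` is a shortest representative of its right coset of
`W_δ = g⁻¹ W_l g ∩ W_l'`. -/
def doubleCosetElt (m : ℕ) (l : WComp k d) (g : SignedPerm d) (l' : WComp k d) : Hecke d :=
  xy m l * Hecke.T g *
    ∑ w₀ with w₀ ∈ evenParabolic m l', ∑ w₁ with w₁ ∈ oddParabolic m l',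
      if ∀ x ∈ conjBy g (parabolic l) ⊓ parabolic l', length (w₀ * w₁) ≤ length (x * (w₀ * w₁))
      then (((-q) ^ (-(length w₁ : ℤ)) : Coefˣ) : Coef) • Hecke.T (w₀ * w₁)
      else 0

/-- The right ideal `[xy]_l ℋ`, as a right `ℋ`-module. -/
def xyIdeal (m : ℕ) (l : WComp k d) : Submodule (Hecke d)ᵐᵒᵖ (Hecke d) :=
  Submodule.span (Hecke d)ᵐᵒᵖ {xy m l}

theorem xy_mul_mem (m : ℕ) (l : WComp k d) (h : Hecke d) : xy m l * h ∈ xyIdeal m l :=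
  Submodule.smul_mem _ (MulOpposite.op h) (Submodule.mem_span_singleton_self _)

theorem doubleCosetElt_mul_mem (m : ℕ) (l : WComp k d) (g : SignedPerm d) (l' : WComp k d)
    (h : Hecke d) : doubleCosetElt m l g l' * h ∈ xyIdeal m l := by
  rw [doubleCosetElt, mul_assoc, mul_assoc]
  exact xy_mul_mem m l _

/-- `⨁_l [xy]_l ℋ`, over the weak compositions of `d` into `m + n + 1` parts. -/
abbrev SignedPermModule (m n d : ℕ) : Type :=
  DirectSum (WComp (m + n) d) fun l => ↥(xyIdeal m l)

/-- The `ι`Schur superalgebra `End_ℋ (⨁_l [xy]_l ℋ)`, with composition as multiplication. -/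
abbrev SchurSuper (m n d : ℕ) : Type :=
  Module.End (Hecke d)ᵐᵒᵖ (SignedPermModule m n d)

variable {m n : ℕ}

/-- The condition `f ([xy]_l h) = δ_{l', l} T_{W_μ g W_l'} h` (all `l` and `h`) that determines
`φ_{μ l'}^g`. -/
def IsPhi (μ : WComp (m + n) d) (g : SignedPerm d) (l' : WComp (m + n) d)
    (f : SchurSuper m n d) : Prop :=
  ∀ (l : WComp (m + n) d) (h : Hecke d),
    f (DirectSum.of (fun l => ↥(xyIdeal m l)) l ⟨xy m l * h, xy_mul_mem m l h⟩) =
      if l = l' then DirectSum.of (fun l => ↥(xyIdeal m l)) μ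
        ⟨doubleCosetElt m μ g l' * h, doubleCosetElt_mul_mem m μ g l' h⟩
      else 0

open Classical in
/-- The map `φ_{μ ν}^g`. -/
def phi (μ : WComp (m + n) d) (g : SignedPerm d) (ν : WComp (m + n) d) : SchurSuper m n d :=
  if h : ∃ f, IsPhi μ g ν f then h.choose else 0

/-- A map with the defining property of `φ_{μ ν}^g` is unique. -/
theorem IsPhi.unique {μ ν : WComp (m + n) d} {g : SignedPerm d} {f f' : SchurSuper m n d}
    (hf : IsPhi μ g ν f) (hf' : IsPhi μ g ν f') : f = f' := by
  refine LinearMap.toAddMonoidHom_injective (DirectSum.addHom_ext fun l x => ?_)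
  obtain ⟨x, hx⟩ := x
  obtain ⟨h, rfl⟩ := Submodule.mem_span_singleton.1 hx
  exact (hf l h.unop).trans (hf' l h.unop).symm

/-! ### Matrices -/

/-- `i` is an odd index, i.e. `|i| > m`. -/
def IsOddIdx (m : ℕ) (i : SymInt k) : Prop := (m : ℤ) < |i.1|

/-- The set `Ξ_{m|n,d}`. -/
def Xi (m n d : ℕ) : Set (Matrix (SymInt (m + n)) (SymInt (m + n)) ℕ) :=
  {A | ∑ i, ∑ j, A i j = 2 * d + 1 ∧ (∀ i j, A i j = A (-i) (-j)) ∧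
    ∀ i j, ¬ (IsOddIdx m i ↔ IsOddIdx m j) → A i j = 0 ∨ A i j = 1}

/-- `A` as an integer matrix. -/
def toInt (A : Matrix (SymInt k) (SymInt k) ℕ) : Matrix (SymInt k) (SymInt k) ℤ :=
  A.map fun x => (x : ℤ)

open Classical in
/-- The element `e_M`: it is `φ_{μ ν}^g` if `M = κ(μ, g, ν)` for an even-odd trivially intersecting
shortest representative `g`, and `0` if there is none, i.e. if `M` is not in `Ξ_{m|n,d}`. -/
def e (m n d : ℕ) (M : Matrix (SymInt (m + n)) (SymInt (m + n)) ℤ) : SchurSuper m n d :=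
  if h : ∃ p : WComp (m + n) d × SignedPerm d × WComp (m + n) d,
      IsSuperRep m p.1 p.2.1 p.2.2 ∧ toInt (kappa p.1 p.2.1 p.2.2) = M
  then phi h.choose.1 h.choose.2.1 h.choose.2.2 else 0

/-- `row(A)`. -/
def row (A : Matrix (SymInt k) (SymInt k) ℕ) (i : Fin (k + 1)) : ℕ :=
  if i.1 = 0 then (A 0 0 - 1) / 2 + ∑ j with 0 < j, A 0 j
  else ∑ j, A (SymInt.ofNat i.1 (Nat.lt_succ_iff.1 i.2)) j

/-- `col(A)`. -/
def col (A : Matrix (SymInt k) (SymInt k) ℕ) : Fin (k + 1) → ℕ := row A.transpose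

/-- `E_{ij}^θ = E_{ij} + E_{-i,-j}`. -/
def Etheta (i j : SymInt k) : Matrix (SymInt k) (SymInt k) ℤ :=
  Matrix.single i j 1 + Matrix.single (-i) (-j) 1

/-! ### The parameters `𝐪_h`, `𝐪̇_h`, `𝐪̈_h` -/

open Classical in
/-- `𝐪_h`: it is `q` for even `h` and `q⁻¹` for odd `h`. -/
def qPar (m : ℕ) (h : SymInt k) : Coefˣ := if IsOddIdx m h then q⁻¹ else q

open Classical in
/-- `𝐪̇_h`: it is `1` for even `h` and `-q⁻¹` for odd `h`. -/
def qDot (m : ℕ) (h : SymInt k) : Coefˣ := if IsOddIdx m h then -q⁻¹ else 1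

open Classical in
/-- `𝐪̈_h`: it is `q` for even `h` and `-1` for odd `h`. -/
def qDDot (m : ℕ) (h : SymInt k) : Coefˣ := if IsOddIdx m h then -1 else q

/-- The matrix `A + ∑_i t_i (E_{pi}^θ - E_{ri}^θ)`. -/
def shift (A : Matrix (SymInt k) (SymInt k) ℕ) (p r : SymInt k) (t : SymInt k → ℕ) :
    Matrix (SymInt k) (SymInt k) ℤ :=
  toInt A + ∑ i, (t i : ℤ) • (Etheta p i - Etheta r i)

open Classical in
/-- The tuples `t = (t_i)` of natural numbers with `∑ t_i = b` and with the property `P`. -/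
def tuples (b : ℕ) (P : (SymInt k → ℕ) → Prop) : Finset (SymInt k → ℕ) :=
  {t ∈ Finset.univ.piAntidiag b | P t}

theorem mem_tuples {b : ℕ} {P : (SymInt k → ℕ) → Prop} {t : SymInt k → ℕ} :
    t ∈ tuples b P ↔ ∑ i, t i = b ∧ P t := by
  simp [tuples]

end
end IotaSchur

open IotaSchur

/-! The right ideal generated by [xy]_λ is a signed permutation module. A shortest element g of a
coset W_λ g is recorded by the word that assigns to a position x the λ-block of g x. Words are odd
functions from positions to letters, and g is recovered from its word by standardization, which
numbers the positions in the order of their letters and breaks ties from left to right. On the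
elements [xy]_λ T_g the generator T_s exchanges two increasing letters, multiplies by q (even
letter) or by -1 (odd letter) if the letters are equal, and follows the quadratic relation if they
decrease: `Word.E_mul_asc`, `Word.E_mul_eq`, `Word.E_mul_desc`. A pair of words (f, u) has a matrix,
which counts the positions with letter i in f and j in u. The matrix κ(μ, g, ν) belongs to the word
of g and the block word of ν, and shortest double coset representatives are the pairs sorted
lexicographically. The double coset element is then the sum of the words f with the prescribed
matrix, each weighted by -q⁻¹ to the number of its inversions inside odd blocks (`Word.dce_eq`).

Such an element x is a right eigenvector of the T_s in W_ν (`Word.sum_mul_simple`). Hence x [xy]_ν =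
c x, where c specializes at v = 1 to the order of W_ν. So c is not zero, [xy]_ν h = 0 implies x h =
0, and e_A is well defined (`isPhi_e`).

The product e_B e_A maps [xy]_ν to an element that is an eigenvector on both sides. Such an element
is determined by its coefficients at the shortest representatives with the parity property
(`Word.eq_zero_of_eigen`), and e_{A'} has coefficient 1 at its own representative and 0 at the
others (`Word.coef_dce`). So the structure constants are coefficients. If B is nearly diagonal, the
T_w that occur in e_A never meet decreasing letters in the words of e_B, so each of them acts by a
power of one eigenvalue (`Word.E_mul_T`). The coefficient at a word f' becomes a sum of monomials
over the intermediate words f for which (f, u) has matrix A and (f', f) has matrix B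
(`Word.coef_dce_mul_tail`, `e_mul_e`).

These f arise from f' by changing the letter p to its neighbour r on a set T of positions, and -p to
-r on -T (`e_mul_e_shift`). The number t_i counts the elements of T in the i-th block of u.
Inversions between different blocks depend on A and t only and give the powers in the formula.
Inversions inside one block are summed over the choices of T and give Gaussian binomials
(`gauss_sum`, `sum_halfSets`). If p = 0, the set of positions with letter 0 is symmetric and T must
be disjoint from -T. Pairs in T with negative sum count as well, opposite blocks i and -i together
give a trinomial (`sum_pair_block`), and the central block gives the type C quotient, by a recursion
on its radius (`zeroSum_succ`). -/

namespace IotaSchur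
noncomputable section
variable {d : ℕ}

/-! ### Standardization of odd functions -/

/-- The strict order on positions by value of `φ`, ties being broken by position. -/
def KeyLt (φ : SymInt d → ℤ) (x y : SymInt d) : Prop := φ x < φ y ∨ (φ x = φ y ∧ x.1 < y.1)

theorem KeyLt.irrefl (φ : SymInt d → ℤ) (x : SymInt d) : ¬ KeyLt φ x x := by
  unfold KeyLt; omega

theorem KeyLt.trans {φ : SymInt d → ℤ} {x y z : SymInt d} (h : KeyLt φ x y) (h' : KeyLt φ y z) :
    KeyLt φ x z := by
  unfold KeyLt at *; omega

theorem KeyLt.trichotomy (φ : SymInt d → ℤ) (x y : SymInt d) :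
    KeyLt φ x y ∨ x = y ∨ KeyLt φ y x := by
  rw [Subtype.ext_iff]; unfold KeyLt; omega

theorem keyLt_neg {φ : SymInt d → ℤ} (hφ : ∀ x, φ (-x) = -φ x) (x y : SymInt d) :
    KeyLt φ (-x) (-y) ↔ KeyLt φ y x := by
  unfold KeyLt; rw [hφ, hφ, SymInt.val_neg, SymInt.val_neg]; omega

theorem card_symInt (d : ℕ) : Fintype.card (SymInt d) = 2 * d + 1 := by
  rw [Fintype.card_ofFinset]; simp; omega

open Classical in
-- Rank the positions by `KeyLt φ`. Negation reverses this order, so the ranks of x and -x add up to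
-- 2d, and the rank minus d is an odd bijection.
theorem exists_std {φ : SymInt d → ℤ} (hφ : ∀ x, φ (-x) = -φ x) :
    ∃ w : SignedPerm d, ∀ x y, (w.1 x).1 < (w.1 y).1 ↔ KeyLt φ x y := by
  let r : SymInt d → ℕ := fun x => (Finset.univ.filter fun y => KeyLt φ y x).card
  have hr : ∀ x y, KeyLt φ x y → r x < r y := fun x y h => by
    apply Finset.card_lt_card
    refine ⟨fun z hz => ?_, fun hs => ?_⟩
    · simp only [Finset.mem_filter, Finset.mem_univ, true_and] at hz ⊢
      exact hz.trans h
    · have := hs (Finset.mem_filter.2 ⟨Finset.mem_univ x, h⟩)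
      exact KeyLt.irrefl φ x (Finset.mem_filter.1 this).2
  have hr' : ∀ x y, r x < r y ↔ KeyLt φ x y := fun x y => by
    refine ⟨fun h => ?_, hr x y⟩
    rcases KeyLt.trichotomy φ x y with h1 | rfl | h1
    · exact h1
    · omega
    · have := hr _ _ h1; omega
  have hs : ∀ x, r x + r (-x) = 2 * d := fun x => by
    have e1 : r (-x) = (Finset.univ.filter fun y => KeyLt φ x y).card := by
      refine Finset.card_bij' (fun y _ => -y) (fun y _ => -y) ?_ ?_ ?_ ?_
      · intro y hy
        simp only [Finset.mem_filter, Finset.mem_univ, true_and] at hy ⊢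
        rw [← keyLt_neg hφ, SymInt.neg_neg']; exact hy
      · intro y hy
        simp only [Finset.mem_filter, Finset.mem_univ, true_and] at hy ⊢
        rwa [keyLt_neg hφ]
      · intro y _; exact SymInt.neg_neg' y
      · intro y _; exact SymInt.neg_neg' y
    have e2 := Finset.card_filter_add_card_filter_not (s := (Finset.univ : Finset (SymInt d)))
      (fun y => KeyLt φ y x)
    have e3 : (Finset.univ.filter fun y => ¬ KeyLt φ y x) =
        insert x (Finset.univ.filter fun y => KeyLt φ x y) := by
      ext y
      simp only [Finset.mem_filter, Finset.mem_univ, true_and, Finset.mem_insert]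
      constructor
      · intro h
        rcases KeyLt.trichotomy φ x y with h1 | h1 | h1
        · exact Or.inr h1
        · exact Or.inl h1.symm
        · exact absurd h1 h
      · rintro (rfl | h) h'
        · exact KeyLt.irrefl _ _ h'
        · exact KeyLt.irrefl _ _ (h.trans h')
    rw [e3, Finset.card_insert_of_notMem (by simp [KeyLt.irrefl]), Finset.card_univ,
      card_symInt] at e2
    rw [e1]
    change (Finset.univ.filter fun y => KeyLt φ y x).card + _ = _
    omega
  let g : SymInt d → SymInt d := fun x => ⟨(r x : ℤ) - d, by
    have := hs x; simp only [Set.mem_Icc]; omega⟩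
  have hg : Function.Injective g := fun x y h => by
    have h1 : (r x : ℤ) - d = r y - d := congrArg Subtype.val h
    rcases KeyLt.trichotomy φ x y with h2 | h2 | h2
    · have := hr _ _ h2; omega
    · exact h2
    · have := hr _ _ h2; omega
  refine ⟨⟨Equiv.ofBijective g ⟨hg, Finite.surjective_of_injective hg⟩, fun x => ?_⟩, fun x y => ?_⟩
  · apply Subtype.ext
    change (r (-x) : ℤ) - d = -((r x : ℤ) - d)
    have := hs x; omega
  · change (r x : ℤ) - d < r y - d ↔ _
    rw [← hr']; omega

open Classical in
/-- The standardization of an odd function: the signed permutation that puts the positions in the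
order `KeyLt φ`. -/
def std (φ : SymInt d → ℤ) : SignedPerm d :=
  if h : ∀ x, φ (-x) = -φ x then (exists_std h).choose else 1

theorem std_lt {φ : SymInt d → ℤ} (hφ : ∀ x, φ (-x) = -φ x) (x y : SymInt d) :
    ((std φ).1 x).1 < ((std φ).1 y).1 ↔ KeyLt φ x y := by
  rw [std, dif_pos hφ]; exact (exists_std hφ).choose_spec x y

theorem signed_mul_apply (u w : SignedPerm d) (x : SymInt d) : (u * w).1 x = u.1 (w.1 x) := rfl
theorem signed_inv_apply (w : SignedPerm d) (x : SymInt d) : w⁻¹.1 (w.1 x) = x :=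
  w.1.symm_apply_apply x
theorem signed_apply_inv (w : SignedPerm d) (x : SymInt d) : w.1 (w⁻¹.1 x) = x :=
  w.1.apply_symm_apply x

theorem signed_ext {u w : SignedPerm d} (h : ∀ x, u.1 x = w.1 x) : u = w :=
  Subtype.ext (Equiv.ext h)

/-- Under the hypothesis u w⁻¹ has no descent, and the identity is the only signed permutation
without descents. -/
theorem eq_of_lt_iff {u w : SignedPerm d}
    (h : ∀ x y, (u.1 x).1 < (u.1 y).1 ↔ (w.1 x).1 < (w.1 y).1) : u = w := by
  have : u * w⁻¹ = 1 := eq_one_of_asc _ fun i => by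
    rw [signed_mul_apply, signed_mul_apply, h, signed_apply_inv, signed_apply_inv]
    simp [lo, hi]
  rwa [mul_inv_eq_one] at this

theorem val_lo (i : Fin d) : (lo i).1 = i.1 := rfl
theorem val_hi (i : Fin d) : (hi i).1 = i.1 + 1 := by simp [hi]

/-- `g` is increasing on the fibres of `φ ∘ g`. -/
def IsMin (φ : SymInt d → ℤ) (g : SignedPerm d) : Prop :=
  ∀ p p', φ (g.1 p) = φ (g.1 p') → p.1 < p'.1 → (g.1 p).1 < (g.1 p').1

/-- Different values of φ ∘ g are in the order of φ by monotonicity, and equal ones in the order of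
positions by minimality. So a minimal g is determined by the word φ ∘ g. -/
theorem IsMin.lt_iff {φ : SymInt d → ℤ} (hm : Monotone φ) {g : SignedPerm d} (h : IsMin φ g)
    (p p' : SymInt d) : (g.1 p).1 < (g.1 p').1 ↔ KeyLt (fun x => φ (g.1 x)) p p' := by
  constructor
  · intro hlt
    have h1 : φ (g.1 p) ≤ φ (g.1 p') := hm hlt.le
    by_contra hc
    unfold KeyLt at hc
    simp only at hc
    have h2 : φ (g.1 p') = φ (g.1 p) := by omega
    rcases lt_trichotomy p'.1 p.1 with h3 | h3 | h3
    · have := h _ _ h2 h3; omega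
    · rw [Subtype.ext h3] at hlt; omega
    · omega
  · rintro (h1 | ⟨h1, h2⟩)
    · by_contra hc
      have : φ (g.1 p') ≤ φ (g.1 p) := hm (not_lt.1 hc)
      simp only at h1; omega
    · exact h _ _ h1 h2

theorem IsMin.unique {φ : SymInt d → ℤ} (hm : Monotone φ) {g g' : SignedPerm d} (h : IsMin φ g)
    (h' : IsMin φ g') (e : ∀ x, φ (g.1 x) = φ (g'.1 x)) : g = g' :=
  eq_of_lt_iff fun x y => by
    rw [h.lt_iff hm, h'.lt_iff hm]; simp only [KeyLt, e]

theorem isMin_std {φ ψ : SymInt d → ℤ} (ho : ∀ x, ψ (-x) = -ψ x)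
    (e : ∀ x, φ ((std ψ).1 x) = ψ x) : IsMin φ (std ψ) := fun p p' h hlt => by
  rw [std_lt ho]; rw [e, e] at h; exact Or.inr ⟨h, hlt⟩

theorem asc_all {φ : SymInt d → ℤ} (ho : ∀ x, φ (-x) = -φ x) (g : SignedPerm d)
    (h : ∀ i, φ (lo i) = φ (hi i) → (g.1 (lo i)).1 < (g.1 (hi i)).1) (z z' : SymInt d)
    (hz : z'.1 = z.1 + 1) (e : φ z = φ z') : (g.1 z).1 < (g.1 z').1 := by
  have b1 := z.2
  have b2 := z'.2
  simp only [Set.mem_Icc] at b1 b2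
  rcases le_or_gt 0 z.1 with h0 | h0
  · obtain ⟨i, rfl, rfl⟩ : ∃ i : Fin d, z = lo i ∧ z' = hi i :=
      ⟨⟨z.1.toNat, by omega⟩, Subtype.ext (by rw [val_lo]; simp [h0]),
        Subtype.ext (by rw [val_hi]; simp [h0]; omega)⟩
    exact h _ e
  · obtain ⟨i, rfl, rfl⟩ : ∃ i : Fin d, z' = -lo i ∧ z = -hi i :=
      ⟨⟨(-z'.1).toNat, by omega⟩, Subtype.ext (by rw [SymInt.val_neg, val_lo]; simp; omega),
        Subtype.ext (by rw [SymInt.val_neg, val_hi]; simp; omega)⟩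
    have := h i (by rw [ho, ho] at e; omega)
    rw [signed_map_neg, signed_map_neg, SymInt.val_neg, SymInt.val_neg]
    omega

/-- The fibres of a monotone function are intervals, so comparisons of neighbours can be chained.
Neighbours on the negative side are handled by oddness. -/
theorem incr_of_asc {φ : SymInt d → ℤ} (hm : Monotone φ) (ho : ∀ x, φ (-x) = -φ x)
    (g : SignedPerm d) (h : ∀ i, φ (lo i) = φ (hi i) → (g.1 (lo i)).1 < (g.1 (hi i)).1)
    (x y : SymInt d) (e : φ x = φ y) (hlt : x.1 < y.1) : (g.1 x).1 < (g.1 y).1 := by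
  obtain ⟨n, hn⟩ : ∃ n : ℕ, y.1 = x.1 + n + 1 := ⟨(y.1 - x.1 - 1).toNat, by omega⟩
  have b1 := x.2
  simp only [Set.mem_Icc] at b1
  induction n generalizing y with
  | zero => exact asc_all ho g h x y (by omega) e
  | succ n ih =>
    have b2 := y.2
    simp only [Set.mem_Icc] at b2
    let y' : SymInt d := ⟨y.1 - 1, by simp only [Set.mem_Icc]; omega⟩
    have e1 : y'.1 = y.1 - 1 := rfl
    have h1 : φ x ≤ φ y' := hm (show x.1 ≤ y'.1 by omega)
    have h2 : φ y' ≤ φ y := hm (show y'.1 ≤ y.1 by omega)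
    have := ih y' (by omega) (by omega) (by rw [e1]; push_cast at hn; omega)
    have := asc_all ho g h y' y (by omega) (by omega)
    omega

theorem isMin_iff_inv {φ : SymInt d → ℤ} {g : SignedPerm d} : IsMin φ g ↔
    ∀ x y, φ x = φ y → x.1 < y.1 → (g⁻¹.1 x).1 < (g⁻¹.1 y).1 := by
  constructor
  · intro h x y e hlt
    rcases lt_trichotomy (g⁻¹.1 x).1 (g⁻¹.1 y).1 with h1 | h1 | h1
    · exact h1
    · have := g⁻¹.1.injective (Subtype.ext h1); rw [this] at hlt; omega
    · have := h _ _ (by rw [signed_apply_inv, signed_apply_inv, e]) h1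
      rw [signed_apply_inv, signed_apply_inv] at this; omega
  · intro h p p' e hlt
    rcases lt_trichotomy (g.1 p).1 (g.1 p').1 with h1 | h1 | h1
    · exact h1
    · have := g.1.injective (Subtype.ext h1); rw [this] at hlt; omega
    · have := h _ _ e.symm h1
      rw [signed_inv_apply, signed_inv_apply] at this; omega

theorem isMin_of_asc {φ : SymInt d → ℤ} (hm : Monotone φ) (ho : ∀ x, φ (-x) = -φ x)
    {g : SignedPerm d}
    (h : ∀ i, φ (lo i) = φ (hi i) → (g⁻¹.1 (lo i)).1 < (g⁻¹.1 (hi i)).1) : IsMin φ g :=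
  isMin_iff_inv.2 (incr_of_asc hm ho _ h)

/-! ### Stabilizers of monotone odd functions -/

/-- The stabilizer of `φ`. -/
def stab (φ : SymInt d → ℤ) : Subgroup (SignedPerm d) where
  carrier := {w | ∀ x, φ (w.1 x) = φ x}
  one_mem' := fun _ => rfl
  mul_mem' := fun {a b} ha hb x => by
    rw [signed_mul_apply, ha, hb]
  inv_mem' := fun {a} ha x => by
    have := ha (a⁻¹.1 x)
    rw [signed_apply_inv] at this
    exact this.symm

theorem mem_stab {φ : SymInt d → ℤ} {w : SignedPerm d} : w ∈ stab φ ↔ ∀ x, φ (w.1 x) = φ x := Iff.rfl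

theorem simpleRefl_apply (i : Fin d) (x : SymInt d) : (simpleRefl i).1 x = simpleReflPerm i x := rfl

theorem refl_cases (i : Fin d) (x : SymInt d) : x = lo i ∨ x = hi i ∨ x = -lo i ∨ x = -hi i ∨
    (x ≠ lo i ∧ x ≠ hi i ∧ x ≠ -lo i ∧ x ≠ -hi i) := by tauto

theorem simpleRefl_mem_stab {φ : SymInt d → ℤ} (ho : ∀ x, φ (-x) = -φ x) (i : Fin d)
    (h : φ (lo i) = φ (hi i)) : simpleRefl i ∈ stab φ := by
  intro x
  have hz : i.1 = 0 → φ (lo i) = 0 := fun h0 => by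
    have : lo i = -lo i := Subtype.ext (by simp [lo, h0])
    have h2 := ho (lo i)
    rw [← this] at h2; omega
  rw [simpleRefl_apply]
  rcases refl_cases i x with rfl | rfl | rfl | rfl | hx
  · rw [refl_lo]; split_ifs
    · rfl
    · exact h.symm
  · rw [refl_hi]; split_ifs with h0
    · have := hz h0; rw [ho]; omega
    · exact h
  · rw [refl_neg_lo]; split_ifs
    · rfl
    · rw [ho, ho, h]
  · rw [refl_neg_hi]; split_ifs with h0
    · have := hz h0; rw [ho]; omega
    · rw [ho, ho, h]
  · rw [refl_other i x hx]

theorem simpleRefl_mem_stab_iff {φ : SymInt d → ℤ} (ho : ∀ x, φ (-x) = -φ x) (i : Fin d) :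
    simpleRefl i ∈ stab φ ↔ φ (lo i) = φ (hi i) := by
  refine ⟨fun h => ?_, simpleRefl_mem_stab ho i⟩
  have h1 := h (hi i)
  rw [simpleRefl_apply, refl_hi] at h1
  split_ifs at h1 with h0
  · have : lo i = -lo i := Subtype.ext (by simp [lo, h0])
    have h2 := ho (lo i)
    rw [← this] at h2
    rw [ho] at h1; omega
  · exact h1

theorem exists_left_descent {w : SignedPerm d} (hw : w ≠ 1) :
    ∃ i : Fin d, (w⁻¹.1 (hi i)).1 < (w⁻¹.1 (lo i)).1 := by
  by_contra hc
  push Not at hc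
  apply hw
  have : w⁻¹ = 1 := eq_one_of_asc _ fun i => lt_of_le_of_ne (hc i) (lo_ne_hi _ i)
  simpa using this

/-- If w preserves φ, then w⁻¹ cannot invert two positions with different values of the monotone φ.
So every left descent of w is itself a generator of the stabilizer. -/
theorem descent_mem {φ : SymInt d → ℤ} (hm : Monotone φ) {w : SignedPerm d} (hw : w ∈ stab φ)
    {i : Fin d} (hi' : (w⁻¹.1 (hi i)).1 < (w⁻¹.1 (lo i)).1) : φ (lo i) = φ (hi i) := by
  have h1 : φ (lo i) ≤ φ (hi i) := hm (show (lo i).1 ≤ (hi i).1 by rw [val_lo, val_hi]; omega)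
  have h2 : φ (w⁻¹.1 (hi i)) ≤ φ (w⁻¹.1 (lo i)) := hm hi'.le
  rw [mem_stab.1 (inv_mem hw), mem_stab.1 (inv_mem hw)] at h2
  omega

theorem length_descent_left {w : SignedPerm d} {i : Fin d}
    (h : (w⁻¹.1 (hi i)).1 < (w⁻¹.1 (lo i)).1) : length w = length (simpleRefl i * w) + 1 := by
  have h1 := length_asc_left w i
  have h2 := length_simple_mul i w
  omega

theorem length_ascent_left {w : SignedPerm d} {i : Fin d}
    (h : (w⁻¹.1 (lo i)).1 < (w⁻¹.1 (hi i)).1) : length (simpleRefl i * w) = length w + 1 := by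
  have h1 := (length_asc_left w i).2 h
  have h2 := length_simple_mul i w
  omega

theorem length_ascent_right {w : SignedPerm d} {i : Fin d}
    (h : (w.1 (lo i)).1 < (w.1 (hi i)).1) : length (w * simpleRefl i) = length w + 1 := by
  have h1 := (length_asc w i).2 h
  have h2 := length_mul_simple w i
  omega

theorem length_descent_right {w : SignedPerm d} {i : Fin d}
    (h : (w.1 (hi i)).1 < (w.1 (lo i)).1) : length w = length (w * simpleRefl i) + 1 := by
  have h1 := length_asc w i
  have h2 := length_mul_simple w i
  omega

/-- Induction over a stabilizer by multiplication with simple reflections on the left. -/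
theorem stab_induction {φ : SymInt d → ℤ} (hm : Monotone φ) (ho : ∀ x, φ (-x) = -φ x)
    {P : SignedPerm d → Prop} (one : P 1)
    (step : ∀ (i : Fin d) (w : SignedPerm d), φ (lo i) = φ (hi i) → w ∈ stab φ →
      (w⁻¹.1 (lo i)).1 < (w⁻¹.1 (hi i)).1 → P w → P (simpleRefl i * w))
    (w : SignedPerm d) (hw : w ∈ stab φ) : P w := by
  induction hN : length w using Nat.strong_induction_on generalizing w with
  | _ N ih =>
    by_cases h1 : w = 1
    · rw [h1]; exact one
    obtain ⟨i, hi'⟩ := exists_left_descent h1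
    have hJ := descent_mem hm hw hi'
    have hl := length_descent_left hi'
    have hw' : simpleRefl i * w ∈ stab φ := mul_mem (simpleRefl_mem_stab ho i hJ) hw
    have e : w = simpleRefl i * (simpleRefl i * w) := by
      rw [← mul_assoc, simpleRefl_mul_self, one_mul]
    rw [e]
    refine step i _ hJ hw' ?_ (ih _ (by omega) _ hw' rfl)
    rw [← length_asc_left, ← e]; omega

/-- Removing left descents keeps an element inside the stabilizer, so it is a product of generators.
This describes standard parabolic subgroups as stabilizers of monotone odd functions. -/
theorem closure_eq_stab {φ : SymInt d → ℤ} (hm : Monotone φ) (ho : ∀ x, φ (-x) = -φ x) :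
    Subgroup.closure (simpleRefl '' {i : Fin d | φ (lo i) = φ (hi i)}) = stab φ := by
  apply le_antisymm
  · rw [Subgroup.closure_le]
    rintro _ ⟨i, hi', rfl⟩
    exact simpleRefl_mem_stab ho i hi'
  · intro w hw
    refine stab_induction hm ho (P := fun w => w ∈ _) (one_mem _) (fun i w hi' _ _ h => ?_) w hw
    exact mul_mem (Subgroup.subset_closure ⟨i, hi', rfl⟩) h

/-- Build u up by left ascents. Each is still an ascent of the product with g, because g⁻¹ is
increasing on the fibres of φ. -/
theorem length_mul_of_isMin {φ : SymInt d → ℤ} (hm : Monotone φ) (ho : ∀ x, φ (-x) = -φ x)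
    {g : SignedPerm d} (hg : IsMin φ g) (u : SignedPerm d) (hu : u ∈ stab φ) :
    length (u * g) = length u + length g := by
  refine stab_induction hm ho (P := fun u => length (u * g) = length u + length g) ?_ ?_ u hu
  · rw [one_mul, length_one, zero_add]
  · intro i w hi' hw hlt ih
    rw [mul_assoc, length_ascent_left hlt, length_ascent_left, ih]
    · omega
    · rw [mul_inv_rev]
      refine isMin_iff_inv.1 hg _ _ ?_ hlt
      rw [mem_stab.1 (inv_mem hw), mem_stab.1 (inv_mem hw), hi']

theorem isMin_iff_length {φ : SymInt d → ℤ} (hm : Monotone φ) (ho : ∀ x, φ (-x) = -φ x)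
    {g : SignedPerm d} : IsMin φ g ↔ ∀ x ∈ stab φ, length g ≤ length (x * g) := by
  constructor
  · intro h x hx
    rw [length_mul_of_isMin hm ho h x hx]; omega
  · intro h
    refine isMin_of_asc hm ho fun i hi' => ?_
    have h1 := h _ (simpleRefl_mem_stab ho i hi')
    rw [← length_asc_left]
    have := length_simple_mul i g
    omega

/-- Two monotone functions with the same fibre sizes agree. -/
theorem eq_of_card_fiber {α β : Type*} [Fintype α] [LinearOrder α] [LinearOrder β] [Fintype β]
    {u v : α → β} (hu : Monotone u) (hv : Monotone v)
    (h : ∀ c, (Finset.univ.filter fun x => u x = c).card =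
      (Finset.univ.filter fun x => v x = c).card) : u = v := by
  have key : ∀ (w : α → β) (c : β), (Finset.univ.filter fun x => w x ≤ c).card =
      ∑ b with b ≤ c, (Finset.univ.filter fun x => w x = b).card := fun w c => by
    rw [Finset.card_eq_sum_card_fiberwise (f := w) (t := Finset.univ.filter (· ≤ c))]
    · refine Finset.sum_congr rfl fun b hb => ?_
      congr 1
      ext x
      simp only [Finset.mem_filter, Finset.mem_univ, true_and] at hb ⊢
      constructor
      · exact fun h => h.2
      · rintro rfl; exact ⟨hb, rfl⟩
    · intro x hx
      simpa using hx
  have hset : ∀ c, (Finset.univ.filter fun x => u x ≤ c) = Finset.univ.filter fun x => v x ≤ c := by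
    intro c
    have hc : (Finset.univ.filter fun x => u x ≤ c).card =
        (Finset.univ.filter fun x => v x ≤ c).card := by
      rw [key, key]; exact Finset.sum_congr rfl fun b _ => h b
    -- Both sets are initial segments of a linear order, so one contains the other and equal
    -- cardinality makes them equal.
    by_cases hsub : (Finset.univ.filter fun x => u x ≤ c) ⊆ Finset.univ.filter fun x => v x ≤ c
    · exact Finset.eq_of_subset_of_card_le hsub hc.ge
    · symm
      refine Finset.eq_of_subset_of_card_le (fun y hy => ?_) hc.le
      obtain ⟨x, hx, hx'⟩ := Finset.not_subset.1 hsub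
      simp only [Finset.mem_filter, Finset.mem_univ, true_and] at hx hx' hy ⊢
      rcases le_total y x with h1 | h1
      · exact (hu h1).trans hx
      · exact absurd ((hv h1).trans hy) hx'
  funext x
  have h1 : ∀ c, u x ≤ c ↔ v x ≤ c := fun c => by
    have := Finset.ext_iff.1 (hset c) x
    simpa using this
  exact le_antisymm ((h1 _).2 le_rfl) ((h1 _).1 le_rfl)

/-- Monotone functions with prescribed fibre sizes exist. -/
theorem exists_monotone_card_fiber {α β : Type*} [Fintype α] [LinearOrder α] [LinearOrder β]
    [Fintype β] (a : β → ℕ) (h : ∑ b, a b = Fintype.card α) :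
    ∃ u : α → β, Monotone u ∧ ∀ c, (Finset.univ.filter fun x => u x = c).card = a c := by
  -- The prescribed fibres are stacked in a lexicographic sum; the order isomorphism onto it,
  -- followed by the projection, is the required function.
  let Y := Σₗ b : β, Fin (a b)
  have iY : Fintype Y := Fintype.ofEquiv (Σ b : β, Fin (a b)) toLex
  have hY : Fintype.card Y = Fintype.card α := by
    rw [← h, ← Fintype.card_congr (toLex : (Σ b : β, Fin (a b)) ≃ Y)]
    simp
  let e : α ≃o Y := (Fintype.orderIsoFinOfCardEq α rfl).symm.trans
    (Fintype.orderIsoFinOfCardEq Y hY)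
  refine ⟨fun x => (ofLex (e x)).1, fun x y hxy => ?_, fun c => ?_⟩
  · have := e.monotone hxy
    rcases Sigma.Lex.le_def.1 this with h1 | ⟨h1, -⟩
    · exact h1.le
    · exact h1.le
  · rw [← Fintype.card_fin (a c), ← Fintype.card_subtype]
    refine Fintype.card_congr ((e.toEquiv.subtypeEquiv (q := fun y => (ofLex y).1 = c)
      fun x => Iff.rfl).trans ?_)
    exact Equiv.sigmaSubtype c

/-! ### Counting pairs of positions -/

/-- The effect of a simple reflection on the number of ordered pairs with a property that fails
for the pairs inverted by it. -/
theorem card_pairs_refl (i : Fin d) (R : SymInt d → SymInt d → Prop) [DecidableRel R]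
    (h1 : ¬ R (lo i) (hi i)) (h2 : ¬ R (-hi i) (-lo i)) (h3 : i.1 = 0 → ¬ R (-hi i) (hi i)) :
    (Finset.univ.filter fun p : SymInt d × SymInt d =>
      p.1.1 < p.2.1 ∧ R (simpleReflPerm i p.1) (simpleReflPerm i p.2)).card =
    (Finset.univ.filter fun p : SymInt d × SymInt d => p.1.1 < p.2.1 ∧ R p.1 p.2).card +
    ((if R (hi i) (lo i) then 1 else 0) + (if R (-lo i) (-hi i) then 1 else 0) +
      if i.1 = 0 ∧ R (hi i) (-hi i) then 1 else 0) := by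
  have ss : ∀ x, simpleReflPerm i (simpleReflPerm i x) = x := fun x =>
    congrArg (fun u : SignedPerm d => u.1 x) (simpleRefl_mul_self i)
  have hs : (simpleReflPerm i).symm = simpleReflPerm i := by
    ext1 x; rw [Equiv.symm_apply_eq, ss]
  let e := (simpleReflPerm i).prodCongr (simpleReflPerm i)
  have v1 := val_lo i
  have v2 := val_hi i
  -- The pairs that the reflection newly puts in increasing order, as far as they satisfy `R`; the
  -- third one occurs for s_0 only. The pairs that it takes out of increasing order do not satisfy
  -- `R` by assumption.
  let N : Finset (SymInt d × SymInt d) := ({(hi i, lo i)} : Finset _).filter (fun p => R p.1 p.2) ∪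
    (({(-lo i, -hi i)} : Finset _).filter (fun p => R p.1 p.2) ∪
      ({(hi i, -hi i)} : Finset _).filter (fun p => i.1 = 0 ∧ R p.1 p.2))
  have key : (Finset.univ.filter fun p : SymInt d × SymInt d =>
      p.1.1 < p.2.1 ∧ R (simpleReflPerm i p.1) (simpleReflPerm i p.2)).map e.toEmbedding =
      (Finset.univ.filter fun p : SymInt d × SymInt d => p.1.1 < p.2.1 ∧ R p.1 p.2) ∪ N := by
    ext ⟨x, y⟩
    rw [Finset.mem_map_equiv]
    simp only [e, N, Equiv.prodCongr_symm, hs, Equiv.prodCongr_apply, Prod.map_apply,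
      Finset.mem_filter, Finset.mem_univ, true_and, Finset.mem_union, Finset.mem_singleton,
      Prod.mk.injEq, ss, lt_iff]
    constructor
    · rintro ⟨h | ⟨rfl, rfl⟩ | ⟨rfl, rfl⟩ | ⟨h0, rfl, rfl⟩, hR⟩
      · exact Or.inl ⟨h.1, hR⟩
      · exact Or.inr (Or.inl ⟨⟨rfl, rfl⟩, hR⟩)
      · exact Or.inr (Or.inr (Or.inl ⟨⟨rfl, rfl⟩, hR⟩))
      · exact Or.inr (Or.inr (Or.inr ⟨⟨rfl, rfl⟩, h0, hR⟩))
    · rintro (⟨h, hR⟩ | ⟨⟨rfl, rfl⟩, hR⟩ | ⟨⟨rfl, rfl⟩, hR⟩ | ⟨⟨rfl, rfl⟩, h0, hR⟩)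
      · refine ⟨Or.inl ⟨h, ?_, ?_, ?_⟩, hR⟩
        · rintro ⟨rfl, rfl⟩; exact h1 hR
        · rintro ⟨rfl, rfl⟩; exact h2 hR
        · rintro ⟨h0, rfl, rfl⟩; exact h3 h0 hR
      · exact ⟨Or.inr (Or.inl ⟨rfl, rfl⟩), hR⟩
      · exact ⟨Or.inr (Or.inr (Or.inl ⟨rfl, rfl⟩)), hR⟩
      · exact ⟨Or.inr (Or.inr (Or.inr ⟨h0, rfl, rfl⟩)), hR⟩
  have hc := congrArg Finset.card key
  rw [Finset.card_map, Finset.card_union_of_disjoint, Finset.card_union_of_disjoint,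
    Finset.card_union_of_disjoint] at hc
  · have sg : ∀ (a : SymInt d × SymInt d) (P : SymInt d × SymInt d → Prop) [DecidablePred P],
        (({a} : Finset _).filter P).card = if P a then 1 else 0 := fun a P _ => by
      rw [Finset.filter_singleton]; split_ifs <;> rfl
    rw [hc, sg, sg, sg, add_assoc]
  · rw [Finset.disjoint_left]
    rintro ⟨x, y⟩ ha hb
    simp only [Finset.mem_filter, Finset.mem_singleton, Prod.mk.injEq] at ha hb
    obtain ⟨⟨rfl, rfl⟩, -⟩ := ha
    have := congrArg Subtype.val hb.1.1
    rw [SymInt.val_neg] at this; omega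
  · rw [Finset.disjoint_left]
    rintro ⟨x, y⟩ ha hb
    simp only [Finset.mem_filter, Finset.mem_singleton, Finset.mem_union, Prod.mk.injEq] at ha hb
    obtain ⟨⟨rfl, rfl⟩, -⟩ := ha
    rcases hb with hb | hb
    · have := congrArg Subtype.val hb.1.1
      rw [SymInt.val_neg] at this; omega
    · have := congrArg Subtype.val hb.1.2
      rw [SymInt.val_neg] at this; omega
  · rw [Finset.disjoint_left]
    rintro ⟨x, y⟩ ha hb
    simp only [N, Finset.mem_filter, Finset.mem_singleton, Finset.mem_union, Prod.mk.injEq,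
      Finset.mem_univ, true_and] at ha hb
    rcases hb with ⟨⟨rfl, rfl⟩, -⟩ | ⟨⟨rfl, rfl⟩, -⟩ | ⟨⟨rfl, rfl⟩, -⟩
    · omega
    · simp only [SymInt.val_neg] at ha; omega
    · simp only [SymInt.val_neg] at ha; omega

end
end IotaSchur

namespace IotaSchur
noncomputable section
variable {d : ℕ}

/-! ### Coefficients and torsion -/

/-- Specialization at `v = 1`. -/
def evalOne : Coef →+* ℤ := LaurentPolynomial.eval₂ (RingHom.id ℤ) 1

theorem evalOne_q : evalOne (q : Coef) = 1 := by
  change evalOne ((LaurentPolynomial.T 1 : Coef) ^ 2) = 1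
  rw [map_pow, evalOne, LaurentPolynomial.eval₂_T]; simp

theorem evalOne_q_inv : evalOne ((q⁻¹ : Coefˣ) : Coef) = 1 := by
  have h := congrArg evalOne (Units.inv_mul q)
  rw [map_mul, evalOne_q, mul_one, map_one] at h
  exact h

theorem ne_zero_of_evalOne {x : Coef} (h : evalOne x ≠ 0) : x ≠ 0 := by
  rintro rfl; exact h (map_zero _)

theorem q_add_one_ne_zero : (q : Coef) + 1 ≠ 0 := ne_zero_of_evalOne (by
  rw [map_add, evalOne_q, map_one]; norm_num)

namespace Hecke

/-- The coefficient of `T_w`. -/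
def coef (w : SignedPerm d) : Hecke d →ₗ[Coef] Coef := (basis d).coord w

open Classical in
theorem coef_T (w u : SignedPerm d) : coef w (T u) = if u = w then 1 else 0 := by
  rw [coef, Module.Basis.coord_apply, T, Module.Basis.repr_self, Finsupp.single_apply]

theorem coef_T_self (w : SignedPerm d) : coef w (T w) = 1 := by rw [coef_T, if_pos rfl]

theorem coef_T_of_ne {w u : SignedPerm d} (h : u ≠ w) : coef w (T u) = 0 := by
  rw [coef_T, if_neg h]

theorem ext_coef {x y : Hecke d} (h : ∀ w, coef w x = coef w y) : x = y :=
  (basis d).ext_elem h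

theorem eq_zero_of_smul {c : Coef} (hc : c ≠ 0) {x : Hecke d} (h : c • x = 0) : x = 0 :=
  ext_coef fun w => by
    have := congrArg (coef w) h
    rw [map_smul, map_zero, smul_eq_mul] at this
    rw [map_zero]
    exact (mul_eq_zero.1 this).resolve_left hc

theorem hom_ext {M : Type*} [AddCommMonoid M] [Module Coef M] {f g : Hecke d →ₗ[Coef] M}
    (h : ∀ w, f (T w) = g (T w)) : f = g := (basis d).ext h

theorem simple_mul (i : Fin d) (x : Hecke d) : T (simpleRefl i) * x = leftOp i x := by
  rw [mul_def, mulHom_simple]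

theorem mul_simple (i : Fin d) (x : Hecke d) : x * T (simpleRefl i) = rightOp i x := by
  have h := length_mul_simple (1 : SignedPerm d) i
  rw [length_one] at h
  have e : T (simpleRefl i) = rightOp i (T 1) := by
    rw [rightOp_T, if_pos (by rw [length_one]; omega), one_mul]
  have := LinearMap.congr_fun (mulHom_comm x i).eq (T 1)
  rw [Module.End.mul_apply, Module.End.mul_apply, mulHom_one] at this
  rw [e, mul_def, this]

theorem T_mul_simple_asc {w : SignedPerm d} {i : Fin d} (h : (w.1 (lo i)).1 < (w.1 (hi i)).1) :
    T w * T (simpleRefl i) = T (w * simpleRefl i) := by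
  rw [mul_simple, rightOp_T, if_pos ((length_asc w i).2 h)]

theorem T_mul_simple_desc {w : SignedPerm d} {i : Fin d} (h : (w.1 (hi i)).1 < (w.1 (lo i)).1) :
    T w * T (simpleRefl i) = (q : Coef) • T (w * simpleRefl i) + ((q : Coef) - 1) • T w := by
  rw [mul_simple, rightOp_T, if_neg (by rw [length_asc]; omega)]

theorem simple_mul_T_asc {w : SignedPerm d} {i : Fin d}
    (h : (w⁻¹.1 (lo i)).1 < (w⁻¹.1 (hi i)).1) :
    T (simpleRefl i) * T w = T (simpleRefl i * w) := by
  rw [simple_mul, leftOp_T, if_pos ((length_asc_left w i).2 h)]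

theorem simple_mul_T_desc {w : SignedPerm d} {i : Fin d}
    (h : (w⁻¹.1 (hi i)).1 < (w⁻¹.1 (lo i)).1) :
    T (simpleRefl i) * T w =
      (q : Coef) • T (simpleRefl i * w) + ((q : Coef) - 1) • T w := by
  rw [simple_mul, leftOp_T, if_neg (by rw [length_asc_left]; omega)]

theorem simple_sq (i : Fin d) : T (simpleRefl i) * T (simpleRefl i) =
    (q : Coef) • (1 : Hecke d) + ((q : Coef) - 1) • T (simpleRefl i) := by
  have h := quadratic i
  rw [mul_sub, add_mul, mul_smul_comm, mul_one, one_mul, sub_eq_zero] at h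
  rw [eq_sub_of_add_eq h, smul_add, sub_smul, one_smul]; abel

theorem mul_simple_ne (w : SignedPerm d) (i : Fin d) : w * simpleRefl i ≠ w := fun h => by
  have := length_mul_simple w i
  rw [h] at this; omega

theorem simple_mul_ne (w : SignedPerm d) (i : Fin d) : simpleRefl i * w ≠ w := fun h => by
  have := length_simple_mul i w
  rw [h] at this; omega

/-- Only T_w and T_{ws} could contribute. Since ws is longer, T_w T_s = T_{ws} gives nothing, and
T_{ws} T_s contributes q. -/
theorem coef_mul_simple {w : SignedPerm d} {i : Fin d} (h : (w.1 (lo i)).1 < (w.1 (hi i)).1)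
    (x : Hecke d) : coef w (x * T (simpleRefl i)) = q * coef (w * simpleRefl i) x := by
  rw [mul_simple]
  have : coef w ∘ₗ rightOp i = (q : Coef) • coef (w * simpleRefl i) := hom_ext fun u => by
    rw [LinearMap.comp_apply, LinearMap.smul_apply, smul_eq_mul]
    have hss : ∀ u : SignedPerm d, u * simpleRefl i * simpleRefl i = u := fun u => by
      rw [mul_assoc, simpleRefl_mul_self, mul_one]
    rw [rightOp_T]
    by_cases h1 : u = w
    · rw [h1, if_pos ((length_asc w i).2 h), coef_T_of_ne (mul_simple_ne w i),
        coef_T_of_ne (mul_simple_ne w i).symm, mul_zero]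
    by_cases h2 : u = w * simpleRefl i
    · have h3 := (length_asc w i).2 h
      rw [h2, hss, if_neg (by omega), coef_T_self, map_add, map_smul, map_smul, coef_T_self,
        coef_T_of_ne (mul_simple_ne w i)]
      simp
    · have h3 : u * simpleRefl i ≠ w := fun h4 => h2 (by rw [← h4, hss])
      rw [coef_T_of_ne h2, mul_zero]
      split_ifs
      · exact coef_T_of_ne h3
      · rw [map_add, map_smul, map_smul, coef_T_of_ne h3, coef_T_of_ne h1]; simp
  exact LinearMap.congr_fun this x

theorem coef_simple_mul {w : SignedPerm d} {i : Fin d}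
    (h : (w⁻¹.1 (lo i)).1 < (w⁻¹.1 (hi i)).1)
    (x : Hecke d) : coef w (T (simpleRefl i) * x) = q * coef (simpleRefl i * w) x := by
  rw [simple_mul]
  have : coef w ∘ₗ leftOp i = (q : Coef) • coef (simpleRefl i * w) := hom_ext fun u => by
    rw [LinearMap.comp_apply, LinearMap.smul_apply, smul_eq_mul]
    have hss : ∀ u : SignedPerm d, simpleRefl i * (simpleRefl i * u) = u := fun u => by
      rw [← mul_assoc, simpleRefl_mul_self, one_mul]
    rw [leftOp_T]
    by_cases h1 : u = w
    · rw [h1, if_pos ((length_asc_left w i).2 h), coef_T_of_ne (simple_mul_ne w i),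
        coef_T_of_ne (simple_mul_ne w i).symm, mul_zero]
    by_cases h2 : u = simpleRefl i * w
    · have h3 := (length_asc_left w i).2 h
      rw [h2, hss, if_neg (by omega), coef_T_self, map_add, map_smul, map_smul, coef_T_self,
        coef_T_of_ne (simple_mul_ne w i)]
      simp
    · have h3 : simpleRefl i * u ≠ w := fun h4 => h2 (by rw [← h4, hss])
      rw [coef_T_of_ne h2, mul_zero]
      split_ifs
      · exact coef_T_of_ne h3
      · rw [map_add, map_smul, map_smul, coef_T_of_ne h3, coef_T_of_ne h1]; simp
  exact LinearMap.congr_fun this x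

/-! ### Sums over stabilizers -/

open Classical in
/-- `∑_{w ∈ H} c^{ℓ(w)} T_w`. -/
def parSum (c : Coef) (H : Subgroup (SignedPerm d)) : Hecke d :=
  ∑ w with w ∈ H, c ^ length w • T w

/-- The hypothesis on c says that c q is a root of (X + 1)(X - q); the cases used are c = 1 with
eigenvalue q and c = -q⁻¹ with eigenvalue -1. The terms of w and ws cancel in pairs. -/
theorem parSum_mul_simple {c : Coef} (hc : c * c * q = 1 + c * (q - 1))
    {H : Subgroup (SignedPerm d)} {i : Fin d} (hi' : simpleRefl i ∈ H) :
    parSum c H * T (simpleRefl i) = (c * q) • parSum c H := by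
  classical
  rw [← sub_eq_zero, parSum, Finset.sum_mul, Finset.smul_sum, ← Finset.sum_sub_distrib]
  have key : ∀ w : SignedPerm d, (w.1 (lo i)).1 < (w.1 (hi i)).1 →
      (c ^ length w • T w * T (simpleRefl i) - (c * q) • c ^ length w • T w) +
      (c ^ length (w * simpleRefl i) • T (w * simpleRefl i) * T (simpleRefl i) -
        (c * q) • c ^ length (w * simpleRefl i) • T (w * simpleRefl i)) = 0 := fun w h => by
    have h' : ((w * simpleRefl i).1 (hi i)).1 < ((w * simpleRefl i).1 (lo i)).1 := by
      have := (asc_mul (w * simpleRefl i) i)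
      rw [mul_assoc, simpleRefl_mul_self, mul_one] at this
      exact this.1 h
    rw [smul_mul_assoc, smul_mul_assoc, T_mul_simple_asc h, T_mul_simple_desc h', mul_assoc w,
      simpleRefl_mul_self, mul_one, length_ascent_right h]
    have e : c * q * c ^ (length w + 1) = c ^ length w + c ^ (length w + 1) * (q - 1) := by
      linear_combination c ^ length w * hc
    rw [smul_smul (c * q) (c ^ (length w + 1)), e, smul_add, smul_smul, smul_smul, smul_smul,
      add_smul, show c * q * c ^ length w = c ^ (length w + 1) * q by ring]
    abel
  refine Finset.sum_involution (fun w _ => w * simpleRefl i) ?_ ?_ ?_ ?_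
  · intro w _
    rcases lt_or_gt_of_ne (lo_ne_hi w i) with h | h
    · exact key w h
    · have := key (w * simpleRefl i) ((asc_mul w i).2 h)
      rw [mul_assoc w, simpleRefl_mul_self, mul_one] at this
      rw [add_comm]; exact this
  · intro w _ _
    exact mul_simple_ne w i
  · intro w hw
    simp only [Finset.mem_filter, Finset.mem_univ, true_and] at hw ⊢
    exact mul_mem hw hi'
  · intro w _
    simp only [mul_assoc, simpleRefl_mul_self, mul_one]

theorem simple_mul_parSum {c : Coef} (hc : c * c * q = 1 + c * (q - 1))
    {H : Subgroup (SignedPerm d)} {i : Fin d} (hi' : simpleRefl i ∈ H) :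
    T (simpleRefl i) * parSum c H = (c * q) • parSum c H := by
  classical
  rw [← sub_eq_zero, parSum, Finset.mul_sum, Finset.smul_sum, ← Finset.sum_sub_distrib]
  have key : ∀ w : SignedPerm d, (w⁻¹.1 (lo i)).1 < (w⁻¹.1 (hi i)).1 →
      (T (simpleRefl i) * c ^ length w • T w - (c * q) • c ^ length w • T w) +
      (T (simpleRefl i) * c ^ length (simpleRefl i * w) • T (simpleRefl i * w) -
        (c * q) • c ^ length (simpleRefl i * w) • T (simpleRefl i * w)) = 0 := fun w h => by
    have h' : ((simpleRefl i * w)⁻¹.1 (hi i)).1 < ((simpleRefl i * w)⁻¹.1 (lo i)).1 := by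
      have := (asc_mul (w⁻¹ * simpleRefl i) i)
      rw [mul_assoc, simpleRefl_mul_self, mul_one] at this
      rw [mul_inv_rev, simpleRefl_inv]
      exact this.1 h
    rw [mul_smul_comm, mul_smul_comm, simple_mul_T_asc h, simple_mul_T_desc h', ← mul_assoc,
      simpleRefl_mul_self, one_mul, length_ascent_left h]
    have e : c * q * c ^ (length w + 1) = c ^ length w + c ^ (length w + 1) * (q - 1) := by
      linear_combination c ^ length w * hc
    rw [smul_smul (c * q) (c ^ (length w + 1)), e, smul_add, smul_smul, smul_smul, smul_smul,
      add_smul, show c * q * c ^ length w = c ^ (length w + 1) * q by ring]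
    abel
  refine Finset.sum_involution (fun w _ => simpleRefl i * w) ?_ ?_ ?_ ?_
  · intro w _
    rcases lt_or_gt_of_ne (lo_ne_hi w⁻¹ i) with h | h
    · exact key w h
    · have := key (simpleRefl i * w) (by
        rw [mul_inv_rev, simpleRefl_inv]; exact (asc_mul w⁻¹ i).2 h)
      rw [← mul_assoc, simpleRefl_mul_self, one_mul] at this
      rw [add_comm]; exact this
  · intro w _ _
    exact simple_mul_ne w i
  · intro w hw
    simp only [Finset.mem_filter, Finset.mem_univ, true_and] at hw ⊢
    exact mul_mem hi' hw
  · intro w _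
    simp only [← mul_assoc, simpleRefl_mul_self, one_mul]

/-- As w fixes both positions, s_i is a left ascent of w but not of w s_i, and `exchange` then gives
s_i w = w s_i. -/
theorem simple_comm_T {w : SignedPerm d} {i : Fin d} (h1 : w.1 (lo i) = lo i)
    (h2 : w.1 (hi i) = hi i) : T (simpleRefl i) * T w = T w * T (simpleRefl i) := by
  have h1' : w⁻¹.1 (lo i) = lo i := by
    have := signed_inv_apply w (lo i); rwa [h1] at this
  have h2' : w⁻¹.1 (hi i) = hi i := by
    have := signed_inv_apply w (hi i); rwa [h2] at this
  have hlt : (lo i).1 < (hi i).1 := by rw [val_lo, val_hi]; omega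
  have e : simpleRefl i * w = w * simpleRefl i := by
    apply exchange
    rw [length_asc_left, length_asc_left, mul_inv_rev, simpleRefl_inv, signed_mul_apply,
      signed_mul_apply, h1', h2', simpleRefl_apply, simpleRefl_apply, refl_lo, refl_hi]
    intro h
    have h3 := h.1 hlt
    have v1 := val_lo i
    have v2 := val_hi i
    split_ifs at h3 with h0
    · rw [SymInt.val_neg] at h3; omega
    · omega
  rw [T_mul_simple_asc (by rw [h1, h2]; exact hlt), simple_mul_T_asc (by rw [h1', h2']; exact hlt),
    e]

theorem simple_comm_parSum {c : Coef} {H : Subgroup (SignedPerm d)} {i : Fin d}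
    (h : ∀ w ∈ H, w.1 (lo i) = lo i ∧ w.1 (hi i) = hi i) :
    T (simpleRefl i) * parSum c H = parSum c H * T (simpleRefl i) := by
  classical
  rw [parSum, Finset.mul_sum, Finset.sum_mul]
  refine Finset.sum_congr rfl fun w hw => ?_
  rw [Finset.mem_filter] at hw
  rw [mul_smul_comm, smul_mul_assoc, simple_comm_T (h w hw.2).1 (h w hw.2).2]

theorem T_mul_T_of_isMin {φ : SymInt d → ℤ} (hm : Monotone φ) (ho : ∀ x, φ (-x) = -φ x)
    {g : SignedPerm d} (hg : IsMin φ g) {u : SignedPerm d} (hu : u ∈ stab φ) :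
    T u * T g = T (u * g) :=
  T_mul_T _ _ (length_mul_of_isMin hm ho hg u hu)

end Hecke
end
end IotaSchur

namespace IotaSchur
noncomputable section
variable {k d : ℕ}

/-! ### Block indices -/

theorem WComp.psum_mono (l : WComp k d) : Monotone l.psum := fun i j h =>
  Finset.sum_le_sum_of_subset fun x hx => by
    simp only [Finset.mem_filter, Finset.mem_univ, true_and] at hx ⊢; omega

theorem WComp.psum_eq (l : WComp k d) {j : ℕ} (hj : k ≤ j) : l.psum j = d := by
  rw [WComp.psum, Finset.filter_true_of_mem (fun x _ => by have := x.2; omega), l.2]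

theorem WComp.psum_succ (l : WComp k d) {j : ℕ} (hj : j + 1 < k + 1) :
    l.psum (j + 1) = l.psum j + l.1 ⟨j + 1, hj⟩ := by
  have : (Finset.univ.filter fun x : Fin (k + 1) => x.1 ≤ j + 1) =
      insert ⟨j + 1, hj⟩ (Finset.univ.filter fun x : Fin (k + 1) => x.1 ≤ j) := by
    ext x
    simp only [Finset.mem_filter, Finset.mem_univ, true_and, Finset.mem_insert, Fin.ext_iff]
    omega
  rw [WComp.psum, this, Finset.sum_insert (by simp), WComp.psum, add_comm]

theorem WComp.psum_zero (l : WComp k d) : l.psum 0 = l.1 0 := by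
  have : (Finset.univ.filter fun x : Fin (k + 1) => x.1 ≤ 0) = {0} := by
    ext x
    simp only [Finset.mem_filter, Finset.mem_univ, true_and, Finset.mem_singleton, Fin.ext_iff]
    simp
  rw [WComp.psum, this, Finset.sum_singleton]

/-- The index of the block of a natural number `a ≤ d`. -/
def WComp.idx (l : WComp k d) (a : ℕ) : ℕ := ((Finset.range k).filter fun j => l.psum j < a).card

theorem WComp.idx_le_k (l : WComp k d) (a : ℕ) : l.idx a ≤ k := by
  have := Finset.card_filter_le (Finset.range k) fun j => l.psum j < a
  rwa [Finset.card_range] at this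

/-- The partial sums increase, so those below a form an initial segment, and `idx` is its length.
For j ≥ k the claim rests on a ≤ d, since the last partial sum is not among those counted. -/
theorem WComp.idx_le (l : WComp k d) {a j : ℕ} (ha : a ≤ d) : l.idx a ≤ j ↔ a ≤ l.psum j := by
  rcases le_or_gt k j with hj | hj
  · rw [l.psum_eq hj]
    exact iff_of_true ((l.idx_le_k a).trans hj) ha
  constructor
  · intro h
    by_contra hc
    have : Finset.range (j + 1) ⊆ (Finset.range k).filter fun j => l.psum j < a := fun x hx => by
      rw [Finset.mem_range] at hx
      rw [Finset.mem_filter, Finset.mem_range]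
      have := l.psum_mono (show x ≤ j by omega)
      omega
    have := Finset.card_le_card this
    rw [Finset.card_range] at this
    change _ ≤ l.idx a at this
    omega
  · intro h
    have : ((Finset.range k).filter fun j => l.psum j < a) ⊆ Finset.range j := fun x hx => by
      rw [Finset.mem_filter, Finset.mem_range] at hx
      rw [Finset.mem_range]
      by_contra hc
      have := l.psum_mono (show j ≤ x by omega)
      omega
    have := Finset.card_le_card this
    rwa [Finset.card_range] at this

theorem SymInt.natAbs_le (x : SymInt d) : x.1.natAbs ≤ d := by
  have := x.2; simp only [Set.mem_Icc] at this; omega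

/-- The index of the block of `x`. -/
def blk (l : WComp k d) (x : SymInt d) : SymInt k :=
  ⟨if 0 ≤ x.1 then l.idx x.1.natAbs else -l.idx x.1.natAbs, by
    have := l.idx_le_k x.1.natAbs
    simp only [Set.mem_Icc]; split_ifs <;> omega⟩

theorem blk_val (l : WComp k d) (x : SymInt d) :
    (blk l x).1 = if 0 ≤ x.1 then (l.idx x.1.natAbs : ℤ) else -l.idx x.1.natAbs := rfl

theorem WComp.idx_zero (l : WComp k d) : l.idx 0 = 0 := by simp [WComp.idx]

theorem blk_neg (l : WComp k d) (x : SymInt d) : blk l (-x) = -blk l x := by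
  apply Subtype.ext
  rw [SymInt.val_neg, blk_val, blk_val, SymInt.val_neg, Int.natAbs_neg]
  rcases lt_trichotomy x.1 0 with h | h | h
  · rw [if_pos (by omega), if_neg (by omega), neg_neg]
  · simp [h, WComp.idx_zero]
  · rw [if_neg (by omega), if_pos (by omega)]

theorem blk_le {l : WComp k d} {x : SymInt d} (hx : 0 ≤ x.1) {j : ℕ} :
    (blk l x).1 ≤ j ↔ x.1 ≤ l.psum j := by
  rw [blk_val, if_pos hx]
  have := l.idx_le (SymInt.natAbs_le x) (j := j)
  omega

theorem blk_nonneg {l : WComp k d} {x : SymInt d} (hx : 0 ≤ x.1) : 0 ≤ (blk l x).1 := by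
  rw [blk_val, if_pos hx]; omega

theorem blk_abs_le {l : WComp k d} {x : SymInt d} {j : ℕ} :
    |(blk l x).1| ≤ j ↔ |x.1| ≤ l.psum j := by
  have := l.idx_le (SymInt.natAbs_le x) (j := j)
  have e : |(blk l x).1| = l.idx x.1.natAbs := by
    rw [blk_val]; split_ifs
    · exact abs_of_nonneg (by omega)
    · rw [abs_neg]; exact abs_of_nonneg (by omega)
  rw [e, Int.abs_eq_natAbs]; omega

theorem WComp.idx_mono (l : WComp k d) : Monotone l.idx := fun a b h => by
  refine Finset.card_le_card fun x hx => ?_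
  rw [Finset.mem_filter] at hx ⊢
  exact ⟨hx.1, by omega⟩

/-- The block index, as an integer. -/
def zblk (l : WComp k d) (x : SymInt d) : ℤ := (blk l x).1

theorem zblk_neg (l : WComp k d) (x : SymInt d) : zblk l (-x) = -zblk l x := by
  rw [zblk, blk_neg]; rfl

theorem zblk_mono (l : WComp k d) : Monotone (zblk l) := fun x y h => by
  have h' : x.1 ≤ y.1 := h
  rw [zblk, zblk, blk_val, blk_val]
  split_ifs with h1 h2
  · exact_mod_cast l.idx_mono (show x.1.natAbs ≤ y.1.natAbs by omega)
  · omega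
  · omega
  · have := l.idx_mono (show y.1.natAbs ≤ x.1.natAbs by omega); omega

theorem mem_block {l : WComp k d} {i : SymInt k} {x : SymInt d} : x ∈ l.block i ↔ blk l x = i := by
  rw [WComp.block, Finset.mem_filter, Subtype.ext_iff]
  simp only [Finset.mem_univ, true_and]
  have bi := i.2
  simp only [Set.mem_Icc] at bi
  have key : ∀ (x : SymInt d) (j : ℤ), 0 < j →
      ((l.psum (j.toNat - 1) : ℤ) < x.1 ∧ x.1 ≤ l.psum j.toNat ↔ (blk l x).1 = j) := by
    intro x j hj
    rcases le_or_gt 0 x.1 with hx | hx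
    · have h1 := blk_le (l := l) hx (j := j.toNat - 1)
      have h2 := blk_le (l := l) hx (j := j.toNat)
      omega
    · have h3 : (blk l x).1 ≤ 0 := by rw [blk_val, if_neg (by omega)]; omega
      constructor
      · intro h; omega
      · intro h; omega
  split_ifs with h0 h1
  · have := blk_abs_le (l := l) (x := x) (j := 0)
    rw [← this, h0]
    simp
  · exact key x i.1 h1
  · have := key (-x) (-i.1) (by omega)
    rw [SymInt.val_neg] at this
    rw [this, blk_neg, SymInt.val_neg, neg_inj]

/-- A block ends at position i exactly if i is a partial sum. So the generators of `parabolic l` are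
the reflections of neighbours in one block, and `closure_eq_stab` applies with φ the block index. -/
theorem zblk_lo_eq_hi {l : WComp k d} {i : Fin d} :
    zblk l (lo i) = zblk l (hi i) ↔ ∀ j < k, i.1 ≠ l.psum j := by
  have h1 : ∀ j : ℕ, zblk l (lo i) ≤ j ↔ (i.1 : ℤ) ≤ l.psum j := fun j =>
    blk_le (by rw [val_lo]; omega)
  have h2 : ∀ j : ℕ, zblk l (hi i) ≤ j ↔ (i.1 : ℤ) + 1 ≤ l.psum j := fun j => by
    rw [← val_hi]; exact blk_le (by rw [val_hi]; omega)
  have h3 : 0 ≤ zblk l (lo i) := blk_nonneg (by rw [val_lo]; omega)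
  have h4 : zblk l (lo i) ≤ zblk l (hi i) :=
    zblk_mono l (show (lo i).1 ≤ (hi i).1 by rw [val_lo, val_hi]; omega)
  constructor
  · intro h j _ hc
    have h1 := h1 j
    have h2 := h2 j
    omega
  · intro h
    by_contra hc
    have h1 := h1 (zblk l (lo i)).toNat
    have h2 := h2 (zblk l (lo i)).toNat
    have h5 := h (zblk l (lo i)).toNat (by
      have := (blk l (hi i)).2
      simp only [Set.mem_Icc] at this
      have h6 : zblk l (hi i) ≤ k := this.2
      omega)
    omega

theorem parabolic_eq (l : WComp k d) : parabolic l = stab (zblk l) := by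
  rw [← closure_eq_stab (zblk_mono l) (zblk_neg l), parabolic]
  simp only [zblk_lo_eq_hi]

open Classical in
/-- The refinement of `φ` that separates the positions with value in `P`. -/
def refine (φ : SymInt d → ℤ) (P : ℤ → Prop) (x : SymInt d) : ℤ :=
  φ x * (2 * d + 1) + if P (φ x) then x.1 else 0

theorem mul_lt_code {a b : ℤ} (h : a < b) (D : ℤ) (hD : 0 ≤ D) : a * D + D ≤ b * D := by
  nlinarith

theorem refine_neg {φ : SymInt d → ℤ} (ho : ∀ x, φ (-x) = -φ x) {P : ℤ → Prop}
    (hP : ∀ c, P (-c) ↔ P c) (x : SymInt d) : refine φ P (-x) = -refine φ P x := by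
  have h : P (φ (-x)) ↔ P (φ x) := by rw [ho, hP]
  unfold refine
  by_cases h1 : P (φ x)
  · rw [if_pos h1, if_pos (h.2 h1), ho, SymInt.val_neg]; ring
  · rw [if_neg h1, if_neg (mt h.1 h1), ho]; ring

theorem refine_bounds (φ : SymInt d → ℤ) (P : ℤ → Prop) (x : SymInt d) :
    φ x * (2 * d + 1) - d ≤ refine φ P x ∧ refine φ P x ≤ φ x * (2 * d + 1) + d := by
  have := x.2
  simp only [Set.mem_Icc] at this
  unfold refine
  split_ifs <;> omega

theorem refine_mono {φ : SymInt d → ℤ} (hm : Monotone φ) (P : ℤ → Prop) :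
    Monotone (refine φ P) := fun x y h => by
  rcases (hm h).lt_or_eq with h1 | h1
  · have b1 := refine_bounds φ P x
    have b2 := refine_bounds φ P y
    have := mul_lt_code h1 (2 * d + 1) (by omega)
    omega
  · have h' : x.1 ≤ y.1 := h
    unfold refine
    rw [h1]
    split_ifs <;> omega

/-- The factor 2d + 1 exceeds the difference of any two positions, so the codes of different values
of φ do not overlap and a code determines its value of φ. -/
theorem refine_eq_iff {φ : SymInt d → ℤ} {P : ℤ → Prop} {x y : SymInt d} :
    refine φ P x = refine φ P y ↔ φ x = φ y ∧ (P (φ x) → x = y) := by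
  constructor
  · intro h
    have h1 : φ x = φ y := by
      have b1 := refine_bounds φ P x
      have b2 := refine_bounds φ P y
      rcases lt_trichotomy (φ x) (φ y) with h2 | h2 | h2
      · have := mul_lt_code h2 (2 * d + 1) (by omega)
        omega
      · exact h2
      · have := mul_lt_code h2 (2 * d + 1) (by omega)
        omega
    refine ⟨h1, fun h2 => Subtype.ext ?_⟩
    unfold refine at h
    rw [← h1, if_pos h2, if_pos h2] at h
    omega
  · rintro ⟨h1, h2⟩
    unfold refine
    rw [← h1]
    split_ifs with h3
    · rw [h2 h3]
    · rfl

/-- The block function with the positions of odd blocks separated. -/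
def evblk (m : ℕ) (l : WComp k d) : SymInt d → ℤ := refine (zblk l) fun c => (m : ℤ) < |c|
/-- The block function with the positions of even blocks separated. -/
def odblk (m : ℕ) (l : WComp k d) : SymInt d → ℤ := refine (zblk l) fun c => ¬ (m : ℤ) < |c|

theorem evblk_neg (m : ℕ) (l : WComp k d) (x : SymInt d) : evblk m l (-x) = -evblk m l x :=
  refine_neg (zblk_neg l) (fun c => by rw [abs_neg]) x
theorem odblk_neg (m : ℕ) (l : WComp k d) (x : SymInt d) : odblk m l (-x) = -odblk m l x :=
  refine_neg (zblk_neg l) (fun c => by rw [abs_neg]) x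
theorem evblk_mono (m : ℕ) (l : WComp k d) : Monotone (evblk m l) := refine_mono (zblk_mono l) _
theorem odblk_mono (m : ℕ) (l : WComp k d) : Monotone (odblk m l) := refine_mono (zblk_mono l) _

theorem lo_ne_hi' (i : Fin d) : lo i ≠ hi i := fun h => by
  have := congrArg Subtype.val h
  rw [val_lo, val_hi] at this; omega

/-- Separating all positions of odd blocks leaves exactly the even generators. So the even part is
again the stabilizer of a monotone odd function, and the results on lengths and minimal elements
apply to it. -/
theorem evenParabolic_eq (m : ℕ) (l : WComp k d) : evenParabolic m l = stab (evblk m l) := by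
  rw [← closure_eq_stab (evblk_mono m l) (evblk_neg m l), evenParabolic]
  congr 2
  ext i
  simp only [evblk, refine_eq_iff, Set.mem_ofPred_eq, zblk_lo_eq_hi, lo_ne_hi' i, imp_false]
  refine and_congr_right fun h => ?_
  rw [zblk_lo_eq_hi.2 h, not_lt, zblk, blk_abs_le, val_hi, abs_of_nonneg (by omega)]
  omega

theorem oddParabolic_eq (m : ℕ) (l : WComp k d) : oddParabolic m l = stab (odblk m l) := by
  rw [← closure_eq_stab (odblk_mono m l) (odblk_neg m l), oddParabolic]
  congr 2
  ext i
  simp only [odblk, refine_eq_iff, Set.mem_ofPred_eq, zblk_lo_eq_hi, lo_ne_hi' i, imp_false]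
  refine and_congr_right fun h => ?_
  have h1 := blk_abs_le (l := l) (x := lo i) (j := m)
  rw [val_lo, abs_of_nonneg (by omega : (0 : ℤ) ≤ (i.1 : ℤ))] at h1
  rw [not_not, zblk]
  omega

theorem mem_even {m : ℕ} {l : WComp k d} {w : SignedPerm d} : w ∈ evenParabolic m l ↔
    (∀ x, zblk l (w.1 x) = zblk l x) ∧ ∀ x, (m : ℤ) < |zblk l x| → w.1 x = x := by
  rw [evenParabolic_eq, mem_stab]
  simp only [evblk, refine_eq_iff]
  exact ⟨fun h => ⟨fun x => (h x).1, fun x hx => (h x).2 (by rwa [(h x).1])⟩,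
    fun h x => ⟨h.1 x, fun hx => h.2 x (by rwa [← h.1 x])⟩⟩

theorem mem_odd {m : ℕ} {l : WComp k d} {w : SignedPerm d} : w ∈ oddParabolic m l ↔
    (∀ x, zblk l (w.1 x) = zblk l x) ∧ ∀ x, |zblk l x| ≤ m → w.1 x = x := by
  rw [oddParabolic_eq, mem_stab]
  simp only [odblk, refine_eq_iff, not_lt]
  exact ⟨fun h => ⟨fun x => (h x).1, fun x hx => (h x).2 (by rwa [(h x).1])⟩,
    fun h x => ⟨h.1 x, fun hx => h.2 x (by rwa [← h.1 x])⟩⟩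

theorem mem_parabolic {l : WComp k d} {w : SignedPerm d} : w ∈ parabolic l ↔
    ∀ x, zblk l (w.1 x) = zblk l x := by
  rw [parabolic_eq, mem_stab]

/-! ### The elements `[xy]` -/

/-- The coefficient base `-q⁻¹` of the odd part. -/
def oddBase : Coef := (((-q)⁻¹ : Coefˣ) : Coef)

theorem oddBase_mul_q : oddBase * q = -1 := by
  rw [oddBase, inv_neg, Units.val_neg, neg_mul, Units.inv_mul]

theorem zpow_neg_length (a : ℕ) : (((-q) ^ (-(a : ℤ)) : Coefˣ) : Coef) = oddBase ^ a := by
  rw [zpow_neg, zpow_natCast, ← inv_pow, Units.val_pow_eq_pow_val]; rfl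

theorem xy_eq (m : ℕ) (l : WComp k d) :
    xy m l = Hecke.parSum 1 (evenParabolic m l) * Hecke.parSum oddBase (oddParabolic m l) := by
  rw [xy, Hecke.parSum, Hecke.parSum]
  congr 1
  · exact Finset.sum_congr rfl fun w _ => by rw [one_pow, one_smul]
  · exact Finset.sum_congr rfl fun w _ => by rw [zpow_neg_length]

/-- The eigenvalue of `T_s` for a simple reflection `s` that moves positions with letter `i`. -/
def chi (m : ℕ) (i : SymInt k) : Coef := (qDDot m i : Coefˣ)

theorem chi_odd {m : ℕ} {i : SymInt k} (h : IsOddIdx m i) : chi m i = -1 := by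
  rw [chi, qDDot, if_pos h]; rfl

theorem chi_even {m : ℕ} {i : SymInt k} (h : ¬ IsOddIdx m i) : chi m i = q := by
  rw [chi, qDDot, if_neg h]

theorem chi_neg (m : ℕ) (i : SymInt k) : chi m (-i) = chi m i := by
  have : IsOddIdx m (-i) ↔ IsOddIdx m i := by rw [IsOddIdx, IsOddIdx, SymInt.val_neg, abs_neg]
  by_cases h : IsOddIdx m i
  · rw [chi_odd h, chi_odd (this.2 h)]
  · rw [chi_even h, chi_even (mt this.1 h)]

/-- A generator of W_l lies in the part with the parity of its block, and the elements of the other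
part fix the positions that it moves. So it can be passed through one factor of [xy] and is absorbed
by the other. -/
theorem gen_cases {m : ℕ} {l : WComp k d} {i : Fin d} (h : zblk l (lo i) = zblk l (hi i)) :
    (IsOddIdx m (blk l (hi i)) ∧ simpleRefl i ∈ oddParabolic m l ∧
      ∀ w ∈ evenParabolic m l, w.1 (lo i) = lo i ∧ w.1 (hi i) = hi i) ∨
    (¬ IsOddIdx m (blk l (hi i)) ∧ simpleRefl i ∈ evenParabolic m l ∧
      ∀ w ∈ oddParabolic m l, w.1 (lo i) = lo i ∧ w.1 (hi i) = hi i) := by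
  by_cases ho : IsOddIdx m (blk l (hi i))
  · refine Or.inl ⟨ho, ?_, fun w hw => ?_⟩
    · rw [oddParabolic_eq, simpleRefl_mem_stab_iff (odblk_neg m l), odblk, refine_eq_iff]
      exact ⟨h, fun h1 => absurd ho (by rw [h] at h1; exact h1)⟩
    · have := (mem_even.1 hw).2
      exact ⟨this _ (by rw [h]; exact ho), this _ ho⟩
  · refine Or.inr ⟨ho, ?_, fun w hw => ?_⟩
    · rw [evenParabolic_eq, simpleRefl_mem_stab_iff (evblk_neg m l), evblk, refine_eq_iff]
      exact ⟨h, fun h1 => absurd (by rw [h] at h1; exact h1) ho⟩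
    · have := (mem_odd.1 hw).2
      have ho' : |zblk l (hi i)| ≤ m := not_lt.1 ho
      exact ⟨this _ (by rw [h]; exact ho'), this _ ho'⟩

theorem one_quad : (1 : Coef) * 1 * q = 1 + 1 * (q - 1) := by ring

theorem oddBase_quad : oddBase * oddBase * q = 1 + oddBase * (q - 1) := by
  linear_combination (oddBase - 1) * oddBase_mul_q

theorem xy_mul_simple {m : ℕ} {l : WComp k d} {i : Fin d} (h : zblk l (lo i) = zblk l (hi i)) :
    xy m l * Hecke.T (simpleRefl i) = chi m (blk l (hi i)) • xy m l := by
  rw [xy_eq]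
  rcases gen_cases (m := m) h with ⟨ho, h1, h2⟩ | ⟨ho, h1, h2⟩
  · rw [mul_assoc, Hecke.parSum_mul_simple oddBase_quad h1, oddBase_mul_q, mul_smul_comm,
      chi_odd ho]
  · rw [mul_assoc, ← Hecke.simple_comm_parSum h2, ← mul_assoc,
      Hecke.parSum_mul_simple one_quad h1, one_mul, smul_mul_assoc, chi_even ho]

theorem simple_mul_xy {m : ℕ} {l : WComp k d} {i : Fin d} (h : zblk l (lo i) = zblk l (hi i)) :
    Hecke.T (simpleRefl i) * xy m l = chi m (blk l (hi i)) • xy m l := by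
  rw [xy_eq]
  rcases gen_cases (m := m) h with ⟨ho, h1, h2⟩ | ⟨ho, h1, h2⟩
  · rw [← mul_assoc, Hecke.simple_comm_parSum h2, mul_assoc,
      Hecke.simple_mul_parSum oddBase_quad h1, oddBase_mul_q, mul_smul_comm, chi_odd ho]
  · rw [← mul_assoc, Hecke.simple_mul_parSum one_quad h1, one_mul, smul_mul_assoc, chi_even ho]

/-! ### Words -/

/-- Words: odd functions from positions to letters. -/
abbrev Word (k d : ℕ) : Type := {f : SymInt d → SymInt k // ∀ x, f (-x) = -f x}

instance : Fintype (Word k d) := Fintype.ofFinite _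

namespace Word

/-- The letters as integers. -/
def z (f : Word k d) (x : SymInt d) : ℤ := (f.1 x).1

theorem z_neg (f : Word k d) (x : SymInt d) : f.z (-x) = -f.z x := by
  rw [z, f.2]; rfl

theorem ext_z {f f' : Word k d} (h : ∀ x, f.z x = f'.z x) : f = f' :=
  Subtype.ext (funext fun x => Subtype.ext (h x))

/-- The word `f ∘ w`. -/
def comp (f : Word k d) (w : SignedPerm d) : Word k d :=
  ⟨fun x => f.1 (w.1 x), fun x => by
    change f.1 (w.1 (-x)) = -f.1 (w.1 x); rw [signed_map_neg, f.2]⟩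

theorem comp_z (f : Word k d) (w : SignedPerm d) (x : SymInt d) : (f.comp w).z x = f.z (w.1 x) :=
  rfl

theorem comp_comp (f : Word k d) (u w : SignedPerm d) : (f.comp u).comp w = f.comp (u * w) := rfl

theorem comp_one (f : Word k d) : f.comp 1 = f := rfl

/-- The block word of a composition. -/
def ofComp (l : WComp k d) : Word k d := ⟨blk l, blk_neg l⟩

theorem ofComp_z (l : WComp k d) : (ofComp l).z = zblk l := rfl

/-- The standardization of a word. -/
def st (f : Word k d) : SignedPerm d := std f.z

theorem st_lt (f : Word k d) (x y : SymInt d) : (f.st.1 x).1 < (f.st.1 y).1 ↔ KeyLt f.z x y :=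
  std_lt f.z_neg x y

/-- `f` is a rearrangement of the block word of `l`. -/
def HasContent (l : WComp k d) (f : Word k d) : Prop := (ofComp l).comp f.st = f

/-- Undoing the standardization sorts the word, and a monotone word with the letter multiplicities
of the block word is the block word. -/
theorem hasContent_comp (l : WComp k d) (w : SignedPerm d) : HasContent l ((ofComp l).comp w) := by
  set f := (ofComp l).comp w with hf
  have h1 : Monotone fun x => f.z (f.st⁻¹.1 x) := fun x y h => by
    by_contra hc
    rw [not_le] at hc
    have := (st_lt f _ _).2 (Or.inl hc)
    rw [signed_apply_inv, signed_apply_inv] at this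
    exact absurd h (not_le.2 this)
  have h2 : (fun x => f.1 (f.st⁻¹.1 x)) = blk l := by
    refine eq_of_card_fiber (α := SymInt d) (β := SymInt k) h1 (zblk_mono l) fun c => ?_
    refine Finset.card_bij' (fun x _ => w.1 (f.st⁻¹.1 x)) (fun x _ => f.st.1 (w⁻¹.1 x)) ?_ ?_ ?_ ?_
    · intro x hx
      simp only [Finset.mem_filter, Finset.mem_univ, true_and] at hx ⊢
      exact hx
    · intro x hx
      simp only [Finset.mem_filter, Finset.mem_univ, true_and] at hx ⊢
      rw [signed_inv_apply, hf]
      change blk l (w.1 (w⁻¹.1 x)) = c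
      rw [signed_apply_inv, hx]
    · intro x _
      simp only [signed_inv_apply, signed_apply_inv]
    · intro x _
      simp only [signed_inv_apply, signed_apply_inv]
  refine Subtype.ext (funext fun x => ?_)
  change blk l (f.st.1 x) = _
  rw [← h2]
  exact congrArg f.1 (signed_inv_apply _ _)

theorem HasContent.comp {l : WComp k d} {f : Word k d} (h : HasContent l f) (w : SignedPerm d) :
    HasContent l (f.comp w) := by
  have h' : (ofComp l).comp f.st = f := h
  rw [← h', comp_comp]
  exact hasContent_comp l _

theorem HasContent.zblk_st {l : WComp k d} {f : Word k d} (h : HasContent l f) (x : SymInt d) :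
    zblk l (f.st.1 x) = f.z x := by
  have h' : (ofComp l).comp f.st = f := h
  conv_rhs => rw [← h']
  rfl

theorem HasContent.isMin {l : WComp k d} {f : Word k d} (h : HasContent l f) :
    IsMin (zblk l) f.st := isMin_std f.z_neg h.zblk_st

theorem st_eq_of_isMin {l : WComp k d} {g : SignedPerm d} (h : IsMin (zblk l) g) :
    ((ofComp l).comp g).st = g := by
  refine IsMin.unique (zblk_mono l) (hasContent_comp l g).isMin h fun x => ?_
  rw [(hasContent_comp l g).zblk_st]; rfl

/-- Only ties are at stake. The pairs whose order s_i reverses carry different letters here, for i =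
0 because the letter at position 0 is zero, so s_i keeps the order of equal letters. -/
theorem st_mul_simple {f : Word k d} {i : Fin d} (h : f.z (lo i) < f.z (hi i)) :
    (f.comp (simpleRefl i)).st = f.st * simpleRefl i := by
  refine eq_of_lt_iff fun x y => ?_
  rw [st_lt, signed_mul_apply, signed_mul_apply, st_lt, KeyLt, KeyLt, comp_z, comp_z,
    simpleRefl_apply, simpleRefl_apply]
  refine or_congr Iff.rfl (and_congr_right fun he => ?_)
  have hn := f.z_neg
  have e : f.z (lo i) ≠ f.z (hi i) := h.ne
  have s0 : ∀ x, simpleReflPerm i (simpleReflPerm i x) = x := fun x =>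
    congrArg (fun u : SignedPerm d => u.1 x) (simpleRefl_mul_self i)
  have h0 : i.1 = 0 → f.z (lo i) = 0 := fun h0 => by
    have : lo i = -lo i := Subtype.ext (by simp [lo, h0])
    have h2 := hn (lo i)
    rw [← this] at h2; omega
  have v1 := val_lo i
  have v2 := val_hi i
  conv_lhs => rw [← s0 x, ← s0 y]
  rw [lt_iff]
  have h1 := hn (lo i)
  have h2 := hn (hi i)
  constructor
  · rintro (h3 | ⟨h3, h4⟩ | ⟨h3, h4⟩ | ⟨h5, h3, h4⟩)
    · exact h3.1
    · rw [h3, h4] at he; omega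
    · rw [h3, h4] at he; omega
    · rw [h3, h4] at he; have := h0 h5; omega
  · intro h3
    refine Or.inl ⟨h3, ?_, ?_, ?_⟩
    · rintro ⟨h3, h4⟩; rw [h3, h4] at he; omega
    · rintro ⟨h3, h4⟩; rw [h3, h4] at he; omega
    · rintro ⟨h5, h3, h4⟩; rw [h3, h4] at he; have := h0 h5; omega

theorem comp_simple_of_eq {f : Word k d} {i : Fin d} (h : f.z (lo i) = f.z (hi i)) :
    f.comp (simpleRefl i) = f :=
  ext_z fun x => mem_stab.1 (simpleRefl_mem_stab f.z_neg i h) x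

/-- A position whose value lay strictly between would carry the same letter and lie strictly between
two neighbouring positions. -/
theorem st_succ {f : Word k d} {i : Fin d} (h : f.z (lo i) = f.z (hi i)) :
    (f.st.1 (hi i)).1 = (f.st.1 (lo i)).1 + 1 := by
  have v1 := val_lo i
  have v2 := val_hi i
  have h1 := (f.st_lt (lo i) (hi i)).2 (Or.inr ⟨h, by omega⟩)
  by_contra hc
  have b1 := (f.st.1 (hi i)).2
  have b2 := (f.st.1 (lo i)).2
  simp only [Set.mem_Icc] at b1 b2
  let y : SymInt d := ⟨(f.st.1 (lo i)).1 + 1, by simp only [Set.mem_Icc]; omega⟩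
  have hy : y.1 = (f.st.1 (lo i)).1 + 1 := rfl
  obtain ⟨p, hp⟩ : ∃ p, f.st.1 p = y := ⟨f.st⁻¹.1 y, signed_apply_inv _ _⟩
  have h2 := (f.st_lt (lo i) p).1 (by rw [hp]; omega)
  have h3 := (f.st_lt p (hi i)).1 (by rw [hp]; omega)
  unfold KeyLt at h2 h3
  omega

/-- Equal neighbouring letters are standardized to consecutive values inside one block, so
conjugation by the standardization turns s_i into a generator s_j of W_l. If the values are
negative, s_j is read off from their negatives, whence the sign of the letter. -/
theorem exists_conj_simple {l : WComp k d} {f : Word k d} (hf : HasContent l f) {i : Fin d}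
    (h : f.z (lo i) = f.z (hi i)) : ∃ j : Fin d, zblk l (lo j) = zblk l (hi j) ∧
      (blk l (hi j) = f.1 (hi i) ∨ blk l (hi j) = -f.1 (hi i)) ∧
      (f.st⁻¹.1 (lo j)).1 < (f.st⁻¹.1 (hi j)).1 ∧
      simpleRefl j * f.st = f.st * simpleRefl i := by
  have hs := st_succ h
  have v1 := val_lo i
  have v2 := val_hi i
  have hlt : ¬ (simpleReflPerm i (lo i)).1 < (simpleReflPerm i (hi i)).1 := by
    rw [refl_lo, refl_hi]; split_ifs
    · rw [SymInt.val_neg]; omega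
    · omega
  have hlt' : ¬ (simpleReflPerm i (-hi i)).1 < (simpleReflPerm i (-lo i)).1 := by
    rw [refl_neg_lo, refl_neg_hi]; split_ifs
    · rw [SymInt.val_neg]; omega
    · rw [SymInt.val_neg, SymInt.val_neg]; omega
  have b1 := (f.st.1 (hi i)).2
  have b2 := (f.st.1 (lo i)).2
  simp only [Set.mem_Icc] at b1 b2
  have z1 := hf.zblk_st (lo i)
  have z2 := hf.zblk_st (hi i)
  have bl : blk l (f.st.1 (hi i)) = f.1 (hi i) := Subtype.ext z2
  have bl' : blk l (f.st.1 (lo i)) = f.1 (hi i) := Subtype.ext (z1.trans h)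
  rcases le_or_gt 0 (f.st.1 (lo i)).1 with h0 | h0
  · obtain ⟨j, e1, e2⟩ : ∃ j : Fin d, f.st.1 (lo i) = lo j ∧ f.st.1 (hi i) = hi j :=
      ⟨⟨(f.st.1 (lo i)).1.toNat, by omega⟩, Subtype.ext (by rw [val_lo]; simp [h0]),
        Subtype.ext (by rw [val_hi]; simp [h0]; omega)⟩
    rw [e1] at z1
    rw [e2] at z2
    have i1 : f.st⁻¹.1 (lo j) = lo i := by rw [← e1, signed_inv_apply]
    have i2 : f.st⁻¹.1 (hi j) = hi i := by rw [← e2, signed_inv_apply]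
    refine ⟨j, by omega, Or.inl (by rw [← e2, bl]), by rw [i1, i2]; omega, ?_⟩
    apply exchange
    rw [length_asc_left, length_asc_left, mul_inv_rev, simpleRefl_inv, signed_mul_apply,
      signed_mul_apply, i1, i2, simpleRefl_apply, simpleRefl_apply]
    intro hc
    exact hlt (hc.1 (by omega))
  · obtain ⟨j, e1, e2⟩ : ∃ j : Fin d, f.st.1 (hi i) = -lo j ∧ f.st.1 (lo i) = -hi j :=
      ⟨⟨(-(f.st.1 (hi i)).1).toNat, by omega⟩,
        Subtype.ext (by rw [SymInt.val_neg, val_lo]; simp; omega),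
        Subtype.ext (by rw [SymInt.val_neg, val_hi]; simp; omega)⟩
    rw [e2, zblk_neg] at z1
    rw [e1, zblk_neg] at z2
    have i1 : f.st⁻¹.1 (lo j) = -hi i := by
      rw [← SymInt.neg_neg' (lo j), ← e1, signed_map_neg, signed_inv_apply]
    have i2 : f.st⁻¹.1 (hi j) = -lo i := by
      rw [← SymInt.neg_neg' (hi j), ← e2, signed_map_neg, signed_inv_apply]
    refine ⟨j, by omega, Or.inr ?_, by rw [i1, i2, SymInt.val_neg, SymInt.val_neg]; omega, ?_⟩
    · rw [← SymInt.neg_neg' (hi j), ← e2, blk_neg, bl']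
    apply exchange
    rw [length_asc_left, length_asc_left, mul_inv_rev, simpleRefl_inv, signed_mul_apply,
      signed_mul_apply, i1, i2, simpleRefl_apply, simpleRefl_apply, SymInt.val_neg, SymInt.val_neg]
    intro hc
    exact hlt' (hc.1 (by omega))

/-- The element `[xy] T_g` of the ideal `[xy] ℋ` that corresponds to a word. -/
def E (m : ℕ) (l : WComp k d) (f : Word k d) : Hecke d := xy m l * Hecke.T f.st

theorem E_mul_asc (m : ℕ) (l : WComp k d) {f : Word k d} {i : Fin d}
    (h : f.z (lo i) < f.z (hi i)) :
    E m l f * Hecke.T (simpleRefl i) = E m l (f.comp (simpleRefl i)) := by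
  rw [E, E, mul_assoc, Hecke.T_mul_simple_asc ((st_lt f _ _).2 (Or.inl h)), st_mul_simple h]

/-- T_{s_i} is moved to the left of the standardization, where it becomes a generator of W_l and is
absorbed by [xy]. -/
theorem E_mul_eq {m : ℕ} {l : WComp k d} {f : Word k d} (hf : HasContent l f) {i : Fin d}
    (h : f.z (lo i) = f.z (hi i)) :
    E m l f * Hecke.T (simpleRefl i) = chi m (f.1 (hi i)) • E m l f := by
  obtain ⟨j, hj, hl, hlt, hc⟩ := exists_conj_simple hf h
  have e : chi m (blk l (hi j)) = chi m (f.1 (hi i)) := by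
    rcases hl with hl | hl <;> rw [hl]
    rw [chi_neg]
  rw [E, mul_assoc, Hecke.T_mul_simple_asc ((st_lt f _ _).2 (Or.inr ⟨h, by
    rw [val_lo, val_hi]; omega⟩)), ← hc, ← Hecke.simple_mul_T_asc hlt, ← mul_assoc,
    xy_mul_simple hj, smul_mul_assoc, e]

theorem comp_simple_simple (f : Word k d) (i : Fin d) :
    (f.comp (simpleRefl i)).comp (simpleRefl i) = f := by
  rw [comp_comp, simpleRefl_mul_self, comp_one]

theorem lo_zero_z (f : Word k d) {i : Fin d} (h0 : i.1 = 0) : f.z (lo i) = 0 := by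
  have : lo i = -lo i := Subtype.ext (by simp [lo, h0])
  have h2 := f.z_neg (lo i)
  rw [← this] at h2; omega

theorem comp_simple_lt {f : Word k d} {i : Fin d} :
    (f.comp (simpleRefl i)).z (lo i) < (f.comp (simpleRefl i)).z (hi i) ↔
      f.z (hi i) < f.z (lo i) := by
  rw [comp_z, comp_z, simpleRefl_apply, simpleRefl_apply, refl_lo, refl_hi]
  split_ifs with h0
  · rw [z_neg, lo_zero_z f h0]; omega
  · rfl

theorem E_mul_desc (m : ℕ) (l : WComp k d) {f : Word k d} {i : Fin d}
    (h : f.z (hi i) < f.z (lo i)) : E m l f * Hecke.T (simpleRefl i) =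
      (q : Coef) • E m l (f.comp (simpleRefl i)) + ((q : Coef) - 1) • E m l f := by
  have h1 := E_mul_asc m l (comp_simple_lt.2 h)
  rw [comp_simple_simple] at h1
  rw [← h1, mul_assoc, Hecke.simple_sq, mul_add, mul_smul_comm, mul_one, mul_smul_comm]

open Classical in
/-- The action of `T_x` on a word whose letters get inverted only upwards. -/
theorem E_mul_T {m : ℕ} {l : WComp k d} {e : Word k d} (he : HasContent l e) (c : Coef)
    (x : SignedPerm d)
    (h : ∀ p p' : SymInt d, p.1 < p'.1 → (x.1 p').1 < (x.1 p).1 →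
      e.z (x.1 p') ≤ e.z (x.1 p) ∧ (e.z (x.1 p') = e.z (x.1 p) → chi m (e.1 (x.1 p)) = c)) :
    ∃ N : ℕ, 2 * N = (Finset.univ.filter fun p : SymInt d × SymInt d =>
        p.1.1 < p.2.1 ∧ p.2.1 ≠ 0 ∧ (x.1 p.2).1 < (x.1 p.1).1 ∧
          e.z (x.1 p.2) = e.z (x.1 p.1)).card ∧
      E m l e * Hecke.T x = c ^ N • E m l (e.comp x) := by
  induction hN : length x using Nat.strong_induction_on generalizing x with
  | _ n ih =>
    by_cases h1 : x = 1
    · subst h1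
      refine ⟨0, ?_, ?_⟩
      · symm
        rw [mul_zero, Finset.card_eq_zero, Finset.filter_eq_empty_iff]
        rintro ⟨a, b⟩ - ⟨h2, -, h3, -⟩
        change b.1 < a.1 at h3
        change a.1 < b.1 at h2
        omega
      · rw [pow_zero, one_smul, ← Hecke.one_def, mul_one, comp_one]
    -- Induction on the length: a right descent is split off, x = y s_i.
    obtain ⟨i, hd⟩ : ∃ i : Fin d, (x.1 (hi i)).1 < (x.1 (lo i)).1 := by
      have := exists_left_descent (w := x⁻¹) (by simpa using h1)
      simpa using this
    obtain ⟨y, rfl⟩ : ∃ y, x = y * simpleRefl i :=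
      ⟨x * simpleRefl i, by rw [mul_assoc, simpleRefl_mul_self, mul_one]⟩
    have ha : (y.1 (lo i)).1 < (y.1 (hi i)).1 := by
      have := (asc_mul (y * simpleRefl i) i).2 hd
      rwa [mul_assoc, simpleRefl_mul_self, mul_one] at this
    have hl := length_ascent_right ha
    have ss : ∀ x, simpleReflPerm i (simpleReflPerm i x) = x := fun x =>
      congrArg (fun u : SignedPerm d => u.1 x) (simpleRefl_mul_self i)
    have s0 : ∀ x, (simpleReflPerm i x).1 = 0 ↔ x.1 = 0 := fun x => by
      rw [simpleReflPerm_val, reflVal]; split_ifs <;> omega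
    simp only [signed_mul_apply, simpleRefl_apply] at h hd ⊢
    have yn : ∀ x, (y.1 (-x)).1 = -(y.1 x).1 := fun x => by rw [signed_map_neg]; rfl
    have y1 := yn (lo i)
    have y2 := yn (hi i)
    have v1 := val_lo i
    have v2 := val_hi i
    have en : ∀ x, e.z (y.1 (-x)) = -e.z (y.1 x) := (e.comp y).z_neg
    have e1 := en (lo i)
    have e2 := en (hi i)
    have y0 := lo_zero y i
    have e0 : i.1 = 0 → e.z (y.1 (lo i)) = 0 := (e.comp y).lo_zero_z
    obtain ⟨N, hN1, hN2⟩ := ih (length y) (by omega) y (fun p p' hp hy => by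
      have h2 := h (simpleReflPerm i p) (simpleReflPerm i p') (by
        rw [lt_iff]
        refine Or.inl ⟨hp, ?_, ?_, ?_⟩
        · rintro ⟨rfl, rfl⟩; omega
        · rintro ⟨rfl, rfl⟩; omega
        · rintro ⟨h0, rfl, rfl⟩; have := y0 h0; omega) (by rwa [ss, ss])
      rwa [ss, ss] at h2) rfl
    -- The pair inverted by the last factor shows that the letters of e ∘ y at `lo i` and `hi i` do
    -- not decrease, so the quadratic relation is never needed. For i = 0 the letter at `lo i` is
    -- zero, and the inequality is read off at `-hi i`.
    have hab : e.z (y.1 (lo i)) ≤ e.z (y.1 (hi i)) ∧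
        (e.z (y.1 (lo i)) = e.z (y.1 (hi i)) → chi m (e.1 (y.1 (hi i))) = c) := by
      have h2 := h (lo i) (hi i) (by omega) hd
      rw [refl_lo, refl_hi] at h2
      split_ifs at h2 with h0
      · rw [e2, e0 h0] at h2
        rw [e0 h0]
        refine ⟨by omega, fun h3 => ?_⟩
        rw [← h2.2 (by omega)]
        congr 1
        apply Subtype.ext
        change e.z _ = e.z _
        rw [e0 h0, h3]
      · exact h2
    have hcard := card_pairs_refl i (fun a b => b.1 ≠ 0 ∧ (y.1 b).1 < (y.1 a).1 ∧
      e.z (y.1 b) = e.z (y.1 a)) (by omega) (by omega) (fun h0 => by have := y0 h0; omega)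
    simp only [ne_eq, s0] at hcard
    -- Increasing letters are exchanged without a factor. Equal letters give one factor c and two
    -- new pairs. For i = 0 there are also exactly two, because of the three inverted pairs the one
    -- with second entry 0 is not counted.
    rcases hab.1.lt_or_eq with hlt | heq
    · refine ⟨N, ?_, ?_⟩
      · refine Eq.trans ?_ (hcard.symm.trans (by congr!))
        rw [hN1]
        simp only [ne_eq]
        rw [if_neg (by omega), if_neg (by omega), if_neg (by
          rintro ⟨h0, -, -, h3⟩; have := e0 h0; omega)]
        rfl
      · rw [← Hecke.T_mul_simple_asc ha, ← mul_assoc, hN2, smul_mul_assoc,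
          E_mul_asc m l (f := e.comp y) hlt, comp_comp]
    · refine ⟨N + 1, ?_, ?_⟩
      · refine Eq.trans ?_ (hcard.symm.trans (by congr!))
        rw [mul_add, hN1]
        simp only [ne_eq, add_right_inj]
        by_cases h0 : i.1 = 0
        · have := y0 h0
          have := e0 h0
          rw [if_neg (by omega), if_pos (by rw [SymInt.val_neg]; omega), if_pos (by
            rw [SymInt.val_neg]; omega)]
        · rw [if_pos (by omega), if_pos (by rw [SymInt.val_neg]; omega), if_neg (by omega)]
      · rw [← Hecke.T_mul_simple_asc ha, ← mul_assoc, hN2, smul_mul_assoc,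
          E_mul_eq (f := e.comp y) (he.comp y) heq, ← comp_comp, comp_simple_of_eq heq, smul_smul,
          pow_succ]
        congr 2
        exact hab.2 heq

/-- The coefficient of `[xy] T_g` at a shortest coset representative. -/
theorem coef_E {m : ℕ} {l : WComp k d} {f : Word k d} (hf : HasContent l f) {g : SignedPerm d}
    (hg : IsMin (zblk l) g) : Hecke.coef g (E m l f) = if f.st = g then 1 else 0 := by
  classical
  have hz := hf.isMin
  have ho : ∀ u ∈ oddParabolic m l, Hecke.T u * Hecke.T f.st = Hecke.T (u * f.st) := fun u hu =>
    Hecke.T_mul_T_of_isMin (zblk_mono l) (zblk_neg l) hz (mem_odd.1 hu).1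
  -- Odd elements fix the even positions, so u times the standardization is still minimal for the
  -- even part and lengths add once more.
  have he : ∀ u ∈ oddParabolic m l, ∀ v ∈ evenParabolic m l,
      Hecke.T v * Hecke.T (u * f.st) = Hecke.T (v * (u * f.st)) := fun u hu v hv => by
    refine Hecke.T_mul_T_of_isMin (evblk_mono m l) (evblk_neg m l) ?_
      (by rw [← evenParabolic_eq]; exact hv)
    rw [isMin_iff_inv]
    intro x y hxy hlt
    rw [evblk, refine_eq_iff] at hxy
    by_cases hx : (m : ℤ) < |zblk l x|
    · rw [hxy.2 hx] at hlt; omega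
    have hu' := mem_odd.1 (inv_mem hu)
    rw [mul_inv_rev, signed_mul_apply, signed_mul_apply, hu'.2 x (not_lt.1 hx),
      hu'.2 y (by rw [← hxy.1]; exact not_lt.1 hx)]
    exact isMin_iff_inv.1 hz _ _ hxy.1 hlt
  rw [E, xy_eq, Hecke.parSum, Hecke.parSum, mul_assoc, Finset.sum_mul, Finset.sum_mul, map_sum]
  -- Factors from W_l do not change the word, so both minimal elements have the same word and agree.
  -- Then v u = 1, and the even and odd parts meet trivially.
  have key : ∀ v ∈ evenParabolic m l, ∀ u ∈ oddParabolic m l, v * (u * f.st) = g →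
      f.st = g ∧ u = 1 ∧ v = 1 := fun v hv u hu h => by
    have e : f.st = g := IsMin.unique (zblk_mono l) hz hg fun x => by
      rw [← h, signed_mul_apply, signed_mul_apply, (mem_even.1 hv).1, (mem_odd.1 hu).1]
    rw [← e, ← mul_assoc, mul_eq_right] at h
    have h1 : u = 1 := signed_ext fun x => by
      by_cases hx : (m : ℤ) < |zblk l x|
      · have h2 : v = u⁻¹ := eq_inv_of_mul_eq_one_left h
        have h3 := (mem_even.1 hv).2 x hx
        rw [h2] at h3
        have := signed_apply_inv u x
        rwa [h3] at this
      · exact (mem_odd.1 hu).2 x (not_lt.1 hx)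
    rw [h1, mul_one] at h
    exact ⟨e, h1, h⟩
  split_ifs with hfg
  · rw [Finset.sum_eq_single_of_mem 1 (by simp [one_mem])]
    · rw [length_one, one_pow, one_smul, ← Hecke.one_def, one_mul, map_sum,
        Finset.sum_eq_single_of_mem 1 (by simp [one_mem])]
      · rw [length_one, pow_zero, one_smul, ← Hecke.one_def, one_mul, hfg, Hecke.coef_T_self]
      · intro u hu h1
        rw [Finset.mem_filter] at hu
        rw [smul_mul_assoc, map_smul, ho u hu.2, Hecke.coef_T_of_ne, smul_zero]
        intro h2
        exact h1 (key 1 (one_mem _) u hu.2 (by rw [one_mul, h2])).2.1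
    · intro v hv h1
      rw [Finset.mem_filter] at hv
      rw [smul_mul_assoc, map_smul, Finset.mul_sum, map_sum, Finset.sum_eq_zero, smul_zero]
      intro u hu
      rw [Finset.mem_filter] at hu
      rw [smul_mul_assoc, mul_smul_comm, map_smul, ho u hu.2, he u hu.2 v hv.2,
        Hecke.coef_T_of_ne, smul_zero]
      intro h2
      exact h1 (key v hv.2 u hu.2 h2).2.2
  · refine Finset.sum_eq_zero fun v hv => ?_
    rw [Finset.mem_filter] at hv
    rw [smul_mul_assoc, map_smul, Finset.mul_sum, map_sum, Finset.sum_eq_zero, smul_zero]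
    intro u hu
    rw [Finset.mem_filter] at hu
    rw [smul_mul_assoc, mul_smul_comm, map_smul, ho u hu.2, he u hu.2 v hv.2,
      Hecke.coef_T_of_ne, smul_zero]
    intro h2
    exact hfg (key v hv.2 u hu.2 h2).1

end Word
end
end IotaSchur

namespace IotaSchur
noncomputable section
variable {k d : ℕ}

/-! ### Counting -/

theorem sum_symInt {M : Type*} [AddCommMonoid M] (c : SymInt d → M) (hc : ∀ x, c (-x) = c x) :
    ∑ x, c x = c 0 + 2 • ∑ x with 0 < x, c x := by
  have h1 : (Finset.univ : Finset (SymInt d)) = {0} ∪ ((Finset.univ.filter fun x => 0 < x) ∪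
      Finset.univ.filter fun x => x < 0) := by
    ext x
    simp only [Finset.mem_univ, Finset.mem_union, Finset.mem_singleton, Finset.mem_filter, true_and,
      true_iff]
    rcases lt_trichotomy x 0 with h | h | h <;> simp [h]
  conv_lhs => rw [h1]
  rw [Finset.sum_union, Finset.sum_union, Finset.sum_singleton, two_nsmul]
  · congr 2
    symm
    refine Finset.sum_bij' (fun x _ => -x) (fun x _ => -x) ?_ ?_ ?_ ?_ ?_
    · intro x hx
      simp only [Finset.mem_filter, Finset.mem_univ, true_and] at hx ⊢
      have h : 0 < x.1 := hx
      show (-x).1 < 0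
      rw [SymInt.val_neg]; omega
    · intro x hx
      simp only [Finset.mem_filter, Finset.mem_univ, true_and] at hx ⊢
      have h : x.1 < 0 := hx
      show 0 < (-x).1
      rw [SymInt.val_neg]; omega
    · intro x _; exact SymInt.neg_neg' x
    · intro x _; exact SymInt.neg_neg' x
    · intro x _; exact (hc x).symm
  · rw [Finset.disjoint_filter]; intro x _ h h'; exact lt_asymm h h'
  · rw [Finset.disjoint_left]
    simp

theorem neg_zero_symInt : (-0 : SymInt d) = 0 := Subtype.ext (by simp)

theorem card_even_pred (P : SymInt d → Prop) [DecidablePred P] (hP : ∀ x, P (-x) ↔ P x) (h0 : P 0) :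
    (Finset.univ.filter P).card = 1 + 2 * (Finset.univ.filter fun x => 0 < x ∧ P x).card := by
  rw [Finset.card_filter, sum_symInt _ (fun x => by simp only [hP]), if_pos h0, Finset.sum_filter,
    Finset.card_filter, smul_eq_mul]
  congr 2
  refine Finset.sum_congr rfl fun x _ => ?_
  by_cases h1 : 0 < x <;> by_cases h2 : P x <;> simp [h1, h2]

theorem card_interval {a b : ℕ} (hb : b ≤ d) :
    (Finset.univ.filter fun x : SymInt d => (a : ℤ) < x.1 ∧ x.1 ≤ b).card = b - a := by
  rw [← Nat.card_Ioc a b]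
  refine Finset.card_bij' (fun x _ => x.1.toNat) (fun y hy => SymInt.ofNat y (by
    rw [Finset.mem_Ioc] at hy; omega)) ?_ ?_ ?_ ?_
  · intro x hx
    simp only [Finset.mem_filter, Finset.mem_univ, true_and] at hx
    rw [Finset.mem_Ioc]; omega
  · intro y hy
    rw [Finset.mem_Ioc] at hy
    simp only [Finset.mem_filter, Finset.mem_univ, true_and, SymInt.val_ofNat]
    omega
  · intro x hx
    simp only [Finset.mem_filter, Finset.mem_univ, true_and] at hx
    apply Subtype.ext
    rw [SymInt.val_ofNat]; omega
  · intro y hy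
    simp

theorem blk_zero (l : WComp k d) : blk l 0 = 0 := by
  apply Subtype.ext
  rw [blk_val, SymInt.val_zero, if_pos le_rfl, Int.natAbs_zero, l.idx_zero]; rfl

theorem neg_eq_zero_symInt (i : SymInt k) : -i = 0 ↔ i = 0 :=
  ⟨fun h => by rw [← SymInt.neg_neg' i, h, neg_zero_symInt], fun h => by rw [h, neg_zero_symInt]⟩

theorem WComp.psum_le (l : WComp k d) (j : ℕ) : l.psum j ≤ d :=
  (l.psum_mono (le_max_right k j)).trans (l.psum_eq (le_max_left k j)).le

theorem card_blk_zero (l : WComp k d) :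
    (Finset.univ.filter fun x => blk l x = 0).card = 1 + 2 * l.1 0 := by
  rw [card_even_pred (fun x => blk l x = 0) (fun x => by rw [blk_neg, neg_eq_zero_symInt])
    (blk_zero l)]
  have h0 := l.psum_le 0
  have := card_interval (d := d) (a := 0) h0
  rw [l.psum_zero, Nat.sub_zero] at this
  rw [← this]
  have key : ∀ x : SymInt d, 0 < x.1 → (blk l x = 0 ↔ x.1 ≤ l.1 0) := fun x hx => by
    rw [← mem_block, WComp.block, Finset.mem_filter, if_pos SymInt.val_zero, l.psum_zero,
      abs_of_pos hx]
    simp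
  congr 3
  ext x
  simp only [Finset.mem_filter, Finset.mem_univ, true_and, Nat.cast_zero]
  exact and_congr_right fun hx => key x hx

theorem card_blk_pos (l : WComp k d) (i : SymInt k) (hi' : 0 < i.1) :
    (Finset.univ.filter fun x => blk l x = i).card =
      l.1 ⟨i.1.toNat, by have := i.2; simp only [Set.mem_Icc] at this; omega⟩ := by
  have hik : i.1.toNat < k + 1 := by have := i.2; simp only [Set.mem_Icc] at this; omega
  have h0 := l.psum_le i.1.toNat
  have h1 := card_interval (d := d) (a := l.psum (i.1.toNat - 1)) h0
  obtain ⟨j, hj⟩ : ∃ j, i.1.toNat = j + 1 := ⟨i.1.toNat - 1, by omega⟩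
  simp only [hj] at hik h1 ⊢
  rw [l.psum_succ hik, Nat.add_sub_cancel, Nat.add_sub_cancel_left] at h1
  rw [← h1]
  congr 1
  ext x
  simp only [Finset.mem_filter, Finset.mem_univ, true_and]
  rw [← mem_block, WComp.block, Finset.mem_filter, if_neg (by omega), if_pos hi', hj,
    l.psum_succ hik, Nat.add_sub_cancel]
  simp

namespace Word

theorem zero_apply (f : Word k d) : f.1 0 = 0 := by
  have := f.2 0
  rw [neg_zero_symInt] at this
  have h := congrArg Subtype.val this
  rw [SymInt.val_neg] at h
  exact Subtype.ext (by rw [SymInt.val_zero]; omega)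

open Classical in
/-- The number of occurrences of a letter. -/
def count (f : Word k d) (i : SymInt k) : ℕ := (Finset.univ.filter fun x => f.1 x = i).card

theorem count_neg (f : Word k d) (i : SymInt k) : f.count (-i) = f.count i := by
  refine Finset.card_bij' (fun x _ => -x) (fun x _ => -x) ?_ ?_ ?_ ?_
  · intro x hx
    simp only [Finset.mem_filter, Finset.mem_univ, true_and] at hx ⊢
    rw [f.2, hx, SymInt.neg_neg']
  · intro x hx
    simp only [Finset.mem_filter, Finset.mem_univ, true_and] at hx ⊢
    rw [f.2, hx]
  · intro x _; exact SymInt.neg_neg' x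
  · intro x _; exact SymInt.neg_neg' x

theorem count_zero (f : Word k d) : f.count 0 % 2 = 1 := by
  classical
  rw [count, card_even_pred (fun x => f.1 x = 0) (fun x => by rw [f.2, neg_eq_zero_symInt])
    (zero_apply f)]
  omega

theorem sum_count (f : Word k d) : ∑ i, f.count i = 2 * d + 1 := by
  classical
  rw [← card_symInt d, ← Finset.card_univ]
  exact (Finset.card_eq_sum_card_fiberwise fun x _ => Finset.mem_univ (f.1 x)).symm

theorem count_comp (f : Word k d) (w : SignedPerm d) (i : SymInt k) :
    (f.comp w).count i = f.count i := by
  refine Finset.card_bij' (fun x _ => w.1 x) (fun x _ => w⁻¹.1 x) ?_ ?_ ?_ ?_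
  · intro x hx
    simp only [Finset.mem_filter, Finset.mem_univ, true_and] at hx ⊢
    exact hx
  · intro x hx
    simp only [Finset.mem_filter, Finset.mem_univ, true_and] at hx ⊢
    change f.1 (w.1 (w⁻¹.1 x)) = i
    rw [signed_apply_inv, hx]
  · intro x _; exact signed_inv_apply _ _
  · intro x _; exact signed_apply_inv _ _

theorem count_ofComp (l : WComp k d) (i : Fin (k + 1)) :
    (ofComp l).count (SymInt.ofNat i.1 (Nat.lt_succ_iff.1 i.2)) =
      if i.1 = 0 then 1 + 2 * l.1 i else l.1 i := by
  classical
  split_ifs with h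
  · have : i = 0 := Fin.ext h
    subst this
    rw [← card_blk_zero l, count]
    congr 1
  · have := card_blk_pos l (SymInt.ofNat i.1 (Nat.lt_succ_iff.1 i.2)) (by
      rw [SymInt.val_ofNat]; omega)
    simp only [SymInt.val_ofNat, Int.toNat_natCast] at this
    rw [← this, count]
    congr 1

theorem comp_eq_of_count {l : WComp k d} {f : Word k d}
    (h : ∀ i, f.count i = (ofComp l).count i) (hm : Monotone f.z) : f = ofComp l :=
  Subtype.ext (eq_of_card_fiber hm (zblk_mono l) fun c => by
    have := h c
    unfold count at this
    convert this)

theorem sum_pos_fin {M : Type*} [AddCommMonoid M] (c : SymInt k → M) :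
    ∑ j with 0 < j, c j = ∑ i : Fin k, c (SymInt.ofNat (i.1 + 1) i.2) := by
  symm
  refine Finset.sum_bij' (fun i _ => SymInt.ofNat (i.1 + 1) i.2) (fun j hj => ⟨j.1.toNat - 1, by
    have h1 := j.2
    have h2 : 0 < j.1 := (Finset.mem_filter.1 hj).2
    simp only [Set.mem_Icc] at h1; omega⟩) ?_ ?_ ?_ ?_ ?_
  · intro i _
    rw [Finset.mem_filter]
    refine ⟨Finset.mem_univ _, ?_⟩
    change (0 : ℤ) < (SymInt.ofNat (i.1 + 1) i.2).1
    rw [SymInt.val_ofNat]; omega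
  · intro j _; exact Finset.mem_univ _
  · intro i _
    apply Fin.ext
    simp
  · intro j hj
    have h2 : 0 < j.1 := (Finset.mem_filter.1 hj).2
    apply Subtype.ext
    rw [SymInt.val_ofNat]; push_cast; omega
  · intro i _; rfl

/-- The parts are the multiplicities of the nonnegative letters. The letter zero sits at position 0
and otherwise at pairs of opposite positions, so its part is half of the multiplicity minus one. -/
theorem exists_ofComp (f : Word k d) (hm : Monotone f.z) : ∃ l : WComp k d, f = ofComp l := by
  have h0 := count_zero f
  let a : Fin (k + 1) → ℕ := fun i => if i.1 = 0 then (f.count 0 - 1) / 2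
    else f.count (SymInt.ofNat i.1 (Nat.lt_succ_iff.1 i.2))
  have ha : ∑ i, a i = d := by
    have h1 := sum_count f
    rw [sum_symInt _ (count_neg f), sum_pos_fin] at h1
    rw [Fin.sum_univ_succ]
    simp only [a, Fin.val_zero, ↓reduceIte, Fin.val_succ, Nat.succ_ne_zero]
    rw [smul_eq_mul] at h1
    omega
  refine ⟨⟨a, ha⟩, comp_eq_of_count (fun i => ?_) hm⟩
  have key : ∀ i : Fin (k + 1), f.count (SymInt.ofNat i.1 (Nat.lt_succ_iff.1 i.2)) =
      (ofComp ⟨a, ha⟩).count (SymInt.ofNat i.1 (Nat.lt_succ_iff.1 i.2)) := fun i => by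
    rw [count_ofComp]
    simp only [a]
    split_ifs with h
    · have e : SymInt.ofNat i.1 (Nat.lt_succ_iff.1 i.2) = 0 := Subtype.ext (by simp [h])
      rw [e]; omega
    · rfl
  have b := i.2
  simp only [Set.mem_Icc] at b
  rcases le_total 0 i.1 with h | h
  · have e : i = SymInt.ofNat i.1.toNat (by omega) := Subtype.ext (by rw [SymInt.val_ofNat]; omega)
    rw [e]
    exact key ⟨i.1.toNat, by omega⟩
  · have e : i = -SymInt.ofNat (-i.1).toNat (by omega) :=
      Subtype.ext (by rw [SymInt.val_neg, SymInt.val_ofNat]; omega)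
    rw [e, count_neg, count_neg]
    exact key ⟨(-i.1).toNat, by omega⟩

theorem exists_content (f : Word k d) : ∃ l : WComp k d, HasContent l f := by
  obtain ⟨l, hl⟩ := exists_ofComp (f.comp f.st⁻¹) (fun x y h => by
    by_contra hc
    rw [not_le] at hc
    have := (st_lt f (f.st⁻¹.1 y) (f.st⁻¹.1 x)).2 (Or.inl hc)
    rw [signed_apply_inv, signed_apply_inv] at this
    exact absurd h (not_le.2 this))
  have : f = (ofComp l).comp f.st := by
    rw [← hl, comp_comp, inv_mul_cancel, comp_one]
  exact ⟨l, this.symm⟩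

/-- The matrix of a pair of words. -/
def mat (f u : Word k d) : Matrix (SymInt k) (SymInt k) ℕ :=
  Matrix.of fun i j => (Finset.univ.filter fun x => f.1 x = i ∧ u.1 x = j).card

theorem mat_apply (f u : Word k d) (i j : SymInt k) :
    mat f u i j = (Finset.univ.filter fun x => f.1 x = i ∧ u.1 x = j).card := rfl

theorem mat_transpose (f u : Word k d) : (mat f u).transpose = mat u f := by
  ext i j
  rw [Matrix.transpose_apply, mat_apply, mat_apply]
  simp only [and_comm]

theorem mat_neg (f u : Word k d) (i j : SymInt k) : mat f u (-i) (-j) = mat f u i j := by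
  rw [mat_apply, mat_apply]
  refine Finset.card_bij' (fun x _ => -x) (fun x _ => -x) ?_ ?_ ?_ ?_
  · intro x hx
    simp only [Finset.mem_filter, Finset.mem_univ, true_and] at hx ⊢
    rw [f.2, u.2, hx.1, hx.2, SymInt.neg_neg', SymInt.neg_neg']; exact ⟨rfl, rfl⟩
  · intro x hx
    simp only [Finset.mem_filter, Finset.mem_univ, true_and] at hx ⊢
    rw [f.2, u.2, hx.1, hx.2]; exact ⟨rfl, rfl⟩
  · intro x _; exact SymInt.neg_neg' x
  · intro x _; exact SymInt.neg_neg' x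

theorem sum_mat (f u : Word k d) (i : SymInt k) : ∑ j, mat f u i j = f.count i := by
  classical
  rw [count, Finset.card_eq_sum_card_fiberwise (f := u.1) (t := Finset.univ)
    (fun x _ => Finset.mem_univ _)]
  refine Finset.sum_congr rfl fun j _ => ?_
  rw [Finset.filter_filter, mat_apply]

theorem mat_comp (f u : Word k d) (w : SignedPerm d) : mat (f.comp w) (u.comp w) = mat f u := by
  ext i j
  rw [mat_apply, mat_apply]
  refine Finset.card_bij' (fun x _ => w.1 x) (fun x _ => w⁻¹.1 x) ?_ ?_ ?_ ?_
  · intro x hx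
    simp only [Finset.mem_filter, Finset.mem_univ, true_and] at hx ⊢
    exact hx
  · intro x hx
    simp only [Finset.mem_filter, Finset.mem_univ, true_and] at hx ⊢
    change f.1 (w.1 (w⁻¹.1 x)) = i ∧ u.1 (w.1 (w⁻¹.1 x)) = j
    rwa [signed_apply_inv]
  · intro x _; exact signed_inv_apply _ _
  · intro x _; exact signed_apply_inv _ _

/-- Pull the intersection of blocks back along g. This turns questions about double cosets into
questions about pairs of words. -/
theorem kappa_eq (μ : WComp k d) (g : SignedPerm d) (ν : WComp k d) :
    kappa μ g ν = mat ((ofComp μ).comp g) (ofComp ν) := by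
  ext i j
  rw [kappa, Matrix.of_apply, mat_apply]
  refine Finset.card_bij' (fun x _ => g⁻¹.1 x) (fun x _ => g.1 x) ?_ ?_ ?_ ?_
  · intro x hx
    simp only [Finset.mem_inter, Finset.mem_image, mem_block, Finset.mem_filter, Finset.mem_univ,
      true_and] at hx ⊢
    obtain ⟨h1, y, h2, rfl⟩ := hx
    rw [signed_inv_apply]
    exact ⟨h1, h2⟩
  · intro x hx
    simp only [Finset.mem_inter, Finset.mem_image, mem_block, Finset.mem_filter, Finset.mem_univ,
      true_and] at hx ⊢
    exact ⟨hx.1, x, hx.2, rfl⟩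
  · intro x _; exact signed_apply_inv _ _
  · intro x _; exact signed_inv_apply _ _

theorem HasContent.count {l : WComp k d} {f : Word k d} (h : HasContent l f) (i : SymInt k) :
    f.count i = (ofComp l).count i := by
  have h' : (ofComp l).comp f.st = f := h
  rw [← h', count_comp]

theorem HasContent.row {l : WComp k d} {f : Word k d} (h : HasContent l f) (u : Word k d) :
    row (mat f u) = l.1 := by
  funext i
  have h1 := count_ofComp l i
  rw [← h.count, ← sum_mat f u] at h1
  unfold IotaSchur.row
  split_ifs at h1 ⊢ with h0
  · have e : SymInt.ofNat i.1 (Nat.lt_succ_iff.1 i.2) = (0 : SymInt k) :=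
      Subtype.ext (by simp [h0])
    rw [e, sum_symInt _ (fun j => by rw [← mat_neg f u 0 j, neg_zero_symInt]), smul_eq_mul] at h1
    omega
  · exact h1

theorem HasContent.col {l : WComp k d} {f : Word k d} (h : HasContent l f) (u : Word k d) :
    col (mat u f) = l.1 := by
  rw [IotaSchur.col, mat_transpose]; exact h.row u

theorem hasContent_ofComp (l : WComp k d) : HasContent l (ofComp l) := hasContent_comp l 1

theorem row_kappa (μ : WComp k d) (g : SignedPerm d) (ν : WComp k d) :
    IotaSchur.row (kappa μ g ν) = μ.1 := by
  rw [kappa_eq]; exact (hasContent_comp μ g).row _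

theorem col_kappa (μ : WComp k d) (g : SignedPerm d) (ν : WComp k d) :
    IotaSchur.col (kappa μ g ν) = ν.1 := by
  rw [kappa_eq]; exact (hasContent_ofComp ν).col _

/-! ### Shortest double coset representatives -/

/-- `g` is minimal with respect to both parabolic subgroups. -/
def DMin (μ : WComp k d) (g : SignedPerm d) (ν : WComp k d) : Prop :=
  IsMin (zblk μ) g ∧ IsMin (zblk ν) g⁻¹

theorem DMin.lt {μ ν : WComp k d} {g : SignedPerm d} (h : DMin μ g ν) {x y : SymInt d}
    (e : zblk ν x = zblk ν y) (hlt : x.1 < y.1) : (g.1 x).1 < (g.1 y).1 := by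
  have := isMin_iff_inv.1 h.2 x y e hlt
  rwa [inv_inv] at this

theorem DMin.le {μ ν : WComp k d} {g : SignedPerm d} (h : DMin μ g ν) {x y : SymInt d}
    (e : zblk ν x = zblk ν y) (hle : x.1 ≤ y.1) : zblk μ (g.1 x) ≤ zblk μ (g.1 y) := by
  rcases hle.lt_or_eq with h1 | h1
  · exact zblk_mono μ (show (g.1 x).1 ≤ (g.1 y).1 from (h.lt e h1).le)
  · rw [Subtype.ext h1]

/-- The pair of words, with values ordered lexicographically. -/
def lexPair (u f : Word k d) (x : SymInt d) : SymInt k ×ₗ SymInt k := toLex (u.1 x, f.1 x)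

theorem lexPair_mono {u f : Word k d} (hu : Monotone u.z)
    (hf : ∀ x y, u.z x = u.z y → x.1 ≤ y.1 → f.z x ≤ f.z y) : Monotone (lexPair u f) :=
  fun x y h => by
    rw [lexPair, lexPair, Prod.Lex.toLex_le_toLex]
    rcases (hu h).lt_or_eq with h1 | h1
    · exact Or.inl h1
    · exact Or.inr ⟨Subtype.ext h1, hf x y h1 h⟩

theorem card_lexPair (u f : Word k d) (c : SymInt k ×ₗ SymInt k) :
    (Finset.univ.filter fun x => lexPair u f x = c).card =
      mat f u (ofLex c).2 (ofLex c).1 := by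
  rw [mat_apply]
  congr 1
  ext x
  simp only [Finset.mem_filter, Finset.mem_univ, true_and]
  constructor
  · rintro rfl; exact ⟨rfl, rfl⟩
  · rintro ⟨h1, h2⟩
    exact congrArg toLex (Prod.ext h2 h1)

/-- The matrix lists the fibre sizes of the pair of words, and a lexicographically sorted pair is
determined by them. -/
theorem eq_of_mat {u f u' f' : Word k d} (h : Monotone (lexPair u f))
    (h' : Monotone (lexPair u' f')) (e : mat f u = mat f' u') : u = u' ∧ f = f' := by
  have := eq_of_card_fiber h h' fun c => by
    have h1 := card_lexPair u f c
    have h2 := card_lexPair u' f' c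
    rw [e, ← h2] at h1
    convert h1
  have h2 : ∀ x, u.1 x = u'.1 x ∧ f.1 x = f'.1 x := fun x => by
    have := congrFun this x
    rw [lexPair, lexPair, toLex_inj, Prod.ext_iff] at this
    exact this
  exact ⟨Subtype.ext (funext fun x => (h2 x).1), Subtype.ext (funext fun x => (h2 x).2)⟩

theorem DMin.mono {μ ν : WComp k d} {g : SignedPerm d} (h : DMin μ g ν) :
    Monotone (lexPair (ofComp ν) ((ofComp μ).comp g)) :=
  lexPair_mono (zblk_mono ν) fun _ _ => h.le

theorem DMin.unique {μ ν : WComp k d} {g g' : SignedPerm d} (h : DMin μ g ν) (h' : DMin μ g' ν)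
    (e : kappa μ g ν = kappa μ g' ν) : g = g' := by
  rw [kappa_eq, kappa_eq] at e
  have h1 := (eq_of_mat h.mono h'.mono e).2
  exact IsMin.unique (zblk_mono μ) h.1 h'.1 fun x =>
    congrArg (fun f : Word k d => f.z x) h1

theorem dmin_of_shortest {μ ν : WComp k d} {g : SignedPerm d}
    (h : ∀ x ∈ parabolic μ, ∀ y ∈ parabolic ν, length g ≤ length (x * g * y)) : DMin μ g ν := by
  refine ⟨(isMin_iff_length (zblk_mono μ) (zblk_neg μ)).2 fun x hx => ?_,
    (isMin_iff_length (zblk_mono ν) (zblk_neg ν)).2 fun x hx => ?_⟩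
  · have := h x (by rwa [parabolic_eq]) 1 (one_mem _)
    rwa [mul_one] at this
  · have := h 1 (one_mem _) x⁻¹ (inv_mem (by rwa [parabolic_eq]))
    rw [one_mul, ← length_inv (g * x⁻¹), ← length_inv g, mul_inv_rev, inv_inv] at this
    exact this

theorem kappa_coset {μ ν : WComp k d} (g : SignedPerm d) {x y : SignedPerm d}
    (hx : x ∈ parabolic μ) (hy : y ∈ parabolic ν) : kappa μ (x * g * y) ν = kappa μ g ν := by
  have h1 : ofComp ν = (ofComp ν).comp y := ext_z fun z => (mem_parabolic.1 hy z).symm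
  have h2 : (ofComp μ).comp x = ofComp μ := ext_z fun z => mem_parabolic.1 hx z
  rw [kappa_eq, kappa_eq, ← comp_comp, ← comp_comp, h2]
  conv_lhs => rw [h1]
  rw [mat_comp]

/-- A shortest element of the double coset is minimal on both sides and has the same matrix as g, so
it is g. -/
theorem DMin.shortest {μ ν : WComp k d} {g : SignedPerm d} (h : DMin μ g ν) :
    ∀ x ∈ parabolic μ, ∀ y ∈ parabolic ν, length g ≤ length (x * g * y) := by
  classical
  obtain ⟨⟨x₀, y₀⟩, h0, hmin⟩ := Finset.exists_min_image
    (Finset.univ.filter fun p : SignedPerm d × SignedPerm d =>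
      p.1 ∈ parabolic μ ∧ p.2 ∈ parabolic ν) (fun p => length (p.1 * g * p.2))
    ⟨(1, 1), by simp [one_mem]⟩
  simp only [Finset.mem_filter, Finset.mem_univ, true_and, Prod.forall] at h0 hmin
  have h1 : DMin μ (x₀ * g * y₀) ν := dmin_of_shortest fun x hx y hy => by
    have := hmin (x * x₀) (y₀ * y) ⟨mul_mem hx h0.1, mul_mem h0.2 hy⟩
    simpa only [mul_assoc] using this
  have e := h1.unique h (kappa_coset g h0.1 h0.2)
  intro x hx y hy
  have := hmin x y ⟨hx, hy⟩
  rwa [e] at this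

theorem mem_stab_refine {φ : SymInt d → ℤ} {P : ℤ → Prop} {w : SignedPerm d} :
    w ∈ stab (refine φ P) ↔ (∀ x, φ (w.1 x) = φ x) ∧ ∀ x, P (φ x) → w.1 x = x := by
  rw [mem_stab]
  simp only [refine_eq_iff]
  exact ⟨fun h => ⟨fun x => (h x).1, fun x hx => (h x).2 (by rwa [(h x).1])⟩,
    fun h x => ⟨h.1 x, fun hx => h.2 x (by rwa [← h.1 x])⟩⟩

theorem mem_conjBy {g w : SignedPerm d} {H : Subgroup (SignedPerm d)} :
    w ∈ conjBy g H ↔ g * w * g⁻¹ ∈ H := by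
  rw [conjBy, Subgroup.mem_map]
  constructor
  · rintro ⟨x, hx, rfl⟩
    simpa [mul_assoc] using hx
  · intro h
    exact ⟨_, h, by simp [mul_assoc]⟩

theorem mem_conjBy_refine {φ : SymInt d → ℤ} {P : ℤ → Prop} {g w : SignedPerm d} :
    w ∈ conjBy g (stab (refine φ P)) ↔ w ∈ stab (refine (fun x => φ (g.1 x)) P) := by
  rw [mem_conjBy, mem_stab_refine, mem_stab_refine]
  constructor
  · rintro ⟨h1, h2⟩
    refine ⟨fun x => ?_, fun x hx => ?_⟩
    · have := h1 (g.1 x)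
      rwa [signed_mul_apply, signed_mul_apply, signed_inv_apply] at this
    · have := h2 (g.1 x) hx
      rw [signed_mul_apply, signed_mul_apply, signed_inv_apply] at this
      exact g.1.injective this
  · rintro ⟨h1, h2⟩
    refine ⟨fun x => ?_, fun x hx => ?_⟩
    · have := h1 (g⁻¹.1 x)
      simp only [signed_apply_inv] at this
      exact this
    · have := h2 (g⁻¹.1 x) (by simpa only [signed_apply_inv] using hx)
      rw [signed_mul_apply, signed_mul_apply, this, signed_apply_inv]

/-- If two unseparated positions share their block on both sides, then so do two neighbours, because
g is increasing on the blocks of ν. The reflection of these neighbours is then a nontrivial element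
of the intersection. Conversely, an element of the intersection moves a position only within both
blocks, and only if it is separated on neither side. -/
theorem inter_eq_bot_iff {μ ν : WComp k d} {g : SignedPerm d} (h : DMin μ g ν) {P Q : ℤ → Prop}
    (hP : ∀ c, P (-c) ↔ P c) (hQ : ∀ c, Q (-c) ↔ Q c) :
    conjBy g (stab (refine (zblk μ) P)) ⊓ stab (refine (zblk ν) Q) = ⊥ ↔
      ∀ x y, x ≠ y → zblk μ (g.1 x) = zblk μ (g.1 y) → zblk ν x = zblk ν y →
        P (zblk μ (g.1 x)) ∨ Q (zblk ν x) := by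
  rw [Subgroup.eq_bot_iff_forall]
  simp only [Subgroup.mem_inf, mem_conjBy_refine]
  constructor
  · intro H
    have key : ∀ x y : SymInt d, x.1 < y.1 → zblk μ (g.1 x) = zblk μ (g.1 y) →
        zblk ν x = zblk ν y → P (zblk μ (g.1 x)) ∨ Q (zblk ν x) := by
      intro x y hlt e1 e2
      by_contra hc
      rw [not_or] at hc
      have bx := x.2
      have by' := y.2
      simp only [Set.mem_Icc] at bx by'
      let z : SymInt d := ⟨x.1 + 1, by simp only [Set.mem_Icc]; omega⟩
      have hz : z.1 = x.1 + 1 := rfl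
      have e3 : zblk ν x = zblk ν z := by
        have h1 := zblk_mono ν (show x.1 ≤ z.1 by omega)
        have h2 := zblk_mono ν (show z.1 ≤ y.1 by omega)
        omega
      have e4 : zblk μ (g.1 x) = zblk μ (g.1 z) := by
        have h1 := h.le e3 (by omega)
        have h2 := h.le (e3.symm.trans e2) (show z.1 ≤ y.1 by omega)
        omega
      have go : ∀ x, zblk μ (g.1 (-x)) = -zblk μ (g.1 x) := ((ofComp μ).comp g).z_neg
      obtain ⟨i, f1, f2, f3, f4⟩ : ∃ i : Fin d, zblk μ (g.1 (lo i)) = zblk μ (g.1 (hi i)) ∧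
          zblk ν (lo i) = zblk ν (hi i) ∧ ¬ P (zblk μ (g.1 (lo i))) ∧ ¬ Q (zblk ν (lo i)) := by
        rcases le_or_gt 0 x.1 with h0 | h0
        · obtain ⟨i, e5, e6⟩ : ∃ i : Fin d, x = lo i ∧ z = hi i :=
            ⟨⟨x.1.toNat, by omega⟩, Subtype.ext (by rw [val_lo]; simp [h0]),
              Subtype.ext (by rw [val_hi]; simp [h0]; omega)⟩
          rw [e5, e6] at e3 e4
          rw [e5] at hc
          exact ⟨i, e4, e3, hc⟩
        · obtain ⟨i, e5, e6⟩ : ∃ i : Fin d, z = -lo i ∧ x = -hi i :=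
            ⟨⟨(-z.1).toNat, by omega⟩, Subtype.ext (by rw [SymInt.val_neg, val_lo]; simp; omega),
              Subtype.ext (by rw [SymInt.val_neg, val_hi]; simp; omega)⟩
          rw [e5, e6, zblk_neg, zblk_neg, neg_inj] at e3
          rw [e5, e6, go, go, neg_inj] at e4
          rw [e6, go, zblk_neg, hP, hQ, e4, e3] at hc
          exact ⟨i, e4.symm, e3.symm, hc⟩
      have h1 := H (simpleRefl i)
        ⟨simpleRefl_mem_stab (refine_neg go hP) i
            (refine_eq_iff.2 ⟨f1, fun h => absurd h f3⟩),
          simpleRefl_mem_stab (refine_neg (zblk_neg ν) hQ) i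
            (refine_eq_iff.2 ⟨f2, fun h => absurd h f4⟩)⟩
      have h2 := Hecke.simple_mul_ne 1 i
      rw [mul_one] at h2
      exact h2 h1
    intro x y hne e1 e2
    rcases lt_trichotomy x.1 y.1 with h1 | h1 | h1
    · exact key x y h1 e1 e2
    · exact absurd (Subtype.ext h1) hne
    · rw [e1, e2]; exact key y x h1 e1.symm e2.symm
  · rintro H w ⟨h1, h2⟩
    rw [mem_stab_refine] at h1 h2
    refine signed_ext fun x => ?_
    by_contra hx
    have hx' : x ≠ w.1 x := fun h => hx h.symm
    rcases H x (w.1 x) hx' (h1.1 x).symm (h2.1 x).symm with h3 | h3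
    · exact hx (h1.2 x h3)
    · exact hx (h2.2 x h3)

theorem kappa_apply_le_one {μ ν : WComp k d} {g : SignedPerm d} {i j : SymInt k} :
    (kappa μ g ν i j = 0 ∨ kappa μ g ν i j = 1) ↔ ∀ x y, blk μ (g.1 x) = i → blk ν x = j →
      blk μ (g.1 y) = i → blk ν y = j → x = y := by
  rw [kappa_eq, mat_apply, ← Nat.le_one_iff_eq_zero_or_eq_one, Finset.card_le_one]
  simp only [Finset.mem_filter, Finset.mem_univ, true_and]
  constructor
  · intro h x y h1 h2 h3 h4
    exact h x ⟨h1, h2⟩ y ⟨h3, h4⟩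
  · intro h x h1 y h2
    exact h x y h1.1 h1.2 h2.1 h2.2

/-- By `inter_eq_bot_iff` the two intersections are trivial exactly if no two positions share an
even block on one side and an odd block on the other. This bounds the entries at places of mixed
parity by 1. -/
theorem superRep_iff {m : ℕ} {μ ν : WComp k d} {g : SignedPerm d} : IsSuperRep m μ g ν ↔
    DMin μ g ν ∧ ∀ i j, ¬ (IsOddIdx m i ↔ IsOddIdx m j) →
      kappa μ g ν i j = 0 ∨ kappa μ g ν i j = 1 := by
  have hs : ∀ c : ℤ, (m : ℤ) < |-c| ↔ (m : ℤ) < |c| := fun c => by rw [abs_neg]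
  have hs' : ∀ c : ℤ, ¬ (m : ℤ) < |-c| ↔ ¬ (m : ℤ) < |c| := fun c => by rw [abs_neg]
  have main : DMin μ g ν → ((conjBy g (oddParabolic m μ) ⊓ evenParabolic m ν = ⊥ ∧
      conjBy g (evenParabolic m μ) ⊓ oddParabolic m ν = ⊥) ↔
      ∀ i j, ¬ (IsOddIdx m i ↔ IsOddIdx m j) →
        kappa μ g ν i j = 0 ∨ kappa μ g ν i j = 1) := by
    intro h
    rw [oddParabolic_eq, oddParabolic_eq, evenParabolic_eq, evenParabolic_eq, evblk, evblk, odblk,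
      odblk, inter_eq_bot_iff h hs' hs, inter_eq_bot_iff h hs hs']
    simp only [kappa_apply_le_one]
    constructor
    · rintro ⟨h1, h2⟩ i j hij x y rfl rfl e1 e2
      by_contra hne
      have h1 := h1 x y hne (congrArg Subtype.val e1.symm) (congrArg Subtype.val e2.symm)
      have h2 := h2 x y hne (congrArg Subtype.val e1.symm) (congrArg Subtype.val e2.symm)
      apply hij
      unfold IsOddIdx
      change (m : ℤ) < |zblk μ (g.1 x)| ↔ (m : ℤ) < |zblk ν x|
      tauto
    · intro H
      refine ⟨fun x y hne e1 e2 => ?_, fun x y hne e1 e2 => ?_⟩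
      all_goals
        by_contra hc
        rw [not_or] at hc
        refine hne (H _ _ ?_ x y rfl rfl (Subtype.ext e1.symm) (Subtype.ext e2.symm))
        unfold IsOddIdx
        change ¬ ((m : ℤ) < |zblk μ (g.1 x)| ↔ (m : ℤ) < |zblk ν x|)
        tauto
  constructor
  · intro h
    have h1 := dmin_of_shortest h.shortest
    exact ⟨h1, (main h1).1 ⟨h.odd_even, h.even_odd⟩⟩
  · rintro ⟨h1, h2⟩
    have h3 := (main h1).2 h2
    exact ⟨h1.shortest, h3.1, h3.2⟩

theorem mat_mem_Xi_iff {m n : ℕ} {f u : Word (m + n) d} : mat f u ∈ Xi m n d ↔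
    ∀ i j, ¬ (IsOddIdx m i ↔ IsOddIdx m j) → mat f u i j = 0 ∨ mat f u i j = 1 := by
  refine ⟨fun h => h.2.2, fun h => ⟨?_, fun i j => (mat_neg f u i j).symm, h⟩⟩
  simp only [sum_mat, sum_count]

theorem kappa_mem_Xi {m n : ℕ} {μ ν : WComp (m + n) d} {g : SignedPerm d}
    (h : IsSuperRep m μ g ν) : kappa μ g ν ∈ Xi m n d := by
  have := (superRep_iff.1 h).2
  rw [kappa_eq] at this ⊢
  exact mat_mem_Xi_iff.2 this

/-- List the pairs (j, i) in lexicographic order, each a_{ij} times, along the positions. The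
symmetry of A makes the list odd, since the list negated in positions and values is sorted with the
same multiplicities. Its first component is the block word of ν, and the second one is standardized
to g. -/
theorem exists_superRep {m n : ℕ} {A : Matrix (SymInt (m + n)) (SymInt (m + n)) ℕ}
    (hA : A ∈ Xi m n d) : ∃ (μ : WComp (m + n) d) (g : SignedPerm d) (ν : WComp (m + n) d),
      IsSuperRep m μ g ν ∧ kappa μ g ν = A := by
  classical
  obtain ⟨hs, hn, hp⟩ := hA
  obtain ⟨F, hF, hc⟩ := exists_monotone_card_fiber (α := SymInt d)
    (β := SymInt (m + n) ×ₗ SymInt (m + n)) (fun c => A (ofLex c).2 (ofLex c).1) (by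
      refine Eq.trans ?_ ((Finset.sum_comm (f := fun j i => A i j)).trans
        (hs.trans (card_symInt d).symm))
      refine Eq.trans ?_ (Fintype.sum_prod_type fun c : SymInt (m + n) × SymInt (m + n) => A c.2 c.1)
      exact Fintype.sum_equiv ofLex _ _ fun _ => rfl)
  have hF' : ∀ x y, x ≤ y → (ofLex (F x)).1 < (ofLex (F y)).1 ∨
      (ofLex (F x)).1 = (ofLex (F y)).1 ∧ (ofLex (F x)).2 ≤ (ofLex (F y)).2 := fun x y h =>
    Prod.Lex.le_iff.1 (hF h)
  have hneg : (fun x => toLex (-(ofLex (F (-x))).1, -(ofLex (F (-x))).2)) = F := by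
    refine eq_of_card_fiber ?_ hF fun c => ?_
    · intro x y h
      have h1 : (-y : SymInt d) ≤ -x := neg_le_neg (show x.1 ≤ y.1 from h)
      rw [Prod.Lex.toLex_le_toLex]
      rcases hF' _ _ h1 with h2 | ⟨h2, h3⟩
      · exact Or.inl (neg_lt_neg (show (ofLex (F (-y))).1.1 < (ofLex (F (-x))).1.1 from h2))
      · refine Or.inr ⟨by rw [h2], ?_⟩
        exact neg_le_neg (show (ofLex (F (-y))).2.1 ≤ (ofLex (F (-x))).2.1 from h3)
    · have e1 := hc c
      have e2 := hc (toLex (-(ofLex c).1, -(ofLex c).2))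
      simp only [ofLex_toLex] at e2
      rw [← hn, ← e1] at e2
      refine Eq.trans (Eq.trans ?_ e2) (by congr!)
      refine Finset.card_bij' (fun x _ => -x) (fun x _ => -x) ?_ ?_ ?_ ?_
      · intro x hx
        simp only [Finset.mem_filter, Finset.mem_univ, true_and] at hx ⊢
        rw [← hx]
        simp only [ofLex_toLex, SymInt.neg_neg']
        rfl
      · intro x hx
        simp only [Finset.mem_filter, Finset.mem_univ, true_and] at hx ⊢
        rw [SymInt.neg_neg', hx]
        simp only [ofLex_toLex, SymInt.neg_neg']
        rfl
      · intro x _; exact SymInt.neg_neg' x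
      · intro x _; exact SymInt.neg_neg' x
  have hneg' : ∀ x, (ofLex (F (-x))).1 = -(ofLex (F x)).1 ∧
      (ofLex (F (-x))).2 = -(ofLex (F x)).2 := fun x => by
    have := congrFun hneg (-x)
    simp only [SymInt.neg_neg'] at this
    rw [← this]
    exact ⟨rfl, rfl⟩
  let u : Word (m + n) d := ⟨fun x => (ofLex (F x)).1, fun x => (hneg' x).1⟩
  let f : Word (m + n) d := ⟨fun x => (ofLex (F x)).2, fun x => (hneg' x).2⟩
  have hu : Monotone u.z := fun x y h => by
    rcases hF' x y h with h1 | ⟨h1, -⟩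
    · exact le_of_lt h1
    · exact (congrArg Subtype.val h1).le
  have hf : ∀ x y, u.z x = u.z y → x.1 ≤ y.1 → f.z x ≤ f.z y := fun x y e h => by
    rcases hF' x y h with h1 | ⟨-, h1⟩
    · exact absurd e (ne_of_lt h1)
    · exact h1
  obtain ⟨ν, hν⟩ := exists_ofComp u hu
  obtain ⟨μ, hμ⟩ := exists_content f
  have hμ' : (ofComp μ).comp f.st = f := hμ
  have hk : kappa μ f.st ν = A := by
    rw [kappa_eq, hμ', ← hν]
    ext i j
    have h1 := hc (toLex (j, i))
    have h2 := card_lexPair u f (toLex (j, i))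
    simp only [ofLex_toLex] at h1 h2
    rw [← h1, ← h2]
    congr 1
  have hd : DMin μ f.st ν := by
    refine ⟨hμ.isMin, isMin_iff_inv.2 fun x y e hlt => ?_⟩
    rw [inv_inv, st_lt]
    rw [← ofComp_z, ← hν] at e
    have := hf x y e hlt.le
    unfold KeyLt
    omega
  exact ⟨μ, f.st, ν, superRep_iff.2 ⟨hd, by rw [hk]; exact hp⟩, hk⟩

end Word
end
end IotaSchur

/-! ### Expansion of the double coset elements in words -/

namespace IotaSchur
noncomputable section
variable {k d : ℕ}

namespace Word

open Classical in
/-- Twice the number of inversions of `v` inside the odd blocks of `u`. -/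
def oi (m : ℕ) (u v : Word k d) : ℕ :=
  (Finset.univ.filter fun p : SymInt d × SymInt d => p.1.1 < p.2.1 ∧ u.z p.1 = u.z p.2 ∧
    IsOddIdx m (u.1 p.1) ∧ v.z p.2 < v.z p.1).card

/-- The coefficient of a word in the expansion of a double coset element. -/
def wt (m : ℕ) (u v : Word k d) : Coef := oddBase ^ (oi m u v / 2)

/-- The pair of words, coded as an integer. -/
def pairCode (u f : Word k d) (x : SymInt d) : ℤ := u.z x * (2 * k + 1) + f.z x

theorem z_bounds (f : Word k d) (x : SymInt d) : -(k : ℤ) ≤ f.z x ∧ f.z x ≤ k := (f.1 x).2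

theorem pairCode_neg (u f : Word k d) (x : SymInt d) : pairCode u f (-x) = -pairCode u f x := by
  rw [pairCode, pairCode, z_neg, z_neg]; ring

theorem pairCode_lt {u f u' f' : Word k d} {x y : SymInt d} :
    pairCode u f x < pairCode u' f' y ↔ u.z x < u'.z y ∨ u.z x = u'.z y ∧ f.z x < f'.z y := by
  have b1 := z_bounds f x
  have b2 := z_bounds f' y
  unfold pairCode
  rcases lt_trichotomy (u.z x) (u'.z y) with h | h | h
  · have := mul_lt_code h (2 * k + 1) (by omega)
    constructor
    · intro _; exact Or.inl h
    · intro _; omega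
  · rw [h]
    constructor
    · intro h1; exact Or.inr ⟨rfl, by omega⟩
    · intro h1; omega
  · have := mul_lt_code h (2 * k + 1) (by omega)
    constructor
    · intro h1; omega
    · intro h1; omega

theorem pairCode_eq {u f u' f' : Word k d} {x y : SymInt d} :
    pairCode u f x = pairCode u' f' y ↔ u.z x = u'.z y ∧ f.z x = f'.z y := by
  have h1 := pairCode_lt (u := u) (f := f) (u' := u') (f' := f') (x := x) (y := y)
  have h2 := pairCode_lt (u := u') (f := f') (u' := u) (f' := f) (x := y) (y := x)
  omega

theorem conj_inter_parabolic (μ ν : WComp k d) (g : SignedPerm d) :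
    conjBy g (parabolic μ) ⊓ parabolic ν = stab (pairCode (ofComp ν) ((ofComp μ).comp g)) := by
  ext w
  rw [Subgroup.mem_inf, mem_conjBy, mem_parabolic, mem_parabolic, mem_stab]
  simp only [pairCode_eq]
  constructor
  · rintro ⟨h1, h2⟩ x
    refine ⟨h2 x, ?_⟩
    have := h1 (g.1 x)
    rwa [signed_mul_apply, signed_mul_apply, signed_inv_apply] at this
  · intro h
    refine ⟨fun x => ?_, fun x => (h x).1⟩
    have := (h (g⁻¹.1 x)).2
    rw [comp_z, comp_z, signed_apply_inv] at this
    exact this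

theorem DMin.pairCode_mono {μ ν : WComp k d} {g : SignedPerm d} (h : DMin μ g ν) :
    Monotone (pairCode (ofComp ν) ((ofComp μ).comp g)) := fun x y hxy => by
  by_contra hc
  rw [not_le, pairCode_lt] at hc
  rcases hc with hc | ⟨h1, h2⟩
  · exact absurd (zblk_mono ν hxy) (not_le.2 hc)
  · exact absurd (h.le h1.symm hxy) (not_le.2 h2)

/-- A word with the matrix of a double coset is a rearrangement of the word of its minimal
element, by an element of the parabolic subgroup. -/
theorem DMin.exists_comp {μ ν : WComp k d} {g : SignedPerm d} (h : DMin μ g ν) {f : Word k d}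
    (hf : mat f (ofComp ν) = kappa μ g ν) : ∃ w : SignedPerm d, w ∈ parabolic ν ∧
      IsMin (pairCode (ofComp ν) ((ofComp μ).comp g)) w ∧ ((ofComp μ).comp g).comp w = f := by
  -- w orders the positions by their ν-block and inside a block by the letter of f. The pair sorted
  -- in this way has matrix κ(μ, g, ν), so it is the pair of g.
  set w := std (pairCode (ofComp ν) f) with hw
  have hlt := std_lt (pairCode_neg (ofComp ν) f)
  have h1 : Monotone (lexPair ((ofComp ν).comp w⁻¹) (f.comp w⁻¹)) := fun x y hxy => by
    rw [lexPair, lexPair, Prod.Lex.toLex_le_toLex]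
    have h2 := hlt (w⁻¹.1 y) (w⁻¹.1 x)
    rw [← hw, signed_apply_inv, signed_apply_inv] at h2
    have h3 : ¬ y.1 < x.1 := not_lt.2 hxy
    rw [h2, KeyLt, pairCode_lt] at h3
    by_cases h4 : ((ofComp ν).comp w⁻¹).1 x = ((ofComp ν).comp w⁻¹).1 y
    · refine Or.inr ⟨h4, ?_⟩
      have h5 : (ofComp ν).z (w⁻¹.1 x) = (ofComp ν).z (w⁻¹.1 y) := congrArg Subtype.val h4
      change f.z (w⁻¹.1 x) ≤ f.z (w⁻¹.1 y)
      by_contra h6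
      exact h3 (Or.inl (Or.inr ⟨h5.symm, not_le.1 h6⟩))
    · refine Or.inl (lt_of_le_of_ne ?_ h4)
      change (ofComp ν).z (w⁻¹.1 x) ≤ (ofComp ν).z (w⁻¹.1 y)
      by_contra h6
      exact h3 (Or.inl (Or.inl (not_le.1 h6)))
  have h2 := eq_of_mat h1 h.mono (by rw [mat_comp, hf, kappa_eq])
  have e1 : (ofComp ν).comp w = ofComp ν := by
    conv_lhs => rw [← h2.1]
    rw [comp_comp, inv_mul_cancel, comp_one]
  have e2 : ((ofComp μ).comp g).comp w = f := by
    rw [← h2.2, comp_comp, inv_mul_cancel, comp_one]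
  have e3 : ∀ x, zblk ν (w.1 x) = zblk ν x := fun x => congrArg (fun u : Word k d => u.z x) e1
  refine ⟨w, mem_parabolic.2 e3, ?_, e2⟩
  refine isMin_std (pairCode_neg (ofComp ν) f) fun x => ?_
  rw [pairCode_eq]
  exact ⟨e3 x, congrArg (fun u : Word k d => u.z x) e2⟩

/-- The set of positions in odd blocks is preserved by w and by negation, so w can be replaced by
the identity outside of it. -/
theorem exists_odd_part {m : ℕ} {ν : WComp k d} {w : SignedPerm d} (hw : w ∈ parabolic ν) :
    ∃ w₁ ∈ oddParabolic m ν, ∀ x, (m : ℤ) < |zblk ν x| → w₁.1 x = w.1 x := by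
  classical
  rw [mem_parabolic] at hw
  let p : SymInt d → Prop := fun x => (m : ℤ) < |zblk ν x|
  have hp : ∀ x, p (w.1 x) ↔ p x := fun x => by simp only [p, hw]
  let σ : Equiv.Perm (SymInt d) := Equiv.Perm.ofSubtype (w.1.subtypePerm hp)
  have h1 : ∀ x, p x → σ x = w.1 x := fun x hx => Equiv.Perm.ofSubtype_apply_of_mem _ hx
  have h2 : ∀ x, ¬ p x → σ x = x := fun x hx => Equiv.Perm.ofSubtype_apply_of_not_mem _ hx
  have hn : ∀ x, p (-x) ↔ p x := fun x => by simp only [p, zblk_neg, abs_neg]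
  refine ⟨⟨σ, fun x => ?_⟩, mem_odd.2 ⟨fun x => ?_, fun x hx => h2 x (not_lt.2 hx)⟩, h1⟩
  · by_cases hx : p x
    · rw [h1 x hx, h1 _ ((hn x).2 hx), signed_map_neg]
    · rw [h2 x hx, h2 _ (mt (hn x).1 hx)]
  · by_cases hx : p x
    · exact (congrArg (zblk ν) (h1 x hx)).trans (hw x)
    · exact congrArg (zblk ν) (h2 x hx)

theorem exists_even_odd {m : ℕ} {ν : WComp k d} {w : SignedPerm d} (hw : w ∈ parabolic ν) :
    ∃ w₀ ∈ evenParabolic m ν, ∃ w₁ ∈ oddParabolic m ν, w₀ * w₁ = w := by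
  obtain ⟨w₁, h1, h2⟩ := exists_odd_part (m := m) hw
  refine ⟨w * w₁⁻¹, mem_even.2 ⟨fun x => ?_, fun x hx => ?_⟩, w₁, h1, by
    rw [mul_assoc, inv_mul_cancel, mul_one]⟩
  · rw [signed_mul_apply, mem_parabolic.1 hw, (mem_odd.1 (inv_mem h1)).1]
  · have h3 := (mem_odd.1 (inv_mem h1)).1 x
    rw [signed_mul_apply, ← h2 _ (by rwa [h3]), signed_apply_inv]

theorem odd_apply {m : ℕ} {ν : WComp k d} {w₀ w₁ : SignedPerm d} (h0 : w₀ ∈ evenParabolic m ν)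
    (h1 : w₁ ∈ oddParabolic m ν) {x : SymInt d} (hx : (m : ℤ) < |zblk ν x|) :
    (w₀ * w₁).1 x = w₁.1 x := by
  rw [signed_mul_apply]
  exact (mem_even.1 h0).2 _ (by rwa [(mem_odd.1 h1).1])

theorem even_odd_unique {m : ℕ} {ν : WComp k d} {w₀ w₁ u₀ u₁ : SignedPerm d}
    (h0 : w₀ ∈ evenParabolic m ν) (h1 : w₁ ∈ oddParabolic m ν) (h2 : u₀ ∈ evenParabolic m ν)
    (h3 : u₁ ∈ oddParabolic m ν) (e : w₀ * w₁ = u₀ * u₁) : w₀ = u₀ ∧ w₁ = u₁ := by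
  have e1 : w₁ = u₁ := signed_ext fun x => by
    by_cases hx : (m : ℤ) < |zblk ν x|
    · rw [← odd_apply h0 h1 hx, e, odd_apply h2 h3 hx]
    · rw [(mem_odd.1 h1).2 x (not_lt.1 hx), (mem_odd.1 h3).2 x (not_lt.1 hx)]
  rw [e1] at e
  exact ⟨mul_right_cancel e, e1⟩

theorem even_mul_odd_mem {m : ℕ} {ν : WComp k d} {w₀ w₁ : SignedPerm d}
    (h0 : w₀ ∈ evenParabolic m ν) (h1 : w₁ ∈ oddParabolic m ν) : w₀ * w₁ ∈ parabolic ν :=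
  mem_parabolic.2 fun x => by
    rw [signed_mul_apply, (mem_even.1 h0).1, (mem_odd.1 h1).1]

/-- An inversion of w stays inside a block of ν, where the word of g increases weakly. Equal letters
are excluded, since w is shortest in its coset of the intersection subgroup. -/
theorem DMin.lt_of_inv {μ ν : WComp k d} {g w : SignedPerm d} (h : DMin μ g ν)
    (hw : w ∈ parabolic ν) (hm : IsMin (pairCode (ofComp ν) ((ofComp μ).comp g)) w)
    {p p' : SymInt d} (hp : p.1 < p'.1) (hi : (w.1 p').1 < (w.1 p).1) :
    zblk ν p = zblk ν p' ∧
      (((ofComp μ).comp g).comp w).z p' < (((ofComp μ).comp g).comp w).z p := by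
  have h1 := zblk_mono ν (show p.1 ≤ p'.1 from hp.le)
  have h2 := zblk_mono ν (show (w.1 p').1 ≤ (w.1 p).1 from hi.le)
  rw [mem_parabolic.1 hw, mem_parabolic.1 hw] at h2
  have e := le_antisymm h1 h2
  have e' : zblk ν (w.1 p') = zblk ν (w.1 p) := by
    rw [mem_parabolic.1 hw, mem_parabolic.1 hw, e]
  refine ⟨e, lt_of_le_of_ne (h.le e' hi.le) fun h3 => ?_⟩
  have := hm p p' (pairCode_eq.2 ⟨e'.symm, h3.symm⟩) hp
  omega

/-- Inversions of the word inside odd blocks are the inversions of w₁, because w₀ fixes these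
positions, w₁ fixes all others, and no equal letters are inverted. The factor 2 is the one in
`two_length`. -/
theorem DMin.oi_comp {m : ℕ} {μ ν : WComp k d} {g w₀ w₁ : SignedPerm d} (h : DMin μ g ν)
    (h0 : w₀ ∈ evenParabolic m ν) (h1 : w₁ ∈ oddParabolic m ν)
    (hm : IsMin (pairCode (ofComp ν) ((ofComp μ).comp g)) (w₀ * w₁)) :
    oi m (ofComp ν) (((ofComp μ).comp g).comp (w₀ * w₁)) = 2 * length w₁ := by
  rw [two_length, oi, invSet]
  congr 1
  ext ⟨x, y⟩
  simp only [Finset.mem_filter, Finset.mem_univ, true_and]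
  have hw := even_mul_odd_mem h0 h1
  have hodd : ∀ z : SymInt d, IsOddIdx m ((ofComp ν).1 z) ↔ (m : ℤ) < |zblk ν z| := fun _ => Iff.rfl
  constructor
  · rintro ⟨a1, a2, a3, a4⟩
    rw [hodd] at a3
    change zblk ν x = zblk ν y at a2
    have a3' : (m : ℤ) < |zblk ν y| := by rwa [← a2]
    refine ⟨fun hy => ?_, a1, ?_⟩
    · have : y = 0 := Subtype.ext hy
      rw [this, zblk, blk_zero] at a3'
      simp at a3'; omega
    · rw [← odd_apply h0 h1 a3, ← odd_apply h0 h1 a3']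
      by_contra hc
      rw [not_lt] at hc
      have := h.le (show zblk ν ((w₀ * w₁).1 x) = zblk ν ((w₀ * w₁).1 y) by
        rw [mem_parabolic.1 hw, mem_parabolic.1 hw, a2]) hc
      exact absurd a4 (not_lt.2 this)
  · rintro ⟨-, a1, a2⟩
    have b1 := zblk_mono ν (show x.1 ≤ y.1 from a1.le)
    have b2 := zblk_mono ν (show (w₁.1 y).1 ≤ (w₁.1 x).1 from a2.le)
    rw [(mem_odd.1 h1).1, (mem_odd.1 h1).1] at b2
    have e := le_antisymm b1 b2
    have hx : (m : ℤ) < |zblk ν x| := by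
      by_contra hc
      rw [(mem_odd.1 h1).2 x (not_lt.1 hc), (mem_odd.1 h1).2 y (by rw [← e]; exact not_lt.1 hc)]
        at a2
      omega
    rw [← odd_apply h0 h1 hx, ← odd_apply h0 h1 (show (m : ℤ) < |zblk ν y| by rwa [← e])] at a2
    exact ⟨a1, e, hx, (h.lt_of_inv hw hm a1 a2).2⟩

open Classical in
/-- The expansion of double coset elements. -/
theorem dce_eq {m : ℕ} {μ ν : WComp k d} {g : SignedPerm d} (h : DMin μ g ν) :
    doubleCosetElt m μ g ν = ∑ f : Word k d with mat f (ofComp ν) = kappa μ g ν,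
      wt m (ofComp ν) f • E m μ f := by
  rw [doubleCosetElt, ← Finset.sum_product', ← Finset.sum_filter, Finset.mul_sum]
  have hmin : ∀ w, (∀ x ∈ conjBy g (parabolic μ) ⊓ parabolic ν, length w ≤ length (x * w)) ↔
      IsMin (pairCode (ofComp ν) ((ofComp μ).comp g)) w := fun w => by
    rw [conj_inter_parabolic, isMin_iff_length h.pairCode_mono (pairCode_neg _ _)]
  -- The shortest coset representatives w₀ w₁ in W_ν correspond to the words with the matrix of g,
  -- by rearranging the word of g.
  refine Finset.sum_bij (fun p _ => ((ofComp μ).comp g).comp (p.1 * p.2)) ?_ ?_ ?_ ?_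
  · rintro ⟨w₀, w₁⟩ hw
    simp only [Finset.mem_filter, Finset.mem_product, Finset.mem_univ, true_and] at hw ⊢
    have hw' := even_mul_odd_mem hw.1.1 hw.1.2
    rw [kappa_eq]
    conv_lhs => rw [show ofComp ν = (ofComp ν).comp (w₀ * w₁) from
      ext_z fun x => (mem_parabolic.1 hw' x).symm]
    rw [mat_comp]
  · rintro ⟨w₀, w₁⟩ hw ⟨u₀, u₁⟩ hu e
    simp only [Finset.mem_filter, Finset.mem_product, Finset.mem_univ, true_and, hmin] at hw hu e
    have hw' := even_mul_odd_mem hw.1.1 hw.1.2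
    have hu' := even_mul_odd_mem hu.1.1 hu.1.2
    have := IsMin.unique h.pairCode_mono hw.2 hu.2 fun x => by
      rw [pairCode_eq]
      refine ⟨?_, congrArg (fun f : Word k d => f.z x) e⟩
      rw [ofComp_z, mem_parabolic.1 hw', mem_parabolic.1 hu']
    have := even_odd_unique hw.1.1 hw.1.2 hu.1.1 hu.1.2 this
    exact Prod.ext this.1 this.2
  · intro f hf
    rw [Finset.mem_filter] at hf
    obtain ⟨w, h1, h2, h3⟩ := h.exists_comp hf.2
    obtain ⟨w₀, h4, w₁, h5, rfl⟩ := exists_even_odd (m := m) h1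
    refine ⟨(w₀, w₁), ?_, h3⟩
    simp only [Finset.mem_filter, Finset.mem_product, Finset.mem_univ, true_and, hmin]
    exact ⟨⟨h4, h5⟩, h2⟩
  · rintro ⟨w₀, w₁⟩ hw
    simp only [Finset.mem_filter, Finset.mem_product, Finset.mem_univ, true_and, hmin] at hw ⊢
    have hw' := even_mul_odd_mem hw.1.1 hw.1.2
    -- Only different letters get inverted, so the eigenvalue never enters and c = 1 can be taken.
    obtain ⟨N, -, h2⟩ := E_mul_T (m := m) (hasContent_comp μ g) 1 (w₀ * w₁) fun p p' hp hi => by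
      have := (h.lt_of_inv hw' hw.2 hp hi).2
      exact ⟨this.le, fun h3 => absurd this (by
        rw [comp_z, comp_z _ _ p, h3]; exact lt_irrefl _)⟩
    rw [one_pow, one_smul, E, st_eq_of_isMin h.1] at h2
    rw [mul_smul_comm, h2, zpow_neg_length, wt, h.oi_comp hw.1.1 hw.1.2 hw.2,
      Nat.mul_div_cancel_left _ two_pos]

end Word
end
end IotaSchur

/-! ### Double coset elements as right eigenvectors -/

namespace IotaSchur
noncomputable section
variable {k d : ℕ}

namespace Word

theorem ofComp_comp_simple {ν : WComp k d} {i : Fin d} (h : zblk ν (lo i) = zblk ν (hi i)) :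
    (ofComp ν).comp (simpleRefl i) = ofComp ν := comp_simple_of_eq h

open Classical in
-- Exchanging increasing neighbours of one block creates one inversion and its mirror image. For s_0
-- the block is that of zero, which is even, so the self-opposite pair never counts.
theorem oi_comp_simple {m : ℕ} {ν : WComp k d} {f : Word k d} {i : Fin d}
    (h : zblk ν (lo i) = zblk ν (hi i)) (hf : f.z (lo i) < f.z (hi i)) :
    oi m (ofComp ν) (f.comp (simpleRefl i)) =
      oi m (ofComp ν) f + if IsOddIdx m (blk ν (hi i)) then 2 else 0 := by
  have e : ∀ x, (ofComp ν).1 (simpleReflPerm i x) = (ofComp ν).1 x := fun x =>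
    congrArg (fun u : Word k d => u.1 x) (ofComp_comp_simple h)
  have e' : ∀ x, (ofComp ν).z (simpleReflPerm i x) = (ofComp ν).z x := fun x =>
    congrArg Subtype.val (e x)
  have n1 := f.z_neg (lo i)
  have n2 := f.z_neg (hi i)
  have h0 := f.lo_zero_z (i := i)
  have hcard := card_pairs_refl i (fun a b => (ofComp ν).z a = (ofComp ν).z b ∧
    IsOddIdx m ((ofComp ν).1 a) ∧ f.z b < f.z a) (by omega) (by omega)
    (fun h1 => by have := h0 h1; omega)
  have ef : ∀ x, f.z (simpleReflPerm i x) = (f.comp (simpleRefl i)).z x := fun _ => rfl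
  simp only [e, e', ef] at hcard
  unfold oi
  refine hcard.trans ?_
  congr 1
  have e1 : (ofComp ν).z (lo i) = (ofComp ν).z (hi i) := h
  have e2 : (ofComp ν).z (-lo i) = (ofComp ν).z (-hi i) := by rw [z_neg, z_neg, e1]
  have e3 : IsOddIdx m ((ofComp ν).1 (-lo i)) ↔ IsOddIdx m (blk ν (hi i)) := by
    have : (ofComp ν).1 (-lo i) = -blk ν (hi i) := Subtype.ext (e2.trans (z_neg _ _))
    rw [this, IsOddIdx, IsOddIdx, SymInt.val_neg, abs_neg]
  have e4 : (ofComp ν).1 (hi i) = blk ν (hi i) := rfl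
  by_cases ho : IsOddIdx m (blk ν (hi i))
  · rw [if_pos ⟨e1.symm, ho, hf⟩, if_pos ⟨e2, e3.2 ho, by omega⟩, if_neg, if_pos ho]
    rintro ⟨h1, -⟩
    have h2 := (ofComp ν).lo_zero_z h1
    rw [e1] at h2
    rw [IsOddIdx, show (blk ν (hi i)).1 = 0 from h2, abs_zero] at ho
    omega
  · rw [if_neg (fun h => ho h.2.1), if_neg (fun h => ho (e3.1 h.2.1)),
      if_neg (fun h => ho h.2.2.1), if_neg ho]

open Classical in
/-- Double coset elements are eigenvectors for the right action. -/
theorem sum_mul_simple {m n : ℕ} {μ ν : WComp (m + n) d} {g : SignedPerm d}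
    (hg : IsSuperRep m μ g ν) {i : Fin d} (h : zblk ν (lo i) = zblk ν (hi i)) :
    doubleCosetElt m μ g ν * Hecke.T (simpleRefl i) =
      chi m (blk ν (hi i)) • doubleCosetElt m μ g ν := by
  obtain ⟨hd, hX⟩ := superRep_iff.1 hg
  have hc : ∀ f : Word (m + n) d, mat f (ofComp ν) = kappa μ g ν → HasContent μ f := fun f hf => by
    obtain ⟨w, -, -, rfl⟩ := hd.exists_comp hf
    exact hasContent_comp μ (g * w)
  -- Two equal letters in one block mean a matrix entry of at least 2, so letter and block have the
  -- same parity and the same eigenvalue.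
  have hchi : ∀ f : Word (m + n) d, mat f (ofComp ν) = kappa μ g ν → f.z (lo i) = f.z (hi i) →
      chi m (f.1 (hi i)) = chi m (blk ν (hi i)) := fun f hf h4 => by
      have h2 := hX (f.1 (hi i)) (blk ν (hi i))
      have h3 : ¬ (kappa μ g ν (f.1 (hi i)) (blk ν (hi i)) = 0 ∨
          kappa μ g ν (f.1 (hi i)) (blk ν (hi i)) = 1) := by
        rw [← hf, mat_apply, ← Nat.le_one_iff_eq_zero_or_eq_one, Finset.card_le_one]
        intro h4'
        exact lo_ne_hi' i (h4' (lo i) (by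
          simp only [Finset.mem_filter, Finset.mem_univ, true_and]
          exact ⟨Subtype.ext h4, Subtype.ext h⟩) (hi i)
          (Finset.mem_filter.2 ⟨Finset.mem_univ _, rfl, rfl⟩))
      have h5 : IsOddIdx m (f.1 (hi i)) ↔ IsOddIdx m (blk ν (hi i)) := by
        by_contra h6
        exact h3 (h2 h6)
      by_cases h6 : IsOddIdx m (f.1 (hi i))
      · rw [chi_odd h6, chi_odd (h5.1 h6)]
      · rw [chi_even h6, chi_even (mt h5.2 h6)]
  rw [dce_eq hd, ← sub_eq_zero, Finset.sum_mul, Finset.smul_sum, ← Finset.sum_sub_distrib]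
  -- The words f and f ∘ s_i have weights in the ratio 1 : -q⁻¹ in an odd block and 1 : 1 in an even
  -- one. With these weights their contributions form an eigenvector for -1 and q, respectively.
  have key : ∀ f : Word (m + n) d, f.z (lo i) < f.z (hi i) →
      (wt m (ofComp ν) f • E m μ f * Hecke.T (simpleRefl i) -
        chi m (blk ν (hi i)) • wt m (ofComp ν) f • E m μ f) +
      (wt m (ofComp ν) (f.comp (simpleRefl i)) • E m μ (f.comp (simpleRefl i)) *
          Hecke.T (simpleRefl i) -
        chi m (blk ν (hi i)) • wt m (ofComp ν) (f.comp (simpleRefl i)) •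
          E m μ (f.comp (simpleRefl i))) = 0 := fun f hlt => by
    have h1 := E_mul_desc m μ (f := f.comp (simpleRefl i)) (i := i) (by
      have := comp_simple_lt (f := f.comp (simpleRefl i)) (i := i)
      rw [comp_simple_simple] at this
      exact this.1 hlt)
    rw [comp_simple_simple] at h1
    rw [smul_mul_assoc, smul_mul_assoc, E_mul_asc m μ hlt, h1, wt, wt, oi_comp_simple h hlt]
    generalize E m μ f = x
    generalize E m μ (f.comp (simpleRefl i)) = y
    generalize oi m (ofComp ν) f = a
    split_ifs with ho
    · rw [chi_odd ho, show (a + 2) / 2 = a / 2 + 1 by omega, pow_succ]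
      generalize oddBase ^ (a / 2) = w
      have e : w * oddBase * q = -w := by linear_combination w * oddBase_mul_q
      rw [smul_add, smul_smul _ (q : Coef), e, smul_smul _ ((q : Coef) - 1), mul_sub, e]
      module
    · rw [chi_even ho, add_zero]
      module
  refine Finset.sum_involution (fun f _ => f.comp (simpleRefl i)) ?_ ?_ ?_ ?_
  · intro f hf
    rw [Finset.mem_filter] at hf
    rcases lt_trichotomy (f.z (lo i)) (f.z (hi i)) with h1 | h1 | h1
    · exact key f h1
    · rw [comp_simple_of_eq h1, smul_mul_assoc, E_mul_eq (hc f hf.2) h1]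
      rw [hchi f hf.2 h1, smul_comm, sub_self, add_zero]
    · have := key (f.comp (simpleRefl i)) (comp_simple_lt.2 h1)
      rw [comp_simple_simple] at this
      rw [add_comm]; exact this
  · intro f hf h1 h2
    have h2 : f.comp (simpleRefl i) = f := h2
    have h3 := comp_simple_lt (f := f) (i := i)
    rw [h2] at h3
    have h4 : f.z (lo i) = f.z (hi i) := by omega
    rw [Finset.mem_filter] at hf
    apply h1
    rw [smul_mul_assoc, E_mul_eq (hc f hf.2) h4]
    rw [hchi f hf.2 h4, smul_comm, sub_self]
  · intro f hf
    simp only [Finset.mem_filter, Finset.mem_univ, true_and] at hf ⊢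
    conv_lhs => rw [← ofComp_comp_simple h]
    rw [mat_comp, hf]
  · intro f _
    exact comp_simple_simple f i

end Word

/-- Right eigenvectors for a parabolic subgroup, with the eigenvalues of `[xy]`. -/
def RightEigen (m : ℕ) (ν : WComp k d) (x : Hecke d) : Prop :=
  ∀ i : Fin d, zblk ν (lo i) = zblk ν (hi i) →
    x * Hecke.T (simpleRefl i) = chi m (blk ν (hi i)) • x

theorem evalOne_oddBase : evalOne oddBase = -1 := by
  have := congrArg evalOne oddBase_mul_q
  rwa [map_mul, evalOne_q, mul_one, map_neg, map_one] at this

theorem mul_T_of_stab {φ : SymInt d → ℤ} (hm : Monotone φ) (ho : ∀ x, φ (-x) = -φ x) {x : Hecke d}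
    {a : ℤ} (h : ∀ i : Fin d, φ (lo i) = φ (hi i) →
      ∃ c : Coef, evalOne c = a ∧ x * Hecke.T (simpleRefl i) = c • x)
    {u : SignedPerm d} (hu : u ∈ stab φ) :
    ∃ c : Coef, evalOne c = a ^ length u ∧ x * Hecke.T u = c • x := by
  refine stab_induction hm ho
    (P := fun u => ∃ c : Coef, evalOne c = a ^ length u ∧ x * Hecke.T u = c • x) ?_ ?_ u hu
  · exact ⟨1, by rw [length_one, pow_zero, map_one], by rw [← Hecke.one_def, mul_one, one_smul]⟩
  · rintro i w hi' - hlt ⟨c, h1, h2⟩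
    obtain ⟨b, h3, h4⟩ := h i hi'
    refine ⟨c * b, by rw [map_mul, h1, h3, length_ascent_left hlt, pow_succ], ?_⟩
    rw [← Hecke.simple_mul_T_asc hlt, ← mul_assoc, h4, smul_mul_assoc, h2, smul_smul, mul_comm]

/-- At v = 1 the eigenvalue of T_u becomes a^ℓ(u) and its coefficient becomes a^{-ℓ(u)}, so the sum
specializes to the order of H, which is not zero. -/
theorem mul_parSum_of_stab {x : Hecke d} {a : ℤ} {b : Coef} (hb : evalOne b * a = 1)
    {H : Subgroup (SignedPerm d)}
    (h : ∀ u ∈ H, ∃ c : Coef, evalOne c = a ^ length u ∧ x * Hecke.T u = c • x) :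
    ∃ c : Coef, evalOne c ≠ 0 ∧ x * Hecke.parSum b H = c • x := by
  classical
  choose! c h1 h2 using h
  refine ⟨∑ u with u ∈ H, b ^ length u * c u, ?_, ?_⟩
  · rw [map_sum, Finset.sum_congr rfl (g := fun _ => (1 : ℤ)) fun u hu => ?_]
    · rw [Finset.sum_const, nsmul_eq_mul, mul_one, Nat.cast_ne_zero]
      exact Finset.card_ne_zero_of_mem (a := 1) (by simp [one_mem])
    · rw [Finset.mem_filter] at hu
      rw [map_mul, map_pow, h1 u hu.2, ← mul_pow, hb, one_pow]
  · rw [Hecke.parSum, Finset.mul_sum, Finset.sum_smul]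
    refine Finset.sum_congr rfl fun u hu => ?_
    rw [Finset.mem_filter] at hu
    rw [mul_smul_comm, h2 u hu.2, smul_smul]

theorem RightEigen.mul_xy {m : ℕ} {ν : WComp k d} {x : Hecke d} (h : RightEigen m ν x) :
    ∃ c : Coef, evalOne c ≠ 0 ∧ x * xy m ν = c • x := by
  obtain ⟨a, ha, ha'⟩ := mul_parSum_of_stab (x := x) (a := 1) (b := 1) (by simp)
    (H := evenParabolic m ν) fun u hu => by
      rw [evenParabolic_eq] at hu
      refine mul_T_of_stab (evblk_mono m ν) (evblk_neg m ν) (fun i hi' => ?_) hu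
      rw [evblk, refine_eq_iff] at hi'
      refine ⟨_, ?_, h i hi'.1⟩
      rw [chi_even, evalOne_q]
      intro hc
      have := hi'.2 (by rw [hi'.1]; exact hc)
      exact lo_ne_hi' i this
  obtain ⟨b, hb, hb'⟩ := mul_parSum_of_stab (x := x) (a := -1) (b := oddBase)
    (by rw [evalOne_oddBase]; norm_num)
    (H := oddParabolic m ν) fun u hu => by
      rw [oddParabolic_eq] at hu
      refine mul_T_of_stab (odblk_mono m ν) (odblk_neg m ν) (fun i hi' => ?_) hu
      rw [odblk, refine_eq_iff] at hi'
      refine ⟨_, ?_, h i hi'.1⟩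
      rw [chi_odd, map_neg, map_one]
      by_contra hc
      have := hi'.2 (by rw [hi'.1]; exact hc)
      exact lo_ne_hi' i this
  refine ⟨a * b, by rw [map_mul]; exact mul_ne_zero ha hb, ?_⟩
  rw [xy_eq, ← mul_assoc, ha', smul_mul_assoc, hb', smul_smul]

/-- A nonzero multiple of x equals x [xy]_ν, so it annihilates h as well, and the Hecke algebra has
no torsion over the coefficients. -/
theorem RightEigen.mul_eq_zero {m : ℕ} {ν : WComp k d} {x : Hecke d} (hx : RightEigen m ν x)
    {h : Hecke d} (h0 : xy m ν * h = 0) : x * h = 0 := by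
  obtain ⟨c, hc, hc'⟩ := hx.mul_xy
  refine Hecke.eq_zero_of_smul (ne_zero_of_evalOne hc) ?_
  rw [← smul_mul_assoc, ← hc', mul_assoc, h0, mul_zero]

/-! ### Endomorphisms defined by right eigenvectors -/

variable {m n : ℕ}

theorem exists_eq_mul {μ : WComp k d} (y : xyIdeal m μ) : ∃ h, xy m μ * h = y.1 := by
  obtain ⟨h, hh⟩ := Submodule.mem_span_singleton.1 y.2
  exact ⟨h.unop, hh⟩

/-- Left multiplication by a right eigenvector, as a map of the ideals `[xy] ℋ`. -/
def eigenHom {μ ν : WComp k d} (x : xyIdeal m μ) (hx : RightEigen m ν x.1) :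
    xyIdeal m ν →ₗ[(Hecke d)ᵐᵒᵖ] xyIdeal m μ where
  -- Any h with [xy]_ν h = y will do: two choices differ by an element that [xy]_ν annihilates, and
  -- then so does x.
  toFun y := MulOpposite.op (exists_eq_mul y).choose • x
  map_add' y z := by
    have h1 := (exists_eq_mul y).choose_spec
    have h2 := (exists_eq_mul z).choose_spec
    have h3 := (exists_eq_mul (y + z)).choose_spec
    apply Subtype.ext
    change x.1 * _ = x.1 * _ + x.1 * _
    rw [← sub_eq_zero, ← mul_add, ← mul_sub]
    apply hx.mul_eq_zero
    rw [mul_sub, mul_add, MulOpposite.unop_op, MulOpposite.unop_op, MulOpposite.unop_op, h1, h2, h3, Submodule.coe_add, sub_self]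
  map_smul' c y := by
    have h1 := (exists_eq_mul y).choose_spec
    have h2 := (exists_eq_mul (c • y)).choose_spec
    apply Subtype.ext
    change x.1 * _ = x.1 * _ * c.unop
    rw [← sub_eq_zero, mul_assoc, ← mul_sub]
    apply hx.mul_eq_zero
    rw [mul_sub, ← mul_assoc, MulOpposite.unop_op, MulOpposite.unop_op, h1, h2]
    change y.1 * c.unop - _ = 0
    rw [sub_self]

theorem eigenHom_apply {μ ν : WComp k d} (x : xyIdeal m μ) (hx : RightEigen m ν x.1)
    (h : Hecke d) : eigenHom x hx ⟨xy m ν * h, xy_mul_mem m ν h⟩ = MulOpposite.op h • x := by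
  have h1 := (exists_eq_mul ⟨xy m ν * h, xy_mul_mem m ν h⟩).choose_spec
  apply Subtype.ext
  change x.1 * _ = x.1 * h
  rw [← sub_eq_zero, ← mul_sub]
  apply hx.mul_eq_zero
  rw [mul_sub, MulOpposite.unop_op, h1, sub_self]

/-- `f` maps `[xy]_l h` to `δ_{l,ν} x h`. -/
def Represents {μ : WComp (m + n) d} (x : xyIdeal m μ) (ν : WComp (m + n) d)
    (f : SchurSuper m n d) : Prop :=
  ∀ (l : WComp (m + n) d) (h : Hecke d),
    f (DirectSum.of (fun l => ↥(xyIdeal m l)) l ⟨xy m l * h, xy_mul_mem m l h⟩) =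
      if l = ν then DirectSum.of (fun l => ↥(xyIdeal m l)) μ (MulOpposite.op h • x) else 0

theorem exists_represents {μ ν : WComp (m + n) d} (x : xyIdeal m μ) (hx : RightEigen m ν x.1) :
    ∃ f, Represents x ν f := by
  classical
  refine ⟨DirectSum.lof (Hecke d)ᵐᵒᵖ _ (fun l => ↥(xyIdeal m l)) μ ∘ₗ eigenHom x hx ∘ₗ
    DirectSum.component (Hecke d)ᵐᵒᵖ _ (fun l => ↥(xyIdeal m l)) ν, fun l h => ?_⟩
  rw [LinearMap.comp_apply, LinearMap.comp_apply]
  split_ifs with hl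
  · subst hl
    have : DirectSum.component (Hecke d)ᵐᵒᵖ _ (fun l => ↥(xyIdeal m l)) l
        (DirectSum.of (fun l => ↥(xyIdeal m l)) l ⟨xy m l * h, xy_mul_mem m l h⟩) =
        ⟨xy m l * h, xy_mul_mem m l h⟩ :=
      DirectSum.of_eq_same (β := fun l => ↥(xyIdeal m l)) l _
    rw [this, eigenHom_apply x hx h]
    rfl
  · have : DirectSum.component (Hecke d)ᵐᵒᵖ _ (fun l => ↥(xyIdeal m l)) ν
        (DirectSum.of (fun l => ↥(xyIdeal m l)) l ⟨xy m l * h, xy_mul_mem m l h⟩) = 0 :=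
      DirectSum.of_eq_of_ne (β := fun l => ↥(xyIdeal m l)) _ _ _ (fun h => hl h.symm)
    rw [this, map_zero, map_zero]

theorem Represents.unique {μ ν : WComp (m + n) d} {x : xyIdeal m μ} {f f' : SchurSuper m n d}
    (hf : Represents x ν f) (hf' : Represents x ν f') : f = f' := by
  refine LinearMap.toAddMonoidHom_injective
    (DirectSum.addHom_ext (β := fun l => ↥(xyIdeal m l)) fun l y => ?_)
  obtain ⟨y, hy⟩ := y
  obtain ⟨h, rfl⟩ := Submodule.mem_span_singleton.1 hy
  exact (hf l h.unop).trans (hf' l h.unop).symm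

theorem Represents.zero {μ ν : WComp (m + n) d} : Represents (m := m) (0 : xyIdeal m μ) ν 0 :=
  fun l h => by rw [smul_zero, map_zero, ite_self]; rfl

theorem Represents.add {μ ν : WComp (m + n) d} {x x' : xyIdeal m μ} {f f' : SchurSuper m n d}
    (h : Represents x ν f) (h' : Represents x' ν f') : Represents (x + x') ν (f + f') :=
  fun l y => by
    rw [LinearMap.add_apply, h, h']
    split_ifs
    · rw [smul_add, map_add]
    · rw [add_zero]

theorem Represents.smul {μ ν : WComp (m + n) d} {x : xyIdeal m μ} {f : SchurSuper m n d}
    (h : Represents x ν f) (c : Coef) : Represents (c • x) ν (c • f) :=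
  fun l y => by
    rw [LinearMap.smul_apply, h]
    split_ifs
    · rw [smul_comm]
      exact ((DirectSum.lof Coef _ (fun l => ↥(xyIdeal m l)) μ).map_smul c _).symm
    · rw [smul_zero]

theorem Represents.sum {ι : Type*} {μ ν : WComp (m + n) d} {x : ι → xyIdeal m μ}
    {f : ι → SchurSuper m n d} {s : Finset ι} (h : ∀ i ∈ s, Represents (x i) ν (f i)) :
    Represents (∑ i ∈ s, x i) ν (∑ i ∈ s, f i) := by
  classical
  induction s using Finset.induction_on with
  | empty => exact Represents.zero
  | insert a s ha ih =>
    rw [Finset.sum_insert ha, Finset.sum_insert ha]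
    exact (h a (Finset.mem_insert_self a s)).add
      (ih fun i hi' => h i (Finset.mem_insert_of_mem hi'))

theorem Represents.mul {l μ ν : WComp (m + n) d} {y : xyIdeal m l} {x : xyIdeal m μ}
    {f f' : SchurSuper m n d} (h : Represents y μ f) (h' : Represents x ν f') {c : Hecke d}
    (hc : xy m μ * c = x.1) : Represents (MulOpposite.op c • y) ν (f * f') := fun l' b => by
  change f (f' _) = _
  rw [h']
  split_ifs with h1
  · have : MulOpposite.op b • x = ⟨xy m μ * (c * b), xy_mul_mem m μ _⟩ := Subtype.ext (by
      change x.1 * b = _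
      rw [← hc, mul_assoc])
    rw [this, h, if_pos rfl, smul_smul]
    rfl
  · rw [map_zero]

/-- A double coset element, in its ideal. -/
def dce (m : ℕ) (μ : WComp k d) (g : SignedPerm d) (ν : WComp k d) : xyIdeal m μ :=
  ⟨doubleCosetElt m μ g ν, by simpa using doubleCosetElt_mul_mem m μ g ν 1⟩

theorem isPhi_iff {μ ν : WComp (m + n) d} {g : SignedPerm d} {f : SchurSuper m n d} :
    IsPhi μ g ν f ↔ Represents (dce m μ g ν) ν f := Iff.rfl

theorem toInt_injective {A B : Matrix (SymInt k) (SymInt k) ℕ} (h : toInt A = toInt B) : A = B := by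
  ext i j
  have := congrFun (congrFun h i) j
  exact Int.ofNat_inj.1 this

/-- The triple chosen in `e` is the given one, since row and column sums recover the compositions
and the matrix recovers the shortest representative. The map exists because the double coset element
is a right eigenvector. -/
theorem isPhi_e {μ ν : WComp (m + n) d} {g : SignedPerm d} (h : IsSuperRep m μ g ν) :
    IsPhi μ g ν (e m n d (toInt (kappa μ g ν))) := by
  have hex : ∃ p : WComp (m + n) d × SignedPerm d × WComp (m + n) d,
      IsSuperRep m p.1 p.2.1 p.2.2 ∧ toInt (kappa p.1 p.2.1 p.2.2) = toInt (kappa μ g ν) :=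
    ⟨(μ, g, ν), h, rfl⟩
  rw [e, dif_pos hex]
  obtain ⟨h1, h2⟩ := hex.choose_spec
  generalize hex.choose = p at h1 h2 ⊢
  obtain ⟨μ', g', ν'⟩ := p
  dsimp only at h1 h2 ⊢
  have h3 := toInt_injective h2
  have e1 : μ' = μ := Subtype.ext (by rw [← Word.row_kappa μ' g' ν', h3, Word.row_kappa])
  have e2 : ν' = ν := Subtype.ext (by rw [← Word.col_kappa μ' g' ν', h3, Word.col_kappa])
  subst e1 e2
  have e3 := (Word.superRep_iff.1 h1).1.unique (Word.superRep_iff.1 h).1 h3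
  subst e3
  have hf : ∃ f, IsPhi (m := m) (n := n) μ' g' ν' f :=
    exists_represents (dce m μ' g' ν') fun i hi' => Word.sum_mul_simple h hi'
  rw [phi, dif_pos hf]
  exact hf.choose_spec

theorem e_eq_zero {M : Matrix (SymInt (m + n)) (SymInt (m + n)) ℤ}
    (h : ∀ A ∈ Xi m n d, toInt A ≠ M) : e m n d M = 0 := by
  rw [e, dif_neg]
  rintro ⟨⟨μ, g, ν⟩, h1, h2⟩
  exact h _ (Word.kappa_mem_Xi h1) h2

end
end IotaSchur

/-! ### Structure constants as coefficients at shortest representatives -/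

namespace IotaSchur
noncomputable section
variable {k d : ℕ}

theorem exists_adjacent {φ : SymInt d → ℤ} (hm : Monotone φ) (ho : ∀ x, φ (-x) = -φ x)
    {x y : SymInt d} (hlt : x.1 < y.1) (e : φ x = φ y) : ∃ i : Fin d, φ (lo i) = φ (hi i) ∧
      (x = lo i ∨ x = -hi i) := by
  have bx := x.2
  have by' := y.2
  simp only [Set.mem_Icc] at bx by'
  let z : SymInt d := ⟨x.1 + 1, by simp only [Set.mem_Icc]; omega⟩
  have hz : z.1 = x.1 + 1 := rfl
  have e3 : φ x = φ z := by
    have h1 := hm (show x.1 ≤ z.1 by omega)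
    have h2 := hm (show z.1 ≤ y.1 by omega)
    omega
  rcases le_or_gt 0 x.1 with h0 | h0
  · obtain ⟨i, e5, e6⟩ : ∃ i : Fin d, x = lo i ∧ z = hi i :=
      ⟨⟨x.1.toNat, by omega⟩, Subtype.ext (by rw [val_lo]; simp [h0]),
        Subtype.ext (by rw [val_hi]; simp [h0]; omega)⟩
    exact ⟨i, by rw [← e5, ← e6, e3], Or.inl e5⟩
  · obtain ⟨i, e5, e6⟩ : ∃ i : Fin d, z = -lo i ∧ x = -hi i :=
      ⟨⟨(-z.1).toNat, by omega⟩, Subtype.ext (by rw [SymInt.val_neg, val_lo]; simp; omega),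
        Subtype.ext (by rw [SymInt.val_neg, val_hi]; simp; omega)⟩
    refine ⟨i, ?_, Or.inr e6⟩
    rw [e5, e6, ho, ho, neg_inj] at e3
    exact e3.symm

theorem chi_sub_ne {m : ℕ} {a b : SymInt k} (h : ¬ (IsOddIdx m a ↔ IsOddIdx m b)) :
    chi m a - chi m b ≠ 0 := by
  intro h1
  by_cases ha : IsOddIdx m a
  · rw [chi_odd ha, chi_even fun hb => h (iff_of_true ha hb)] at h1
    exact q_add_one_ne_zero (by linear_combination -h1)
  · rw [chi_even ha, chi_odd (not_not.1 fun hb => h (iff_of_false ha hb))] at h1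
    exact q_add_one_ne_zero (by linear_combination h1)

namespace Word

/-- An eigenvector on both sides vanishes if its coefficients at the admissible shortest double
coset representatives do. -/
theorem eq_zero_of_eigen {m : ℕ} {μ ν : WComp k d} {x : Hecke d}
    (hl : ∀ i : Fin d, zblk μ (lo i) = zblk μ (hi i) →
      Hecke.T (simpleRefl i) * x = chi m (blk μ (hi i)) • x)
    (hr : RightEigen m ν x) (h0 : ∀ g, IsSuperRep m μ g ν → Hecke.coef g x = 0) : x = 0 := by
  refine Hecke.ext_coef fun g => ?_
  rw [map_zero]
  have hq : ∀ y : Coef, (q : Coef) * y = 0 → y = 0 := fun y hy =>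
    (Units.mul_right_eq_zero q).1 hy
  induction hN : length g using Nat.strong_induction_on generalizing g with
  | _ N ih =>
    -- At a descent of g inside W_ν, the eigenvalue equation makes q times the coefficient at g a
    -- multiple of the coefficient at the shorter g s_i, which vanishes by induction. The left side
    -- is treated in the same way.
    by_cases h1 : ∃ i, zblk ν (lo i) = zblk ν (hi i) ∧ (g.1 (hi i)).1 < (g.1 (lo i)).1
    · obtain ⟨i, hi', hd⟩ := h1
      have h2 := Hecke.coef_mul_simple ((asc_mul g i).2 hd) x
      rw [hr i hi', map_smul, mul_assoc, simpleRefl_mul_self, mul_one,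
        ih _ (by have := length_descent_right hd; omega) _ rfl, smul_zero] at h2
      exact hq _ h2.symm
    by_cases h2 : ∃ i, zblk μ (lo i) = zblk μ (hi i) ∧ (g⁻¹.1 (hi i)).1 < (g⁻¹.1 (lo i)).1
    · obtain ⟨i, hi', hd⟩ := h2
      have h2 := Hecke.coef_simple_mul (w := simpleRefl i * g) (i := i) (by
        rw [mul_inv_rev, simpleRefl_inv]; exact (asc_mul g⁻¹ i).2 hd) x
      rw [hl i hi', map_smul, ← mul_assoc, simpleRefl_mul_self, one_mul,
        ih _ (by have := length_descent_left hd; omega) _ rfl, smul_zero] at h2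
      exact hq _ h2.symm
    push Not at h1 h2
    have hD : DMin μ g ν := by
      refine ⟨isMin_of_asc (zblk_mono μ) (zblk_neg μ) fun i hi' =>
        lt_of_le_of_ne (h2 i hi') (lo_ne_hi _ i), isMin_of_asc (zblk_mono ν) (zblk_neg ν)
        fun i hi' => ?_⟩
      rw [inv_inv]
      exact lt_of_le_of_ne (h1 i hi') (lo_ne_hi _ i)
    by_cases hs : IsSuperRep m μ g ν
    · exact h0 g hs
    rw [superRep_iff] at hs
    have h3 : ∃ a b, ¬ (IsOddIdx m a ↔ IsOddIdx m b) ∧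
        ¬ (kappa μ g ν a b = 0 ∨ kappa μ g ν a b = 1) := by
      by_contra hc
      exact hs ⟨hD, fun a b hab => by_contra fun h4 => hc ⟨a, b, hab, h4⟩⟩
    obtain ⟨a, b, hab, hk⟩ := h3
    rw [kappa_apply_le_one] at hk
    push Not at hk
    obtain ⟨u, v, rfl, rfl, h5, h6, h7⟩ := hk
    -- If g is minimal on both sides but has an entry of at least 2 at a place of mixed parity, then
    -- s_j g = g s_i for generators of different parity. Both eigenvalue equations involve the
    -- coefficient at this longer element, so the coefficient at g is annihilated by the difference
    -- of the eigenvalues, which is ±(q + 1).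
    have key : ∀ u v : SymInt d, u.1 < v.1 → blk μ (g.1 v) = blk μ (g.1 u) → blk ν v = blk ν u →
        ¬ (IsOddIdx m (blk μ (g.1 u)) ↔ IsOddIdx m (blk ν u)) → Hecke.coef g x = 0 := by
      intro u v huv e1 e2 hab
      obtain ⟨i, hi', hu⟩ := exists_adjacent hD.pairCode_mono (pairCode_neg _ _) huv
        (pairCode_eq.2 ⟨congrArg Subtype.val e2.symm, congrArg Subtype.val e1.symm⟩)
      rw [pairCode_eq] at hi'
      obtain ⟨j, j1, j2, j3, j4⟩ := exists_conj_simple (hasContent_comp μ g) hi'.2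
      rw [st_eq_of_isMin hD.1] at j3 j4
      have c1 := Hecke.coef_mul_simple (hD.lt hi'.1 (by rw [val_lo, val_hi]; omega)) x
      have c2 := Hecke.coef_simple_mul j3 x
      rw [hr i hi'.1, map_smul] at c1
      rw [hl j j1, map_smul, j4, ← c1, ← sub_eq_zero, ← sub_smul, smul_eq_mul] at c2
      have e3 : chi m (blk μ (hi j)) = chi m (blk μ (g.1 (hi i))) := by
        rcases j2 with h | h
        · rw [h]; rfl
        · rw [h, chi_neg]; rfl
      rw [e3] at c2
      have e4 : blk μ (g.1 (lo i)) = blk μ (g.1 (hi i)) := Subtype.ext hi'.2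
      have e5 : blk ν (lo i) = blk ν (hi i) := Subtype.ext hi'.1
      have hneg : ∀ a : SymInt k, IsOddIdx m (-a) ↔ IsOddIdx m a := fun a => by
        rw [IsOddIdx, IsOddIdx, SymInt.val_neg, abs_neg]
      have hab' : ¬ (IsOddIdx m (blk μ (g.1 (hi i))) ↔ IsOddIdx m (blk ν (hi i))) := by
        rcases hu with rfl | rfl
        · rwa [e4, e5] at hab
        · rwa [signed_map_neg, blk_neg, blk_neg, hneg, hneg] at hab
      refine (mul_eq_zero.1 c2).resolve_left ?_
      exact chi_sub_ne hab'
    rcases lt_trichotomy u.1 v.1 with h8 | h8 | h8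
    · exact key u v h8 h5 h6 hab
    · exact absurd (Subtype.ext h8) h7
    · exact key v u h8 h5.symm h6.symm (by rwa [h5, h6])

open Classical in
/-- Twice the exponent that comes from the equal letters of `v` at the inversions of `u`. -/
def ni (u v : Word k d) : ℕ :=
  (Finset.univ.filter fun p : SymInt d × SymInt d => p.1.1 < p.2.1 ∧ p.2.1 ≠ 0 ∧
    u.z p.2 < u.z p.1 ∧ v.z p.2 = v.z p.1).card

theorem st_lt_of_eq {f : Word k d} {x y : SymInt d} (e : f.z x = f.z y) :
    (f.st.1 x).1 < (f.st.1 y).1 ↔ x.1 < y.1 := by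
  rw [st_lt, KeyLt]; omega

/-- Standardization keeps the order of positions with equal letters, so inversions inside the letter
classes of f become inversions inside blocks. -/
theorem oi_comp_inv {m : ℕ} {l : WComp k d} {f u : Word k d} (hf : HasContent l f) :
    oi m (ofComp l) (u.comp f.st⁻¹) = oi m f u := by
  have h1 : ∀ x, (ofComp l).1 (f.st.1 x) = f.1 x := fun x => congrArg (fun f : Word k d => f.1 x) hf
  classical
  unfold oi
  refine Finset.card_bij' (fun p _ => (f.st⁻¹.1 p.1, f.st⁻¹.1 p.2))
    (fun p _ => (f.st.1 p.1, f.st.1 p.2)) ?_ ?_ ?_ ?_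
  · rintro ⟨x, y⟩ hp
    obtain ⟨x, rfl⟩ := f.st.1.surjective x
    obtain ⟨y, rfl⟩ := f.st.1.surjective y
    rw [Finset.mem_filter] at hp ⊢
    simp only [Finset.mem_univ, true_and, signed_inv_apply, h1, z, comp] at hp ⊢
    exact ⟨(st_lt_of_eq hp.2.1).1 hp.1, hp.2⟩
  · rintro ⟨x, y⟩ hp
    rw [Finset.mem_filter] at hp ⊢
    simp only [Finset.mem_univ, true_and, signed_inv_apply, h1, z, comp] at hp ⊢
    exact ⟨(st_lt_of_eq hp.2.1).2 hp.1, hp.2⟩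
  · rintro ⟨x, y⟩ _
    simp only [signed_apply_inv]
  · rintro ⟨x, y⟩ _
    simp only [signed_inv_apply]

open Classical in
/-- The part of a double coset element to the right of `[xy]`. -/
def tail (m : ℕ) (μ : WComp k d) (g : SignedPerm d) (ν : WComp k d) : Hecke d :=
  ∑ f : Word k d with mat f (ofComp ν) = kappa μ g ν,
    wt m (ofComp ν) f • Hecke.T f.st

theorem xy_mul_tail {m : ℕ} {μ ν : WComp k d} {g : SignedPerm d} (h : DMin μ g ν) :
    xy m μ * tail m μ g ν = doubleCosetElt m μ g ν := by
  rw [dce_eq h, tail, Finset.mul_sum]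
  exact Finset.sum_congr rfl fun f _ => by rw [mul_smul_comm, E]

theorem hasContent_of_mat {μ ν : WComp k d} {g : SignedPerm d} (h : DMin μ g ν) {f : Word k d}
    (hf : mat f (ofComp ν) = kappa μ g ν) : HasContent μ f := by
  obtain ⟨w, -, -, rfl⟩ := h.exists_comp hf
  exact hasContent_comp μ (g * w)

theorem eq_comp_of_st {l : WComp k d} {f : Word k d} (hf : HasContent l f) {g : SignedPerm d}
    (hg : IsMin (zblk l) g) : f.st = g ↔ f = (ofComp l).comp g := by
  constructor
  · rintro rfl; exact hf.symm
  · rintro rfl; exact st_eq_of_isMin hg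

/-- The matrices with at most one nonzero entry off the diagonal, up to sign. -/
def IsNearDiag (m : ℕ) (B : Matrix (SymInt k) (SymInt k) ℕ) (c : Coef) : Prop :=
  ∀ i j i' j', B i j ≠ 0 → B i' j' ≠ 0 → j'.1 < j.1 → i'.1 ≤ i.1 ∧ (i'.1 = i.1 → chi m i = c)

open Classical in
-- Near diagonality ensures that the inversions of the standardization of f meet only increasing or
-- equal letters of a word e of B, and that equal ones have eigenvalue c. So `E_mul_T` turns e into
-- a power of c times one word, and only e = f' ∘ (st f)⁻¹ reaches the word f' of g.
theorem coef_dce_mul_tail {m : ℕ} {l μ ν : WComp k d} {gB gA g : SignedPerm d} {c : Coef}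
    (hB : DMin l gB μ) (hA : DMin μ gA ν) (hc : IsNearDiag m (kappa l gB μ) c)
    (hg : IsMin (zblk l) g) :
    Hecke.coef g (doubleCosetElt m l gB μ * tail m μ gA ν) =
      ∑ f : Word k d with mat f (ofComp ν) = kappa μ gA ν ∧
        mat ((ofComp l).comp g) f = kappa l gB μ,
        wt m (ofComp ν) f * wt m f ((ofComp l).comp g) * c ^ (ni f ((ofComp l).comp g) / 2) := by
  rw [tail, Finset.mul_sum, map_sum, ← Finset.filter_filter, Finset.sum_filter (p := fun f =>
    mat ((ofComp l).comp g) f = kappa l gB μ)]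
  refine Finset.sum_congr rfl fun f hf => ?_
  rw [Finset.mem_filter] at hf
  have hf' := hasContent_of_mat hA hf.2
  have h1 : (ofComp μ).comp f.st = f := hf'
  rw [mul_smul_comm, map_smul, smul_eq_mul, dce_eq hB, Finset.sum_mul, map_sum]
  set f' := (ofComp l).comp g with hf'_def
  have h2 : ∀ e : Word k d, mat e (ofComp μ) = kappa l gB μ →
      Hecke.coef g (wt m (ofComp μ) e • E m l e * Hecke.T f.st) =
        if e = f'.comp f.st⁻¹ then wt m f f' * c ^ (ni f f' / 2) else 0 := by
    intro e he
    have he' := hasContent_of_mat hB he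
    obtain ⟨N, h3, h4⟩ := E_mul_T (m := m) he' c f.st fun p p' hp hi => by
      have h5 : f.z p' < f.z p := by
        have := (st_lt f p' p).1 hi
        unfold KeyLt at this
        omega
      have h6 : ∀ x : SymInt d, kappa l gB μ (e.1 (f.st.1 x)) (f.1 x) ≠ 0 := fun x => by
        rw [← he, mat_apply]
        refine Finset.card_ne_zero_of_mem (a := f.st.1 x) ?_
        rw [Finset.mem_filter]
        exact ⟨Finset.mem_univ _, rfl, congrArg (fun f : Word k d => f.1 x) h1⟩
      exact hc _ _ _ _ (h6 p) (h6 p') h5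
    rw [smul_mul_assoc, h4, map_smul, map_smul, coef_E (he'.comp _) hg]
    have h7 : (e.comp f.st).st = g ↔ e = f'.comp f.st⁻¹ := by
      rw [eq_comp_of_st (he'.comp _) hg]
      constructor
      · intro h
        rw [hf'_def, ← h, comp_comp, mul_inv_cancel, comp_one]
      · rintro rfl
        rw [comp_comp, inv_mul_cancel, comp_one]
    by_cases h8 : e = f'.comp f.st⁻¹
    · rw [if_pos (h7.2 h8), if_pos h8, smul_eq_mul, smul_eq_mul, mul_one]
      congr 1
      · rw [h8, wt, oi_comp_inv hf', wt]
      · congr 1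
        rw [← Nat.mul_div_cancel_left N two_pos, h3, ni]
        congr 2
        ext ⟨x, y⟩
        simp only [Finset.mem_filter, Finset.mem_univ, true_and]
        have h9 : ∀ x, e.z (f.st.1 x) = f'.z x := fun x => by
          rw [h8, comp_z, signed_inv_apply]
        rw [h9, h9, st_lt, KeyLt]
        have : x.1 < y.1 → ((f.z y < f.z x ∨ f.z y = f.z x ∧ y.1 < x.1) ↔ f.z y < f.z x) := by
          omega
        tauto
    · rw [if_neg (mt h7.1 h8), if_neg h8, smul_zero, smul_zero]
  rw [Finset.sum_congr rfl (fun e he => h2 e (Finset.mem_filter.1 he).2), Finset.sum_ite_eq']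
  have h3 : mat (f'.comp f.st⁻¹) (ofComp μ) = mat f' f := by
    conv_rhs => rw [← mat_comp _ _ f.st⁻¹]
    congr 1
    rw [← h1]
    conv_lhs => rw [← comp_one (ofComp μ), ← mul_inv_cancel f.st, ← comp_comp]
    rw [h1]
  simp only [Finset.mem_filter, Finset.mem_univ, true_and, h3]
  split_ifs
  · rw [mul_assoc]
  · rw [mul_zero]

theorem DMin.oi_eq_zero {m : ℕ} {μ ν : WComp k d} {g : SignedPerm d} (h : DMin μ g ν) :
    oi m (ofComp ν) ((ofComp μ).comp g) = 0 := by
  classical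
  rw [oi, Finset.card_eq_zero, Finset.filter_eq_empty_iff]
  rintro ⟨x, y⟩ - ⟨h1, h2, -, h3⟩
  exact absurd h3 (not_lt.2 (h.le h2 h1.le))

open Classical in
-- Among the words in the expansion only that of g' can contribute. Its weight is 1, because it has
-- no inversions inside the blocks of ν.
theorem coef_dce {m : ℕ} {μ ν : WComp k d} {g g' : SignedPerm d} (h : DMin μ g ν)
    (h' : DMin μ g' ν) : Hecke.coef g' (doubleCosetElt m μ g ν) =
      if kappa μ g' ν = kappa μ g ν then 1 else 0 := by
  rw [dce_eq h, map_sum]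
  have h2 : ∀ f : Word k d, mat f (ofComp ν) = kappa μ g ν →
      Hecke.coef g' (wt m (ofComp ν) f • E m μ f) =
        if f = (ofComp μ).comp g' then 1 else 0 := fun f hf => by
    have hf' := hasContent_of_mat h hf
    rw [map_smul, coef_E hf' h'.1]
    simp only [eq_comp_of_st hf' h'.1]
    split_ifs with h1
    · rw [h1, wt, h'.oi_eq_zero, Nat.zero_div, pow_zero, smul_eq_mul, one_mul]
    · rw [smul_zero]
  rw [Finset.sum_congr rfl (fun e he => h2 e (Finset.mem_filter.1 he).2), Finset.sum_ite_eq']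
  simp only [Finset.mem_filter, Finset.mem_univ, true_and, kappa_eq]

end Word

theorem simple_mul_of_mem {m : ℕ} {μ : WComp k d} (y : xyIdeal m μ) (i : Fin d)
    (h : zblk μ (lo i) = zblk μ (hi i)) :
    Hecke.T (simpleRefl i) * y.1 = chi m (blk μ (hi i)) • y.1 := by
  obtain ⟨b, hb⟩ := exists_eq_mul y
  rw [← hb, ← mul_assoc, simple_mul_xy h, smul_mul_assoc]

variable {m n : ℕ}

open Classical in
/-- Multiplication by a nearly diagonal element, reduced to an identity of coefficients. -/
theorem e_mul_e {A B : Matrix (SymInt (m + n)) (SymInt (m + n)) ℕ} (hA : A ∈ Xi m n d)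
    (hB : B ∈ Xi m n d) (hBA : col B = row A) {c : Coef} (hc : Word.IsNearDiag m B c)
    {ι : Type*} (S : Finset ι) (a : ι → Coef)
    (M : ι → Matrix (SymInt (m + n)) (SymInt (m + n)) ℤ)
    (hM : ∀ t ∈ S, ∀ A' ∈ Xi m n d, toInt A' = M t → row A' = row B ∧ col A' = col A)
    (h : ∀ (f' u : Word (m + n) d), Monotone u.z →
      (∀ x y, u.z x = u.z y → x.1 ≤ y.1 → f'.z x ≤ f'.z y) → Word.mat f' u ∈ Xi m n d →
      (∑ f : Word (m + n) d with Word.mat f u = A ∧ Word.mat f' f = B,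
        Word.wt m u f * Word.wt m f f' * c ^ (Word.ni f f' / 2)) =
      ∑ t ∈ S with toInt (Word.mat f' u) = M t, a t) :
    e m n d (toInt B) * e m n d (toInt A) = ∑ t ∈ S, a t • e m n d (M t) := by
  obtain ⟨μ, gA, ν, sA, rfl⟩ := Word.exists_superRep hA
  obtain ⟨l, gB, μ', sB, rfl⟩ := Word.exists_superRep hB
  have e1 : μ' = μ := Subtype.ext (by rw [← Word.col_kappa l gB μ', hBA, Word.row_kappa])
  subst e1
  have dA := (Word.superRep_iff.1 sA).1
  have dB := (Word.superRep_iff.1 sB).1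
  have rB : RightEigen m μ' (doubleCosetElt m l gB μ') := fun i hi' => Word.sum_mul_simple sB hi'
  have hprod := Represents.mul (isPhi_iff.1 (isPhi_e sB)) (isPhi_iff.1 (isPhi_e sA))
    (Word.xy_mul_tail dA)
  -- Each e_M on the right is represented by a right eigenvector with coefficients 0 or 1 at the
  -- admissible representatives; for M outside of Ξ it is 0.
  have hex : ∀ t ∈ S, ∃ x : xyIdeal m l, Represents x ν (e m n d (M t)) ∧ RightEigen m ν x.1 ∧
      ∀ g, IsSuperRep m l g ν → Hecke.coef g x.1 = if toInt (kappa l g ν) = M t then 1 else 0 := by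
    intro t ht
    by_cases hX : ∃ A' ∈ Xi m n d, toInt A' = M t
    · obtain ⟨A', hA', hAt⟩ := hX
      obtain ⟨h1, h2⟩ := hM t ht A' hA' hAt
      obtain ⟨l', g, ν', s, rfl⟩ := Word.exists_superRep hA'
      rw [Word.row_kappa, Word.row_kappa] at h1
      rw [Word.col_kappa, Word.col_kappa] at h2
      obtain rfl : l' = l := Subtype.ext h1
      obtain rfl : ν' = ν := Subtype.ext h2
      rw [← hAt]
      refine ⟨dce m l' g ν', isPhi_iff.1 (isPhi_e s), fun i hi' => Word.sum_mul_simple s hi',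
        fun g' s' => ?_⟩
      rw [show (dce m l' g ν').1 = doubleCosetElt m l' g ν' from rfl,
        Word.coef_dce (Word.superRep_iff.1 s).1 (Word.superRep_iff.1 s').1]
      have : toInt (kappa l' g' ν') = toInt (kappa l' g ν') ↔ kappa l' g' ν' = kappa l' g ν' :=
        ⟨toInt_injective, congrArg _⟩
      simp only [this]
    · push Not at hX
      rw [e_eq_zero hX]
      refine ⟨0, Represents.zero, fun i _ => ?_, fun g s => ?_⟩
      · rw [Submodule.coe_zero, zero_mul, smul_zero]
      · rw [Submodule.coe_zero, map_zero, if_neg (hX _ (Word.kappa_mem_Xi s))]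
  choose! x hx1 hx2 hx3 using hex
  have hsum := Represents.sum (s := S) fun t ht => (hx1 t ht).smul (a t)
  refine hprod.unique ?_
  convert hsum using 1
  rw [← sub_eq_zero]
  -- The difference of both sides is an eigenvector on the left, as an element of the ideal of [xy],
  -- and on the right. So it suffices to compare coefficients.
  set y := MulOpposite.op (Word.tail m μ' gA ν) • dce m l gB μ' - ∑ t ∈ S, a t • x t with hy
  have hy1 : y.1 = doubleCosetElt m l gB μ' * Word.tail m μ' gA ν - ∑ t ∈ S, a t • (x t).1 := by
    rw [hy, Submodule.coe_sub, Submodule.coe_sum]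
    rfl
  apply Subtype.ext
  refine Word.eq_zero_of_eigen (m := m) (fun i hi' => simple_mul_of_mem y i hi') (ν := ν) ?_ ?_
  · intro i hi'
    rw [hy1, sub_mul, smul_sub, Finset.sum_mul, Finset.smul_sum]
    congr 1
    -- The eigenvalue equation holds for [xy] times the tail of A only, not for the tail itself. It
    -- passes to the product because what [xy] annihilates is also annihilated by the element of B.
    · rw [mul_assoc, ← mul_smul_comm, ← sub_eq_zero, ← mul_sub]
      apply rB.mul_eq_zero
      rw [mul_sub, ← mul_assoc, mul_smul_comm, Word.xy_mul_tail dA, Word.sum_mul_simple sA hi',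
        sub_self]
    · refine Finset.sum_congr rfl fun t ht => ?_
      rw [smul_mul_assoc, hx2 t ht i hi', smul_comm]
  · intro g s
    have dg := (Word.superRep_iff.1 s).1
    rw [hy1, map_sub, map_sum, Word.coef_dce_mul_tail dB dA hc dg.1]
    have h1 := h ((Word.ofComp l).comp g) (Word.ofComp ν) (zblk_mono ν) (fun _ _ => dg.le)
      (by rw [← Word.kappa_eq]; exact Word.kappa_mem_Xi s)
    rw [h1, Finset.sum_filter, sub_eq_zero]
    refine Finset.sum_congr rfl fun t ht => ?_
    rw [map_smul, hx3 t ht g s, Word.kappa_eq, smul_eq_mul, mul_ite, mul_one, mul_zero]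

end
end IotaSchur

namespace IotaSchur
noncomputable section
variable {k d : ℕ}

/-! ### Shifted matrices -/

theorem Etheta_apply (i j a c : SymInt k) : Etheta i j a c =
    (if i = a ∧ j = c then 1 else 0) + if -i = a ∧ -j = c then 1 else 0 := by
  rw [Etheta, Matrix.add_apply, Matrix.single_apply, Matrix.single_apply]

theorem neg_eq_iff_symInt {i j : SymInt k} : -i = j ↔ i = -j :=
  ⟨fun h => by rw [← h, SymInt.neg_neg'], fun h => by rw [h, SymInt.neg_neg']⟩

theorem shift_apply (A : Matrix (SymInt k) (SymInt k) ℕ) (p r : SymInt k) (t : SymInt k → ℕ)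
    (a c : SymInt k) : shift A p r t a c = A a c +
      t c * ((if p = a then 1 else 0) - if r = a then 1 else 0) +
      t (-c) * ((if -p = a then 1 else 0) - if -r = a then 1 else 0) := by
  have h : ∀ (s : SymInt k), ∑ i, (t i : ℤ) * Etheta s i a c =
      t c * (if s = a then 1 else 0) + t (-c) * if -s = a then 1 else 0 := fun s => by
    simp only [Etheta_apply, mul_add, Finset.sum_add_distrib, neg_eq_iff_symInt (j := c)]
    congr 1
    · rw [Finset.sum_eq_single c]
      · simp
      · intro i _ hi'; simp [hi']
      · simp
    · rw [Finset.sum_eq_single (-c)]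
      · simp
      · intro i _ hi'; simp [hi']
      · simp
  rw [shift, Matrix.add_apply, Matrix.sum_apply]
  simp only [Matrix.smul_apply, Matrix.sub_apply, smul_eq_mul, mul_sub, Finset.sum_sub_distrib]
  rw [h, h]
  change (A a c : ℤ) + _ = _
  ring

theorem sum_shift (A : Matrix (SymInt k) (SymInt k) ℕ) (p r : SymInt k) (t : SymInt k → ℕ)
    (a : SymInt k) : ∑ c, shift A p r t a c = ∑ c, (A a c : ℤ) + (∑ c, t c : ℕ) *
      ((if p = a then 1 else 0) - (if r = a then 1 else 0) +
        ((if -p = a then 1 else 0) - if -r = a then 1 else 0)) := by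
  have h : ∑ c, (t (-c) : ℤ) = ∑ c, (t c : ℤ) :=
    Fintype.sum_bijective (fun c => -c) ⟨fun a b h => by
      rw [← SymInt.neg_neg' a, ← SymInt.neg_neg' b]; exact congrArg _ h,
      fun c => ⟨-c, SymInt.neg_neg' c⟩⟩ _ _ fun _ => rfl
  simp only [shift_apply, Finset.sum_add_distrib, ← Finset.sum_mul]
  rw [h]
  push_cast
  ring

theorem sum_shift_col (A : Matrix (SymInt k) (SymInt k) ℕ) (p r : SymInt k) (t : SymInt k → ℕ)
    (c : SymInt k) : ∑ a, shift A p r t a c = ∑ a, (A a c : ℤ) := by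
  simp only [shift_apply, Finset.sum_add_distrib, ← Finset.mul_sum, Finset.sum_sub_distrib]
  simp

theorem nearDiag_apply {B : Matrix (SymInt k) (SymInt k) ℕ} {p r : SymInt k} {b : ℕ}
    (hB : (toInt B - (b : ℤ) • Etheta p r).IsDiag) {i j : SymInt k} (h : i ≠ j) :
    (B i j : ℤ) = b * ((if p = i ∧ r = j then 1 else 0) + if -p = i ∧ -r = j then 1 else 0) := by
  have : (toInt B - (b : ℤ) • Etheta p r) i j = 0 := hB h
  rw [Matrix.sub_apply, Matrix.smul_apply, Etheta_apply, smul_eq_mul, sub_eq_zero] at this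
  exact this

/-- The difference of row and column sums of a nearly diagonal matrix. -/
theorem sum_nearDiag {B : Matrix (SymInt k) (SymInt k) ℕ} {p r : SymInt k} {b : ℕ}
    (hB : (toInt B - (b : ℤ) • Etheta p r).IsDiag) (i : SymInt k) :
    ∑ j, (B i j : ℤ) = ∑ j, (B j i : ℤ) + b * ((if p = i then 1 else 0) -
      (if r = i then 1 else 0) + ((if -p = i then 1 else 0) - if -r = i then 1 else 0)) := by
  have h : ∀ j, (B i j : ℤ) - B j i = b * (Etheta p r i j - Etheta p r j i) := fun j => by
    by_cases hij : i = j
    · rw [hij]; ring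
    · rw [nearDiag_apply hB hij, nearDiag_apply hB (Ne.symm hij), Etheta_apply, Etheta_apply]
      ring
  rw [← sub_eq_iff_eq_add', ← Finset.sum_sub_distrib, Finset.sum_congr rfl fun j _ => h j,
    ← Finset.mul_sum, Finset.sum_sub_distrib]
  congr 1
  simp only [Etheta_apply, Finset.sum_add_distrib]
  have e1 : ∀ x y : SymInt k, (∑ j, if x = i ∧ y = j then (1 : ℤ) else 0) =
      if x = i then 1 else 0 := fun x y => by
    by_cases hx : x = i <;> simp [hx]
  have e2 : ∀ x y : SymInt k, (∑ j, if x = j ∧ y = i then (1 : ℤ) else 0) =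
      if y = i then 1 else 0 := fun x y => by
    by_cases hy : y = i <;> simp [hy]
  rw [e1, e1, e2, e2]
  ring

theorem toInt_apply (A : Matrix (SymInt k) (SymInt k) ℕ) (i j : SymInt k) :
    toInt A i j = (A i j : ℤ) := rfl

variable {m n : ℕ}

theorem exists_words {A : Matrix (SymInt (m + n)) (SymInt (m + n)) ℕ} (hA : A ∈ Xi m n d) :
    ∃ (μ ν : WComp (m + n) d) (f u : Word (m + n) d), Word.HasContent μ f ∧ Word.HasContent ν u ∧
      Word.mat f u = A := by
  obtain ⟨μ, g, ν, -, rfl⟩ := Word.exists_superRep hA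
  exact ⟨μ, ν, _, _, Word.hasContent_comp μ g, Word.hasContent_ofComp ν, (Word.kappa_eq _ _ _).symm⟩

theorem sum_mat_col (f u : Word k d) (j : SymInt k) : ∑ i, Word.mat f u i j = u.count j := by
  rw [← Word.sum_mat u f j, ← Word.mat_transpose]; rfl

theorem count_eq_iff {l l' : WComp k d} :
    (∀ i, (Word.ofComp l).count i = (Word.ofComp l').count i) ↔ l = l' := by
  refine ⟨fun h => Subtype.ext (funext fun i => ?_), fun h i => by rw [h]⟩
  have h1 := Word.count_ofComp l i
  rw [h, Word.count_ofComp] at h1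
  split_ifs at h1 <;> omega

theorem row_eq_iff {A B : Matrix (SymInt (m + n)) (SymInt (m + n)) ℕ} (hA : A ∈ Xi m n d)
    (hB : B ∈ Xi m n d) : row A = row B ↔ ∀ i, ∑ j, A i j = ∑ j, B i j := by
  obtain ⟨μ, ν, f, u, h1, h2, rfl⟩ := exists_words hA
  obtain ⟨μ', ν', f', u', h1', h2', rfl⟩ := exists_words hB
  simp only [h1.row, h1'.row, Word.sum_mat, h1.count, h1'.count, count_eq_iff]
  exact Subtype.ext_iff.symm

theorem col_eq_iff {A B : Matrix (SymInt (m + n)) (SymInt (m + n)) ℕ} (hA : A ∈ Xi m n d)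
    (hB : B ∈ Xi m n d) : col A = col B ↔ ∀ i, ∑ j, A j i = ∑ j, B j i := by
  obtain ⟨μ, ν, f, u, h1, h2, rfl⟩ := exists_words hA
  obtain ⟨μ', ν', f', u', h1', h2', rfl⟩ := exists_words hB
  simp only [h2.col, h2'.col, sum_mat_col, h2.count, h2'.count, count_eq_iff]
  exact Subtype.ext_iff.symm

theorem col_eq_row_iff {A B : Matrix (SymInt (m + n)) (SymInt (m + n)) ℕ} (hA : A ∈ Xi m n d)
    (hB : B ∈ Xi m n d) : col B = row A ↔ ∀ i, ∑ j, B j i = ∑ j, A i j := by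
  obtain ⟨μ, ν, f, u, h1, h2, rfl⟩ := exists_words hA
  obtain ⟨μ', ν', f', u', h1', h2', rfl⟩ := exists_words hB
  simp only [h2'.col, h1.row, sum_mat_col, Word.sum_mat, h2'.count, h1.count, count_eq_iff]
  exact Subtype.ext_iff.symm

/-- The shift moves b units from row r to row p and their negatives, which is also the difference
between the row and the column sums of B. Column sums do not change. -/
theorem row_col_of_shift {A B A' : Matrix (SymInt (m + n)) (SymInt (m + n)) ℕ} (hA : A ∈ Xi m n d)
    (hB : B ∈ Xi m n d) (hA' : A' ∈ Xi m n d) {p r : SymInt (m + n)} {b : ℕ}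
    (hBd : (toInt B - (b : ℤ) • Etheta p r).IsDiag) (hBA : col B = row A)
    {t : SymInt (m + n) → ℕ} (ht : ∑ i, t i = b) (h : toInt A' = shift A p r t) :
    row A' = row B ∧ col A' = col A := by
  rw [col_eq_row_iff hA hB] at hBA
  rw [row_eq_iff hA' hB, col_eq_iff hA' hA]
  refine ⟨fun i => ?_, fun i => ?_⟩
  · have h1 := sum_shift A p r t i
    rw [← h, ht] at h1
    have h2 := sum_nearDiag hBd i
    have h3 := hBA i
    zify at h3 ⊢
    rw [h2, h3]
    exact h1
  · have h1 := sum_shift_col A p r t i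
    rw [← h] at h1
    zify
    exact h1

namespace Word

/-! ### Changing letters -/

open Classical in
/-- The word `f'` with the letters at `T` changed to `r`, and those at `-T` to `-r`. -/
def change (f' : Word k d) (r : SymInt k) (T : Finset (SymInt d)) : Word k d :=
  ⟨fun x => if x ∈ T ∧ -x ∉ T then r else if -x ∈ T ∧ x ∉ T then -r else f'.1 x, fun x => by
    by_cases h1 : x ∈ T <;> by_cases h2 : -x ∈ T <;> simp [h1, h2, SymInt.neg_neg', f'.2]⟩

open Classical in
/-- The sets of positions with letter `p` that are disjoint from their negatives. -/
def halfSets (f' : Word k d) (p : SymInt k) : Finset (Finset (SymInt d)) :=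
  Finset.univ.filter fun T => (∀ x ∈ T, f'.1 x = p) ∧ ∀ x ∈ T, -x ∉ T

theorem mem_halfSets {f' : Word k d} {p : SymInt k} {T : Finset (SymInt d)} :
    T ∈ halfSets f' p ↔ (∀ x ∈ T, f'.1 x = p) ∧ ∀ x ∈ T, -x ∉ T := by
  simp [halfSets]

theorem change_cases {f' : Word k d} {p r : SymInt k} {T : Finset (SymInt d)}
    (hT : T ∈ halfSets f' p) (x : SymInt d) :
    (x ∈ T ∧ -x ∉ T ∧ f'.1 x = p ∧ (change f' r T).1 x = r) ∨
    (x ∉ T ∧ -x ∈ T ∧ f'.1 x = -p ∧ (change f' r T).1 x = -r) ∨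
    (x ∉ T ∧ -x ∉ T ∧ (change f' r T).1 x = f'.1 x) := by
  rw [mem_halfSets] at hT
  by_cases h1 : x ∈ T
  · have h2 := hT.2 x h1
    exact Or.inl ⟨h1, h2, hT.1 x h1, if_pos ⟨h1, h2⟩⟩
  · by_cases h2 : -x ∈ T
    · refine Or.inr (Or.inl ⟨h1, h2, ?_, ?_⟩)
      · rw [← hT.1 _ h2, f'.2, SymInt.neg_neg']
      · exact (if_neg (fun h => h1 h.1)).trans (if_pos ⟨h2, h1⟩)
    · exact Or.inr (Or.inr ⟨h1, h2, (if_neg (fun h => h1 h.1)).trans (if_neg fun h => h2 h.1)⟩)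

open Classical in
/-- The number of elements of `T` in the blocks of `u`. -/
def cnt (u : Word k d) (T : Finset (SymInt d)) (i : SymInt k) : ℕ := (T.filter fun x => u.1 x = i).card

theorem sum_cnt (u : Word k d) (T : Finset (SymInt d)) : ∑ i, cnt u T i = T.card := by
  classical
  exact (Finset.card_eq_sum_card_fiberwise fun x _ => Finset.mem_univ (u.1 x)).symm

theorem cnt_neg (u : Word k d) (T : Finset (SymInt d)) (c : SymInt k) :
    (Finset.univ.filter fun x => -x ∈ T ∧ u.1 x = c).card = cnt u T (-c) := by
  classical
  refine Finset.card_bij' (fun x _ => -x) (fun x _ => -x) ?_ ?_ ?_ ?_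
  · intro x hx
    simp only [Finset.mem_filter, Finset.mem_univ, true_and] at hx ⊢
    rw [u.2, hx.2]; exact ⟨hx.1, rfl⟩
  · intro x hx
    simp only [Finset.mem_filter, Finset.mem_univ, true_and] at hx ⊢
    rw [u.2, hx.2, SymInt.neg_neg', SymInt.neg_neg']; exact ⟨hx.1, rfl⟩
  · intro x _; exact SymInt.neg_neg' x
  · intro x _; exact SymInt.neg_neg' x

/-- Compare position by position: in the column of its u-letter, an element of T accounts for one
unit in row p instead of row r, and an element of -T for one in row -p instead of row -r. -/
theorem mat_change {f' : Word k d} {p r : SymInt k} {T : Finset (SymInt d)}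
    (hT : T ∈ halfSets f' p) (u : Word k d) :
    toInt (mat f' u) = shift (mat (change f' r T) u) p r (cnt u T) := by
  classical
  ext a c
  rw [shift_apply, toInt_apply, mat_apply, mat_apply, ← cnt_neg, cnt, ← Finset.filter_univ_mem T,
    Finset.filter_filter]
  simp only [Finset.filter_univ_mem]
  have h : ∀ (P : SymInt d → Prop) [DecidablePred P],
      (((Finset.univ.filter P).card : ℕ) : ℤ) = ∑ x, if P x then 1 else 0 := fun P _ => by
    rw [Finset.card_filter]; push_cast; rfl
  rw [h, h, h, h, Finset.sum_mul, Finset.sum_mul, ← Finset.sum_add_distrib,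
    ← Finset.sum_add_distrib]
  refine Finset.sum_congr rfl fun x _ => ?_
  by_cases hu : u.1 x = c
  · rcases change_cases (r := r) hT x with ⟨h1, h2, h3, h4⟩ | ⟨h1, h2, h3, h4⟩ | ⟨h1, h2, h4⟩
    · simp only [h1, h2, h3, h4, hu, and_true, if_true, if_false]; ring
    · simp only [h1, h2, h3, h4, hu, and_true, if_true, if_false]; ring
    · simp only [h1, h2, h4, hu, and_true, if_false]; ring
  · simp only [hu, and_false, if_false]; ring

theorem mem_change_iff {f' : Word k d} {p r : SymInt k} (hpr : p ≠ r) {T : Finset (SymInt d)}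
    (hT : T ∈ halfSets f' p) (x : SymInt d) :
    x ∈ T ↔ f'.1 x = p ∧ (change f' r T).1 x = r := by
  rcases change_cases (r := r) hT x with ⟨h1, h2, h3, h4⟩ | ⟨h1, h2, h3, h4⟩ | ⟨h1, h2, h4⟩
  · exact iff_of_true h1 ⟨h3, h4⟩
  · refine iff_of_false h1 ?_
    rintro ⟨h5, h6⟩
    rw [h3] at h5
    rw [h4] at h6
    have h5 := congrArg Subtype.val h5
    have h6 := congrArg Subtype.val h6
    rw [SymInt.val_neg] at h5 h6
    exact hpr (Subtype.ext (by omega))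
  · refine iff_of_false h1 ?_
    rintro ⟨h5, h6⟩
    exact hpr (by rw [← h5, ← h6, h4])

open Classical in
theorem mat_self (f : Word k d) (i j : SymInt k) (h : i ≠ j) : mat f f i j = 0 := by
  rw [mat_apply, Finset.card_eq_zero, Finset.filter_eq_empty_iff]
  rintro x - ⟨h1, h2⟩
  exact h (h1.symm.trans h2)

theorem mat_change_self {f' : Word k d} {p r : SymInt k} (hpr : p ≠ r) {T : Finset (SymInt d)}
    (hT : T ∈ halfSets f' p) : (toInt (mat f' (change f' r T)) -
      (T.card : ℤ) • Etheta p r).IsDiag := by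
  classical
  intro i j hij
  rw [mat_change (r := r) hT, Matrix.sub_apply, shift_apply, mat_self _ _ _ hij, Matrix.smul_apply,
    Etheta_apply, smul_eq_mul]
  have hc : ∀ j, cnt (change f' r T) T j = if r = j then T.card else 0 := fun j => by
    rw [cnt]
    split_ifs with h
    · rw [Finset.filter_true_of_mem]
      intro x hx
      rw [((mem_change_iff hpr hT x).1 hx).2, h]
    · rw [Finset.filter_false_of_mem, Finset.card_empty]
      intro x hx
      rw [((mem_change_iff hpr hT x).1 hx).2]
      exact h
  have key : ∀ p r : SymInt k, ((if r = j then T.card else 0 : ℕ) : ℤ) *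
      ((if p = i then 1 else 0) - if r = i then 1 else 0) =
        T.card * if p = i ∧ r = j then 1 else 0 := fun p r => by
    by_cases h1 : r = j
    · have h2 : r ≠ i := fun h => hij (h.symm.trans h1)
      simp [h1, hij.symm]
    · simp [h1]
  rw [hc, hc]
  simp only [← neg_eq_iff_symInt (i := r)]
  rw [key, key]
  push_cast
  ring

end Word
end
end IotaSchur

/-! ### Intermediate words as sets of positions -/

namespace IotaSchur
noncomputable section
variable {k d : ℕ}

namespace Word

open Classical in
/-- The positions with letters `p` in `f'` and `r` in `f`. -/
def letterSet (f' f : Word k d) (p r : SymInt k) : Finset (SymInt d) :=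
  Finset.univ.filter fun x => f'.1 x = p ∧ f.1 x = r

theorem mem_letterSet {f' f : Word k d} {p r : SymInt k} {x : SymInt d} :
    x ∈ letterSet f' f p r ↔ f'.1 x = p ∧ f.1 x = r := by simp [letterSet]

theorem letterSet_change {f' : Word k d} {p r : SymInt k} (hpr : p ≠ r) {T : Finset (SymInt d)}
    (hT : T ∈ halfSets f' p) : letterSet f' (change f' r T) p r = T := by
  ext x
  rw [mem_letterSet, ← mem_change_iff hpr hT]

theorem eq_neg_self_symInt {i : SymInt k} (h : i = -i) : i = 0 :=
  Subtype.ext (by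
    have := congrArg Subtype.val h
    rw [SymInt.val_neg] at this
    rw [SymInt.val_zero]; omega)

theorem letterSet_mem_halfSets {f' f : Word k d} {p r : SymInt k} (hpr : p ≠ r) :
    letterSet f' f p r ∈ halfSets f' p := by
  rw [mem_halfSets]
  refine ⟨fun x hx => (mem_letterSet.1 hx).1, fun x hx hx' => ?_⟩
  rw [mem_letterSet] at hx hx'
  rw [f'.2, f.2, hx.1, hx.2] at hx'
  exact hpr (by rw [eq_neg_self_symInt hx'.1.symm, eq_neg_self_symInt hx'.2.symm])

variable {B : Matrix (SymInt k) (SymInt k) ℕ} {p r : SymInt k} {b : ℕ}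

theorem apply_cases (hB : (toInt B - (b : ℤ) • Etheta p r).IsDiag) {f' f : Word k d}
    (h : mat f' f = B) (x : SymInt d) : f'.1 x = f.1 x ∨ (f'.1 x = p ∧ f.1 x = r) ∨
      (f'.1 x = -p ∧ f.1 x = -r) := by
  by_contra hc
  push Not at hc
  have h1 := nearDiag_apply hB hc.1
  rw [if_neg (fun h => hc.2.1 h.1.symm h.2.symm), if_neg (fun h => hc.2.2 h.1.symm h.2.symm),
    add_zero, mul_zero, ← h, mat_apply] at h1
  exact Finset.card_ne_zero_of_mem (a := x) (by simp) (Int.ofNat_eq_zero.1 h1)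

/-- Off the diagonal B is supported at (p, r) and (-p, -r). So f and f' differ only where they have
these letters, and f is recovered from f' and the set of positions. -/
theorem change_letterSet (hpr : p ≠ r) (hB : (toInt B - (b : ℤ) • Etheta p r).IsDiag)
    {f' f : Word k d} (h : mat f' f = B) : change f' r (letterSet f' f p r) = f := by
  refine Subtype.ext (funext fun x => ?_)
  rcases change_cases (r := r) (letterSet_mem_halfSets (f' := f') (f := f) hpr) x with
    ⟨h1, -, -, h4⟩ | ⟨-, h2, -, h4⟩ | ⟨h1, h2, h4⟩
  · rw [h4, (mem_letterSet.1 h1).2]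
  · rw [h4, ← (mem_letterSet.1 h2).2, f.2, SymInt.neg_neg']
  · rw [h4]
    rcases apply_cases hB h x with h5 | h5 | h5
    · exact h5
    · exact absurd (mem_letterSet.2 h5) h1
    · refine absurd (mem_letterSet.2 ?_) h2
      rw [f'.2, f.2, h5.1, h5.2, SymInt.neg_neg', SymInt.neg_neg']
      exact ⟨rfl, rfl⟩

theorem card_letterSet (hpr : p ≠ r) (hB : (toInt B - (b : ℤ) • Etheta p r).IsDiag)
    {f' f : Word k d} (h : mat f' f = B) : (letterSet f' f p r).card = b := by
  have h1 := nearDiag_apply hB hpr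
  rw [if_pos ⟨rfl, rfl⟩, if_neg, add_zero, mul_one, ← h, mat_apply] at h1
  · rw [letterSet, ← Int.ofNat_inj.1 h1]
  · rintro ⟨h2, h3⟩
    exact hpr (by rw [eq_neg_self_symInt h2.symm, eq_neg_self_symInt h3.symm])

theorem shift_injective {A A' : Matrix (SymInt k) (SymInt k) ℕ} {t : SymInt k → ℕ}
    (h : shift A p r t = shift A' p r t) : A = A' :=
  toInt_injective (add_right_cancel h)

/-- The off-diagonal entries are prescribed by b, and the column sums then fix the diagonal ones. -/
theorem mat_eq_of_nearDiag (hB : (toInt B - (b : ℤ) • Etheta p r).IsDiag) {f' f : Word k d}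
    (h : (toInt (mat f' f) - (b : ℤ) • Etheta p r).IsDiag) (hc : ∀ j, ∑ i, B i j = f.count j) :
    mat f' f = B := by
  have off : ∀ i j, i ≠ j → mat f' f i j = B i j := fun i j hij => by
    have h1 := nearDiag_apply hB hij
    rw [← nearDiag_apply h hij] at h1
    exact (Int.ofNat_inj.1 h1).symm
  ext i j
  by_cases hij : i = j
  · subst hij
    have h1 := hc i
    rw [← sum_mat_col f' f, ← Finset.add_sum_erase _ _ (Finset.mem_univ i),
      ← Finset.add_sum_erase _ (fun j => mat f' f j i) (Finset.mem_univ i),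
      Finset.sum_congr rfl fun j hj => off j i (Finset.ne_of_mem_erase hj)] at h1
    exact (Nat.add_right_cancel h1).symm
  · exact off i j hij

end Word

variable {m n : ℕ}

open Classical in
/-- Multiplication by a nearly diagonal element, as a sum over sets of positions. -/
theorem e_mul_e_shift {A B : Matrix (SymInt (m + n)) (SymInt (m + n)) ℕ} (hA : A ∈ Xi m n d)
    (hB : B ∈ Xi m n d) (hBA : col B = row A) {p r : SymInt (m + n)} (hpr : p ≠ r) {b : ℕ}
    (hBd : (toInt B - (b : ℤ) • Etheta p r).IsDiag) {c : Coef} (hc : Word.IsNearDiag m B c)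
    (P : (SymInt (m + n) → ℕ) → Prop) (a : (SymInt (m + n) → ℕ) → Coef)
    (hP : ∀ (f' u : Word (m + n) d), ∀ T ∈ Word.halfSets f' p,
      Word.mat (Word.change f' r T) u = A → P (Word.cnt u T))
    (h : ∀ (f' u : Word (m + n) d), Monotone u.z →
      (∀ x y, u.z x = u.z y → x.1 ≤ y.1 → f'.z x ≤ f'.z y) → Word.mat f' u ∈ Xi m n d →
      ∀ t : SymInt (m + n) → ℕ, P t → toInt (Word.mat f' u) = shift A p r t →
      (∑ T ∈ Word.halfSets f' p with Word.cnt u T = t,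
        Word.wt m u (Word.change f' r T) * Word.wt m (Word.change f' r T) f' *
          c ^ (Word.ni (Word.change f' r T) f' / 2)) = a t) :
    e m n d (toInt B) * e m n d (toInt A) =
      ∑ t ∈ tuples b P, a t • e m n d (shift A p r t) := by
  refine e_mul_e hA hB hBA hc (tuples b P) a (shift A p r) (fun t ht A' hA' h1 =>
    row_col_of_shift hA hB hA' hBd hBA (mem_tuples.1 ht).1 h1) fun f' u hu hf' hX => ?_
  have hsum : ∀ f : Word (m + n) d, Word.mat f u = A → ∀ j, ∑ i, B i j = f.count j := by
    intro f hf j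
    rw [← Word.sum_mat f u, hf]
    exact (col_eq_row_iff hA hB).1 hBA j
  -- The intermediate words are grouped by the tuple t of block counts of their sets of positions.
  rw [← Finset.sum_fiberwise_of_maps_to (t := {t ∈ tuples b P | toInt (Word.mat f' u) =
    shift A p r t}) (g := fun f => Word.cnt u (Word.letterSet f' f p r))]
  · refine Finset.sum_congr rfl fun t ht => ?_
    rw [Finset.mem_filter, mem_tuples] at ht
    rw [← h f' u hu hf' hX t ht.1.2 ht.2]
    refine Finset.sum_bij' (fun f _ => Word.letterSet f' f p r) (fun T _ => Word.change f' r T)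
      ?_ ?_ ?_ ?_ ?_
    · intro f hf
      simp only [Finset.mem_filter, Finset.mem_univ, true_and] at hf ⊢
      exact ⟨Word.letterSet_mem_halfSets hpr, hf.2⟩
    · intro T hT
      simp only [Finset.mem_filter, Finset.mem_univ, true_and] at hT ⊢
      rw [Word.letterSet_change hpr hT.1]
      have h1 := Word.mat_change (r := r) hT.1 u
      rw [ht.2, hT.2] at h1
      have h2 := (Word.shift_injective h1).symm
      refine ⟨⟨h2, Word.mat_eq_of_nearDiag hBd ?_ (hsum _ h2)⟩, hT.2⟩
      have h3 := Word.mat_change_self hpr hT.1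
      rwa [← Word.sum_cnt u T, hT.2, ht.1.1] at h3
    · intro f hf
      simp only [Finset.mem_filter, Finset.mem_univ, true_and] at hf
      exact Word.change_letterSet hpr hBd hf.1.2
    · intro T hT
      rw [Finset.mem_filter] at hT
      exact Word.letterSet_change hpr hT.1
    · intro f hf
      simp only [Finset.mem_filter, Finset.mem_univ, true_and] at hf
      rw [Word.change_letterSet hpr hBd hf.1.2]
  · intro f hf
    simp only [Finset.mem_filter, Finset.mem_univ, true_and] at hf
    have h1 := Word.letterSet_mem_halfSets (f' := f') (f := f) hpr
    have h2 := Word.change_letterSet hpr hBd hf.2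
    have h3 := Word.mat_change (r := r) h1 u
    rw [h2, hf.1] at h3
    rw [Finset.mem_filter, mem_tuples, Word.sum_cnt, Word.card_letterSet hpr hBd hf.2]
    exact ⟨⟨rfl, hP f' u _ h1 (by rw [h2, hf.1])⟩, h3⟩

end
end IotaSchur

namespace IotaSchur
noncomputable section
variable {k d : ℕ}

/-! ### Gaussian sums over subsets -/

theorem evalOne_qInt {p : Coef} (hp : evalOne p = 1) (a : ℕ) : evalOne (qInt p a) = a := by
  simp [qInt, map_sum, map_pow, hp]

theorem qFact_ne_zero {p : Coef} (hp : evalOne p = 1) (a : ℕ) : qFact p a ≠ 0 := by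
  refine Finset.prod_ne_zero_iff.2 fun i _ => ne_zero_of_evalOne ?_
  rw [evalOne_qInt hp]
  exact_mod_cast Nat.succ_ne_zero i

theorem cFact_ne_zero (a : ℕ) : cFact a ≠ 0 := by
  refine Finset.prod_ne_zero_iff.2 fun i _ => ne_zero_of_evalOne ?_
  rw [cInt, map_mul, evalOne_qInt evalOne_q, map_add, map_pow, evalOne_q, map_one]
  push_cast
  positivity

/-- The number of pairs `x < y` with `x ∈ X` and `y ∈ Y`. -/
def inv (X Y : Finset (SymInt d)) : ℕ := ∑ x ∈ X, ∑ y ∈ Y, if x < y then 1 else 0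

theorem inv_insert_left {a : SymInt d} {X : Finset (SymInt d)} (h : a ∉ X) (Y : Finset (SymInt d)) :
    inv (insert a X) Y = (Y.filter fun y => a < y).card + inv X Y := by
  rw [inv, Finset.sum_insert h, Finset.card_filter]; rfl

theorem inv_insert_right {b : SymInt d} (X : Finset (SymInt d)) {Y : Finset (SymInt d)} (h : b ∉ Y) :
    inv X (insert b Y) = (X.filter fun x => x < b).card + inv X Y := by
  rw [inv, Finset.card_filter]
  simp only [inv, Finset.sum_insert h, Finset.sum_add_distrib]

theorem inv_empty_left (Y : Finset (SymInt d)) : inv ∅ Y = 0 := rfl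

theorem inv_empty_right (X : Finset (SymInt d)) : inv X ∅ = 0 := by simp [inv]

/-- Split by the largest element M of Z. If M is not in T, it lies above every element of T and
gives the factor p^|T|; if it is in T, it gives nothing. This is the q-Pascal rule. -/
theorem gauss_sum (p : Coef) (Z : Finset (SymInt d)) (t s : ℕ) (hZ : Z.card = t + s) :
    (∑ T ∈ Z.powersetCard t, p ^ inv T (Z \ T)) * (qFact p t * qFact p s) = qFact p (t + s) := by
  induction Z using Finset.induction_on_max generalizing t s with
  | empty =>
    rw [Finset.card_empty] at hZ
    obtain rfl : t = 0 := by omega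
    obtain rfl : s = 0 := by omega
    simp [inv_empty_left, qFact]
  | insert M Z hM ih =>
    have hMZ : M ∉ Z := fun h => lt_irrefl _ (hM M h)
    rw [Finset.card_insert_of_notMem hMZ] at hZ
    rcases t with _ | t
    · simp [inv_empty_left, qFact]
    rcases s with _ | s
    · rw [show t + 1 = (insert M Z).card by rw [Finset.card_insert_of_notMem hMZ]; omega,
        Finset.powersetCard_self, Finset.sum_singleton, sdiff_self]
      simp [inv_empty_right, qFact]
    have h1 := ih (t + 1) s (by omega)
    have h2 := ih t (s + 1) (by omega)
    rw [Finset.powersetCard_succ_insert hMZ, Finset.sum_union, Finset.sum_image]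
    · have e1 : ∀ T ∈ Z.powersetCard (t + 1), p ^ inv T (insert M Z \ T) =
          p ^ (t + 1) * p ^ inv T (Z \ T) := fun T hT => by
        rw [Finset.mem_powersetCard] at hT
        have hMT : M ∉ T := fun h => hMZ (hT.1 h)
        rw [Finset.insert_sdiff_of_notMem _ hMT, inv_insert_right _ (fun h =>
          hMZ (Finset.mem_sdiff.1 h).1), Finset.filter_true_of_mem fun x hx => hM x (hT.1 hx), hT.2,
          pow_add]
      have e2 : ∀ T ∈ Z.powersetCard t, p ^ inv (insert M T) (insert M Z \ insert M T) =
          p ^ inv T (Z \ T) := fun T hT => by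
        rw [Finset.mem_powersetCard] at hT
        have hMT : M ∉ T := fun h => hMZ (hT.1 h)
        have e : insert M Z \ insert M T = Z \ T := by
          rw [Finset.insert_sdiff_insert, Finset.sdiff_insert_of_notMem hMZ]
        rw [e, inv_insert_left hMT, Finset.filter_false_of_mem, Finset.card_empty, zero_add]
        intro y hy
        exact not_lt.2 (hM y (Finset.mem_sdiff.1 hy).1).le
      rw [Finset.sum_congr rfl e1, Finset.sum_congr rfl e2, ← Finset.mul_sum,
        show t + 1 + (s + 1) = (t + (s + 1)) + 1 by omega, qFact_succ p (t + (s + 1)),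
        show t + (s + 1) + 1 = (t + 1) + (s + 1) by omega, qInt_add]
      rw [show t + 1 + s = t + (s + 1) by omega] at h1
      rw [qFact_succ p t, qFact_succ p s] at *
      linear_combination p ^ (t + 1) * qInt p (s + 1) * h1 + qInt p (t + 1) * h2
    · intro T hT T' hT' h
      rw [Finset.mem_coe, Finset.mem_powersetCard] at hT hT'
      have := congrArg (fun X => Finset.erase X M) h
      rwa [Finset.erase_insert fun h => hMZ (hT.1 h),
        Finset.erase_insert fun h => hMZ (hT'.1 h)] at this
    · rw [Finset.disjoint_left]
      intro T hT hT'
      rw [Finset.mem_powersetCard] at hT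
      obtain ⟨T', -, rfl⟩ := Finset.mem_image.1 hT'
      exact hMZ (hT.1 (Finset.mem_insert_self _ _))

theorem gauss_sum' (p : Coef) (Z : Finset (SymInt d)) (t s : ℕ) (hZ : Z.card = t + s) :
    (∑ T ∈ Z.powersetCard t, p ^ inv (Z \ T) T) * (qFact p t * qFact p s) = qFact p (t + s) := by
  rw [mul_comm (qFact p t), add_comm, ← gauss_sum p Z s t (by omega)]
  congr 1
  refine Finset.sum_bij' (fun T _ => Z \ T) (fun T _ => Z \ T) ?_ ?_ ?_ ?_ ?_
  · intro T hT
    rw [Finset.mem_powersetCard] at hT ⊢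
    exact ⟨Finset.sdiff_subset, by rw [Finset.card_sdiff_of_subset hT.1]; omega⟩
  · intro T hT
    rw [Finset.mem_powersetCard] at hT ⊢
    exact ⟨Finset.sdiff_subset, by rw [Finset.card_sdiff_of_subset hT.1]; omega⟩
  · intro T hT
    exact Finset.sdiff_sdiff_eq_self (Finset.mem_powersetCard.1 hT).1
  · intro T hT
    exact Finset.sdiff_sdiff_eq_self (Finset.mem_powersetCard.1 hT).1
  · intro T hT
    rw [Finset.sdiff_sdiff_eq_self (Finset.mem_powersetCard.1 hT).1]

theorem sum_inv_eq_qBinom {p : Coef} (hp : evalOne p = 1) (Z : Finset (SymInt d)) (t : ℕ) (ht : t ≤ Z.card) :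
    ∑ T ∈ Z.powersetCard t, p ^ inv T (Z \ T) = qBinom p Z.card t := by
  have h1 := gauss_sum p Z t (Z.card - t) (by omega)
  rw [show t + (Z.card - t) = Z.card by omega, ← qBinom_mul p ht] at h1
  exact mul_right_cancel₀ (mul_ne_zero (qFact_ne_zero hp _) (qFact_ne_zero hp _)) h1

theorem sum_inv_eq_qBinom' {p : Coef} (hp : evalOne p = 1) (Z : Finset (SymInt d)) (t : ℕ)
    (ht : t ≤ Z.card) : ∑ T ∈ Z.powersetCard t, p ^ inv (Z \ T) T = qBinom p Z.card t := by
  have h1 := gauss_sum' p Z t (Z.card - t) (by omega)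
  rw [show t + (Z.card - t) = Z.card by omega, ← qBinom_mul p ht] at h1
  exact mul_right_cancel₀ (mul_ne_zero (qFact_ne_zero hp _) (qFact_ne_zero hp _)) h1

/-- Choose P in Z and then R in the rest. The inner sum is a binomial that does not depend on P, and
the two binomials multiply to the trinomial. -/
theorem trinomial_sum {p : Coef} (hp : evalOne p = 1) (Z : Finset (SymInt d)) (a b c : ℕ)
    (hZ : Z.card = c + a + b) :
    ∑ P ∈ Z.powersetCard a, ∑ R ∈ (Z \ P).powersetCard b,
      p ^ (inv P (Z \ P) + inv ((Z \ P) \ R) R) =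
      exactDiv (qFact p (c + a + b)) (qFact p c * qFact p a * qFact p b) := by
  have h1 := qTrinom_mul p c a b
  have hc := qFact_ne_zero hp c
  have ha := qFact_ne_zero hp a
  have hb := qFact_ne_zero hp b
  refine mul_right_cancel₀ (mul_ne_zero (mul_ne_zero hc ha) hb) (Eq.trans ?_ h1.symm)
  have h2 : ∀ P ∈ Z.powersetCard a, (∑ R ∈ (Z \ P).powersetCard b,
      p ^ (inv P (Z \ P) + inv ((Z \ P) \ R) R)) * (qFact p b * qFact p c) =
      p ^ inv P (Z \ P) * qFact p (b + c) := fun P hP => by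
    rw [Finset.mem_powersetCard] at hP
    rw [← gauss_sum' p (Z \ P) b c (by rw [Finset.card_sdiff_of_subset hP.1]; omega)]
    simp only [pow_add, ← Finset.mul_sum]
    ring
  rw [show qFact p c * qFact p a * qFact p b = (qFact p b * qFact p c) * qFact p a by ring,
    ← mul_assoc, Finset.sum_mul, Finset.sum_congr rfl h2, ← Finset.sum_mul,
    show c + a + b = a + (b + c) by omega, ← gauss_sum p Z a (b + c) (by omega)]
  ring

/-- Sums over the subsets of a set that is cut into pieces. -/
theorem sum_powerset_fiber {α ι : Type*} [DecidableEq α] [Fintype ι] [DecidableEq ι] (Z : Finset α)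
    (κ : α → ι) (Q : ι → Finset α → Prop) [∀ i, DecidablePred (Q i)] (F : ι → Finset α → Coef) :
    ∑ T ∈ Z.powerset with ∀ i, Q i (T.filter fun x => κ x = i),
      ∏ i, F i (T.filter fun x => κ x = i) =
    ∏ i, ∑ T ∈ (Z.filter fun x => κ x = i).powerset with Q i T, F i T := by
  rw [Finset.prod_univ_sum]
  have key : ∀ g : ι → Finset α, g ∈ Fintype.piFinset (fun i =>
      (Z.filter fun x => κ x = i).powerset.filter (Q i)) → ∀ i,
      ((Finset.univ.biUnion g).filter fun x => κ x = i) = g i := fun g hg i => by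
    rw [Fintype.mem_piFinset] at hg
    have hg' : ∀ i, ∀ x ∈ g i, x ∈ Z ∧ κ x = i := fun i x hx => by
      have := (Finset.mem_filter.1 (hg i)).1
      exact Finset.mem_filter.1 (Finset.mem_powerset.1 this hx)
    ext x
    simp only [Finset.mem_filter, Finset.mem_biUnion, Finset.mem_univ, true_and]
    constructor
    · rintro ⟨⟨j, hj⟩, hx⟩
      rw [← hx, (hg' j x hj).2]
      exact hj
    · intro hx
      exact ⟨⟨i, hx⟩, (hg' i x hx).2⟩
  refine Finset.sum_bij' (fun T _ i => T.filter fun x => κ x = i) (fun g _ => Finset.univ.biUnion g)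
    ?_ ?_ ?_ ?_ ?_
  · intro T hT
    rw [Finset.mem_filter, Finset.mem_powerset] at hT
    rw [Fintype.mem_piFinset]
    intro i
    rw [Finset.mem_filter, Finset.mem_powerset]
    exact ⟨Finset.filter_subset_filter _ hT.1, hT.2 i⟩
  · intro g hg
    rw [Finset.mem_filter, Finset.mem_powerset]
    refine ⟨?_, fun i => ?_⟩
    · intro x hx
      obtain ⟨i, -, hi'⟩ := Finset.mem_biUnion.1 hx
      have := (Finset.mem_filter.1 (Fintype.mem_piFinset.1 hg i)).1
      exact (Finset.mem_filter.1 (Finset.mem_powerset.1 this hi')).1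
    · rw [key g hg]
      exact (Finset.mem_filter.1 (Fintype.mem_piFinset.1 hg i)).2
  · intro T hT
    ext x
    simp
  · intro g hg
    funext i
    exact key g hg i
  · intro T _; rfl

/-! ### The block of zero -/

/-- The interval `[-n..n]`. -/
def ball (d n : ℕ) : Finset (SymInt d) := Finset.univ.filter fun x => |x.1| ≤ n

theorem mem_ball {n : ℕ} {x : SymInt d} : x ∈ ball d n ↔ |x.1| ≤ n := by simp [ball]

theorem card_ball {n : ℕ} (h : n ≤ d) : (ball d n).card = 2 * n + 1 := by
  rw [ball, card_even_pred (fun x : SymInt d => |x.1| ≤ n) (fun x => by rw [SymInt.val_neg, abs_neg])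
    (by simp)]
  have := card_interval (d := d) (a := 0) h
  rw [Nat.sub_zero] at this
  conv_rhs => rw [← this]
  rw [add_comm]
  congr 3
  ext x
  simp only [Finset.mem_filter, Finset.mem_univ, true_and, Nat.cast_zero]
  refine and_congr_right fun hx => ?_
  rw [abs_of_pos hx]

/-- The pairs in `X` with negative sum. -/
def npair (X : Finset (SymInt d)) : ℕ :=
  ∑ x ∈ X, ∑ y ∈ X, if x < y ∧ x.1 + y.1 < 0 then 1 else 0

theorem npair_insert {a : SymInt d} {X : Finset (SymInt d)} (h : a ∉ X) :
    npair (insert a X) = (X.filter fun x => x.1 + a.1 < 0).card + npair X := by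
  rw [npair, Finset.sum_insert h, Finset.sum_insert h, if_neg (fun h => lt_irrefl _ h.1), zero_add]
  simp only [Finset.sum_insert h]
  rw [Finset.sum_add_distrib, ← add_assoc, ← Finset.sum_add_distrib, Finset.card_filter, npair]
  congr 1
  refine Finset.sum_congr rfl fun x hx => ?_
  have hne : x ≠ a := fun h' => h (h' ▸ hx)
  rcases lt_or_gt_of_ne hne with h1 | h1
  · simp only [h1, not_lt_of_gt h1, true_and, false_and, if_false, zero_add]
  · simp only [h1, not_lt_of_gt h1, true_and, false_and, if_false, add_zero, add_comm a.1]

/-- The elements of `Z` outside of `X ∪ -X`. -/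
def rest (Z X : Finset (SymInt d)) : Finset (SymInt d) := Z.filter fun y => y ∉ X ∧ -y ∉ X

/-- The subsets with `t` elements of `Z` that are disjoint from their negatives. -/
def halfs (Z : Finset (SymInt d)) (t : ℕ) : Finset (Finset (SymInt d)) :=
  Z.powerset.filter fun X => (∀ x ∈ X, -x ∉ X) ∧ X.card = t

theorem mem_halfs {Z X : Finset (SymInt d)} {t : ℕ} :
    X ∈ halfs Z t ↔ X ⊆ Z ∧ (∀ x ∈ X, -x ∉ X) ∧ X.card = t := by
  rw [halfs, Finset.mem_filter, Finset.mem_powerset]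

theorem card_rest {n t : ℕ} (h : n ≤ d) {X : Finset (SymInt d)} (hX : X ∈ halfs (ball d n) t) :
    (rest (ball d n) X).card + 2 * t = 2 * n + 1 := by
  rw [mem_halfs] at hX
  obtain ⟨h1, h2, h3⟩ := hX
  have hinj : Function.Injective fun x : SymInt d => -x := fun a b h => by
    rw [← SymInt.neg_neg' a, ← SymInt.neg_neg' b]; exact congrArg (fun x => -x) h
  let X' := X.image fun x : SymInt d => -x
  have hX' : ∀ x, x ∈ X' ↔ -x ∈ X := fun x => by
    simp only [X', Finset.mem_image]
    constructor
    · rintro ⟨y, hy, rfl⟩; rwa [SymInt.neg_neg']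
    · intro hx; exact ⟨-x, hx, SymInt.neg_neg' x⟩
  have e : ball d n = rest (ball d n) X ∪ (X ∪ X') := by
    ext x
    simp only [rest, Finset.mem_union, Finset.mem_filter, hX']
    constructor
    · intro hx; tauto
    · rintro (hx | hx | hx)
      · exact hx.1
      · exact h1 hx
      · have := h1 hx
        rw [mem_ball, SymInt.val_neg, abs_neg] at this
        exact mem_ball.2 this
  have hc := card_ball h
  rw [e, Finset.card_union_of_disjoint, Finset.card_union_of_disjoint, Finset.card_image_of_injective _ hinj] at hc
  · omega
  · rw [Finset.disjoint_left]
    intro x hx hx'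
    exact h2 x hx ((hX' x).1 hx')
  · rw [Finset.disjoint_left]
    intro x hx hx'
    simp only [rest, Finset.mem_filter] at hx
    rcases Finset.mem_union.1 hx' with h4 | h4
    · exact hx.2.1 h4
    · exact hx.2.2 ((hX' x).1 h4)

/-- The sum that the block of zero contributes. -/
def zeroSum (d n t : ℕ) : Coef :=
  ∑ X ∈ halfs (ball d n) t, (q : Coef) ^ (inv X (rest (ball d n) X) + npair X)

theorem zeroSum_zero (n : ℕ) : zeroSum d n 0 = 1 := by
  have : halfs (ball d n) 0 = {∅} := by
    ext X
    rw [mem_halfs, Finset.mem_singleton, Finset.card_eq_zero]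
    constructor
    · exact fun h => h.2.2
    · rintro rfl; simp
  rw [zeroSum, this, Finset.sum_singleton, inv_empty_left]
  simp [npair]

theorem zeroSum_zero_succ (t : ℕ) : zeroSum d 0 (t + 1) = 0 := by
  have : halfs (ball d 0) (t + 1) = ∅ := by
    rw [Finset.eq_empty_iff_forall_notMem]
    intro X hX
    rw [mem_halfs] at hX
    obtain ⟨x, hx⟩ : X.Nonempty := Finset.card_pos.1 (by omega)
    have h1 := mem_ball.1 (hX.1 hx)
    have h2 : x.1 = 0 := by simpa using h1
    have h3 : -x = x := Subtype.ext (by rw [SymInt.val_neg]; omega)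
    exact hX.2.1 x hx (by rwa [h3])
  rw [zeroSum, this, Finset.sum_empty]

/-- Split by the new elements ±M with M = n + 1. If M is in X, it lies above everything and has no
negative sum with an element of X: factor 1. If -M is in X, it lies below the 2n + 1 - 2t remaining
elements and has negative sum with the t others of X: exponent 2n + 1 - t. Otherwise both belong to
the rest, and M lies above all t + 1 elements of X. -/
theorem zeroSum_succ {n : ℕ} (h : n + 1 ≤ d) (t : ℕ) : zeroSum d (n + 1) (t + 1) =
    (1 + (q : Coef) ^ (2 * n + 1 - t)) * zeroSum d n t +
      (q : Coef) ^ (t + 1) * zeroSum d n (t + 1) := by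
  let M : SymInt d := SymInt.ofNat (n + 1) h
  have hM : M.1 = n + 1 := by simp [M]
  have hM' : (-M).1 = -(n + 1) := by rw [SymInt.val_neg, hM]
  have hMM : M ≠ -M := fun h => by have := congrArg Subtype.val h; omega
  have hball : ∀ x : SymInt d, x ∈ ball d (n + 1) ↔ x ∈ ball d n ∨ x = M ∨ x = -M := fun x => by
    rw [mem_ball, mem_ball, Subtype.ext_iff, Subtype.ext_iff, hM, hM', abs_le, abs_le]
    push_cast
    omega
  have hlt : ∀ x ∈ ball d n, -M < x ∧ x < M ∧ x ≠ M ∧ x ≠ -M ∧ x.1 + M.1 ≥ 0 ∧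
      x.1 + (-M).1 < 0 := fun x hx => by
    rw [mem_ball, abs_le] at hx
    have h1 : x.1 ≠ M.1 := by omega
    have h2 : x.1 ≠ (-M).1 := by omega
    refine ⟨?_, ?_, fun h => h1 (congrArg _ h), fun h => h2 (congrArg _ h), by omega, by omega⟩
    · show (-M).1 < x.1; omega
    · show x.1 < M.1; omega
  have hneg : ∀ x : SymInt d, -x = M ↔ x = -M := fun x => neg_eq_iff_symInt
  have hneg' : ∀ x : SymInt d, -x = -M ↔ x = M := fun x => by
    rw [neg_eq_iff_symInt, SymInt.neg_neg']
  have sub : ∀ X ⊆ ball d n, M ∉ X ∧ -M ∉ X := fun X hX =>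
    ⟨fun h => (hlt _ (hX h)).2.2.1 rfl, fun h => (hlt _ (hX h)).2.2.2.1 rfl⟩
  have subn : ∀ X ⊆ ball d n, ∀ x ∈ X, -x ≠ M ∧ -x ≠ -M := fun X hX x hx =>
    ⟨fun h => (hlt _ (hX hx)).2.2.2.1 ((hneg x).1 h), fun h => (hlt _ (hX hx)).2.2.1 ((hneg' x).1 h)⟩
  have p1 : ∀ X ∈ halfs (ball d n) t, M ∉ X ∧
      inv (insert M X) (rest (ball d (n + 1)) (insert M X)) + npair (insert M X) =
        inv X (rest (ball d n) X) + npair X := fun X hX => by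
    obtain ⟨h1, h2, h3⟩ := mem_halfs.1 hX
    have hs := sub X h1
    have e : rest (ball d (n + 1)) (insert M X) = rest (ball d n) X := by
      ext y
      simp only [rest, Finset.mem_filter, hball, Finset.mem_insert, not_or, hneg]
      constructor
      · rintro ⟨h4, h5, h6⟩; exact ⟨by tauto, h5.2, h6.2⟩
      · rintro ⟨h4, h5, h6⟩
        have := hlt y h4
        exact ⟨Or.inl h4, ⟨this.2.2.1, h5⟩, this.2.2.2.1, h6⟩
    refine ⟨hs.1, ?_⟩
    rw [e, inv_insert_left hs.1, npair_insert hs.1, Finset.filter_false_of_mem,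
      Finset.filter_false_of_mem]
    · simp
    · intro x hx; have := (hlt x (h1 hx)).2.2.2.2.1; omega
    · intro y hy
      exact not_lt_of_gt (hlt y (Finset.mem_filter.1 hy).1).2.1
  have p2 : ∀ X ∈ halfs (ball d n) t, -M ∉ X ∧
      inv (insert (-M) X) (rest (ball d (n + 1)) (insert (-M) X)) + npair (insert (-M) X) =
        (2 * n + 1 - t) + (inv X (rest (ball d n) X) + npair X) := fun X hX => by
    have hr := card_rest (by omega) hX
    obtain ⟨h1, h2, h3⟩ := mem_halfs.1 hX
    have hs := sub X h1
    have e : rest (ball d (n + 1)) (insert (-M) X) = rest (ball d n) X := by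
      ext y
      simp only [rest, Finset.mem_filter, hball, Finset.mem_insert, not_or, hneg']
      constructor
      · rintro ⟨h4, h5, h6⟩; exact ⟨by tauto, h5.2, h6.2⟩
      · rintro ⟨h4, h5, h6⟩
        have := hlt y h4
        exact ⟨Or.inl h4, ⟨this.2.2.2.1, h5⟩, this.2.2.1, h6⟩
    refine ⟨hs.2, ?_⟩
    rw [e, inv_insert_left hs.2, npair_insert hs.2, Finset.filter_true_of_mem,
      Finset.filter_true_of_mem]
    · omega
    · intro x hx; exact (hlt x (h1 hx)).2.2.2.2.2
    · intro y hy
      exact (hlt y (Finset.mem_filter.1 hy).1).1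
  have p3 : ∀ X ∈ halfs (ball d n) (t + 1),
      inv X (rest (ball d (n + 1)) X) = (t + 1) + inv X (rest (ball d n) X) := fun X hX => by
    obtain ⟨h1, h2, h3⟩ := mem_halfs.1 hX
    have hs := sub X h1
    have e : rest (ball d (n + 1)) X = insert M (insert (-M) (rest (ball d n) X)) := by
      ext y
      simp only [rest, Finset.mem_filter, hball, Finset.mem_insert]
      constructor
      · rintro ⟨h4, h5, h6⟩; tauto
      · rintro (rfl | rfl | h4)
        · exact ⟨Or.inr (Or.inl rfl), hs.1, hs.2⟩
        · exact ⟨Or.inr (Or.inr rfl), hs.2, by rw [SymInt.neg_neg']; exact hs.1⟩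
        · exact ⟨Or.inl h4.1, h4.2⟩
    have f1 : -M ∉ rest (ball d n) X := fun h => (hlt _ (Finset.mem_filter.1 h).1).2.2.2.1 rfl
    have f2 : M ∉ insert (-M) (rest (ball d n) X) := fun h => by
      rcases Finset.mem_insert.1 h with h | h
      · exact hMM h
      · exact (hlt _ (Finset.mem_filter.1 h).1).2.2.1 rfl
    rw [e, inv_insert_right _ f2, inv_insert_right _ f1, Finset.filter_true_of_mem,
      Finset.filter_false_of_mem, h3]
    · simp
    · intro x hx; exact not_lt_of_gt (hlt x (h1 hx)).1
    · intro x hx; exact (hlt x (h1 hx)).2.1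
  have hsub : ∀ X ⊆ ball d (n + 1), M ∉ X → -M ∉ X → X ⊆ ball d n := fun X hX h1 h2 x hx => by
    rcases (hball x).1 (hX hx) with h | rfl | rfl
    · exact h
    · exact absurd hx h1
    · exact absurd hx h2
  have q1 : ∑ X ∈ halfs (ball d (n + 1)) (t + 1) with M ∈ X,
      (q : Coef) ^ (inv X (rest (ball d (n + 1)) X) + npair X) = zeroSum d n t := by
    symm
    refine Finset.sum_bij' (fun X _ => insert M X) (fun X _ => X.erase M) ?_ ?_ ?_ ?_ ?_
    · intro X hX
      have := (p1 X hX).1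
      obtain ⟨h1, h2, h3⟩ := mem_halfs.1 hX
      rw [Finset.mem_filter, mem_halfs]
      refine ⟨⟨?_, ?_, by rw [Finset.card_insert_of_notMem this, h3]⟩, Finset.mem_insert_self _ _⟩
      · intro x hx
        rw [hball]
        rcases Finset.mem_insert.1 hx with h | h
        · exact Or.inr (Or.inl h)
        · exact Or.inl (h1 h)
      · intro x hx hx'
        rw [Finset.mem_insert] at hx hx'
        rcases hx with rfl | hx
        · rcases hx' with h | h
          · exact hMM h.symm
          · exact (sub X h1).2 h
        · rcases hx' with h | h
          · exact (subn X h1 x hx).1 h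
          · exact h2 x hx h
    · intro X hX
      rw [Finset.mem_filter, mem_halfs] at hX
      obtain ⟨⟨h1, h2, h3⟩, h4⟩ := hX
      rw [mem_halfs]
      refine ⟨hsub _ (fun x hx => h1 (Finset.mem_of_mem_erase hx)) (by simp)
        (fun h => h2 M h4 (Finset.mem_of_mem_erase h)),
        fun x hx hx' => h2 x (Finset.mem_of_mem_erase hx) (Finset.mem_of_mem_erase hx'), ?_⟩
      rw [Finset.card_erase_of_mem h4, h3]; rfl
    · intro X hX; exact Finset.erase_insert (p1 X hX).1
    · intro X hX; exact Finset.insert_erase (Finset.mem_filter.1 hX).2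
    · intro X hX; rw [(p1 X hX).2]
  have q2 : ∑ X ∈ halfs (ball d (n + 1)) (t + 1) with ¬ M ∈ X ∧ -M ∈ X,
      (q : Coef) ^ (inv X (rest (ball d (n + 1)) X) + npair X) =
        (q : Coef) ^ (2 * n + 1 - t) * zeroSum d n t := by
    symm
    rw [zeroSum, Finset.mul_sum]
    refine Finset.sum_bij' (fun X _ => insert (-M) X) (fun X _ => X.erase (-M)) ?_ ?_ ?_ ?_ ?_
    · intro X hX
      have := (p2 X hX).1
      obtain ⟨h1, h2, h3⟩ := mem_halfs.1 hX
      rw [Finset.mem_filter, mem_halfs]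
      refine ⟨⟨?_, ?_, by rw [Finset.card_insert_of_notMem this, h3]⟩, ?_,
        Finset.mem_insert_self _ _⟩
      · intro x hx
        rw [hball]
        rcases Finset.mem_insert.1 hx with h | h
        · exact Or.inr (Or.inr h)
        · exact Or.inl (h1 h)
      · intro x hx hx'
        rw [Finset.mem_insert] at hx hx'
        rcases hx with rfl | hx
        · rw [SymInt.neg_neg'] at hx'
          rcases hx' with h | h
          · exact hMM h
          · exact (sub X h1).1 h
        · rcases hx' with h | h
          · exact (subn X h1 x hx).2 h
          · exact h2 x hx h
      · intro h
        rcases Finset.mem_insert.1 h with h | h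
        · exact hMM h
        · exact (sub X h1).1 h
    · intro X hX
      rw [Finset.mem_filter, mem_halfs] at hX
      obtain ⟨⟨h1, h2, h3⟩, h4, h5⟩ := hX
      rw [mem_halfs]
      refine ⟨hsub _ (fun x hx => h1 (Finset.mem_of_mem_erase hx))
        (fun h => h4 (Finset.mem_of_mem_erase h)) (by simp),
        fun x hx hx' => h2 x (Finset.mem_of_mem_erase hx) (Finset.mem_of_mem_erase hx'), ?_⟩
      rw [Finset.card_erase_of_mem h5, h3]; rfl
    · intro X hX; exact Finset.erase_insert (p2 X hX).1
    · intro X hX; exact Finset.insert_erase (Finset.mem_filter.1 hX).2.2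
    · intro X hX; rw [(p2 X hX).2, ← pow_add]
  have q3 : ∑ X ∈ halfs (ball d (n + 1)) (t + 1) with ¬ M ∈ X ∧ ¬ -M ∈ X,
      (q : Coef) ^ (inv X (rest (ball d (n + 1)) X) + npair X) =
        (q : Coef) ^ (t + 1) * zeroSum d n (t + 1) := by
    have e : (halfs (ball d (n + 1)) (t + 1)).filter (fun X => ¬ M ∈ X ∧ ¬ -M ∈ X) =
        halfs (ball d n) (t + 1) := by
      ext X
      rw [Finset.mem_filter, mem_halfs, mem_halfs]
      constructor
      · rintro ⟨⟨h1, h2⟩, h3, h4⟩; exact ⟨hsub X h1 h3 h4, h2⟩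
      · rintro ⟨h1, h2⟩
        exact ⟨⟨fun x hx => (hball x).2 (Or.inl (h1 hx)), h2⟩, sub X h1⟩
    rw [e, zeroSum, Finset.mul_sum]
    refine Finset.sum_congr rfl fun X hX => ?_
    rw [p3 X hX, add_assoc, pow_add]
  rw [zeroSum, ← Finset.sum_filter_add_sum_filter_not _ (fun X => M ∈ X), q1,
    ← Finset.sum_filter_add_sum_filter_not _ (fun X => -M ∈ X), Finset.filter_filter,
    Finset.filter_filter, q2, q3]
  ring

theorem zeroSum_of_lt {n : ℕ} (h : n ≤ d) {t : ℕ} (ht : n < t) : zeroSum d n t = 0 := by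
  induction n generalizing t with
  | zero =>
    obtain ⟨t, rfl⟩ : ∃ s, t = s + 1 := ⟨t - 1, by omega⟩
    exact zeroSum_zero_succ t
  | succ n ih =>
    obtain ⟨t, rfl⟩ : ∃ s, t = s + 1 := ⟨t - 1, by omega⟩
    rw [zeroSum_succ h, ih (by omega) (by omega), ih (by omega) (by omega), mul_zero, mul_zero,
      add_zero]

theorem cFact_succ (a : ℕ) : cFact (a + 1) = cFact a * cInt (a + 1) := Finset.prod_range_succ _ _

theorem cInt_mul (a : ℕ) : cInt a * ((q : Coef) - 1) = (q : Coef) ^ (2 * a) - 1 := by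
  rw [cInt]
  linear_combination ((q : Coef) ^ a + 1) * qInt_mul q a

/-- Specialization at v = 1 cannot detect this element, so the coefficients of v⁰ are compared. -/
theorem q_sub_one_ne_zero : (q : Coef) - 1 ≠ 0 := by
  intro h
  have h1 : (q : Coef) = LaurentPolynomial.T 2 := by
    rw [q, Units.val_pow_eq_pow_val]
    change (LaurentPolynomial.T 1) ^ 2 = _
    rw [LaurentPolynomial.T_pow]; norm_num
  rw [h1, ← LaurentPolynomial.T_zero, sub_eq_zero] at h
  have := congrArg (fun f : Coef => f.coeff 0) h
  simp at this

/-- Induction on the radius with `zeroSum_succ`. If s = 0, the second term vanishes, because the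
smaller ball has no set of t + 1 positions that is disjoint from its negative. -/
theorem zeroSum_mul (t s : ℕ) (h : t + s ≤ d) :
    zeroSum d (t + s) t * (cFact s * qFact q t) = cFact (t + s) := by
  induction hN : t + s generalizing t s with
  | zero =>
    obtain rfl : t = 0 := by omega
    obtain rfl : s = 0 := by omega
    simp [zeroSum_zero, qFact]
  | succ N ih =>
    rcases t with _ | t
    · obtain rfl : s = N + 1 := by omega
      simp [zeroSum_zero, qFact]
    rw [zeroSum_succ (by omega), qFact_succ, cFact_succ]
    have h1 := ih t s (by omega) (by omega)
    have e3 := qInt_mul q (t + 1)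
    have e4 := cInt_mul (N + 1)
    rcases s with _ | s
    · obtain rfl : t = N := by omega
      rw [zeroSum_of_lt (t := t + 1) (by omega) (by omega), mul_zero, add_zero]
      have e : (1 + (q : Coef) ^ (2 * t + 1 - t)) * qInt q (t + 1) = cInt (t + 1) := by
        rw [cInt, show 2 * t + 1 - t = t + 1 by omega]; ring
      linear_combination (1 + (q : Coef) ^ (2 * t + 1 - t)) * qInt q (t + 1) * h1 + cFact t * e
    · have h2 := ih (t + 1) s (by omega) (by omega)
      rw [qFact_succ] at h2
      rw [cFact_succ] at h1 ⊢
      have e5 := cInt_mul (s + 1)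
      -- The recursion matches that of the factorials by this identity of quantum integers.
      -- Multiplied by q - 1, it becomes an identity of powers of q.
      have e : (1 + (q : Coef) ^ (2 * N + 1 - t)) * qInt q (t + 1) + q ^ (t + 1) * cInt (s + 1) =
          cInt (N + 1) := by
        refine mul_right_cancel₀ q_sub_one_ne_zero ?_
        obtain rfl : N = t + 1 + s := by omega
        rw [show 2 * (t + 1 + s) + 1 - t = t + 2 * s + 3 by omega]
        linear_combination (1 + (q : Coef) ^ (t + 2 * s + 3)) * e3 + (q : Coef) ^ (t + 1) * e5 - e4
      linear_combination (1 + (q : Coef) ^ (2 * N + 1 - t)) * qInt q (t + 1) * h1 +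
        (q : Coef) ^ (t + 1) * cInt (s + 1) * h2 + cFact N * e

theorem zeroSum_eq (t s : ℕ) (h : t + s ≤ d) :
    zeroSum d (s + t) t = exactDiv (cFact (s + t)) (cFact s * qFact q t) := by
  refine mul_right_cancel₀ (mul_ne_zero (cFact_ne_zero s) (qFact_ne_zero evalOne_q t)) ?_
  rw [cQuot_mul, add_comm, zeroSum_mul t s h]

end
end IotaSchur

namespace IotaSchur
noncomputable section
variable {k d : ℕ}

/-! ### Inversions between sets of positions -/

theorem isOddIdx_iff {m : ℕ} {i : SymInt k} : IsOddIdx m i ↔ (m : ℤ) < i.1 ∨ (m : ℤ) < -i.1 := lt_abs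

/-- The map (x, y) ↦ (-y, -x) preserves increasing pairs, and `R` is the disjoint union of `R'` and
its mirror image. This accounts for the halves in the exponents `oi / 2` and `ni / 2`. -/
theorem card_pairs_symm (R R' : SymInt d → SymInt d → Prop) [∀ x y, Decidable (R x y)]
    [∀ x y, Decidable (R' x y)] (h : ∀ x y, x.1 < y.1 → (R x y ↔ R' x y ∨ R' (-y) (-x)))
    (h' : ∀ x y, x.1 < y.1 → R' x y → ¬ R' (-y) (-x)) :
    (Finset.univ.filter fun p : SymInt d × SymInt d => p.1.1 < p.2.1 ∧ R p.1 p.2).card =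
      2 * (Finset.univ.filter fun p : SymInt d × SymInt d => p.1.1 < p.2.1 ∧ R' p.1 p.2).card := by
  have e : (Finset.univ.filter fun p : SymInt d × SymInt d => p.1.1 < p.2.1 ∧ R p.1 p.2) =
      (Finset.univ.filter fun p : SymInt d × SymInt d => p.1.1 < p.2.1 ∧ R' p.1 p.2) ∪
      (Finset.univ.filter fun p : SymInt d × SymInt d => p.1.1 < p.2.1 ∧ R' (-p.2) (-p.1)) := by
    ext ⟨x, y⟩
    simp only [Finset.mem_filter, Finset.mem_univ, true_and, Finset.mem_union, ← and_or_left]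
    exact and_congr_right (h x y)
  have e' : (Finset.univ.filter fun p : SymInt d × SymInt d =>
      p.1.1 < p.2.1 ∧ R' (-p.2) (-p.1)).card =
      (Finset.univ.filter fun p : SymInt d × SymInt d => p.1.1 < p.2.1 ∧ R' p.1 p.2).card := by
    refine Finset.card_bij' (fun p _ => (-p.2, -p.1)) (fun p _ => (-p.2, -p.1)) ?_ ?_ ?_ ?_
    · rintro ⟨x, y⟩ hp
      simp only [Finset.mem_filter, Finset.mem_univ, true_and, SymInt.val_neg] at hp ⊢
      exact ⟨by omega, hp.2⟩
    · rintro ⟨x, y⟩ hp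
      simp only [Finset.mem_filter, Finset.mem_univ, true_and, SymInt.val_neg,
        SymInt.neg_neg'] at hp ⊢
      exact ⟨by omega, hp.2⟩
    · rintro ⟨x, y⟩ _; simp only [SymInt.neg_neg']
    · rintro ⟨x, y⟩ _; simp only [SymInt.neg_neg']
  rw [e, Finset.card_union_of_disjoint, e', two_mul]
  rw [Finset.disjoint_left]
  rintro ⟨x, y⟩ h1 h2
  simp only [Finset.mem_filter, Finset.mem_univ, true_and] at h1 h2
  exact h' x y h1.1 h1.2 h2.2

theorem inv_eq_card (X Y : Finset (SymInt d)) : inv X Y =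
    (Finset.univ.filter fun p : SymInt d × SymInt d => p.1.1 < p.2.1 ∧ p.1 ∈ X ∧ p.2 ∈ Y).card := by
  have e : (Finset.univ.filter fun p : SymInt d × SymInt d => p.1.1 < p.2.1 ∧ p.1 ∈ X ∧ p.2 ∈ Y) =
      (X ×ˢ Y).filter fun p => p.1 < p.2 := by
    ext p
    simp only [Finset.mem_filter, Finset.mem_univ, true_and, Finset.mem_product, and_comm,
      Subtype.coe_lt_coe]
  rw [e, Finset.card_filter, Finset.sum_product]
  rfl

/-- The part of a set of positions in a block. -/
def part (u : SymInt d → SymInt k) (X : Finset (SymInt d)) (i : SymInt k) : Finset (SymInt d) :=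
  X.filter fun x => u x = i

theorem mem_part {u : SymInt d → SymInt k} {X : Finset (SymInt d)} {i : SymInt k} {x : SymInt d} :
    x ∈ part u X i ↔ x ∈ X ∧ u x = i := Finset.mem_filter

theorem sum_part (u : SymInt d → SymInt k) (X Y : Finset (SymInt d))
    (g : SymInt d → SymInt d → ℕ) :
    ∑ x ∈ X, ∑ y ∈ Y, g x y = ∑ i, ∑ j, ∑ x ∈ part u X i, ∑ y ∈ part u Y j, g x y := by
  have h : ∀ x, ∑ y ∈ Y, g x y = ∑ j, ∑ y ∈ part u Y j, g x y := fun x =>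
    (Finset.sum_fiberwise Y u (fun y => g x y)).symm
  rw [← Finset.sum_fiberwise X u (fun x => ∑ y ∈ Y, g x y)]
  simp_rw [h]
  exact Finset.sum_congr rfl fun i _ => Finset.sum_comm

theorem sum_sum_const_nat (X Y : Finset (SymInt d)) (g : SymInt d → SymInt d → ℕ)
    (h : ∀ x ∈ X, ∀ y ∈ Y, g x y = 1) : ∑ x ∈ X, ∑ y ∈ Y, g x y = X.card * Y.card := by
  rw [Finset.sum_congr rfl fun x hx => Finset.sum_congr rfl (h x hx)]
  simp

theorem sum_sum_zero (X Y : Finset (SymInt d)) (g : SymInt d → SymInt d → ℕ)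
    (h : ∀ x ∈ X, ∀ y ∈ Y, g x y = 0) : ∑ x ∈ X, ∑ y ∈ Y, g x y = 0 :=
  Finset.sum_eq_zero fun x hx => Finset.sum_eq_zero (h x hx)

/-- Blocks are ordered as their indices. So between different blocks either all pairs count or none
do, and only the inversions inside a block depend on the positions. -/
theorem inv_part {u : SymInt d → SymInt k} (hu : Monotone u) (X Y : Finset (SymInt d)) :
    inv X Y = ∑ i, inv (part u X i) (part u Y i) +
      ∑ i, ∑ j with i < j, (part u X i).card * (part u Y j).card := by
  rw [inv, sum_part u, ← Finset.sum_add_distrib]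
  refine Finset.sum_congr rfl fun i _ => ?_
  have e := Finset.sum_ite_eq Finset.univ i (fun j => inv (part u X i) (part u Y j))
  rw [if_pos (Finset.mem_univ i)] at e
  rw [Finset.sum_filter, ← e, ← Finset.sum_add_distrib]
  refine Finset.sum_congr rfl fun j _ => ?_
  rcases lt_trichotomy i j with h | h | h
  · rw [if_neg h.ne, if_pos h, zero_add]
    refine sum_sum_const_nat _ _ _ fun x hx y hy => if_pos ?_
    rw [mem_part] at hx hy
    by_contra hxy
    have := hu (not_lt.1 hxy)
    rw [hx.2, hy.2] at this
    exact not_lt_of_ge this h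
  · rw [if_pos h, if_neg h.not_lt, add_zero]; rfl
  · rw [if_neg h.ne', if_neg (not_lt_of_gt h), zero_add]
    refine sum_sum_zero _ _ _ fun x hx y hy => if_neg fun hxy => ?_
    rw [mem_part] at hx hy
    have := hu hxy.le
    rw [hx.2, hy.2] at this
    exact not_lt_of_ge this h

/-- The pairs with negative sum in a product. -/
def cross (X Y : Finset (SymInt d)) : ℕ := ∑ x ∈ X, ∑ y ∈ Y, if x.1 + y.1 < 0 then 1 else 0

theorem card_pairs_lt (X : Finset (SymInt d)) :
    ∑ x ∈ X, ∑ y ∈ X, (if x < y then 1 else 0) = X.card.choose 2 := by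
  induction X using Finset.induction_on_max with
  | empty => simp
  | insert M X hM ih =>
    have h : M ∉ X := fun h => lt_irrefl _ (hM M h)
    change inv _ _ = _
    rw [inv_insert_left h, inv_insert_right _ h, Finset.card_insert_of_notMem h,
      Finset.filter_true_of_mem hM, Finset.filter_false_of_mem, inv, ih, Nat.choose_succ_succ]
    · simp
    · intro y hy
      rcases Finset.mem_insert.1 hy with rfl | hy
      · exact lt_irrefl _
      · exact not_lt_of_gt (hM y hy)

/-- For x < y in blocks i and j, a negative sum is automatic if i < j < -i or i = j < 0, and
impossible if j > -i. The positions matter only for j = -i, which leaves opposite blocks and the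
central block. -/
theorem npair_part {u : SymInt d → SymInt k} (hu : Monotone u) (hn : ∀ x, u (-x) = -u x)
    (X : Finset (SymInt d)) :
    npair X = npair (part u X 0) + ∑ i with i < 0, cross (part u X i) (part u X (-i)) +
      (∑ i, ∑ j with i < j ∧ j < -i, (part u X j).card * (part u X i).card +
        ∑ i with i < 0, (part u X i).card.choose 2) := by
  have hlt : ∀ {i j : SymInt k} {x y}, x ∈ part u X i → y ∈ part u X j → i < j → x < y :=
    fun {i j x y} hx hy h => by
      rw [mem_part] at hx hy
      by_contra hxy
      have := hu (not_lt.1 hxy)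
      rw [hx.2, hy.2] at this
      exact not_lt_of_ge this h
  have hle : ∀ {i j : SymInt k} {x y}, x ∈ part u X i → y ∈ part u X j → i < -j →
      x.1 + y.1 < 0 := fun {i j x y} hx hy h => by
    rw [mem_part] at hx hy
    by_contra hxy
    have : -y ≤ x := by show (-y).1 ≤ x.1; rw [SymInt.val_neg]; omega
    have := hu this
    rw [hn, hx.2, hy.2] at this
    exact not_lt_of_ge this h
  have hge : ∀ {i j : SymInt k} {x y}, x ∈ part u X i → y ∈ part u X j → -j < i →
      ¬ x.1 + y.1 < 0 := fun {i j x y} hx hy h hxy => by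
    rw [mem_part] at hx hy
    have : x ≤ -y := by show x.1 ≤ (-y).1; rw [SymInt.val_neg]; omega
    have := hu this
    rw [hn, hx.2, hy.2] at this
    exact not_lt_of_ge this h
  have val : ∀ i j : SymInt k, (i < j ↔ i.1 < j.1) ∧ (i = j ↔ i.1 = j.1) ∧ (i < -j ↔ i.1 < -j.1) ∧
      (-j < i ↔ -j.1 < i.1) ∧ (j = -i ↔ j.1 = -i.1) ∧ (i < 0 ↔ i.1 < 0) ∧ (i = 0 ↔ i.1 = 0) :=
    fun i j => ⟨Iff.rfl, Subtype.ext_iff, Iff.rfl, Iff.rfl, Subtype.ext_iff, Iff.rfl,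
      Subtype.ext_iff⟩
  have key : ∀ i j, (∑ x ∈ part u X i, ∑ y ∈ part u X j,
      if x < y ∧ x.1 + y.1 < 0 then 1 else 0) =
      ((if i = j then (if i = 0 then npair (part u X 0) else 0) else 0) +
      (if j = -i then (if i < 0 then cross (part u X i) (part u X (-i)) else 0) else 0)) +
      ((if i < j ∧ j < -i then (part u X j).card * (part u X i).card else 0) +
      (if i = j then (if i < 0 then (part u X i).card.choose 2 else 0) else 0)) := fun i j => by
    obtain ⟨v1, v2, v3, v4, v5, v6, v7⟩ := val i j
    have v8 : j < -i ↔ j.1 < -i.1 := Iff.rfl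
    rcases lt_trichotomy i j with h | h | h
    · have h' := v1.1 h
      rw [if_neg (show ¬ i = j from h.ne), zero_add, if_neg (show ¬ i = j from h.ne), add_zero]
      rcases lt_trichotomy j.1 (-i.1) with h1 | h1 | h1
      · rw [if_neg (fun h2 => by have := v5.1 h2; omega), if_pos ⟨h, v8.2 h1⟩, zero_add, mul_comm]
        exact sum_sum_const_nat _ _ _ fun x hx y hy =>
          if_pos ⟨hlt hx hy h, hle hx hy (v3.2 (by omega))⟩
      · rw [if_pos (v5.2 h1), if_neg (show ¬ (i < j ∧ j < -i) from fun h2 => by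
          have := v8.1 h2.2; omega), if_pos (v6.2 (by omega)), add_zero, ← v5.2 h1]
        refine Finset.sum_congr rfl fun x hx => Finset.sum_congr rfl fun y hy => ?_
        simp only [hlt hx hy h, true_and]
      · rw [if_neg (fun h2 => by have := v5.1 h2; omega),
          if_neg (fun h2 => by have := v8.1 h2.2; omega)]
        exact sum_sum_zero _ _ _ fun x hx y hy => if_neg fun h2 => hge hx hy (v4.2 (by omega)) h2.2
    · subst h
      rw [if_pos rfl, if_pos rfl, if_neg (show ¬ (i < i ∧ i < -i) from fun h => lt_irrefl _ h.1),
        zero_add]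
      rcases lt_trichotomy i.1 0 with h | h | h
      · rw [if_neg (fun h2 => by have := v7.1 h2; omega),
          if_neg (fun h2 => by have := v5.1 h2; omega), if_pos (v6.2 h), zero_add, zero_add,
          ← card_pairs_lt]
        refine Finset.sum_congr rfl fun x hx => Finset.sum_congr rfl fun y hy => ?_
        simp only [hle hx hy (v3.2 (by omega)), and_true]
      · obtain rfl : i = 0 := v7.2 h
        rw [if_pos rfl, if_neg (lt_irrefl (0 : SymInt k))]
        simp only [ite_self, add_zero]
        rfl
      · rw [if_neg (fun h2 => by have := v7.1 h2; omega),
          if_neg (fun h2 => by have := v5.1 h2; omega),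
          if_neg (fun h2 => by have := v6.1 h2; omega)]
        exact sum_sum_zero _ _ _ fun x hx y hy => if_neg fun h2 => hge hx hy (v4.2 (by omega)) h2.2
    · have h' : j.1 < i.1 := h
      rw [if_neg (show ¬ i = j from h.ne'), if_neg (show ¬ i = j from h.ne'),
        if_neg (show ¬ (i < j ∧ j < -i) from fun h2 => lt_asymm h h2.1)]
      have : (if j = -i then (if i < 0 then cross (part u X i) (part u X (-i)) else 0) else 0) = 0 := by
        split_ifs with h1 h2
        · have := v5.1 h1; have := v6.1 h2; omega
        · rfl
        · rfl
      rw [this]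
      refine sum_sum_zero _ _ _ fun x hx y hy => if_neg fun h2 => ?_
      exact lt_asymm h2.1 (hlt hy hx h)
  rw [npair, sum_part u]
  simp_rw [key]
  simp only [Finset.sum_add_distrib, Finset.sum_ite_eq, Finset.sum_ite_eq', Finset.mem_univ,
    if_true, ← Finset.sum_filter]

/-! ### Words that differ from another one in one letter -/

namespace Word

/-- The positions with a given letter. -/
def places (f : Word k d) (p : SymInt k) : Finset (SymInt d) :=
  Finset.univ.filter fun x => f.z x = p.1

theorem mem_places {f : Word k d} {p : SymInt k} {x : SymInt d} :
    x ∈ places f p ↔ f.z x = p.1 := by simp [places]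

theorem change_z {f' : Word k d} {p r : SymInt k} {T : Finset (SymInt d)}
    (hT : T ∈ halfSets f' p) (x : SymInt d) :
    (x ∈ T ∧ -x ∉ T ∧ f'.z x = p.1 ∧ (change f' r T).z x = r.1) ∨
    (x ∉ T ∧ -x ∈ T ∧ f'.z x = -p.1 ∧ (change f' r T).z x = -r.1) ∨
    (x ∉ T ∧ -x ∉ T ∧ (change f' r T).z x = f'.z x) := by
  rcases change_cases (r := r) hT x with ⟨h1, h2, h3, h4⟩ | ⟨h1, h2, h3, h4⟩ | ⟨h1, h2, h4⟩
  · exact Or.inl ⟨h1, h2, congrArg _ h3, congrArg _ h4⟩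
  · exact Or.inr (Or.inl ⟨h1, h2, congrArg _ h3, congrArg _ h4⟩)
  · exact Or.inr (Or.inr ⟨h1, h2, congrArg _ h4⟩)

section counts
variable {m : ℕ} {f' u : Word k d} {p r : SymInt k} {T : Finset (SymInt d)}

open Classical in
-- The letter r of the changed word stands at the old places of r and at T, where f' has the smaller
-- letter p. The inversions are the pairs with an old r before an element of T; the mirror images
-- belong to -r.
theorem oi_change_up (hT : T ∈ halfSets f' p) (hp : 0 ≤ p.1) (hr : r.1 = p.1 + 1) :
    oi m (change f' r T) f' = 2 * if IsOddIdx m r then inv (places f' r) T else 0 := by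
  have := card_pairs_symm (fun x y => (change f' r T).z x = (change f' r T).z y ∧
    IsOddIdx m ((change f' r T).1 x) ∧ f'.z y < f'.z x)
    (fun x y => IsOddIdx m r ∧ x ∈ places f' r ∧ y ∈ T) (fun x y _ => ?_) (fun x y _ => ?_)
  · rw [oi, this]
    split_ifs with h
    · simp only [h, true_and, inv_eq_card]
    · simp [h]
  · simp only [isOddIdx_iff, mem_places, z_neg]
    have e : ((change f' r T).1 x).1 = (change f' r T).z x := rfl
    rw [e]
    rcases change_z (r := r) hT x with ⟨h1, h2, h3, h4⟩ | ⟨h1, h2, h3, h4⟩ | ⟨h1, h2, h4⟩ <;>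
    rcases change_z (r := r) hT y with ⟨g1, g2, g3, g4⟩ | ⟨g1, g2, g3, g4⟩ | ⟨g1, g2, g4⟩ <;>
    simp only [h2, h4, g1, g4, true_and, and_true, and_false, or_false, false_or, iff_false] <;> omega
  · simp only [mem_places, z_neg]
    rintro ⟨h1, h2, h3⟩ ⟨g1, g2, g3⟩
    have h4 := congrArg Subtype.val ((mem_halfSets.1 hT).1 y h3)
    have h5 : (f'.1 y).1 = f'.z y := rfl
    omega

open Classical in
theorem oi_change_down (hT : T ∈ halfSets f' p) (hr : 0 ≤ r.1) (hp : p.1 = r.1 + 1) :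
    oi m (change f' r T) f' = 2 * if IsOddIdx m r then inv T (places f' r) else 0 := by
  have := card_pairs_symm (fun x y => (change f' r T).z x = (change f' r T).z y ∧
    IsOddIdx m ((change f' r T).1 x) ∧ f'.z y < f'.z x)
    (fun x y => IsOddIdx m r ∧ x ∈ T ∧ y ∈ places f' r) (fun x y _ => ?_) (fun x y _ => ?_)
  · rw [oi, this]
    split_ifs with h
    · simp only [h, true_and, inv_eq_card]
    · simp [h]
  · simp only [isOddIdx_iff, mem_places, z_neg]
    have e : ((change f' r T).1 x).1 = (change f' r T).z x := rfl
    rw [e]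
    rcases change_z (r := r) hT x with ⟨h1, h2, h3, h4⟩ | ⟨h1, h2, h3, h4⟩ | ⟨h1, h2, h4⟩ <;>
    rcases change_z (r := r) hT y with ⟨g1, g2, g3, g4⟩ | ⟨g1, g2, g3, g4⟩ | ⟨g1, g2, g4⟩ <;>
    simp only [h1, h4, g2, g4, true_and, false_and, and_false, or_false, false_or, iff_false] <;> omega
  · simp only [mem_places, z_neg]
    rintro ⟨h1, h2, h3⟩ ⟨g1, g2, g3⟩
    have h4 := congrArg Subtype.val ((mem_halfSets.1 hT).1 x h2)
    have h5 : (f'.1 x).1 = f'.z x := rfl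
    omega

/-- Among the positions where f' has the letter p, those in T were raised, so an inversion is an
element of T before one that was kept. As p is positive, position 0 does not interfere. -/
theorem ni_change_up (hT : T ∈ halfSets f' p) (hp : 0 < p.1) (hr : r.1 = p.1 + 1) :
    ni (change f' r T) f' = 2 * inv T (places f' p \ T) := by
  classical
  have := card_pairs_symm (fun x y => y.1 ≠ 0 ∧ (change f' r T).z y < (change f' r T).z x ∧
    f'.z y = f'.z x) (fun x y => x ∈ T ∧ y ∈ places f' p \ T) (fun x y _ => ?_) (fun x y _ => ?_)
  · rw [ni, this, inv_eq_card]
  · have e : y.1 = 0 → f'.z y = 0 := fun h => by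
      have h1 := z_neg f' y
      rw [show -y = y from Subtype.ext (by rw [SymInt.val_neg]; omega)] at h1
      omega
    simp only [mem_places, z_neg, Finset.mem_sdiff]
    rcases change_z (r := r) hT x with ⟨h1, h2, h3, h4⟩ | ⟨h1, h2, h3, h4⟩ | ⟨h1, h2, h4⟩ <;>
    rcases change_z (r := r) hT y with ⟨g1, g2, g3, g4⟩ | ⟨g1, g2, g3, g4⟩ | ⟨g1, g2, g4⟩ <;>
    simp only [h1, h2, h4, g1, g2, g4, true_and, false_and, and_false, or_false, false_or,
      not_true, not_false_iff, and_true, iff_false] <;> omega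
  · simp only [mem_places, z_neg, Finset.mem_sdiff]
    rintro ⟨h1, h2, h3⟩ ⟨g1, g2, g3⟩
    have h4 := congrArg Subtype.val ((mem_halfSets.1 hT).1 x h1)
    have h5 : (f'.1 x).1 = f'.z x := rfl
    omega

theorem ni_change_down (hT : T ∈ halfSets f' p) (hr : 0 ≤ r.1) (hp : p.1 = r.1 + 1) :
    ni (change f' r T) f' = 2 * inv (places f' p \ T) T := by
  classical
  have := card_pairs_symm (fun x y => y.1 ≠ 0 ∧ (change f' r T).z y < (change f' r T).z x ∧
    f'.z y = f'.z x) (fun x y => x ∈ places f' p \ T ∧ y ∈ T) (fun x y _ => ?_) (fun x y _ => ?_)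
  · rw [ni, this, inv_eq_card]
  · have e : y.1 = 0 → f'.z y = 0 := fun h => by
      have h1 := z_neg f' y
      rw [show -y = y from Subtype.ext (by rw [SymInt.val_neg]; omega)] at h1
      omega
    simp only [mem_places, z_neg, Finset.mem_sdiff]
    rcases change_z (r := r) hT x with ⟨h1, h2, h3, h4⟩ | ⟨h1, h2, h3, h4⟩ | ⟨h1, h2, h4⟩ <;>
    rcases change_z (r := r) hT y with ⟨g1, g2, g3, g4⟩ | ⟨g1, g2, g3, g4⟩ | ⟨g1, g2, g4⟩ <;>
    simp only [h1, h2, h4, g1, g2, g4, and_false, or_false, false_or,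
      not_true, not_false_iff, and_true, iff_false] <;> omega
  · simp only [mem_places, z_neg, Finset.mem_sdiff]
    rintro ⟨⟨h1, h2⟩, h3⟩ ⟨⟨g1, g2⟩, g3⟩
    have h4 := congrArg Subtype.val ((mem_halfSets.1 hT).1 y h3)
    have h5 : (f'.1 y).1 = f'.z y := rfl
    omega

open Classical in
theorem sum_odd_inv (u : Word k d) (X Y : Finset (SymInt d)) :
    (Finset.univ.filter fun q : SymInt d × SymInt d => q.1.1 < q.2.1 ∧ u.z q.1 = u.z q.2 ∧
      IsOddIdx m (u.1 q.1) ∧ q.1 ∈ X ∧ q.2 ∈ Y).card =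
      ∑ i, if IsOddIdx m i then inv (part u.1 X i) (part u.1 Y i) else 0 := by
  rw [Finset.card_eq_sum_card_fiberwise (f := fun q => u.1 q.1) (t := Finset.univ)
    fun _ _ => Finset.mem_univ _]
  refine Finset.sum_congr rfl fun i _ => ?_
  split_ifs with h
  · rw [inv_eq_card, Finset.filter_filter]
    congr 1
    ext ⟨x, y⟩
    simp only [Finset.mem_filter, Finset.mem_univ, true_and, mem_part, z, ← Subtype.ext_iff]
    constructor
    · rintro ⟨⟨h1, h2, h3, h4, h5⟩, h6⟩
      exact ⟨h1, ⟨h4, h6⟩, h5, by rw [← h2, h6]⟩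
    · rintro ⟨h1, ⟨h2, h3⟩, h4, h5⟩
      exact ⟨⟨h1, by rw [h3, h5], by rwa [h3], h2, h4⟩, h3⟩
  · rw [Finset.card_eq_zero, Finset.filter_filter, Finset.filter_eq_empty_iff]
    rintro ⟨x, y⟩ - ⟨⟨h1, h2, h3, h4, h5⟩, h6⟩
    rw [h6] at h3
    exact h h3

open Classical in
-- Inside a block of u the word f' increases weakly, and a letter moves by one step only. So an
-- inversion needs equal letters p in f', with the left position raised and the right one kept, or
-- the mirror image of this.
theorem oi_self_change_up (hT : T ∈ halfSets f' p) (hp : 0 < p.1) (hr : r.1 = p.1 + 1)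
    (hf' : ∀ x y, u.z x = u.z y → x.1 ≤ y.1 → f'.z x ≤ f'.z y) :
    oi m u (change f' r T) = 2 * ∑ i, if IsOddIdx m i then
      inv (part u.1 T i) (part u.1 (places f' p \ T) i) else 0 := by
  have := card_pairs_symm (fun x y => u.z x = u.z y ∧ IsOddIdx m (u.1 x) ∧
    (change f' r T).z y < (change f' r T).z x) (fun x y => u.z x = u.z y ∧ IsOddIdx m (u.1 x) ∧
    x ∈ T ∧ y ∈ places f' p \ T) (fun x y hxy => ?_) (fun x y _ => ?_)
  · rw [oi, this, sum_odd_inv]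
  · by_cases hu : u.z x = u.z y
    · have h0 := hf' x y hu hxy.le
      simp only [mem_places, z_neg, Finset.mem_sdiff, isOddIdx_iff]
      have e : ((u.1 (-y))).1 = -u.z y := z_neg u y
      have e' : (u.1 x).1 = u.z x := rfl
      rw [e, e']
      rcases change_z (r := r) hT x with ⟨h1, h2, h3, h4⟩ | ⟨h1, h2, h3, h4⟩ | ⟨h1, h2, h4⟩ <;>
      rcases change_z (r := r) hT y with ⟨g1, g2, g3, g4⟩ | ⟨g1, g2, g3, g4⟩ | ⟨g1, g2, g4⟩ <;>
      simp only [h1, h2, h4, g1, g2, g4, true_and, false_and, and_false, or_false, false_or,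
        not_true, not_false_iff, and_true, iff_false] <;> omega
    · refine iff_of_false (fun h => hu h.1) ?_
      rintro (h | h)
      · exact hu h.1
      · have := h.1; rw [z_neg, z_neg] at this; omega
  · simp only [mem_places, z_neg, Finset.mem_sdiff]
    rintro ⟨-, -, h1, h2, h3⟩ ⟨-, -, g1, g2, g3⟩
    have h4 := congrArg Subtype.val ((mem_halfSets.1 hT).1 x h1)
    have h5 : (f'.1 x).1 = f'.z x := rfl
    omega

open Classical in
theorem oi_self_change_down (hT : T ∈ halfSets f' p) (hr : 0 ≤ r.1) (hp : p.1 = r.1 + 1)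
    (hf' : ∀ x y, u.z x = u.z y → x.1 ≤ y.1 → f'.z x ≤ f'.z y) :
    oi m u (change f' r T) = 2 * ∑ i, if IsOddIdx m i then
      inv (part u.1 (places f' p \ T) i) (part u.1 T i) else 0 := by
  have := card_pairs_symm (fun x y => u.z x = u.z y ∧ IsOddIdx m (u.1 x) ∧
    (change f' r T).z y < (change f' r T).z x) (fun x y => u.z x = u.z y ∧ IsOddIdx m (u.1 x) ∧
    x ∈ places f' p \ T ∧ y ∈ T) (fun x y hxy => ?_) (fun x y _ => ?_)
  · rw [oi, this, sum_odd_inv]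
  · by_cases hu : u.z x = u.z y
    · have h0 := hf' x y hu hxy.le
      simp only [mem_places, z_neg, Finset.mem_sdiff, isOddIdx_iff]
      have e : ((u.1 (-y))).1 = -u.z y := z_neg u y
      have e' : (u.1 x).1 = u.z x := rfl
      rw [e, e']
      rcases change_z (r := r) hT x with ⟨h1, h2, h3, h4⟩ | ⟨h1, h2, h3, h4⟩ | ⟨h1, h2, h4⟩ <;>
      rcases change_z (r := r) hT y with ⟨g1, g2, g3, g4⟩ | ⟨g1, g2, g3, g4⟩ | ⟨g1, g2, g4⟩ <;>
      simp only [h1, h2, h4, g1, g2, g4, and_false, or_false, false_or,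
        not_true, not_false_iff, and_true, iff_false] <;> omega
    · refine iff_of_false (fun h => hu h.1) ?_
      rintro (h | h)
      · exact hu h.1
      · have := h.1; rw [z_neg, z_neg] at this; omega
  · simp only [mem_places, z_neg, Finset.mem_sdiff]
    rintro ⟨-, -, ⟨h1, h2⟩, h3⟩ ⟨-, -, ⟨g1, g2⟩, g3⟩
    have h4 := congrArg Subtype.val ((mem_halfSets.1 hT).1 y h3)
    have h5 : (f'.1 y).1 = f'.z y := rfl
    omega

end counts
end Word
end
end IotaSchur

namespace IotaSchur
noncomputable section
variable {k d m : ℕ}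

/-! ### Powers of the parameters -/

open Classical in
theorem qDot_zpow {r : SymInt k} {E : ℤ} {N : ℕ} (h : IsOddIdx m r → E = N) :
    ((qDot m r ^ E : Coefˣ) : Coef) = oddBase ^ (if IsOddIdx m r then N else 0) := by
  by_cases ho : IsOddIdx m r
  · rw [h ho, zpow_natCast, Units.val_pow_eq_pow_val, if_pos ho, qDot, if_pos ho, oddBase]
    simp
  · rw [if_neg ho, qDot, if_neg ho, one_zpow, pow_zero, Units.val_one]

theorem qDDot_zpow {p : SymInt k} {E : ℤ} {N : ℕ} (h : E = N) :
    ((qDDot m p ^ E : Coefˣ) : Coef) = chi m p ^ N := by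
  rw [h, zpow_natCast, Units.val_pow_eq_pow_val, chi]

theorem evalOne_qPar (p : SymInt k) : evalOne (qPar m p : Coef) = 1 := by
  rw [qPar]
  split_ifs
  · exact evalOne_q_inv
  · exact evalOne_q

open Classical in
-- (-q⁻¹)(-1) = q⁻¹ in an odd block and 1 · q = q in an even one: inside a block, the weight of a
-- word and the eigenvalue combine to the base of the Gaussian binomial.
theorem oddBase_chi {i p : SymInt k} (h : IsOddIdx m i ↔ IsOddIdx m p) :
    (if IsOddIdx m i then oddBase else 1) * chi m p = qPar m p := by
  by_cases hp : IsOddIdx m p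
  · rw [if_pos (h.2 hp), chi_odd hp, qPar, if_pos hp, oddBase]
    simp
  · rw [if_neg (mt h.1 hp), chi_even hp, qPar, if_neg hp, one_mul]

namespace Word

variable {f' u : Word k d} {p r : SymInt k} {T : Finset (SymInt d)}

theorem mem_halfSets_iff (hp : p.1 ≠ 0) : T ∈ halfSets f' p ↔ T ⊆ places f' p := by
  rw [mem_halfSets]
  have h : ∀ x, f'.1 x = p ↔ x ∈ places f' p := fun x => by
    rw [mem_places, Subtype.ext_iff]; rfl
  simp only [h]
  refine ⟨fun h => h.1, fun h' => ⟨h', fun x hx hx' => ?_⟩⟩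
  have h1 := mem_places.1 (h' hx)
  have h2 := mem_places.1 (h' hx')
  rw [z_neg] at h2
  omega

theorem card_part_places (f u : Word k d) (i j : SymInt k) :
    (part u.1 (places f i) j).card = mat f u i j := by
  classical
  rw [mat_apply]
  congr 1
  ext x
  simp only [mem_part, mem_places, Finset.mem_filter, Finset.mem_univ, true_and, z,
    Subtype.ext_iff]

theorem part_sdiff (v : SymInt d → SymInt k) (X Y : Finset (SymInt d)) (i : SymInt k) :
    part v (X \ Y) i = part v X i \ part v Y i := by
  ext x
  simp only [mem_part, Finset.mem_sdiff]
  tauto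

theorem part_subset (v : SymInt d → SymInt k) {X Y : Finset (SymInt d)} (h : X ⊆ Y) (i : SymInt k) :
    part v X i ⊆ part v Y i := Finset.filter_subset_filter _ h

theorem cnt_eq_card (u : Word k d) (T : Finset (SymInt d)) (i : SymInt k) :
    cnt u T i = (part u.1 T i).card := by
  rw [cnt, part]

end Word

open Classical in
/-- The sum over the sets of positions with a given nonzero letter. -/
theorem sum_halfSets {m n : ℕ} {f' u : Word (m + n) d} {p : SymInt (m + n)} (hp : p.1 ≠ 0)
    (hX : Word.mat f' u ∈ Xi m n d) {a t : SymInt (m + n) → ℕ}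
    (ha : ∀ i, Word.mat f' u p i = a i + t i) {D : Finset (SymInt d) → Finset (SymInt d) → ℕ}
    (hD : ∀ {c : Coef}, evalOne c = 1 → ∀ (Z : Finset (SymInt d)) (s : ℕ), s ≤ Z.card →
      ∑ T ∈ Z.powersetCard s, c ^ D T (Z \ T) = qBinom c Z.card s)
    (hD₁ : ∀ S, D ∅ S = 0) (hD₂ : ∀ S, D S ∅ = 0) :
    ∑ T ∈ Word.halfSets f' p with Word.cnt u T = t,
      (oddBase ^ (∑ i, if IsOddIdx m i then
        D (part u.1 T i) (part u.1 (Word.places f' p \ T) i) else 0) *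
      chi m p ^ ∑ i, D (part u.1 T i) (part u.1 (Word.places f' p \ T) i)) =
    ∏ i, qBinom (qPar m p) (a i + t i) (t i) := by
  have hs : (Word.halfSets f' p).filter (fun T => Word.cnt u T = t) =
      (Word.places f' p).powerset.filter fun T => ∀ i, (T.filter fun x => u.1 x = i).card = t i := by
    ext T
    rw [Finset.mem_filter, Finset.mem_filter, Word.mem_halfSets_iff hp, Finset.mem_powerset]
    exact and_congr_right fun _ => funext_iff
  rw [hs]
  -- Both exponents are sums over the blocks of u, so the sum over T is a product of sums over the
  -- parts of T.
  have key := sum_powerset_fiber (Word.places f' p) u.1 (fun i T => T.card = t i) (fun i T =>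
    (if IsOddIdx m i then oddBase else 1) ^ D T (part u.1 (Word.places f' p) i \ T) *
      chi m p ^ D T (part u.1 (Word.places f' p) i \ T))
  refine Eq.trans (Finset.sum_congr rfl fun T _ => ?_) (key.trans (Finset.prod_congr rfl ?_))
  · rw [Finset.prod_mul_distrib, Finset.prod_pow_eq_pow_sum, ← Finset.prod_pow_eq_pow_sum]
    congr 1
    · refine Finset.prod_congr rfl fun i _ => ?_
      rw [Word.part_sdiff]
      split_ifs
      · rfl
      · rw [one_pow, pow_zero]
    · simp only [Word.part_sdiff]
      rfl
  · intro i _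
    have hZ : (part u.1 (Word.places f' p) i).card = a i + t i := by
      rw [Word.card_part_places, ha]
    rw [← hZ, ← hD (evalOne_qPar p) _ _ (by omega)]
    refine Finset.sum_congr ?_ fun T hT => ?_
    · ext T
      rw [Finset.mem_filter, Finset.mem_powerset, Finset.mem_powersetCard]
      rfl
    · rw [Finset.mem_powersetCard] at hT
      rw [← mul_pow]
      -- If block and letter have different parity, the block contains at most one position with
      -- letter p. Then there are no inversions and the base of the power is irrelevant.
      by_cases hpar : IsOddIdx m i ↔ IsOddIdx m p
      · rw [oddBase_chi hpar]
      · have h1 := hX.2.2 p i fun h => hpar h.symm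
        rw [← Word.card_part_places] at h1
        have h0 : D T (part u.1 (Word.places f' p) i \ T) = 0 := by
          rcases Finset.eq_empty_or_nonempty T with h | h
          · rw [h, hD₁]
          · have h2 := Finset.card_pos.2 h
            have h3 := Finset.card_le_card hT.1
            rw [Finset.eq_of_subset_of_card_le hT.1 (by omega), Finset.sdiff_self, hD₂]
        rw [h0, pow_zero, pow_zero]

theorem sum_sum_lt_comm (F : SymInt k → SymInt k → ℤ) :
    ∑ i, ∑ j with i < j, F i j = ∑ j, ∑ i with i < j, F i j :=
  Finset.sum_comm' fun x y => by simp

section main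
variable {m n : ℕ} {A : Matrix (SymInt (m + n)) (SymInt (m + n)) ℕ} {f' u : Word (m + n) d}
  {p r : SymInt (m + n)} {t : SymInt (m + n) → ℕ}

open Classical in
-- All exponents are split by the blocks of u. The parts between different blocks are constant on
-- the sum and form the two powers; the parts inside blocks are summed by `sum_halfSets`.
theorem sum_halfSets_up (hp : 0 < p.1) (hr : r.1 = p.1 + 1) (hu : Monotone u.z)
    (hf' : ∀ x y, u.z x = u.z y → x.1 ≤ y.1 → f'.z x ≤ f'.z y) (hX : Word.mat f' u ∈ Xi m n d)
    (h : toInt (Word.mat f' u) = shift A p r t) :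
    (∑ T ∈ Word.halfSets f' p with Word.cnt u T = t,
      Word.wt m u (Word.change f' r T) * Word.wt m (Word.change f' r T) f' *
        chi m p ^ (Word.ni (Word.change f' r T) f' / 2)) =
    ((qDot m r ^ (∑ k, ∑ j with j < k, ((A r j : ℤ) - t j) * t k) *
      qDDot m p ^ (∑ k, ∑ j with k < j, (A p j : ℤ) * t k) : Coefˣ) : Coef) *
      ∏ k, qBinom (qPar m p) (A p k + t k) (t k) := by
  have e1 : ∀ i, Word.mat f' u p i = A p i + t i := fun i => by
    have h1 := congrFun (congrFun h p) i
    rw [toInt_apply, shift_apply, if_pos rfl, if_neg (fun h => by rw [h] at hr; omega),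
      if_neg (fun h => by have := congrArg Subtype.val h; rw [SymInt.val_neg] at this; omega),
      if_neg (fun h => by have := congrArg Subtype.val h; rw [SymInt.val_neg] at this; omega)] at h1
    omega
  have e2 : ∀ i, (Word.mat f' u r i : ℤ) = A r i - t i := fun i => by
    have h1 := congrFun (congrFun h r) i
    rw [toInt_apply, shift_apply, if_pos rfl, if_neg (fun h => by rw [h] at hr; omega),
      if_neg (fun h => by have := congrArg Subtype.val h; rw [SymInt.val_neg] at this; omega),
      if_neg (fun h => by have := congrArg Subtype.val h; rw [SymInt.val_neg] at this; omega)] at h1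
    omega
  rw [← sum_halfSets hp.ne' hX e1 sum_inv_eq_qBinom inv_empty_left inv_empty_right,
    Finset.mul_sum]
  refine Finset.sum_congr rfl fun T hT => ?_
  rw [Finset.mem_filter] at hT
  obtain ⟨hT, hc⟩ := hT
  have ht : ∀ i, (part u.1 T i).card = t i := fun i => by rw [← hc, Word.cnt_eq_card]
  have hTs := (Word.mem_halfSets_iff hp.ne').1 hT
  have hS : ∀ i, (part u.1 (Word.places f' p \ T) i).card = A p i := fun i => by
    have h1 := e1 i
    rw [← Word.card_part_places] at h1
    rw [Word.part_sdiff, Finset.card_sdiff_of_subset (Word.part_subset u.1 hTs i), h1, ht]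
    omega
  have i1 := inv_part (show Monotone u.1 from hu) (Word.places f' r) T
  have i2 := inv_part (show Monotone u.1 from hu) T (Word.places f' p \ T)
  -- Inside a block of u the letters of f' increase, so the letter r = p + 1 never precedes an
  -- element of T.
  have i0 : ∀ i, inv (part u.1 (Word.places f' r) i) (part u.1 T i) = 0 := fun i =>
    sum_sum_zero _ _ _ fun x hx y hy => if_neg fun hxy => by
      rw [mem_part] at hx hy
      have h1 := Word.mem_places.1 hx.1
      have h2 := Word.mem_places.1 (hTs hy.1)
      have h3 := hf' x y (congrArg Subtype.val (hx.2.trans hy.2.symm)) (le_of_lt hxy)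
      omega
  simp only [i0, Finset.sum_const_zero, zero_add, ht, Word.card_part_places] at i1
  simp only [ht, hS] at i2
  rw [Units.val_mul, qDot_zpow (N := inv (Word.places f' r) T), qDDot_zpow
    (N := ∑ i, ∑ j with i < j, t i * A p j), Word.wt, Word.wt,
    Word.oi_self_change_up hT hp hr hf', Word.oi_change_up hT hp.le hr, Word.ni_change_up hT hp hr,
    Nat.mul_div_cancel_left _ two_pos, Nat.mul_div_cancel_left _ two_pos,
    Nat.mul_div_cancel_left _ two_pos, i2, pow_add]
  · ring
  · push_cast
    simp only [mul_comm]
  · intro _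
    rw [i1]
    push_cast
    rw [sum_sum_lt_comm]
    simp only [e2]

open Classical in
theorem sum_halfSets_down (hr : 0 ≤ r.1) (hp : p.1 = r.1 + 1) (hu : Monotone u.z)
    (hf' : ∀ x y, u.z x = u.z y → x.1 ≤ y.1 → f'.z x ≤ f'.z y) (hX : Word.mat f' u ∈ Xi m n d)
    (h : toInt (Word.mat f' u) = shift A p r t) :
    (∑ T ∈ Word.halfSets f' p with Word.cnt u T = t,
      Word.wt m u (Word.change f' r T) * Word.wt m (Word.change f' r T) f' *
        chi m p ^ (Word.ni (Word.change f' r T) f' / 2)) =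
    ((qDot m r ^ (∑ k, ∑ j with k < j, ((A r j : ℤ) - t j) * t k) *
      qDDot m p ^ (∑ k, ∑ j with j < k, (A p j : ℤ) * t k) : Coefˣ) : Coef) *
      ∏ k, qBinom (qPar m p) (A p k + t k) (t k) := by
  have e1 : ∀ i, Word.mat f' u p i = A p i + t i := fun i => by
    have h1 := congrFun (congrFun h p) i
    rw [toInt_apply, shift_apply, if_pos rfl, if_neg (fun h => by rw [h] at hp; omega),
      if_neg (fun h => by have := congrArg Subtype.val h; rw [SymInt.val_neg] at this; omega),
      if_neg (fun h => by have := congrArg Subtype.val h; rw [SymInt.val_neg] at this; omega)] at h1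
    omega
  -- For r = 0 the entry would also lose t_{-i}. The formula is needed for odd r only, since the
  -- corresponding parameter is 1 for even r, and an odd index is not zero.
  have e2 : IsOddIdx m r → ∀ i, (Word.mat f' u r i : ℤ) = A r i - t i := fun ho i => by
    rw [isOddIdx_iff] at ho
    have h1 := congrFun (congrFun h r) i
    rw [toInt_apply, shift_apply, if_pos rfl, if_neg (fun h => by rw [h] at hp; omega),
      if_neg (fun h => by have := congrArg Subtype.val h; rw [SymInt.val_neg] at this; omega),
      if_neg (fun h => by have := congrArg Subtype.val h; rw [SymInt.val_neg] at this; omega)] at h1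
    omega
  have hp0 : p.1 ≠ 0 := by omega
  rw [← sum_halfSets hp0 hX e1 (D := fun X Y => inv Y X) sum_inv_eq_qBinom' inv_empty_right
    inv_empty_left, Finset.mul_sum]
  refine Finset.sum_congr rfl fun T hT => ?_
  rw [Finset.mem_filter] at hT
  obtain ⟨hT, hc⟩ := hT
  have ht : ∀ i, (part u.1 T i).card = t i := fun i => by rw [← hc, Word.cnt_eq_card]
  have hTs := (Word.mem_halfSets_iff hp0).1 hT
  have hS : ∀ i, (part u.1 (Word.places f' p \ T) i).card = A p i := fun i => by
    have h1 := e1 i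
    rw [← Word.card_part_places] at h1
    rw [Word.part_sdiff, Finset.card_sdiff_of_subset (Word.part_subset u.1 hTs i), h1, ht]
    omega
  have i1 := inv_part (show Monotone u.1 from hu) T (Word.places f' r)
  have i2 := inv_part (show Monotone u.1 from hu) (Word.places f' p \ T) T
  have i0 : ∀ i, inv (part u.1 T i) (part u.1 (Word.places f' r) i) = 0 := fun i =>
    sum_sum_zero _ _ _ fun x hx y hy => if_neg fun hxy => by
      rw [mem_part] at hx hy
      have h1 := Word.mem_places.1 (hTs hx.1)
      have h2 := Word.mem_places.1 hy.1
      have h3 := hf' x y (congrArg Subtype.val (hx.2.trans hy.2.symm)) (le_of_lt hxy)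
      omega
  simp only [i0, Finset.sum_const_zero, zero_add, ht, Word.card_part_places] at i1
  simp only [ht, hS] at i2
  rw [Units.val_mul, qDot_zpow (N := inv T (Word.places f' r)), qDDot_zpow
    (N := ∑ i, ∑ j with i < j, A p i * t j), Word.wt, Word.wt,
    Word.oi_self_change_down hT hr hp hf', Word.oi_change_down hT hr hp,
    Word.ni_change_down hT hr hp, Nat.mul_div_cancel_left _ two_pos,
    Nat.mul_div_cancel_left _ two_pos, Nat.mul_div_cancel_left _ two_pos, i2, pow_add]
  · ring
  · push_cast
    rw [sum_sum_lt_comm]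
  · intro ho
    rw [i1]
    push_cast
    simp only [e2 ho, mul_comm]

end main
end
end IotaSchur

namespace IotaSchur
noncomputable section
variable {k d m : ℕ}

/-! ### Sums over symmetric intervals -/

theorem sum_symInt_split (φ : SymInt k → ℕ) :
    ∑ i, φ i = φ 0 + ∑ i with 0 < i, (φ i + φ (-i)) := by
  have h := sum_symInt (fun i => φ i + φ (-i)) fun i => by
    rw [SymInt.neg_neg', add_comm]
  have h2 : ∑ i : SymInt k, φ (-i) = ∑ i, φ i :=
    Finset.sum_bij' (fun i _ => -i) (fun i _ => -i) (by simp) (by simp)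
      (fun i _ => SymInt.neg_neg' i) (fun i _ => SymInt.neg_neg' i) fun i _ => rfl
  rw [Finset.sum_add_distrib, h2, neg_zero_symInt, smul_eq_mul] at h
  omega

theorem sum_symInt_neg (φ : SymInt k → ℕ) : ∑ i with i < 0, φ i = ∑ i with 0 < i, φ (-i) := by
  have h : ∀ i : SymInt k, (-i < 0 ↔ 0 < i) ∧ (0 < -i ↔ i < 0) := fun i => by
    constructor
    · show -i.1 < 0 ↔ 0 < i.1; omega
    · show 0 < -i.1 ↔ i.1 < 0; omega
  refine Finset.sum_bij' (fun i _ => -i) (fun i _ => -i) ?_ ?_ (fun i _ => SymInt.neg_neg' i)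
    (fun i _ => SymInt.neg_neg' i) fun i _ => by rw [SymInt.neg_neg']
  · intro i hi
    rw [Finset.mem_filter] at hi ⊢
    exact ⟨Finset.mem_univ _, (h i).2.2 hi.2⟩
  · intro i hi
    rw [Finset.mem_filter] at hi ⊢
    exact ⟨Finset.mem_univ _, (h i).1.2 hi.2⟩

theorem prod_symInt_nonneg (c : SymInt k → Coef) (h : ∀ i, i < 0 → c i = 1) :
    ∏ i, c i = c 0 * ∏ i with 0 < i, c i := by
  rw [← Finset.mul_prod_erase _ _ (Finset.mem_univ (0 : SymInt k))]
  congr 1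
  symm
  refine Finset.prod_subset ?_ ?_
  · intro i hi
    exact Finset.mem_erase.2 ⟨(Finset.mem_filter.1 hi).2.ne', Finset.mem_univ _⟩
  · intro i hi hi'
    refine h i (lt_of_le_of_ne (not_lt.1 fun h => hi' (Finset.mem_filter.2 ⟨Finset.mem_univ _, h⟩))
      (Finset.mem_erase.1 hi).1)

/-! ### The letter zero -/

namespace Word

variable {f' u : Word k d} {r : SymInt k} {T : Finset (SymInt d)}

/-- The pairs (x, -x) are exchanged for the pairs (x, 0), which satisfy the same condition. The
mirror map (x, y) ↦ (-y, -x) then has no fixed point among the pairs counted, as `card_pairs_symm`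
requires. -/
theorem ni_eq_card (f g : Word k d) : ni f g =
    (Finset.univ.filter fun p : SymInt d × SymInt d => p.1.1 < p.2.1 ∧
      (p.2 ≠ -p.1 ∧ f.z p.2 < f.z p.1 ∧ g.z p.2 = g.z p.1)).card := by
  have z0 : ∀ (f : Word k d) (x : SymInt d), x.1 = 0 → f.z x = 0 := fun f x h => by
    have h1 := z_neg f x
    rw [show -x = x from Subtype.ext (by rw [SymInt.val_neg]; omega)] at h1
    omega
  have ext : ∀ x y : SymInt d, x = y ↔ x.1 = y.1 := fun x y => Subtype.ext_iff
  refine Finset.card_bij' (fun p _ => if p.2 = -p.1 then (p.1, 0) else p)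
    (fun p _ => if p.2 = 0 then (p.1, -p.1) else p) ?_ ?_ ?_ ?_
  · rintro ⟨x, y⟩ h
    simp only [Finset.mem_filter, Finset.mem_univ, true_and] at h ⊢
    split_ifs with h1
    · subst h1
      have hf := z0 f 0 rfl
      have hg := z0 g 0 rfl
      simp only [z_neg, SymInt.val_neg, ne_eq, ext, SymInt.val_zero, hf, hg] at h ⊢
      omega
    · exact ⟨h.1, h1, h.2.2⟩
  · rintro ⟨x, y⟩ h
    simp only [Finset.mem_filter, Finset.mem_univ, true_and] at h ⊢
    split_ifs with h1
    · subst h1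
      have hf := z0 f 0 rfl
      have hg := z0 g 0 rfl
      simp only [z_neg, SymInt.val_neg, ne_eq, ext, SymInt.val_zero, hf, hg] at h ⊢
      omega
    · exact ⟨h.1, fun h2 => h1 (Subtype.ext h2), h.2.2⟩
  · rintro ⟨x, y⟩ h
    simp only [Finset.mem_filter, Finset.mem_univ, true_and] at h
    by_cases h1 : y = -x
    · simp only [h1, if_true]
    · have : y ≠ 0 := fun h2 => h.2.1 (congrArg Subtype.val h2)
      simp only [h1, if_false, this]
  · rintro ⟨x, y⟩ h
    simp only [Finset.mem_filter, Finset.mem_univ, true_and] at h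
    by_cases h1 : y = 0
    · simp only [h1, if_true]
    · simp only [h1, if_false, h.2.1]

theorem npair_eq_card (X : Finset (SymInt d)) : npair X =
    (Finset.univ.filter fun p : SymInt d × SymInt d =>
      p.1.1 < p.2.1 ∧ p.1 ∈ X ∧ -p.2 ∈ X ∧ p.1.1 < -p.2.1).card := by
  have h1 : npair X = ((X ×ˢ X).filter fun p => p.1 < p.2 ∧ p.1.1 + p.2.1 < 0).card := by
    rw [Finset.card_filter, Finset.sum_product]
    rfl
  rw [h1]
  refine Finset.card_bij' (fun p _ => (p.1, -p.2)) (fun p _ => (p.1, -p.2)) ?_ ?_ ?_ ?_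
  · rintro ⟨x, y⟩ h
    simp only [Finset.mem_filter, Finset.mem_univ, true_and, Finset.mem_product, SymInt.neg_neg',
      SymInt.val_neg, ← Subtype.coe_lt_coe] at h ⊢
    exact ⟨by omega, h.1.1, h.1.2, by omega⟩
  · rintro ⟨x, y⟩ h
    simp only [Finset.mem_filter, Finset.mem_univ, true_and, Finset.mem_product, SymInt.val_neg,
      ← Subtype.coe_lt_coe] at h ⊢
    exact ⟨⟨h.2.1, h.2.2.1⟩, by omega, by omega⟩
  · rintro ⟨x, y⟩ _; simp only [SymInt.neg_neg']
  · rintro ⟨x, y⟩ _; simp only [SymInt.neg_neg']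

theorem mem_rest {Z X : Finset (SymInt d)} {y : SymInt d} :
    y ∈ rest Z X ↔ y ∈ Z ∧ y ∉ X ∧ -y ∉ X := Finset.mem_filter

/-- On the places of 0 the changed word is r on T, -r on -T and 0 on the rest. Up to mirror images
an inversion is an element of T before one of the rest, or x in T before -y with y in T. The latter
means x + y < 0, and x < y selects one pair of each mirror couple. -/
theorem ni_change_zero (hT : T ∈ halfSets f' 0) (hr : r.1 = 1) :
    ni (change f' r T) f' = 2 * (inv T (rest (places f' 0) T) + npair T) := by
  have h1 := card_pairs_symm (fun x y => y ≠ -x ∧ (change f' r T).z y < (change f' r T).z x ∧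
    f'.z y = f'.z x) (fun x y => x ∈ T ∧ (y ∈ rest (places f' 0) T ∨ -y ∈ T ∧ x.1 < -y.1))
    (fun x y hxy => ?_) (fun x y hxy => ?_)
  · rw [ni_eq_card, h1, inv_eq_card, npair_eq_card, ← Finset.card_union_of_disjoint,
      ← Finset.filter_or]
    · simp only [← and_or_left]
    · rw [Finset.disjoint_left]
      rintro ⟨x, y⟩ h2 h3
      simp only [Finset.mem_filter, mem_rest] at h2 h3
      exact h2.2.2.2.2.2 h3.2.2.2.1
  · have ext : y = -x ↔ y.1 = -x.1 := Subtype.ext_iff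
    have hne : x ∈ T → -y ∉ T → ¬ y.1 = -x.1 := fun h1 h2 h3 => h2 (by
      rwa [ext.2 h3, SymInt.neg_neg'])
    have hne' : x ∉ T → -y ∈ T → ¬ y.1 = -x.1 := fun h1 h2 h3 => h1 (by
      rwa [ext.2 h3, SymInt.neg_neg'] at h2)
    simp only [mem_places, z_neg, mem_rest, ne_eq, ext, SymInt.neg_neg', SymInt.val_neg,
      SymInt.val_zero]
    rcases change_z (r := r) hT x with ⟨h1, h2, h3, h4⟩ | ⟨h1, h2, h3, h4⟩ | ⟨h1, h2, h4⟩ <;>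
    rcases change_z (r := r) hT y with ⟨g1, g2, g3, g4⟩ | ⟨g1, g2, g3, g4⟩ | ⟨g1, g2, g4⟩ <;>
    simp only [h1, h2, h4, g1, g2, g4, true_and, false_and, and_false, or_false, false_or,
      not_true, not_false_iff, and_true, iff_false] <;>
    simp only [h1, g2, not_true, not_false_iff, true_imp_iff, false_imp_iff] at hne hne' <;>
    (try simp only [SymInt.val_zero] at *) <;> omega
  · simp only [mem_rest, SymInt.neg_neg', SymInt.val_neg]
    rintro ⟨h2, h3⟩ ⟨h4, h5⟩
    rcases h3 with h3 | h3
    · exact h3.2.2 h4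
    · rcases h5 with h5 | h5
      · exact h5.2.2 h2
      · omega

theorem places_change_zero (hT : T ∈ halfSets f' 0) (hr : r.1 = 1) :
    places (change f' r T) 0 = rest (places f' 0) T := by
  ext x
  rw [mem_rest, mem_places, mem_places]
  rcases change_z (r := r) hT x with ⟨h1, h2, h3, h4⟩ | ⟨h1, h2, h3, h4⟩ | ⟨h1, h2, h4⟩
  · simp only [h1, h4, not_true, false_and, and_false, iff_false, SymInt.val_zero]; omega
  · simp only [h2, h4, not_true, and_false, iff_false, SymInt.val_zero]; omega
  · simp only [h1, h2, h4, not_false_iff, and_true]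

/-- An inversion would need two positions in one odd block of u with the letter 0 in f', but the
even letter 0 occurs there at most once. -/
theorem oi_self_change_zero {m n : ℕ} {f' u : Word (m + n) d} {r : SymInt (m + n)}
    (hT : T ∈ halfSets f' 0) (hr : r.1 = 1)
    (hf' : ∀ x y, u.z x = u.z y → x.1 ≤ y.1 → f'.z x ≤ f'.z y) (hX : mat f' u ∈ Xi m n d) :
    oi m u (change f' r T) = 0 := by
  classical
  rw [oi, Finset.card_eq_zero, Finset.filter_eq_empty_iff]
  rintro ⟨x, y⟩ - ⟨h1, h2, h3, h4⟩
  simp only at h1 h2 h3 h4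
  have h0 := hf' x y h2 h1.le
  have h5 : f'.z x = 0 ∧ f'.z y = 0 := by
    rcases change_z (r := r) hT x with ⟨h1, h2, h3, h4⟩ | ⟨h1, h2, h3, h4⟩ | ⟨h1, h2, h4⟩ <;>
    rcases change_z (r := r) hT y with ⟨g1, g2, g3, g4⟩ | ⟨g1, g2, g3, g4⟩ | ⟨g1, g2, g4⟩ <;>
    (try simp only [SymInt.val_zero] at *) <;> omega
  have h6 := hX.2.2 0 (u.1 x) fun h => by
    have := (h.2 h3)
    rw [isOddIdx_iff, SymInt.val_zero] at this
    omega
  rw [← card_part_places] at h6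
  have h7 : (part u.1 (places f' 0) (u.1 x)).card ≤ 1 := by omega
  rw [Finset.card_le_one] at h7
  have h8 := h7 x (mem_part.2 ⟨mem_places.2 h5.1, rfl⟩) y
    (mem_part.2 ⟨mem_places.2 h5.2, (Subtype.ext h2).symm⟩)
  rw [h8] at h1
  exact lt_irrefl _ h1

end Word

/-! ### The blocks of a pair of opposite indices -/

/-- The negatives of the elements of a set. -/
def nset (X : Finset (SymInt d)) : Finset (SymInt d) := X.image fun x => -x

theorem mem_nset {X : Finset (SymInt d)} {x : SymInt d} : x ∈ nset X ↔ -x ∈ X := by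
  rw [nset, Finset.mem_image]
  constructor
  · rintro ⟨y, hy, rfl⟩; rwa [SymInt.neg_neg']
  · intro h; exact ⟨-x, h, SymInt.neg_neg' x⟩

theorem nset_nset (X : Finset (SymInt d)) : nset (nset X) = X := by
  ext x; rw [mem_nset, mem_nset, SymInt.neg_neg']

theorem neg_symInt_injective : Function.Injective fun x : SymInt d => -x := fun a b h => by
  rw [← SymInt.neg_neg' a, ← SymInt.neg_neg' b]; exact congrArg (fun x => -x) h

theorem card_nset (X : Finset (SymInt d)) : (nset X).card = X.card :=
  Finset.card_image_of_injective _ neg_symInt_injective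

theorem sum_nset (X : Finset (SymInt d)) (g : SymInt d → ℕ) : ∑ x ∈ nset X, g x = ∑ x ∈ X, g (-x) :=
  Finset.sum_image fun _ _ _ _ h => neg_symInt_injective h

theorem inv_nset (X Y : Finset (SymInt d)) : inv (nset X) (nset Y) = inv Y X := by
  rw [inv, sum_nset, inv, Finset.sum_comm (s := Y)]
  simp only [sum_nset]
  refine Finset.sum_congr rfl fun y _ => Finset.sum_congr rfl fun x _ => ?_
  simp only [← Subtype.coe_lt_coe, SymInt.val_neg, neg_lt_neg_iff]

theorem cross_nset (X Y : Finset (SymInt d)) : cross (nset X) Y = inv Y X := by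
  rw [cross, sum_nset, inv, Finset.sum_comm]
  refine Finset.sum_congr rfl fun y _ => Finset.sum_congr rfl fun x _ => ?_
  simp only [← Subtype.coe_lt_coe, SymInt.val_neg, neg_add_lt_iff_lt_add, add_zero]

theorem inv_union_right (X : Finset (SymInt d)) {Y Z : Finset (SymInt d)} (h : Disjoint Y Z) :
    inv X (Y ∪ Z) = inv X Y + inv X Z := by
  simp only [inv, Finset.sum_union h, Finset.sum_add_distrib]

/-- Reflect the part of T in block -i into block i. Since T is disjoint from -T, it becomes a pair
of disjoint sets P and R in one block. The pairs with negative sum become the inversions between P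
and R, which complete the exponent of `trinomial_sum`. -/
theorem sum_pair_block {c : Coef} (hc : evalOne c = 1) {u : SymInt d → SymInt k}
    (hn : ∀ x, u (-x) = -u x) {Z : Finset (SymInt d)} (hZ : ∀ x, -x ∈ Z ↔ x ∈ Z) {i : SymInt k}
    (hi : 0 < i) {a b s : ℕ} (h : (part u Z i).card = s + a + b) :
    ∑ T ∈ (Z.filter fun x => u x = i ∨ u x = -i).powerset with (∀ x ∈ T, -x ∉ T) ∧
      (part u T i).card = a ∧ (part u T (-i)).card = b,
      c ^ (inv (part u T i) (part u (rest Z T) i) + inv (part u T (-i)) (part u (rest Z T) (-i)) +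
        cross (part u T (-i)) (part u T i)) =
    exactDiv (qFact c (s + a + b)) (qFact c s * qFact c a * qFact c b) := by
  have hne : i ≠ -i := fun h => by
    have h1 := congrArg Subtype.val h
    have h2 : 0 < i.1 := hi
    rw [SymInt.val_neg] at h1; omega
  have hnn : ∀ x, u (-x) = i ↔ u x = -i := fun x => by
    rw [hn, neg_eq_iff_symInt]
  have hnn' : ∀ x, u (-x) = -i ↔ u x = i := fun x => by
    rw [hn, neg_eq_iff_symInt, SymInt.neg_neg']
  rw [← trinomial_sum hc _ a b s h, Finset.sum_sigma']
  refine Finset.sum_bij' (fun T _ => ⟨part u T i, nset (part u T (-i))⟩)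
    (fun p _ => p.1 ∪ nset p.2) ?_ ?_ ?_ ?_ ?_
  · intro T hT
    simp only [Finset.mem_filter, Finset.mem_powerset] at hT
    obtain ⟨h1, h2, h3, h4⟩ := hT
    rw [Finset.mem_sigma, Finset.mem_powersetCard, Finset.mem_powersetCard, card_nset]
    refine ⟨⟨fun x hx => ?_, h3⟩, fun x hx => ?_, h4⟩
    · rw [mem_part] at hx ⊢
      exact ⟨(Finset.mem_filter.1 (h1 hx.1)).1, hx.2⟩
    · simp only [mem_nset, mem_part, Finset.mem_sdiff, hnn'] at hx ⊢
      refine ⟨⟨(hZ x).1 (Finset.mem_filter.1 (h1 hx.1)).1, hx.2⟩, fun h => h2 x h.1 hx.1⟩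
  · rintro ⟨P, R⟩ hp
    rw [Finset.mem_sigma, Finset.mem_powersetCard, Finset.mem_powersetCard] at hp
    obtain ⟨⟨h1, h2⟩, h3, h4⟩ := hp
    simp only at h1 h2 h3 h4
    have hP : ∀ x ∈ P, x ∈ Z ∧ u x = i := fun x hx => mem_part.1 (h1 hx)
    have hR : ∀ x ∈ R, (x ∈ Z ∧ u x = i) ∧ x ∉ P := fun x hx => by
      have := Finset.mem_sdiff.1 (h3 hx)
      exact ⟨mem_part.1 this.1, this.2⟩
    have e1 : part u (P ∪ nset R) i = P := by
      ext x
      rw [mem_part, Finset.mem_union, mem_nset]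
      constructor
      · rintro ⟨h | h, h'⟩
        · exact h
        · exact absurd (h'.symm.trans ((hnn x).1 (hR _ h).1.2)) hne
      · intro h; exact ⟨Or.inl h, (hP x h).2⟩
    have e2 : part u (P ∪ nset R) (-i) = nset R := by
      ext x
      rw [mem_part, Finset.mem_union, mem_nset]
      constructor
      · rintro ⟨h | h, h'⟩
        · exact absurd ((hP x h).2.symm.trans h') hne
        · exact h
      · intro h; exact ⟨Or.inr h, (hnn x).1 (hR _ h).1.2⟩
    simp only [Finset.mem_filter, Finset.mem_powerset]
    refine ⟨fun x hx => ?_, fun x hx hx' => ?_, by rw [e1, h2], by rw [e2, card_nset, h4]⟩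
    · rw [Finset.mem_filter]
      rcases Finset.mem_union.1 hx with h | h
      · exact ⟨(hP x h).1, Or.inl (hP x h).2⟩
      · have := hR _ (mem_nset.1 h)
        exact ⟨(hZ x).1 this.1.1, Or.inr ((hnn x).1 this.1.2)⟩
    · rw [Finset.mem_union, mem_nset] at hx hx'
      rw [SymInt.neg_neg'] at hx'
      rcases hx with h | h
      · rcases hx' with h' | h'
        · exact hne ((hP x h).2.symm.trans ((hnn x).1 (hP _ h').2))
        · exact (hR x h').2 h
      · rcases hx' with h' | h'
        · exact (hR _ h).2 h'
        · exact hne ((hR x h').1.2.symm.trans ((hnn x).1 (hR _ h).1.2))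
  · intro T hT
    simp only [Finset.mem_filter, Finset.mem_powerset] at hT
    simp only [nset_nset]
    ext x
    rw [Finset.mem_union, mem_part, mem_part]
    constructor
    · rintro (h | h) <;> exact h.1
    · intro h
      exact (Finset.mem_filter.1 (hT.1 h)).2.imp (fun h' => ⟨h, h'⟩) fun h' => ⟨h, h'⟩
  · rintro ⟨P, R⟩ hp
    rw [Finset.mem_sigma, Finset.mem_powersetCard, Finset.mem_powersetCard] at hp
    obtain ⟨⟨h1, h2⟩, h3, h4⟩ := hp
    simp only at h1 h2 h3 h4
    have hP : ∀ x ∈ P, x ∈ Z ∧ u x = i := fun x hx => mem_part.1 (h1 hx)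
    have hR : ∀ x ∈ R, (x ∈ Z ∧ u x = i) ∧ x ∉ P := fun x hx => by
      have := Finset.mem_sdiff.1 (h3 hx)
      exact ⟨mem_part.1 this.1, this.2⟩
    have e1 : part u (P ∪ nset R) i = P := by
      ext x
      rw [mem_part, Finset.mem_union, mem_nset]
      constructor
      · rintro ⟨h | h, h'⟩
        · exact h
        · exact absurd (h'.symm.trans ((hnn x).1 (hR _ h).1.2)) hne
      · intro h; exact ⟨Or.inl h, (hP x h).2⟩
    have e2 : part u (P ∪ nset R) (-i) = nset R := by
      ext x
      rw [mem_part, Finset.mem_union, mem_nset]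
      constructor
      · rintro ⟨h | h, h'⟩
        · exact absurd ((hP x h).2.symm.trans h') hne
        · exact h
      · intro h; exact ⟨Or.inr h, (hnn x).1 (hR _ h).1.2⟩
    simp only [e1, e2, nset_nset]
  · intro T hT
    simp only [Finset.mem_filter, Finset.mem_powerset] at hT
    obtain ⟨h1, h2, h3, h4⟩ := hT
    simp only
    set P := part u T i with hP
    set R := nset (part u T (-i)) with hR
    have hR' : part u T (-i) = nset R := by rw [hR, nset_nset]
    have hTP : ∀ x, u x = i → (x ∈ T ↔ x ∈ P) := fun x hx => by
      rw [hP, mem_part]; exact ⟨fun h => ⟨h, hx⟩, fun h => h.1⟩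
    have hTR : ∀ x, u x = i → (-x ∈ T ↔ x ∈ R) := fun x hx => by
      rw [hR, mem_nset, mem_part, hnn']; exact ⟨fun h => ⟨h, hx⟩, fun h => h.1⟩
    have hRZ : ∀ x ∈ R, x ∈ Z ∧ u x = i ∧ x ∉ P := fun x hx => by
      rw [hR, mem_nset, mem_part, hnn'] at hx
      refine ⟨(hZ x).1 (Finset.mem_filter.1 (h1 hx.1)).1, hx.2, fun h => ?_⟩
      exact h2 x (mem_part.1 h).1 hx.1
    have e1 : part u (rest Z T) i = (part u Z i \ P) \ R := by
      ext x
      rw [mem_part, Word.mem_rest, Finset.mem_sdiff, Finset.mem_sdiff, mem_part]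
      constructor
      · rintro ⟨⟨g1, g2, g3⟩, g4⟩
        exact ⟨⟨⟨g1, g4⟩, mt (hTP x g4).2 g2⟩, mt (hTR x g4).2 g3⟩
      · rintro ⟨⟨⟨g1, g2⟩, g3⟩, g4⟩
        exact ⟨⟨g1, mt (hTP x g2).1 g3, mt (hTR x g2).1 g4⟩, g2⟩
    have e2 : part u (rest Z T) (-i) = nset ((part u Z i \ P) \ R) := by
      ext x
      rw [← e1, mem_nset, mem_part, mem_part, hnn, Word.mem_rest, Word.mem_rest, hZ,
        SymInt.neg_neg', and_comm (a := -x ∉ T)]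
    have e3 : part u Z i \ P = ((part u Z i \ P) \ R) ∪ R := by
      rw [Finset.sdiff_union_of_subset]
      intro x hx
      rw [Finset.mem_sdiff, mem_part]
      have := hRZ x hx
      exact ⟨⟨this.1, this.2.1⟩, this.2.2⟩
    have e4 : inv P (part u Z i \ P) = inv P ((part u Z i \ P) \ R) + inv P R := by
      conv_lhs => rw [e3]
      exact inv_union_right _ Finset.sdiff_disjoint
    rw [e1, e2, hR', inv_nset, cross_nset, e4]
    congr 1
    ring

/-- A symmetric convex set of positions that contains zero is a ball. -/
theorem exists_eq_ball {Z : Finset (SymInt d)} (h0 : (0 : SymInt d) ∈ Z) 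
    (hc : ∀ x ∈ Z, ∀ y : SymInt d, |y.1| ≤ |x.1| → y ∈ Z) : ∃ N ≤ d, Z = ball d N := by
  obtain ⟨x, hx, hmax⟩ := Finset.exists_max_image Z (fun x => |x.1|) ⟨0, h0⟩
  refine ⟨x.1.natAbs, ?_, ?_⟩
  · have := x.2
    rw [Set.mem_Icc] at this
    omega
  · ext y
    rw [mem_ball, Int.natCast_natAbs]
    exact ⟨hmax y, hc x hx y⟩

section zero
variable {m n : ℕ} {A : Matrix (SymInt (m + n)) (SymInt (m + n)) ℕ} {f' u : Word (m + n) d}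
  {r : SymInt (m + n)} {t : SymInt (m + n) → ℕ}

/-- If x has letter zero in both words, then so does every y between -x and x: first for u by
monotonicity, then for f', which increases inside the block. -/
theorem exists_zero_block (hu : Monotone u.z)
    (hf' : ∀ x y, u.z x = u.z y → x.1 ≤ y.1 → f'.z x ≤ f'.z y) :
    ∃ N ≤ d, part u.1 (Word.places f' 0) 0 = ball d N := by
  have z0 : ∀ (f : Word (m + n) d), f.z 0 = 0 := fun f => by
    have h1 := f.z_neg 0
    rw [neg_zero_symInt] at h1
    omega
  have mem : ∀ x, x ∈ part u.1 (Word.places f' 0) 0 ↔ f'.z x = 0 ∧ u.z x = 0 := fun x => by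
    rw [mem_part, Word.mem_places, Subtype.ext_iff]; rfl
  refine exists_eq_ball ((mem 0).2 ⟨z0 f', z0 u⟩) fun x hx y hy => ?_
  · wlog hx0 : 0 ≤ x.1 generalizing x
    · refine this (-x) ?_ (by rwa [SymInt.val_neg, abs_neg]) (by rw [SymInt.val_neg]; omega)
      rw [mem] at hx ⊢
      rw [Word.z_neg, Word.z_neg]
      omega
    rw [mem] at hx ⊢
    rw [abs_of_nonneg hx0, abs_le] at hy
    have h1 := hu (show y ≤ x from hy.2)
    have h2 := hu (show -x ≤ y from by show (-x).1 ≤ y.1; rw [SymInt.val_neg]; omega)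
    rw [Word.z_neg] at h2
    have h3 := hf' y x (by omega) hy.2
    have h4 := hf' (-x) y (by rw [Word.z_neg]; omega) (by rw [SymInt.val_neg]; omega)
    rw [Word.z_neg] at h4
    omega

theorem sum_zero_block {N t₀ : ℕ} {u : SymInt d → SymInt k} {Z : Finset (SymInt d)}
    (h : part u Z 0 = ball d N) :
    ∑ T ∈ (part u Z 0).powerset with (∀ x ∈ T, -x ∉ T) ∧ (part u T 0).card = t₀,
      (q : Coef) ^ (inv (part u T 0) (part u (rest Z T) 0) + npair (part u T 0)) =
    zeroSum d N t₀ := by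
  have e : ∀ T ⊆ part u Z 0, part u T 0 = T := fun T hT => by
    rw [part, Finset.filter_true_of_mem]
    intro x hx
    exact (mem_part.1 (hT hx)).2
  rw [zeroSum]
  refine Finset.sum_congr ?_ fun T hT => ?_
  · ext T
    rw [mem_halfs, Finset.mem_filter, Finset.mem_powerset, ← h]
    refine and_congr_right fun hT => ?_
    rw [e T hT]
  · rw [mem_halfs, ← h] at hT
    rw [e T hT.1]
    congr 3
    rw [← h]
    ext x
    rw [mem_part, Word.mem_rest, Word.mem_rest, mem_part]
    tauto

/-- The nonnegative one of a pair of opposite indices. -/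
def absIdx (i : SymInt k) : SymInt k := if 0 ≤ i then i else -i

theorem absIdx_eq_iff {i j : SymInt k} (hj : 0 ≤ j) : absIdx i = j ↔ i = j ∨ i = -j := by
  have h1 : (0 : SymInt k) ≤ i ↔ 0 ≤ i.1 := Iff.rfl
  have h2 : 0 ≤ j.1 := hj
  rw [absIdx]
  split_ifs with h
  · rw [h1] at h
    rw [Subtype.ext_iff, Subtype.ext_iff, SymInt.val_neg]
    omega
  · rw [h1] at h
    rw [Subtype.ext_iff, Subtype.ext_iff, Subtype.ext_iff, SymInt.val_neg, SymInt.val_neg]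
    omega

theorem absIdx_nonneg (i : SymInt k) : 0 ≤ absIdx i := by
  rw [absIdx]
  split_ifs with h
  · exact h
  · have h1 : ¬ 0 ≤ i.1 := h
    show 0 ≤ (-i).1
    rw [SymInt.val_neg]
    omega

open Classical in
-- The condition that T is disjoint from -T couples only opposite blocks, so the sum factors over
-- the classes {i, -i}, indexed by i ≥ 0. The negative indices get the trivial factor 1.
theorem sum_halfSets_blocks {N : ℕ} {u : SymInt d → SymInt k}
    (hn : ∀ x, u (-x) = -u x) {Z : Finset (SymInt d)} (hZ : ∀ x, -x ∈ Z ↔ x ∈ Z)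
    (hN : part u Z 0 = ball d N) {a t : SymInt k → ℕ}
    (ha : ∀ i, (part u Z i).card = a i + t i + t (-i)) :
    ∑ T ∈ Z.powerset with (∀ x ∈ T, -x ∉ T) ∧ ∀ i, (part u T i).card = t i,
      (q : Coef) ^ (∑ i, inv (part u T i) (part u (rest Z T) i) + (npair (part u T 0) +
        ∑ i with i < 0, cross (part u T i) (part u T (-i)))) =
    zeroSum d N (t 0) * ∏ i with 0 < i, exactDiv (qFact q (a i + t i + t (-i)))
      (qFact q (a i) * qFact q (t i) * qFact q (t (-i))) := by
  let κ : SymInt d → SymInt k := fun x => absIdx (u x)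
  let Q : SymInt k → Finset (SymInt d) → Prop := fun i T => (∀ x ∈ T, -x ∉ T) ∧
    (0 ≤ i → (part u T i).card = t i ∧ (part u T (-i)).card = t (-i))
  let F : SymInt k → Finset (SymInt d) → Coef := fun i T =>
    if i = 0 then (q : Coef) ^ (inv (part u T 0) (part u (rest Z T) 0) + npair (part u T 0))
    else if 0 < i then (q : Coef) ^ (inv (part u T i) (part u (rest Z T) i) +
      inv (part u T (-i)) (part u (rest Z T) (-i)) + cross (part u T (-i)) (part u T i)) else 1
  have key := sum_powerset_fiber Z κ Q F
  have hκ : ∀ (X : Finset (SymInt d)) (i j : SymInt k), 0 ≤ i → (j = i ∨ j = -i) →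
      part u (X.filter fun x => κ x = i) j = part u X j := fun X i j hi hj => by
    ext x
    rw [mem_part, mem_part, Finset.mem_filter, and_assoc]
    refine and_congr_right fun _ => ⟨fun h => h.2, fun h => ⟨?_, h⟩⟩
    exact (absIdx_eq_iff hi).2 (by rwa [h])
  have hκr : ∀ (T : Finset (SymInt d)) (i j : SymInt k), 0 ≤ i → (j = i ∨ j = -i) →
      part u (rest Z (T.filter fun x => κ x = i)) j = part u (rest Z T) j :=
    fun T i j hi hj => by
    ext x
    rw [mem_part, mem_part, Word.mem_rest, Word.mem_rest, Finset.mem_filter, Finset.mem_filter]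
    refine and_congr_left fun hx => ?_
    have h1 : κ x = i := (absIdx_eq_iff hi).2 (by rwa [hx])
    have h2 : κ (-x) = i := (absIdx_eq_iff hi).2 (by
      rw [hn, hx, neg_eq_iff_symInt, neg_eq_iff_symInt, SymInt.neg_neg']; exact hj.symm)
    rw [h1, h2]
    simp only [and_true]
  have hF : ∀ i : SymInt k, i < 0 → ∀ T, F i T = 1 := fun i hi T => by
    simp only [F, if_neg hi.ne, if_neg (not_lt_of_gt hi)]
  refine Eq.trans (Finset.sum_congr ?_ fun T hT => ?_) (key.trans ?_)
  · ext T
    rw [Finset.mem_filter, Finset.mem_filter]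
    refine and_congr_right fun _ => ⟨fun h i => ⟨fun x hx hx' => ?_, fun hi => ?_⟩, fun h => ⟨?_, ?_⟩⟩
    · exact h.1 x (Finset.mem_filter.1 hx).1 (Finset.mem_filter.1 hx').1
    · rw [hκ T i i hi (Or.inl rfl), hκ T i (-i) hi (Or.inr rfl)]
      exact ⟨h.2 i, h.2 (-i)⟩
    · intro x hx hx'
      refine (h (κ x)).1 x (Finset.mem_filter.2 ⟨hx, rfl⟩) (Finset.mem_filter.2 ⟨hx', ?_⟩)
      have h1 := (absIdx_eq_iff (absIdx_nonneg (u x))).1 (rfl : absIdx (u x) = absIdx (u x))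
      refine (absIdx_eq_iff (absIdx_nonneg (u x))).2 ?_
      rw [hn, neg_eq_iff_symInt, neg_eq_iff_symInt, SymInt.neg_neg']
      exact h1.symm
    · intro i
      have h1 := (absIdx_eq_iff (absIdx_nonneg i)).1 (rfl : absIdx i = absIdx i)
      have h2 := (h (absIdx i)).2 (absIdx_nonneg i)
      rw [hκ T _ _ (absIdx_nonneg i) (Or.inl rfl), hκ T _ _ (absIdx_nonneg i) (Or.inr rfl)] at h2
      rcases h1 with h1 | h1
      · rw [← h1] at h2; exact h2.1
      · rw [← h1] at h2; exact h2.2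
  · rw [prod_symInt_nonneg _ fun i hi => hF i hi _, sum_symInt_split, sum_symInt_neg, add_add_add_comm,
      ← Finset.sum_add_distrib, pow_add, ← Finset.prod_pow_eq_pow_sum]
    congr 1
    · simp only [F, if_true]
      rw [hκ T 0 0 le_rfl (Or.inl rfl), hκr T 0 0 le_rfl (Or.inl rfl)]
    · refine Finset.prod_congr rfl fun i hi => ?_
      have hi := (Finset.mem_filter.1 hi).2
      simp only [F, if_neg hi.ne', if_pos hi, SymInt.neg_neg']
      rw [hκ T i i hi.le (Or.inl rfl), hκr T i i hi.le (Or.inl rfl),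
        hκ T i (-i) hi.le (Or.inr rfl), hκr T i (-i) hi.le (Or.inr rfl)]
  · rw [prod_symInt_nonneg]
    · congr 1
      · rw [← sum_zero_block hN]
        refine Finset.sum_congr ?_ fun T _ => by simp only [F, if_true]
        ext T
        rw [Finset.mem_filter, Finset.mem_filter, Finset.mem_powerset, Finset.mem_powerset]
        have e : (Z.filter fun x => κ x = 0) = part u Z 0 := by
          ext x
          rw [Finset.mem_filter, mem_part, absIdx_eq_iff le_rfl, neg_zero_symInt, or_self]
        rw [e]
        refine and_congr_right fun _ => and_congr_right fun _ => ?_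
        simp only [le_refl, true_imp_iff, neg_zero_symInt, and_self]
      · refine Finset.prod_congr rfl fun i hi => ?_
        have hi := (Finset.mem_filter.1 hi).2
        rw [← sum_pair_block evalOne_q hn hZ hi (ha i)]
        refine Finset.sum_congr ?_ fun T _ => by simp only [F, if_neg hi.ne', if_pos hi]
        ext T
        rw [Finset.mem_filter, Finset.mem_filter]
        have e : (Z.filter fun x => κ x = i) = Z.filter fun x => u x = i ∨ u x = -i := by
          ext x
          rw [Finset.mem_filter, Finset.mem_filter, absIdx_eq_iff hi.le]
        rw [e]
        refine and_congr_right fun _ => and_congr_right fun _ => ?_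
        simp only [hi.le, true_imp_iff]
    · intro i hi
      have e : (Z.filter fun x => κ x = i) = ∅ := Finset.filter_false_of_mem fun x _ h => by
        have := absIdx_nonneg (u x)
        rw [show absIdx (u x) = i from h] at this
        exact not_lt_of_ge this hi
      rw [e, Finset.powerset_empty, Finset.filter_true_of_mem, Finset.sum_singleton, hF i hi]
      intro T hT
      rw [Finset.mem_singleton.1 hT]
      exact ⟨by simp, fun h => absurd hi (not_lt_of_ge h)⟩

open Classical in
-- The scheme is that of `sum_halfSets_up`, with two changes: there are no inversions inside the odd
-- blocks of u, and the pairs of T with negative sum add to the exponent. Their automatic part, from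
-- `npair_part`, gives the two extra sums in the power of q.
theorem sum_halfSets_zero (hr : r.1 = 1) (hu : Monotone u.z)
    (hf' : ∀ x y, u.z x = u.z y → x.1 ≤ y.1 → f'.z x ≤ f'.z y) (hX : Word.mat f' u ∈ Xi m n d)
    (h : toInt (Word.mat f' u) = shift A 0 r t) :
    (∑ T ∈ Word.halfSets f' 0 with Word.cnt u T = t,
      Word.wt m u (Word.change f' r T) * Word.wt m (Word.change f' r T) f' *
        chi m (0 : SymInt (m + n)) ^ (Word.ni (Word.change f' r T) f' / 2)) =
    ((qDot m r ^ (∑ k, ∑ j with j < k, ((A r j : ℤ) - t j) * t k) *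
      qDDot m (0 : SymInt (m + n)) ^
        ((∑ k, ∑ j with k < j, (A 0 j : ℤ) * t k) +
          (∑ k, ∑ j with k < j ∧ j < -k, (t j : ℤ) * t k) +
          ∑ k with k < 0, ((t k).choose 2 : ℤ)) : Coefˣ) : Coef) *
    (exactDiv (cFact ((A 0 0 - 1) / 2 + t 0))
        (cFact ((A 0 0 - 1) / 2) * qFact (qPar m (0 : SymInt (m + n))) (t 0)) *
      ∏ k : SymInt (m + n) with 0 < k,
        exactDiv (qFact (qPar m (0 : SymInt (m + n))) (A 0 k + t k + t (-k)))
          (qFact (qPar m (0 : SymInt (m + n))) (A 0 k) *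
            qFact (qPar m (0 : SymInt (m + n))) (t k) *
            qFact (qPar m (0 : SymInt (m + n))) (t (-k)))) := by
  have hr0 : r ≠ 0 := fun h => by rw [h, SymInt.val_zero] at hr; omega
  have heven : ¬ IsOddIdx m (0 : SymInt (m + n)) := by
    rw [isOddIdx_iff, SymInt.val_zero]; omega
  have e1 : ∀ i, Word.mat f' u 0 i = A 0 i + t i + t (-i) := fun i => by
    have h1 := congrFun (congrFun h 0) i
    rw [toInt_apply, shift_apply, neg_zero_symInt, if_pos rfl, if_neg hr0,
      if_neg (mt (neg_eq_zero_symInt r).1 hr0)] at h1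
    omega
  have e2 : ∀ i, (Word.mat f' u r i : ℤ) = A r i - t i := fun i => by
    have h1 := congrFun (congrFun h r) i
    rw [toInt_apply, shift_apply, neg_zero_symInt, if_pos rfl, if_neg hr0.symm,
      if_neg (fun h => by have := congrArg Subtype.val h; rw [SymInt.val_neg] at this; omega)] at h1
    omega
  obtain ⟨N, hNd, hN⟩ := exists_zero_block hu hf'
  -- The central ball has 2N + 1 = a_{00} + 2 t_0 positions.
  have hNs : N = (A 0 0 - 1) / 2 + t 0 := by
    have h1 := congrArg Finset.card hN
    rw [card_ball hNd, Word.card_part_places, e1, neg_zero_symInt] at h1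
    omega
  have hZ : ∀ x, -x ∈ Word.places f' 0 ↔ x ∈ Word.places f' 0 := fun x => by
    rw [Word.mem_places, Word.mem_places, Word.z_neg, SymInt.val_zero]; omega
  have key := sum_halfSets_blocks (t := t) u.2 hZ hN fun i => by rw [Word.card_part_places, e1]
  have hs : (Word.places f' 0).powerset.filter (fun T => (∀ x ∈ T, -x ∉ T) ∧
      ∀ i, (part u.1 T i).card = t i) = (Word.halfSets f' 0).filter fun T => Word.cnt u T = t := by
    ext T
    rw [Finset.mem_filter, Finset.mem_filter, Word.mem_halfSets, Finset.mem_powerset, funext_iff]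
    have e : (∀ x ∈ T, f'.1 x = 0) ↔ T ⊆ Word.places f' 0 := forall₂_congr fun x _ => by
      rw [Word.mem_places, Subtype.ext_iff]; rfl
    simp only [e, and_assoc, Word.cnt_eq_card]
  rw [show (qPar m (0 : SymInt (m + n)) : Coef) = q by rw [qPar, if_neg heven],
    ← zeroSum_eq (d := d) _ _ (by omega), ← hNs, ← key, hs, Finset.mul_sum]
  refine Finset.sum_congr rfl fun T hT => ?_
  rw [Finset.mem_filter] at hT
  obtain ⟨hT, hc⟩ := hT
  have ht : ∀ i, (part u.1 T i).card = t i := fun i => by rw [← hc, Word.cnt_eq_card]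
  have hA : Word.mat (Word.change f' r T) u = A := by
    have h1 := Word.mat_change (r := r) hT u
    rw [h, hc] at h1
    exact (Word.shift_injective h1).symm
  have hS : ∀ i, (part u.1 (rest (Word.places f' 0) T) i).card = A 0 i := fun i => by
    rw [← Word.places_change_zero hT hr, Word.card_part_places, hA]
  have hTs : ∀ x ∈ T, f'.z x = 0 := fun x hx =>
    congrArg Subtype.val ((Word.mem_halfSets.1 hT).1 x hx)
  have i1 := inv_part (show Monotone u.1 from hu) (Word.places f' r) T
  have i2 := inv_part (show Monotone u.1 from hu) T (rest (Word.places f' 0) T)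
  have i3 := npair_part (show Monotone u.1 from hu) u.2 T
  have i0 : ∀ i, inv (part u.1 (Word.places f' r) i) (part u.1 T i) = 0 := fun i =>
    sum_sum_zero _ _ _ fun x hx y hy => if_neg fun hxy => by
      rw [mem_part] at hx hy
      have h1 := Word.mem_places.1 hx.1
      have h2 := hTs y hy.1
      have h3 := hf' x y (congrArg Subtype.val (hx.2.trans hy.2.symm)) (le_of_lt hxy)
      omega
  simp only [i0, Finset.sum_const_zero, zero_add, ht, Word.card_part_places] at i1
  simp only [ht, hS] at i2
  simp only [ht] at i3
  rw [Units.val_mul, qDot_zpow (N := inv (Word.places f' r) T), qDDot_zpow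
    (N := ∑ i, ∑ j with i < j, t i * A 0 j + (∑ i, ∑ j with i < j ∧ j < -i, t j * t i +
      ∑ i with i < 0, (t i).choose 2)), Word.wt, Word.wt,
    Word.oi_self_change_zero hT hr hf' hX, Word.oi_change_up hT le_rfl (by rw [hr]; rfl),
    Word.ni_change_zero hT hr, Nat.mul_div_cancel_left _ two_pos,
    Nat.mul_div_cancel_left _ two_pos, i2, i3, chi_even heven]
  · simp only [pow_add, Nat.zero_div, pow_zero]
    ring
  · push_cast
    simp only [mul_comm, add_assoc]
  · intro _
    rw [i1]
    push_cast
    rw [sum_sum_lt_comm]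
    simp only [e2]

end zero
end
end IotaSchur

/-! ### Admissible tuples and the product formulas -/

namespace IotaSchur
noncomputable section
variable {d m n : ℕ}

namespace Word

/-- The nonzero entries lie on the diagonal and at ±(p, r) with p and r neighbours. So the row index
cannot drop as the column index grows, and two columns share a row only in the rows p and -p, which
have the same eigenvalue. -/
theorem isNearDiag {k : ℕ} {B : Matrix (SymInt k) (SymInt k) ℕ} {p r : SymInt k} {b : ℕ}
    (hB : (toInt B - (b : ℤ) • Etheta p r).IsDiag)
    (h : 0 ≤ p.1 ∧ r.1 = p.1 + 1 ∨ 0 ≤ r.1 ∧ p.1 = r.1 + 1) : IsNearDiag m B (chi m p) := by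
  have key : ∀ i j, B i j ≠ 0 → i.1 = j.1 ∨ i.1 = p.1 ∧ j.1 = r.1 ∨ i.1 = -p.1 ∧ j.1 = -r.1 := by
    intro i j hij
    by_cases hd : i = j
    · exact Or.inl (congrArg _ hd)
    · have h1 := nearDiag_apply hB hd
      by_cases h2 : p = i ∧ r = j
      · rw [h2.1, h2.2]; exact Or.inr (Or.inl ⟨rfl, rfl⟩)
      · by_cases h3 : -p = i ∧ -r = j
        · rw [← h3.1, ← h3.2]; exact Or.inr (Or.inr ⟨rfl, rfl⟩)
        · rw [if_neg h2, if_neg h3, add_zero, mul_zero] at h1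
          exact absurd (Int.ofNat_eq_zero.1 h1) hij
  intro i j i' j' hij hij' hlt
  have h1 := key i j hij
  have h2 := key i' j' hij'
  refine ⟨by omega, fun he => ?_⟩
  have h3 : i.1 = p.1 ∨ i.1 = -p.1 := by omega
  rcases h3 with h3 | h3
  · rw [show i = p from Subtype.ext h3]
  · rw [show i = -p from Subtype.ext h3, chi_neg]

theorem cnt_le {k : ℕ} {f' u : Word k d} {p r : SymInt k} {T : Finset (SymInt d)}
    (hT : T ∈ halfSets f' p) (i : SymInt k) : cnt u T i ≤ mat (change f' r T) u r i := by
  rw [cnt_eq_card, ← card_part_places]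
  refine Finset.card_le_card (part_subset _ (fun x hx => ?_) i)
  rw [mem_places]
  rcases change_z (r := r) hT x with h | h | h
  · exact h.2.2.2
  · exact absurd hx h.1
  · exact absurd hx h.1

/-- When letters are changed to 0, both T and -T become places of 0, and they are disjoint. This
explains the stronger bound on t for h = 0. -/
theorem cnt_add_cnt_neg_le {k : ℕ} {f' u : Word k d} {p : SymInt k} {T : Finset (SymInt d)}
    (hT : T ∈ halfSets f' p) (i : SymInt k) :
    cnt u T i + cnt u T (-i) ≤ mat (change f' 0 T) u 0 i := by
  have hneg : cnt u T (-i) = (part u.1 (nset T) i).card := by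
    rw [← cnt_neg]
    congr 1
    ext x
    rw [Finset.mem_filter, mem_part, mem_nset]
    simp
  rw [hneg, cnt_eq_card, ← card_part_places, ← Finset.card_union_of_disjoint]
  · refine Finset.card_le_card fun x hx => ?_
    rw [Finset.mem_union, mem_part, mem_part, mem_nset] at hx
    rw [mem_part, mem_places]
    refine ⟨?_, hx.elim And.right And.right⟩
    rcases change_z (r := 0) hT x with h | h | h
    · exact h.2.2.2
    · rw [h.2.2.2]; rfl
    · exact hx.elim (fun h' => absurd h'.1 h.1) fun h' => absurd h'.1 h.2.1
  · rw [Finset.disjoint_left]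
    intro x hx hx'
    rw [mem_part] at hx
    rw [mem_part, mem_nset] at hx'
    exact (mem_halfSets.1 hT).2 x hx.1 hx'.1

end Word
end
end IotaSchur

theorem proposition3p5 (d m n : ℕ) (hd : 0 < d) :
    -- the elements `e_A`, `A ∈ Ξ_{m|n,d}`, are well defined
    ((∀ A ∈ Xi m n d, ∃ (μ : WComp (m + n) d) (g : SignedPerm d) (ν : WComp (m + n) d),
        IsSuperRep m μ g ν ∧ kappa μ g ν = A) ∧
      ∀ (μ : WComp (m + n) d) (g : SignedPerm d) (ν : WComp (m + n) d), IsSuperRep m μ g ν →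
        kappa μ g ν ∈ Xi m n d ∧ IsPhi μ g ν (e m n d (toInt (kappa μ g ν)))) ∧
    -- `B - b E_{h,h+1}^θ` diagonal, `0 < h`, where `h' = h + 1`
    (∀ h h' : SymInt (m + n), 0 < h.1 → h.1 ≠ m → h'.1 = h.1 + 1 →
      ∀ A ∈ Xi m n d, ∀ B ∈ Xi m n d, ∀ b : ℕ,
      (toInt B - (b : ℤ) • Etheta h h').IsDiag → col B = row A →
      e m n d (toInt B) * e m n d (toInt A) =
        ∑ t ∈ tuples b (fun t => ∀ i, t i ≤ A h' i),
          (((qDot m h' ^ (∑ k, ∑ j with j < k, ((A h' j : ℤ) - t j) * t k) *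
              qDDot m h ^ (∑ k, ∑ j with k < j, (A h j : ℤ) * t k) : Coefˣ) : Coef) *
            ∏ k, qBinom (qPar m h) (A h k + t k) (t k)) •
          e m n d (shift A h h' t)) ∧
    -- `B - b E_{01}^θ` diagonal, where `h' = 1`
    (∀ h' : SymInt (m + n), 0 ≠ m → h'.1 = 1 →
      ∀ A ∈ Xi m n d, ∀ B ∈ Xi m n d, ∀ b : ℕ,
      (toInt B - (b : ℤ) • Etheta 0 h').IsDiag → col B = row A →
      e m n d (toInt B) * e m n d (toInt A) =
        ∑ t ∈ tuples b (fun t => ∀ i, t i ≤ A h' i),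
          (((qDot m h' ^ (∑ k, ∑ j with j < k, ((A h' j : ℤ) - t j) * t k) *
              qDDot m (0 : SymInt (m + n)) ^
                ((∑ k, ∑ j with k < j, (A 0 j : ℤ) * t k) +
                  (∑ k, ∑ j with k < j ∧ j < -k, (t j : ℤ) * t k) +
                  ∑ k with k < 0, ((t k).choose 2 : ℤ)) : Coefˣ) : Coef) *
            (exactDiv (cFact ((A 0 0 - 1) / 2 + t 0))
                (cFact ((A 0 0 - 1) / 2) * qFact (qPar m (0 : SymInt (m + n))) (t 0)) *
              ∏ k : SymInt (m + n) with 0 < k,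
                exactDiv (qFact (qPar m (0 : SymInt (m + n))) (A 0 k + t k + t (-k)))
                  (qFact (qPar m (0 : SymInt (m + n))) (A 0 k) *
                    qFact (qPar m (0 : SymInt (m + n))) (t k) *
                    qFact (qPar m (0 : SymInt (m + n))) (t (-k))))) •
          e m n d (shift A 0 h' t)) ∧
    -- `C - c E_{h+1,h}^θ` diagonal, `0 ≤ h`, where `h' = h + 1`
    (∀ h h' : SymInt (m + n), 0 ≤ h.1 → h.1 ≠ m → h'.1 = h.1 + 1 →
      ∀ A ∈ Xi m n d, ∀ C ∈ Xi m n d, ∀ c : ℕ,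
      (toInt C - (c : ℤ) • Etheta h' h).IsDiag → col C = row A →
      e m n d (toInt C) * e m n d (toInt A) =
        ∑ t ∈ tuples c (fun t => if h.1 = 0 then ∀ i, t i + t (-i) ≤ A h i
            else ∀ i, t i ≤ A h i),
          (((qDot m h ^ (∑ k, ∑ j with k < j, ((A h j : ℤ) - t j) * t k) *
              qDDot m h' ^ (∑ k, ∑ j with j < k, (A h' j : ℤ) * t k) : Coefˣ) : Coef) *
            ∏ k, qBinom (qPar m h') (A h' k + t k) (t k)) •
          e m n d (shift A h' h t)) := by
  refine ⟨⟨fun A hA => Word.exists_superRep hA, fun μ g ν h => ⟨Word.kappa_mem_Xi h, isPhi_e h⟩⟩,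
    ?_, ?_, ?_⟩
  · intro h h' h0 _ hh A hA B hB b hBd hBA
    have hne : h ≠ h' := fun he => by rw [he] at hh; omega
    refine e_mul_e_shift hA hB hBA hne hBd (Word.isNearDiag hBd (Or.inl ⟨h0.le, hh⟩)) _ _
      (fun f' u T hT hf i => ?_) fun f' u hu hf' hX t _ ht => sum_halfSets_up h0 hh hu hf' hX ht
    rw [← hf]
    exact Word.cnt_le hT i
  · intro h' _ hh A hA B hB b hBd hBA
    have hne : 0 ≠ h' := fun he => by rw [← he, SymInt.val_zero] at hh; omega
    refine e_mul_e_shift hA hB hBA hne hBd (Word.isNearDiag hBd (Or.inl ⟨le_rfl, hh⟩)) _ _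
      (fun f' u T hT hf i => ?_) fun f' u hu hf' hX t _ ht => sum_halfSets_zero hh hu hf' hX ht
    rw [← hf]
    exact Word.cnt_le hT i
  · intro h h' h0 _ hh A hA C hC c hCd hCA
    have hne : h' ≠ h := fun he => by rw [he] at hh; omega
    refine e_mul_e_shift hA hC hCA hne hCd (Word.isNearDiag hCd (Or.inr ⟨h0, hh⟩)) _ _
      (fun f' u T hT hf => ?_) fun f' u hu hf' hX t _ ht => sum_halfSets_down h0 hh hu hf' hX ht
    rw [← hf]
    split_ifs with hz
    · obtain rfl : h = 0 := Subtype.ext hz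
      exact fun i => Word.cnt_add_cnt_neg_le hT i
    · exact fun i => Word.cnt_le hT i
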